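/- Let $X$ be a complex manifold of dimension $n+1$, let $f:X\to\Delta$ be a proper holomorphic map to the open unit disc which is smooth over $\Delta\setminus\{0\}$, and suppose that $Y=f^{-1}(0)=\sum_{i\in I}e_iY_i$ ($I$ finite, $e_i\ge 1$) is a simple normal crossing divisor with smooth irreducible components $Y_i$: near each point of $Y$ there are holomorphic coordinates $z_0,\dots,z_n$ in which the components through the point are coordinate hyperplanes $z_{\sigma(i)}=0$ and $f=\prod_i z_{\sigma(i)}^{e_i}$. For $J\subset I$ put $Y^J=\bigcap_{j\in J}Y_j$ ($Y^\emptyset=X$). Let $\mathscr D_X$ be the sheaf of holomorphic differential operators with its order filtration $F_\bullet$. Let $\mathscr T_{X/\Delta}(\log Y)$ be the sheaf of vector fields $\theta$ that are logarithmic along $Y_{\rm red}$ and satisfy $\theta f=0$, and let $\Omega^p_{X/\Delta}(\log Y)$ be the alternating $p$-forms on it (the relative logarithmic $p$-forms). Let $\Omega^{n+\bullet}_{X/\Delta}(\log Y)\otimes\mathscr D_X$ be the complex of right $\mathscr D_X$-modules with the exterior derivative in which vector fields act on $\mathscr D_X$ by left multiplication, filtered by $F_\ell=\Omega^{n+\bullet}_{X/\Delta}(\log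 Y)\otimes F_{\ell+n+\bullet}\mathscr D_X$. Let $$\mathcal M=\mathscr H^0\bigl(\Omega^{n+\bullet}_{X/\Delta}(\log Y)|_Y\otimes\mathscr D_X\bigr)$$ with the induced filtration $F_\bullet\mathcal M$, where restriction to $Y$ is reduction modulo $f$ acting from the left. For $\alpha\in\mathbb Q\cap[0,1)$ let $I_\alpha=\{i\in I:\alpha e_i\in\mathbb Z\}$, and let $C^\bullet_\alpha\otimes\mathscr D_X$ be the quotient of the subcomplex $\Omega^{n+\bullet}_{X/\Delta}(\log Y)(-\lceil\alpha Y\rceil)\otimes\mathscr D_X$ by the subcomplex $\Omega^{n+\bullet}_{X/\Delta}(\log Y)(-\lfloor\alpha Y\rfloor-Y_{\rm red})\otimes\mathscr D_X$, with the induced filtration. The characteristic cycle $cc$ of a right $\mathscr D_X$-module with a good filtration is the cycle on $T^*X=\operatorname{Spec}_X\mathrm{gr}^F\mathscr D_X$ of its associated graded module; $[T^*_{Y^J}X]$ is the cycle of the conormal bundle of $Y^J$ (zero if $Y^J=\emptyset$). Then the following hold. 1. There is a unique right $\mathscr D_X$-linear operator $R:\mathcal M\to\mathcal M$, defined on every stalk,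 such that $R[\alpha']=[\beta]$ whenever $\alpha',\beta$ are $\mathscr D_X$-valued logarithmic $n$-forms on $X$ with $d\alpha'=\frac{df}{f}\wedge\beta$. The filtration of $\mathcal M$ is good, and $$cc(\mathcal M)=\sum_{J\subset I}\Bigl(\sum_{j\in J}e_j\Bigr)[T^*_{Y^J}X].$$ 2. For $\alpha\in\mathbb Q\cap[0,1)$ let $\mathcal M_{\ge\alpha}$ (resp. $\mathcal M_{>\alpha}$) be the sum of the generalized eigenmodules $\ker(R-\lambda)^\infty$ with $\lambda\ge\alpha$ (resp. $\lambda>\alpha$), and let $\mathcal M_\alpha=\mathcal M_{\ge\alpha}/\mathcal M_{>\alpha}$ with the filtration induced from $F_\bullet\mathcal M$ as a subquotient. Then: (a) the complex $C^\bullet_\alpha\otimes\mathscr D_X$ is filtered acyclic: each $F_\ell(C^\bullet_\alpha\otimes\mathscr D_X)$ is exact in negative degrees and $\mathscr H^0(F_\ell(C^\bullet_\alpha\otimes\mathscr D_X))\to\mathscr H^0(C^\bullet_\alpha\otimes\mathscr D_X)$ is injective; (b) the filtration of $\mathscr H^0(C^\bullet_\alpha\otimes\mathscr D_X)$ is good and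 $cc\bigl(\mathscr H^0(C^\bullet_\alpha\otimes\mathscr D_X)\bigr)=\sum_{J\subset I}\#(I_\alpha\cap J)\,[T^*_{Y^J}X]$; (c) the inclusion of $\Omega^{n}_{X/\Delta}(\log Y)(-\lceil\alpha Y\rceil)\otimes\mathscr D_X$ into $\Omega^{n}_{X/\Delta}(\log Y)\otimes\mathscr D_X$ induces an isomorphism of filtered right $\mathscr D_X$-modules $$\psi_\alpha:\bigl(\mathscr H^0(C^\bullet_\alpha\otimes\mathscr D_X),F_\bullet\bigr)\xrightarrow{\ \sim\ }(\mathcal M_\alpha,F_\bullet\mathcal M_\alpha);$$ (d) the filtration of $\mathcal M_\alpha$ is good and $cc(\mathcal M_\alpha)=\sum_{J\subset I}\#(I_\alpha\cap J)\,[T^*_{Y^J}X]$. -/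

import Mathlib

open scoped Manifold ContDiff Topology DirectSum
open Filter
noncomputable section
namespace LogD

section Algebra
variable (A : Type*) [CommRing A] [Algebra ℂ A]

/-- `opOrd A (k + 1)` consists of the `ℂ`-linear differential operators on `A` of order at most `k`,
i.e. the `P` with `[P, g]` of order at most `k - 1` for every `g`; `opOrd A 0 = 0`. -/
def opOrd : ℕ → Submodule ℂ (Module.End ℂ A)
  | 0 => ⊥
  | k + 1 =>
    { carrier := {P | ∀ g : A, P * LinearMap.mulLeft ℂ g - LinearMap.mulLeft ℂ g * P ∈ opOrd k}
      add_mem' := by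
        intro P Q hP hQ g
        have := (opOrd k).add_mem (hP g) (hQ g)
        convert this using 1
        rw [add_mul, mul_add]; abel
      zero_mem' := by intro g; simp
      smul_mem' := by
        intro c P hP g
        have := (opOrd k).smul_mem c (hP g)
        convert this using 1
        rw [smul_sub, smul_mul_assoc, mul_smul_comm] }

variable {A}

theorem mem_opOrd_succ {k : ℕ} {P : Module.End ℂ A} : P ∈ opOrd A (k + 1) ↔
    ∀ g : A, P * LinearMap.mulLeft ℂ g - LinearMap.mulLeft ℂ g * P ∈ opOrd A k := Iff.rfl

theorem opOrd_le_succ (k : ℕ) : opOrd A k ≤ opOrd A (k + 1) := by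
  induction k with
  | zero => intro P hP; rw [show P = 0 from hP]; exact zero_mem _
  | succ k ih => intro P hP g; exact ih (hP g)

theorem opOrd_mono : Monotone (opOrd A) := monotone_nat_of_le_succ opOrd_le_succ

theorem opOrd_mul {a b : ℕ} {P Q : Module.End ℂ A} (hP : P ∈ opOrd A a)
    (hQ : Q ∈ opOrd A (b + 1)) : P * Q ∈ opOrd A (a + b) := by
  induction hn : a + b generalizing a b P Q with
  | zero =>
    obtain rfl : a = 0 := by omega
    rw [show P = 0 from hP, zero_mul]; exact zero_mem _
  | succ m ih =>
    rcases a with _ | a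
    · rw [show P = 0 from hP, zero_mul]; exact zero_mem _
    · intro g
      have e : P * Q * LinearMap.mulLeft ℂ g - LinearMap.mulLeft ℂ g * (P * Q) =
          P * (Q * LinearMap.mulLeft ℂ g - LinearMap.mulLeft ℂ g * Q) +
          (P * LinearMap.mulLeft ℂ g - LinearMap.mulLeft ℂ g * P) * Q := by
        simp only [mul_sub, sub_mul, mul_assoc]; abel
      rw [e]
      refine add_mem ?_ (ih (hP g) hQ (by omega))
      rcases b with _ | b
      · rw [show Q * LinearMap.mulLeft ℂ g - LinearMap.mulLeft ℂ g * Q = 0 from hQ g, mul_zero]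
        exact zero_mem _
      · exact ih hP (hQ g) (by omega)

theorem opOrd_comm {a b : ℕ} {P Q : Module.End ℂ A} (hP : P ∈ opOrd A (a + 1))
    (hQ : Q ∈ opOrd A (b + 1)) : P * Q - Q * P ∈ opOrd A (a + b) := by
  induction hn : a + b generalizing a b P Q with
  | zero =>
    obtain ⟨rfl, rfl⟩ : a = 0 ∧ b = 0 := by omega
    have key : ∀ {T : Module.End ℂ A}, T ∈ opOrd A 1 → ∀ u, T u = u * T 1 := by
      intro T hT u
      have h := LinearMap.congr_fun (show T * LinearMap.mulLeft ℂ u -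
        LinearMap.mulLeft ℂ u * T = 0 from hT u) 1
      simpa [sub_eq_zero] using h
    have : P * Q - Q * P = 0 := by
      ext u
      simp only [LinearMap.sub_apply, Module.End.mul_apply, LinearMap.zero_apply]
      rw [key hP (Q u), key hQ (P u), key hP u, key hQ u]; ring
    rw [this]; exact zero_mem _
  | succ m ih =>
    intro g
    have e : (P * Q - Q * P) * LinearMap.mulLeft ℂ g - LinearMap.mulLeft ℂ g * (P * Q - Q * P) =
        (P * (Q * LinearMap.mulLeft ℂ g - LinearMap.mulLeft ℂ g * Q) -
          (Q * LinearMap.mulLeft ℂ g - LinearMap.mulLeft ℂ g * Q) * P) +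
        ((P * LinearMap.mulLeft ℂ g - LinearMap.mulLeft ℂ g * P) * Q -
          Q * (P * LinearMap.mulLeft ℂ g - LinearMap.mulLeft ℂ g * P)) := by
      simp only [mul_sub, sub_mul, mul_assoc]; abel
    rw [e]
    refine add_mem ?_ ?_
    · rcases b with _ | b
      · rw [show Q * LinearMap.mulLeft ℂ g - LinearMap.mulLeft ℂ g * Q = 0 from hQ g]
        simp
      · exact ih hP (hQ g) (by omega)
    · rcases a with _ | a
      · rw [show P * LinearMap.mulLeft ℂ g - LinearMap.mulLeft ℂ g * P = 0 from hP g]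
        simp
      · exact ih (hP g) hQ (by omega)

theorem mulLeft_mem (g : A) : LinearMap.mulLeft ℂ g ∈ opOrd A 1 := by
  intro h
  have : LinearMap.mulLeft ℂ g * LinearMap.mulLeft ℂ h -
      LinearMap.mulLeft ℂ h * LinearMap.mulLeft ℂ g = 0 := by
    ext u; simp [mul_left_comm]
  rw [this]; exact zero_mem _

theorem derivation_mem (θ : Derivation ℂ A A) : (θ : A →ₗ[ℂ] A) ∈ opOrd A 2 := by
  intro g
  have : (θ : Module.End ℂ A) * LinearMap.mulLeft ℂ g - LinearMap.mulLeft ℂ g * θ =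
      LinearMap.mulLeft ℂ (θ g) := by
    ext u
    simp [Module.End.mul_apply, mul_comm]
  rw [this]; exact mulLeft_mem _

variable (A) in
/-- The algebra of all differential operators on `A`, as operators. -/
def diffOps : Subalgebra ℂ (Module.End ℂ A) where
  carrier := {P | ∃ k, P ∈ opOrd A k}
  mul_mem' := by
    rintro P Q ⟨a, hP⟩ ⟨b, hQ⟩
    exact ⟨a + b, opOrd_mul hP (opOrd_le_succ b hQ)⟩
  add_mem' := by
    rintro P Q ⟨a, hP⟩ ⟨b, hQ⟩
    exact ⟨max a b, add_mem (opOrd_mono (le_max_left a b) hP) (opOrd_mono (le_max_right a b) hQ)⟩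
  algebraMap_mem' := by
    intro c
    refine ⟨1, ?_⟩
    have : algebraMap ℂ (Module.End ℂ A) c = LinearMap.mulLeft ℂ (algebraMap ℂ A c) := by
      ext u; simp [Algebra.smul_def]
    rw [this]; exact mulLeft_mem _

variable (A) in
/-- The ring `D` of differential operators on `A`. -/
def D : Type _ := diffOps A

instance : Ring (D A) := inferInstanceAs (Ring (diffOps A))

instance : Algebra ℂ (D A) := inferInstanceAs (Algebra ℂ (diffOps A))

/-- The operator on `A` underlying an element of `D`. -/
def D.toEnd : D A →+* Module.End ℂ A := (diffOps A).val.toRingHom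

theorem D.toEnd_injective : Function.Injective (D.toEnd (A := A)) := Subtype.val_injective

variable (A) in
/-- The opposite ring of `D`: right `D`-modules are modules over `DR A`. -/
def DR : Type _ := (D A)ᵐᵒᵖ

instance : Ring (DR A) := inferInstanceAs (Ring (D A)ᵐᵒᵖ)

instance : Algebra ℂ (DR A) := inferInstanceAs (Algebra ℂ (D A)ᵐᵒᵖ)

/-- `P` as an operator acting from the right. -/
def D.op (P : D A) : DR A := MulOpposite.op P

/-- The differential operator underlying an element of `DR A`. -/
def DR.unop (P : DR A) : D A := MulOpposite.unop P

/-- `D` as a right module over itself. -/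
instance : Module (DR A) (D A) := inferInstanceAs (Module (D A)ᵐᵒᵖ (D A))

theorem DR.smul_def (P : DR A) (Q : D A) : P • Q = Q * P.unop := rfl

/-- Functions as operators of order zero. -/
def toD : A →+* D A where
  toFun g := ⟨LinearMap.mulLeft ℂ g, 1, mulLeft_mem g⟩
  map_one' := D.toEnd_injective (LinearMap.mulLeft_one ℂ A)
  map_mul' g h := D.toEnd_injective (LinearMap.mulLeft_mul ℂ A g h)
  map_zero' := D.toEnd_injective (LinearMap.mulLeft_zero_eq_zero ℂ A)
  map_add' g h := D.toEnd_injective (map_add (LinearMap.mul ℂ A) g h)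

/-- Vector fields as operators of order one. -/
def derD (θ : Derivation ℂ A A) : D A := ⟨(θ : A →ₗ[ℂ] A), 2, derivation_mem θ⟩

/-- `D` as a left `A`-module. -/
instance instModuleD : Module A (D A) := Module.compHom (D A) (toD (A := A))

theorem smul_D_def (g : A) (P : D A) : g • P = toD g * P := rfl

instance : SMulCommClass A (DR A) (D A) where
  smul_comm g Q P := by
    rw [DR.smul_def, DR.smul_def, smul_D_def, smul_D_def, mul_assoc]

variable (A) in
/-- `FD A k` : the operators of order at most `k`. -/
def FD (k : ℤ) : AddSubgroup (DR A) where
  carrier := {P | P.unop.toEnd ∈ opOrd A (k + 1).toNat}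
  add_mem' hP hQ := (opOrd A _).add_mem hP hQ
  zero_mem' := (opOrd A _).zero_mem
  neg_mem' hP := (opOrd A _).neg_mem hP

theorem mem_FD {k : ℤ} {P : DR A} : P ∈ FD A k ↔ P.unop.toEnd ∈ opOrd A (k + 1).toNat := Iff.rfl

theorem FD_neg {k : ℤ} (hk : k < 0) {P : DR A} (hP : P ∈ FD A k) : P = 0 := by
  rw [mem_FD, show (k + 1).toNat = 0 by omega] at hP
  exact MulOpposite.unop_injective (D.toEnd_injective (A := A) (a₁ := P.unop) (a₂ := 0) hP)

theorem FD_mono : Monotone (FD A) := fun _ _ h _ hP => opOrd_mono (by omega) hP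

theorem FD_mul {k l : ℤ} {P Q : DR A} (hP : P ∈ FD A k) (hQ : Q ∈ FD A l) :
    P * Q ∈ FD A (k + l) := by
  rcases lt_or_ge k 0 with hk | hk
  · rw [FD_neg hk hP, zero_mul]; exact zero_mem _
  rcases lt_or_ge l 0 with hl | hl
  · rw [FD_neg hl hQ, mul_zero]; exact zero_mem _
  rw [mem_FD] at hP hQ
  rw [show (k + 1).toNat = k.toNat + 1 by omega] at hP
  have := opOrd_mul hQ hP
  rwa [show (l + 1).toNat + k.toNat = (k + l + 1).toNat by omega] at this

theorem FD_comm {k l : ℤ} {P Q : DR A} (hP : P ∈ FD A k) (hQ : Q ∈ FD A l) :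
    P * Q - Q * P ∈ FD A (k + l - 1) := by
  rcases lt_or_ge k 0 with hk | hk
  · rw [FD_neg hk hP, zero_mul, mul_zero, sub_zero]; exact zero_mem _
  rcases lt_or_ge l 0 with hl | hl
  · rw [FD_neg hl hQ, zero_mul, mul_zero, sub_zero]; exact zero_mem _
  rw [mem_FD] at hP hQ
  rw [show (k + 1).toNat = k.toNat + 1 by omega] at hP
  rw [show (l + 1).toNat = l.toNat + 1 by omega] at hQ
  have := opOrd_comm hQ hP
  rwa [show l.toNat + k.toNat = (k + l - 1 + 1).toNat by omega] at this

theorem one_mem_FD : (1 : DR A) ∈ FD A 0 := by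
  have := mulLeft_mem (1 : A)
  rwa [LinearMap.mulLeft_one] at this

theorem toD_mem (g : A) : (toD g).op ∈ FD A 0 := mulLeft_mem g

theorem derD_mem (θ : Derivation ℂ A A) : (derD θ).op ∈ FD A 1 := derivation_mem θ

instance : SetLike.GradedMonoid (FD A) where
  one_mem := one_mem_FD
  mul_mem _ _ _ _ := FD_mul

variable (A) in
/-- The Rees ring of the order filtration. -/
abbrev Rees := ⨁ k : ℤ, FD A k

variable (A) in
/-- The Rees parameter: the operator `1` placed in degree one. -/
def reesVar : Rees A := DirectSum.of (fun k : ℤ => FD A k) 1 ⟨1, FD_mono zero_le_one one_mem_FD⟩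

/-- The homogeneous element of degree `k` given by an operator of order at most `k`. -/
def reesOf (k : ℤ) (P : FD A k) : Rees A := DirectSum.of (fun k : ℤ => FD A k) k P

theorem reesOf_mul {k l : ℤ} (P : FD A k) (Q : FD A l) :
    reesOf k P * reesOf l Q = reesOf (k + l) ⟨P.1 * Q.1, FD_mul P.2 Q.2⟩ :=
  DirectSum.of_mul_of _ _

theorem reesOf_congr {k l : ℤ} (h : k = l) (P : FD A k) (Q : FD A l) (e : P.1 = Q.1) :
    reesOf k P = reesOf l Q := by
  subst h; rw [Subtype.ext e]

theorem reesVar_comm (p : Rees A) : reesVar A * p = p * reesVar A := by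
  induction p using DirectSum.induction_on with
  | zero => simp
  | of k P =>
    change reesOf 1 _ * reesOf k P = reesOf k P * reesOf 1 _
    rw [reesOf_mul, reesOf_mul]
    exact reesOf_congr (add_comm _ _) _ _ (by simp)
  | add p q hp hq => rw [mul_add, add_mul, hp, hq]

variable (A) in
/-- The two-sided ideal generated by the Rees parameter. -/
def reesIdeal : Ideal (Rees A) := Ideal.span {reesVar A}

theorem mem_reesIdeal {p : Rees A} : p ∈ reesIdeal A ↔ ∃ q, q * reesVar A = p := by
  rw [reesIdeal, Ideal.mem_span_singleton']

instance : (reesIdeal A).IsTwoSided where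
  mul_mem_of_left {p} q hp := by
    obtain ⟨r, rfl⟩ := mem_reesIdeal.1 hp
    exact mem_reesIdeal.2 ⟨r * q, by rw [mul_assoc, mul_assoc, reesVar_comm]⟩

theorem rees_comm (p q : Rees A) : p * q - q * p ∈ reesIdeal A := by
  induction p using DirectSum.induction_on with
  | zero => rw [zero_mul, mul_zero, sub_zero]; exact zero_mem _
  | add p p' hp hp' =>
    have : (p + p') * q - q * (p + p') = (p * q - q * p) + (p' * q - q * p') := by noncomm_ring
    rw [this]; exact add_mem hp hp'
  | of k P =>
    induction q using DirectSum.induction_on with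
    | zero => rw [zero_mul, mul_zero, sub_zero]; exact zero_mem _
    | add q q' hq hq' =>
      have : ∀ p : Rees A, p * (q + q') - (q + q') * p =
        (p * q - q * p) + (p * q' - q' * p) := fun p => by noncomm_ring
      rw [this]; exact add_mem hq hq'
    | of l Q =>
      refine mem_reesIdeal.2 ⟨reesOf (k + l - 1) ⟨P.1 * Q.1 - Q.1 * P.1, FD_comm P.2 Q.2⟩, ?_⟩
      change reesOf _ _ * reesOf 1 _ = reesOf k P * reesOf l Q - reesOf l Q * reesOf k P
      rw [reesOf_mul, reesOf_mul, reesOf_mul, reesOf_congr (add_comm l k) _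
        ⟨Q.1 * P.1, add_comm l k ▸ FD_mul Q.2 P.2⟩ rfl, reesOf, reesOf, reesOf, ← map_sub]
      exact reesOf_congr (by ring) _ _ (by simp)

variable (A) in
/-- The associated graded ring `gr D = ⨁ F_k / F_{k-1}` of the order filtration, as the quotient of
the Rees ring `⨁ F_k` by the Rees parameter. It is commutative, so it is also that of `DR A`. -/
def GrD := Rees A ⧸ reesIdeal A

instance : Ring (GrD A) := inferInstanceAs (Ring (Rees A ⧸ reesIdeal A))

instance : CommRing (GrD A) where
  mul_comm a b := by
    obtain ⟨p, rfl⟩ := Ideal.Quotient.mk_surjective (I := reesIdeal A) a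
    obtain ⟨q, rfl⟩ := Ideal.Quotient.mk_surjective (I := reesIdeal A) b
    exact (Ideal.Quotient.eq (I := reesIdeal A) (x := p * q) (y := q * p)).2 (rees_comm p q)

/-- The symbol in degree `k` of an operator of order at most `k`. -/
def symb (k : ℤ) (P : FD A k) : GrD A := Ideal.Quotient.mk (reesIdeal A) (reesOf k P)

variable (A) in
/-- A filtration of a right `D`-module, compatible with the order filtration. -/
structure Filt (M : Type*) [AddCommGroup M] [Module (DR A) M] where
  F : ℤ → AddSubgroup M
  mono : Monotone F
  smul_mem : ∀ {k l : ℤ} {P : (DR A)} {m : M}, P ∈ FD A k → m ∈ F l → P • m ∈ F (k + l)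

namespace Filt
variable {M : Type*} [AddCommGroup M] [Module (DR A) M] (Φ : Filt A M)

instance : SetLike.GradedSMul (FD A) Φ.F where
  smul_mem _ _ _ _ hP hm := Φ.smul_mem hP hm

/-- The Rees module `⨁ F_l`. -/
def Rees : Type _ := ⨁ l : ℤ, Φ.F l

instance : AddCommGroup Φ.Rees := inferInstanceAs (AddCommGroup (⨁ l : ℤ, Φ.F l))
instance : Module (LogD.Rees A) Φ.Rees :=
  inferInstanceAs (Module (⨁ k : ℤ, FD A k) (⨁ l : ℤ, Φ.F l))

/-- The associated graded module `⨁ F_l / F_{l-1}`, as the Rees module modulo the Rees parameter. -/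
def Gr : Type _ := Φ.Rees ⧸ (reesIdeal A • (⊤ : Submodule (LogD.Rees A) Φ.Rees))

instance : AddCommGroup Φ.Gr :=
  inferInstanceAs (AddCommGroup (Φ.Rees ⧸ (reesIdeal A • (⊤ : Submodule (LogD.Rees A) Φ.Rees))))
instance : Module (GrD A) Φ.Gr :=
  inferInstanceAs (Module (LogD.Rees A ⧸ reesIdeal A)
    (Φ.Rees ⧸ (reesIdeal A • (⊤ : Submodule (LogD.Rees A) Φ.Rees))))


/-- The induced filtration on a submodule. -/
def restrict (N : Submodule (DR A) M) : Filt A N where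
  F l := (Φ.F l).comap N.subtype.toAddMonoidHom
  mono _ _ h _ hm := Φ.mono h hm
  smul_mem hP hm := Φ.smul_mem hP hm

/-- The induced filtration on a quotient module. -/
def quotient (N : Submodule (DR A) M) : Filt A (M ⧸ N) where
  F l := (Φ.F l).map N.mkQ.toAddMonoidHom
  mono _ _ h := AddSubgroup.map_mono (Φ.mono h)
  smul_mem := by
    rintro k l P _ hP ⟨m, hm, rfl⟩
    exact ⟨P • m, Φ.smul_mem hP hm, map_smul N.mkQ P m⟩

/-- A good filtration: exhaustive, bounded below, with finitely generated associated graded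
module. -/
structure IsGood : Prop where
  exhaustive : ∀ m : M, ∃ l, m ∈ Φ.F l
  bounded : ∃ l, Φ.F l = ⊥
  finite : Module.Finite (GrD A) Φ.Gr

end Filt

/-- The cycle of a module `G` over a commutative ring `S`: the function sending the generic point
`p` of an irreducible component of the support of `G` to the length of `G_p` over `S_p`, and every
other prime to `0`. -/
def cycle (S G : Type*) [CommRing S] [AddCommGroup G] [Module S G] : PrimeSpectrum S → ℕ∞ :=
  open Classical in fun p =>
    if Minimal (· ∈ Module.support S G) p then
      Module.length (Localization.AtPrime p.asIdeal) (LocalizedModule p.asIdeal.primeCompl G)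
    else 0

/-- The characteristic cycle of a filtered right `D`-module. -/
def Filt.charCycle {M : Type*} [AddCommGroup M] [Module (DR A) M] (Φ : Filt A M) :
    PrimeSpectrum (GrD A) → ℕ∞ := cycle (GrD A) Φ.Gr

/-- The ideal of the conormal bundle of the submanifold with ideal `I`: it is generated by the
functions in `I` and by the symbols of the vector fields tangent to the submanifold. -/
def conormalIdeal (I : Ideal A) : Ideal (GrD A) :=
  Ideal.span ({σ | ∃ g ∈ I, σ = symb 0 ⟨(toD g).op, toD_mem g⟩} ∪
    {σ | ∃ θ : Derivation ℂ A A, (∀ g ∈ I, θ g ∈ I) ∧ σ = symb 1 ⟨(derD θ).op, derD_mem θ⟩})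

/-- The cycle of the conormal bundle of the submanifold with ideal `I`. -/
def conormalCycle (I : Ideal A) : PrimeSpectrum (GrD A) → ℕ∞ :=
  cycle (GrD A) (GrD A ⧸ conormalIdeal I)

variable (A) in
/-- A Lie algebra of vector fields which is an `A`-module. -/
structure Fields where
  T : Submodule A (Derivation ℂ A A)
  lie_mem : ∀ {θ η : Derivation ℂ A A}, θ ∈ T → η ∈ T → ⁅θ, η⁆ ∈ T

/-- The logarithmic vector fields along the reduced divisor with ideal `J`. -/
def logFields (J : Ideal A) : Fields A where
  T :=
    { carrier := {θ | ∀ g ∈ J, θ g ∈ J}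
      add_mem' := fun h h' g hg => J.add_mem (h g hg) (h' g hg)
      zero_mem' := fun _ _ => J.zero_mem
      smul_mem' := fun c _ h g hg => J.mul_mem_left c (h g hg) }
  lie_mem {θ η} h h' g hg := by
    rw [Derivation.commutator_apply]
    exact J.sub_mem (h _ (h' g hg)) (h' _ (h g hg))

/-- The relative logarithmic vector fields: those which kill `t`. -/
def relFields (J : Ideal A) (t : A) : Fields A where
  T :=
    { carrier := {θ | θ ∈ (logFields J).T ∧ θ t = 0}
      add_mem' := fun h h' => ⟨add_mem h.1 h'.1, by simp [h.2, h'.2]⟩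
      zero_mem' := ⟨zero_mem _, rfl⟩
      smul_mem' := fun c _ h => ⟨Submodule.smul_mem _ c h.1, by simp [h.2]⟩ }
  lie_mem {θ η} h h' := ⟨(logFields J).lie_mem h.1 h'.1, by
    rw [Derivation.commutator_apply, h.2, h'.2, map_zero, map_zero, sub_zero]⟩

theorem relFields_le (J : Ideal A) (t : A) : (relFields J t).T ≤ (logFields J).T := fun _ h => h.1

namespace Fields
variable (L : Fields A)

/-- `D`-valued `p`-forms on `L`. -/
def Form (p : ℕ) : Type _ := L.T [⋀^Fin p]→ₗ[A] D A

variable {L} in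
instance {p : ℕ} : FunLike (L.Form p) (Fin p → L.T) (D A) :=
  inferInstanceAs (FunLike (L.T [⋀^Fin p]→ₗ[A] D A) (Fin p → L.T) (D A))

instance (p : ℕ) : AddCommGroup (L.Form p) := inferInstanceAs (AddCommGroup (L.T [⋀^Fin p]→ₗ[A] D A))

instance (p : ℕ) : Module A (L.Form p) := inferInstanceAs (Module A (L.T [⋀^Fin p]→ₗ[A] D A))

instance (p : ℕ) : Module (DR A) (L.Form p) :=
  inferInstanceAs (Module (DR A) (L.T [⋀^Fin p]→ₗ[A] D A))

variable {L}
theorem Form.add_apply {p : ℕ} (φ ψ : L.Form p) (θ : Fin p → L.T) : (φ + ψ) θ = φ θ + ψ θ := rfl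

theorem Form.smul_apply {p : ℕ} (P : DR A) (φ : L.Form p) (θ : Fin p → L.T) :
    (P • φ) θ = P • φ θ := rfl

theorem Form.smul_comm' {p : ℕ} (P : DR A) (g : A) (φ : L.Form p) : P • g • φ = g • P • φ :=
  AlternatingMap.ext fun θ => (smul_comm g P ((φ : L.T [⋀^Fin p]→ₗ[A] D A) θ)).symm

variable (L)

/-- The bracket of two fields in `L`. -/
def br (θ η : L.T) : L.T := ⟨⁅(θ : Derivation ℂ A A), (η : Derivation ℂ A A)⁆, L.lie_mem θ.2 η.2⟩

variable {L} in
/-- The exterior derivative of a `D`-valued `p`-form, where fields act on `D` by left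
multiplication. -/
def d {p : ℕ} (φ : L.Form p) (θ : Fin (p + 1) → L.T) : D A :=
  ∑ i : Fin (p + 1), (-1 : ℤ) ^ (i : ℕ) • (derD (θ i : Derivation ℂ A A) * φ (i.removeNth θ) -
    ∑ j ∈ Finset.Ioi i, φ (i.removeNth (Function.update θ j (L.br (θ i) (θ j)))))

variable {L} in
theorem d_add {p : ℕ} (φ ψ : L.Form p) (θ : Fin (p + 1) → L.T) : d (φ + ψ) θ = d φ θ + d ψ θ := by
  simp only [d, Form.add_apply, mul_add, Finset.sum_add_distrib]
  rw [← Finset.sum_add_distrib]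
  refine Finset.sum_congr rfl fun i _ => ?_
  rw [← smul_add]; congr 1; abel

variable {L} in
theorem d_smul {p : ℕ} (P : DR A) (φ : L.Form p) (θ : Fin (p + 1) → L.T) :
    d (P • φ) θ = P • d φ θ := by
  simp only [d, Form.smul_apply, DR.smul_def, Finset.sum_mul, smul_mul_assoc, sub_mul,
    mul_assoc]

/-- The forms with coefficients in the ideal `a`. -/
def K (a : Ideal A) (p : ℕ) : Submodule (DR A) (L.Form p) where
  carrier := {φ | φ ∈ a • (⊤ : Submodule A (L.Form p))}
  add_mem' h h' := (a • (⊤ : Submodule A (L.Form p))).add_mem h h'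
  zero_mem' := (a • (⊤ : Submodule A (L.Form p))).zero_mem
  smul_mem' P φ h := by
    refine Submodule.smul_induction_on (p := fun φ => P • φ ∈ a • (⊤ : Submodule A (L.Form p))) h
      ?_ ?_
    · intro g hg ψ _
      rw [Form.smul_comm']
      exact Submodule.smul_mem_smul hg trivial
    · intro φ ψ h h'
      rw [smul_add]; exact add_mem h h'

theorem mem_K {a : Ideal A} {p : ℕ} {φ : L.Form p} :
    φ ∈ L.K a p ↔ φ ∈ a • (⊤ : Submodule A (L.Form p)) := Iff.rfl

theorem mem_K_top {p : ℕ} (φ : L.Form p) : φ ∈ L.K ⊤ p := by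
  rw [mem_K, Submodule.top_smul]; trivial

/-- The exterior derivatives of the `(p-1)`-forms with coefficients in `a`. -/
def bdry (a : Ideal A) : ∀ p : ℕ, Submodule (DR A) (L.Form p)
  | 0 => ⊥
  | p + 1 =>
    { carrier := {ψ | ∃ φ ∈ L.K a p, ∀ θ, ψ θ = d φ θ}
      add_mem' := by
        rintro ψ ψ' ⟨φ, h, e⟩ ⟨φ', h', e'⟩
        exact ⟨φ + φ', add_mem h h', fun θ => by rw [d_add, Form.add_apply, e, e']⟩
      zero_mem' := ⟨0, zero_mem _, fun θ => by
        have := d_smul 0 (0 : L.Form p) θ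
        rw [zero_smul, zero_smul] at this
        rw [this]; rfl⟩
      smul_mem' := by
        rintro P ψ ⟨φ, h, e⟩
        exact ⟨P • φ, Submodule.smul_mem _ P h, fun θ => by
          rw [d_smul, Form.smul_apply, e]⟩ }

/-- For ideals `b ≤ a`, the cohomology in the top degree `n` of the quotient of the complex of
forms with coefficients in `a` by the complex of forms with coefficients in `b`. -/
abbrev H0 (a b : Ideal A) (n : ℕ) :=
  L.K a n ⧸ (L.K b n ⊔ L.bdry a n).comap (L.K a n).subtype

/-- The class in `H0` of a form. -/
def cls {a : Ideal A} (b : Ideal A) {n : ℕ} (φ : L.Form n) (h : φ ∈ L.K a n) : L.H0 a b n :=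
  Submodule.Quotient.mk ⟨φ, h⟩

/-- The forms of top degree `n`, with the filtration by order shifted by `n`. -/
def formFilt (n : ℕ) : Filt A (L.Form n) where
  F l :=
    { carrier := {φ | ∀ θ, (φ θ).op ∈ FD A (l + n)}
      add_mem' := fun h h' θ => add_mem (h θ) (h' θ)
      zero_mem' := fun _ => zero_mem (FD A _)
      neg_mem' := fun h θ => neg_mem (h θ) }
  mono l l' h φ hφ θ := FD_mono (by omega) (hφ θ)
  smul_mem {k l P φ} hP hφ θ := by
    have := FD_mul hP (hφ θ)
    rwa [← add_assoc] at this

/-- The induced filtration on `H0`. -/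
def H0Filt (a b : Ideal A) (n : ℕ) : Filt A (L.H0 a b n) :=
  ((L.formFilt n).restrict (L.K a n)).quotient _

/-- The step `F_l` in degree `p - n` of the complex of forms with coefficients in `a`. -/
def FK (a : Ideal A) (p : ℕ) (l : ℤ) : Set (L.Form p) :=
  {φ | φ ∈ L.K a p ∧ ∀ θ, (φ θ).op ∈ FD A (l + p)}

/-- The image of `F_l` of the degree before `p - n` in degree `p - n`. -/
def FB (a : Ideal A) (l : ℤ) : ∀ p : ℕ, Set (L.Form p)
  | 0 => {0}
  | p + 1 => {ψ | ∃ φ ∈ L.FK a p l, ∀ θ, ψ θ = d φ θ}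

/-- The quotient complex with terms `K a p / K b p`, in degrees `p - n ≤ 0`, is filtered acyclic:
every step `F_l` of it is exact in negative degrees, and the cohomology in degree zero of `F_l`
injects into that of the whole complex. -/
structure FilteredAcyclic (a b : Ideal A) (n : ℕ) : Prop where
  exact : ∀ (l : ℤ) (p : ℕ), p < n → ∀ φ ∈ L.FK a p l,
    (∃ χ ∈ L.FK b (p + 1) l, ∀ θ, d φ θ = χ θ) → ∃ χ ∈ L.FK b p l, φ - χ ∈ L.FB a l p
  strict : ∀ l : ℤ, ∀ φ ∈ L.FK a n l, φ ∈ L.K b n ⊔ L.bdry a n →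
    ∃ χ ∈ L.FK b n l, φ - χ ∈ L.FB a l n

end Fields

section Residue
variable (J : Ideal A) (t : A) (n : ℕ)

/-- The module `M`. -/
abbrev M := (relFields J t).H0 ⊤ (Ideal.span {t}) n

variable {n} in
/-- The class in `M` of a form. -/
def M.mk (φ : (relFields J t).Form n) : M J t n :=
  (relFields J t).cls _ φ ((relFields J t).mem_K_top φ)

variable {n} in
/-- The restriction of forms on the logarithmic fields to the relative fields. -/
def res (α : (logFields J).Form n) : (relFields J t).Form n :=
  AlternatingMap.compLinearMap (α : (logFields J).T [⋀^Fin n]→ₗ[A] D A)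
    (Submodule.inclusion (relFields_le J t))

/-- `R` is the operator `[α] ↦ [(dt/t ∧)⁻¹ dα]`: whenever `dα = dt/t ∧ β` for logarithmic forms
`α`, `β` of degree `n`, it maps the class of `α` to the class of `β`. The value of `dt/t` on a
field `θ` is the function `c` with `θ t = c t`. -/
def IsResidue (R : M J t n →ₗ[DR A] M J t n) : Prop :=
  ∀ α β : (logFields J).Form n,
    (∀ (θ : Fin (n + 1) → (logFields J).T) (c : Fin (n + 1) → A),
      (∀ i, (θ i : Derivation ℂ A A) t = c i * t) →
        Fields.d α θ = ∑ i : Fin (n + 1), (-1 : ℤ) ^ (i : ℕ) • c i • β (i.removeNth θ)) →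
    R (M.mk J t (res J t α)) = M.mk J t (res J t β)

/-- The operator `R` on `M`. -/
def residue : M J t n →ₗ[DR A] M J t n :=
  open Classical in if h : ∃ R, IsResidue J t n R then h.choose else 0

end Residue

/-- Multiplication by a complex number on a right `D`-module. -/
def scalar {M : Type*} [AddCommGroup M] [Module (DR A) M] (c : ℂ) : M →ₗ[DR A] M where
  toFun m := (algebraMap ℂ (DR A) c) • m
  map_add' := smul_add _
  map_smul' P m := by
    rw [smul_smul, Algebra.commutes, ← smul_smul]; rfl

/-- The sum of the generalized eigenspaces of `R` for the real eigenvalues in `s`. -/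
def genEigen {M : Type*} [AddCommGroup M] [Module (DR A) M] (R : M →ₗ[DR A] M) (s : Set ℝ) :
    Submodule (DR A) M :=
  ⨆ c ∈ s, ⨆ k : ℕ, LinearMap.ker ((R - scalar (c : ℂ)) ^ k)

section Eigen
variable (J : Ideal A) (t : A) (n : ℕ) (α : ℝ)

/-- `M_{≥ α}` -/
def Mge : Submodule (DR A) (M J t n) := genEigen (residue J t n) (Set.Ici α)

/-- `M_{> α}` -/
def Mgt : Submodule (DR A) (M J t n) := genEigen (residue J t n) (Set.Ioi α)

/-- `M_α = M_{≥ α} / M_{> α}` -/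
abbrev Meig := Mge J t n α ⧸ (Mgt J t n α).comap (Mge J t n α).subtype

/-- The filtration on `M`. -/
def MFilt : Filt A (M J t n) := (relFields J t).H0Filt _ _ n

/-- The filtration on `M_α` as a subquotient of `M`. -/
def MeigFilt : Filt A (Meig J t n α) := ((MFilt J t n).restrict (Mge J t n α)).quotient _

end Eigen
end Algebra

section Geometry

/-- The local model `ℂ^{n+1}`. -/
abbrev Model (n : ℕ) := EuclideanSpace ℂ (Fin (n + 1))

variable (n : ℕ) {X : Type*} [TopologicalSpace X] [ChartedSpace (Model n) X]

/-- The ring of germs at `x` of holomorphic functions. -/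
def holGerms (x : X) : Subring (Germ (𝓝 x) ℂ) where
  carrier := {g | ∃ h : X → ℂ, g = (h : Germ (𝓝 x) ℂ) ∧
    ∀ᶠ y in 𝓝 x, MDifferentiableAt 𝓘(ℂ, Model n) 𝓘(ℂ) h y}
  mul_mem' := by
    rintro _ _ ⟨h, rfl, hh⟩ ⟨k, rfl, hk⟩
    exact ⟨h * k, rfl, by filter_upwards [hh, hk] with y h1 h2 using h1.mul h2⟩
  one_mem' := ⟨1, rfl, Eventually.of_forall fun _ => mdifferentiableAt_const⟩
  add_mem' := by
    rintro _ _ ⟨h, rfl, hh⟩ ⟨k, rfl, hk⟩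
    exact ⟨h + k, rfl, by filter_upwards [hh, hk] with y h1 h2 using h1.add h2⟩
  zero_mem' := ⟨0, rfl, Eventually.of_forall fun _ => mdifferentiableAt_const⟩
  neg_mem' := by
    rintro _ ⟨h, rfl, hh⟩
    exact ⟨-h, rfl, by filter_upwards [hh] with y h1 using h1.neg⟩

/-- The stalk at `x` of the sheaf of holomorphic functions. -/
def O (x : X) : Type _ := holGerms n x

instance (x : X) : CommRing (O n x) := inferInstanceAs (CommRing (holGerms n x))

variable {n} in
/-- The underlying germ of a function. -/
def O.germ {x : X} : O n x →+* Germ (𝓝 x) ℂ := (holGerms n x).subtype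

/-- The germs of constant functions. -/
def O.const (x : X) : ℂ →+* O n x where
  toFun c := ⟨((fun _ : X => c : X → ℂ) : Germ (𝓝 x) ℂ), fun _ => c, rfl,
    Eventually.of_forall fun _ => mdifferentiableAt_const⟩
  map_one' := rfl
  map_mul' _ _ := rfl
  map_zero' := rfl
  map_add' _ _ := rfl

instance (x : X) : Algebra ℂ (O n x) := (O.const n x).toAlgebra

/-- The ideal of germs at `x` of functions vanishing on `V`. -/
def vanish (V : Set X) (x : X) : Ideal (O n x) where
  carrier := {g | ∃ h : X → ℂ, g.germ = (h : Germ (𝓝 x) ℂ) ∧ ∀ᶠ y in 𝓝 x, y ∈ V → h y = 0}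
  add_mem' := by
    rintro g g' ⟨h, e, hh⟩ ⟨k, e', hk⟩
    refine ⟨h + k, by rw [map_add, e, e']; rfl, ?_⟩
    filter_upwards [hh, hk] with y h1 h2 hy
    simp [h1 hy, h2 hy]
  zero_mem' := ⟨0, rfl, by simp⟩
  smul_mem' := by
    rintro c g ⟨h, e, hh⟩
    obtain ⟨k, e', -⟩ := c.2
    refine ⟨k * h, ?_, ?_⟩
    · rw [smul_eq_mul, map_mul, e]
      exact congrArg (· * (h : Germ (𝓝 x) ℂ)) e'
    · filter_upwards [hh] with y h1 hy
      simp [h1 hy]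

/-- A proper holomorphic family `f` over the unit disc, with total space `X` of dimension `n + 1`,
smooth over the punctured disc, and whose central fibre is a simple normal crossing divisor
`∑ e_i Y_i` with irreducible components `Y_i`. -/
structure Degeneration (X : Type*) [TopologicalSpace X] [ChartedSpace (Model n) X]
    (I : Type*) [Fintype I] where
  f : X → ℂ
  holomorphic : MDifferentiable 𝓘(ℂ, Model n) 𝓘(ℂ) f
  norm_lt : ∀ x, ‖f x‖ < 1
  proper : ∀ r : ℝ, r < 1 → IsCompact {x | ‖f x‖ ≤ r}
  smooth : ∀ x, f x ≠ 0 → mfderiv 𝓘(ℂ, Model n) 𝓘(ℂ) f x ≠ 0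
  Y : I → Set X
  e : I → ℕ
  e_pos : ∀ i, 0 < e i
  isClosed : ∀ i, IsClosed (Y i)
  isConnected : ∀ i, IsConnected (Y i)
  fiber : ∀ x, f x = 0 ↔ ∃ i, x ∈ Y i
  /-- Near every point of the central fibre there are holomorphic coordinates `z` in which the
  components through the point are coordinate hyperplanes `z_{σ i} = 0`, and
  `f = ∏ z_{σ i} ^ e_i`. -/
  local_form : open Classical in ∀ x, f x = 0 →
    ∃ z ∈ IsManifold.maximalAtlas 𝓘(ℂ, Model n) ω X, x ∈ z.source ∧
      ∃ σ : I → Fin (n + 1), Set.InjOn σ {i | x ∈ Y i} ∧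
        (∀ i, x ∈ Y i → ∀ y ∈ z.source, y ∈ Y i ↔ z y (σ i) = 0) ∧
        ∀ y ∈ z.source, f y = ∏ i with x ∈ Y i, z y (σ i) ^ e i

/-- A family of germs is a section over `U` of the sheaf of holomorphic functions. -/
def IsSecO (U : Set X) (g : ∀ x : X, O n x) : Prop :=
  ∃ h : X → ℂ, ∀ x ∈ U, (g x).germ = (h : Germ (𝓝 x) ℂ)

/-- A family of germs of vector fields is a section over the open set `U`: it maps functions to
functions. -/
def IsSecT (U : Set X) (θ : ∀ x : X, Derivation ℂ (O n x) (O n x)) : Prop :=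
  ∀ V ⊆ U, IsOpen V → ∀ g, IsSecO n V g → IsSecO n V fun x => θ x (g x)

/-- A family of germs of differential operators is a section over the open set `U`: it maps
functions to functions. -/
def IsSecD (U : Set X) (P : ∀ x : X, D (O n x)) : Prop :=
  ∀ V ⊆ U, IsOpen V → ∀ g, IsSecO n V g → IsSecO n V fun x => (P x).toEnd (g x)

namespace Degeneration
variable {n} {I : Type*} [Fintype I] (S : Degeneration n X I)

/-- The germ of `f`. -/
def t (x : X) : O n x :=
  ⟨(S.f : Germ (𝓝 x) ℂ), S.f, rfl, Eventually.of_forall fun y => S.holomorphic y⟩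

/-- The ideal of the reduced central fibre at `x`. -/
def J (x : X) : Ideal (O n x) := vanish n (⋃ i, S.Y i) x

/-- The intersection of the components with index in `K`. -/
def YK (K : Finset I) : Set X := ⋂ i ∈ K, S.Y i

/-- The germ over `x` of the cycle of the conormal bundle of `Y^K`. -/
def conormal (K : Finset I) (x : X) : PrimeSpectrum (GrD (O n x)) → ℕ∞ :=
  conormalCycle (vanish n (S.YK K) x)

/-- The germs at `x` of relative logarithmic vector fields. -/
def rel (x : X) : Fields (O n x) := relFields (S.J x) (S.t x)

/-- A family of germs of `D`-valued relative logarithmic `p`-forms is a section over the open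
set `U`. -/
def IsSecForm {p : ℕ} (U : Set X) (φ : ∀ x : X, (S.rel x).Form p) : Prop :=
  ∀ V ⊆ U, IsOpen V → ∀ θ : ∀ x : X, Fin p → (S.rel x).T,
    (∀ i, IsSecT n V fun x => (θ x i : Derivation ℂ (O n x) (O n x))) →
      IsSecD n V fun x => φ x (θ x)

/-- The ideal of `∑ m_i Y_i` at `x`. -/
def divIdeal (m : I → ℕ) (x : X) : Ideal (O n x) := ∏ i, vanish n (S.Y i) x ^ m i

/-- The ideal of the divisor `⌈α Y⌉`. -/
def idealGe (α : ℚ) (x : X) : Ideal (O n x) := S.divIdeal (fun i => ⌈α * S.e i⌉₊) x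

/-- The ideal of the divisor `⌊α Y⌋ + Y_red`. -/
def idealGt (α : ℚ) (x : X) : Ideal (O n x) := S.divIdeal (fun i => ⌊α * S.e i⌋₊ + 1) x

/-- The indices `i` with `α e_i` an integer. -/
def indices (α : ℚ) : Finset I := open Classical in {i | ∃ k : ℤ, α * S.e i = k}

/-- The stalk at `x` of the `D`-module `M`. -/
abbrev stalkM (x : X) := M (S.J x) (S.t x) n

/-- The stalk at `x` of the filtered `D`-module `M_α`. -/
abbrev stalkEig (α : ℚ) (x : X) := Meig (S.J x) (S.t x) n α

/-- The stalk at `x` of the zeroth cohomology of the complex `C_α ⊗ D`. -/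
abbrev stalkH0 (α : ℚ) (x : X) := (S.rel x).H0 (S.idealGe α x) (S.idealGt α x) n

/-- The filtration on the stalk of `M`. -/
abbrev filtM (x : X) : Filt (O n x) (S.stalkM x) := MFilt (S.J x) (S.t x) n

/-- The filtration on the stalk of `M_α`. -/
abbrev filtEig (α : ℚ) (x : X) : Filt (O n x) (S.stalkEig α x) := MeigFilt (S.J x) (S.t x) n α

/-- The filtration on the stalk of the zeroth cohomology of `C_α ⊗ D`. -/
abbrev filtH0 (α : ℚ) (x : X) : Filt (O n x) (S.stalkH0 α x) := (S.rel x).H0Filt _ _ n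

/-- A family of germs is a section over `U` of the zeroth cohomology of `C_α ⊗ D`: locally it is
the family of classes of a form. -/
def IsSecH0 (α : ℚ) (U : Set X) (s : ∀ x, S.stalkH0 α x) : Prop :=
  ∀ x ∈ U, ∃ V ⊆ U, IsOpen V ∧ x ∈ V ∧ ∃ φ : ∀ y : X, (S.rel y).Form n, S.IsSecForm V φ ∧
    ∀ y ∈ V, ∃ h : φ y ∈ (S.rel y).K (S.idealGe α y) n, s y = (S.rel y).cls _ (φ y) h

/-- A family of germs is a section over `U` of `M_α`: locally it is the family of classes of a
form whose classes in `M` lie in `M_{≥ α}`. -/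
def IsSecEig (α : ℚ) (U : Set X) (s : ∀ x, S.stalkEig α x) : Prop :=
  ∀ x ∈ U, ∃ V ⊆ U, IsOpen V ∧ x ∈ V ∧ ∃ φ : ∀ y : X, (S.rel y).Form n, S.IsSecForm V φ ∧
    ∀ y ∈ V, ∃ h : M.mk (S.J y) (S.t y) (φ y) ∈ Mge (S.J y) (S.t y) n α,
      s y = Submodule.Quotient.mk ⟨_, h⟩

end Degeneration
end Geometry
end LogD
end

/-! Everything is proved on stalks, in coordinates. Near a point of the central fibre write `t = ∏
u_l ^ e_l`, where `l` runs over the set `E` of coordinates that cut out components, and fix a base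
index `i ∈ E`. The relative logarithmic fields then have a basis of `n` commuting fields: `u_j ∂_j /
e_j - u_i ∂_i / e_i` for `j ∈ E` different from `i`, and `∂_j` for `j ∉ E`. In this basis the de
Rham complex with values in `D` is the Koszul complex of the left multiplications by these fields.
On forms divisible by a monomial `g`, dividing by `g` only adds constants to the fields
(`LogCoords.twist`), so the symbols stay the same.

The associated graded ring of `D` is the polynomial ring `A[ξ]` (`Coords.grEquiv`). Modulo the base
variable `x_i` the symbols of the fields become unit multiples of `x_j ξ_j` and of `ξ_j`. These
involve disjoint sets of variables, hence form a regular sequence in any order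
(`VarRing.mem_of_sg_mul`). So the Koszul complex of the symbols is exact modulo `x_i`, and descent
along the order (`KoszulData.lower`) lifts this to operators: the complex of forms divisible by `g`,
modulo those divisible by `g u_i`, is filtered acyclic. Every `i ∈ E` can be taken as base index,
and filtered acyclicity passes to extensions (`Fields.FilteredAcyclic.trans`); so the same holds for
any two monomials `g` and `g h`.

It follows that the cohomology in degree zero is a cyclic filtered module whose associated graded
module is the quotient of `A[ξ]` by `h` and the symbols of the fields
(`LogCoords.Adapted.cycle_H0`). Since each `x_j` with `j ∈ E` is a non-zero-divisor modulo those
symbols, lengths add up over the factors of `h`. A factor `x_j` contributes once each conormal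
bundle of a stratum with `j ∈ K`. Hence the multiplicity at `K` is the sum over `K` of the exponents
of `h` (`VarRing.cycle_mon`). Taking `h = t` gives the cycle of `M`; taking for `h` the product of
the `u_i` with `α e_i` an integer gives that of `C_α`.

The operator `R` multiplies the coefficient of a top form from the left by `u_i ∂_i / e_i`. Passing
a monomial with exponents `m` costs the constant `m_i / e_i`, so `R - m_i / e_i` maps the forms
divisible by `g` to those divisible by `g u_i`. Going from `1` to `t` one factor at a time, the
eigenvalues `r / e_j` appear in a known order. This identifies `M_{≥ α}` and `M_{> α}` with the
images of the forms with zeros along `⌈αY⌉` and `⌊αY⌋ + Y_red` (`LogCoords.Adapted.genEigen_eq`).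
The acyclicity of all forms modulo those divisible by `g` then makes `ψ_α` an isomorphism, and its
strictness makes it a filtered one (`LogCoords.Adapted.exists_equiv`).

The analytic input is that germs of holomorphic functions have the structure `Coords`: partial
derivatives, restriction to coordinate hyperplanes, and the fact that a derivation killing the
coordinates is zero. Off the central fibre all the modules vanish. That `ψ_α` respects sections
holds because an identity between germs of operators spreads to a neighbourhood
(`IsSecD.exists_eq`). -/

noncomputable section
set_option linter.unusedSectionVars false
set_option linter.unusedSimpArgs false
namespace LogD

/-! ### Symbols of differential operators in coordinates. -/

section
open MvPolynomial

/-- Algebraic coordinates on a ring of germs: functions `w i`, the dual derivations, and for every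
`i` the restriction to `w i = 0`. -/
structure Coords (A ι : Type*) [CommRing A] [Algebra ℂ A] where
  w : ι → A
  der : ι → Derivation ℂ A A
  restr : ι → A →+* A
  der_self : ∀ i, der i (w i) = 1
  der_ne : ∀ i j, i ≠ j → der i (w j) = 0
  der_ext : ∀ θ : Derivation ℂ A A, (∀ i, θ (w i) = 0) → θ = 0
  restr_self : ∀ i, restr i (w i) = 0
  restr_ne : ∀ i j, i ≠ j → restr i (w j) = w j
  restr_sub : ∀ i a, a - restr i a ∈ Ideal.span {w i}

section Symbols
variable {A : Type*} [CommRing A] [Algebra ℂ A]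

/-- The commutator with multiplication by `g`. -/
def brk (g : A) : Module.End ℂ A →ₗ[ℂ] Module.End ℂ A :=
  LinearMap.mulRight ℂ (LinearMap.mulLeft ℂ g : Module.End ℂ A) -
    LinearMap.mulLeft ℂ (LinearMap.mulLeft ℂ g : Module.End ℂ A)

theorem brk_def (g : A) (P : Module.End ℂ A) :
    brk g P = P * LinearMap.mulLeft ℂ g - LinearMap.mulLeft ℂ g * P := rfl

theorem brk_apply (g : A) (P : Module.End ℂ A) (u : A) : brk g P u = P (g * u) - g * P u := rfl

theorem brk_mul (g : A) (P Q : Module.End ℂ A) : brk g (P * Q) = P * brk g Q + brk g P * Q := by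
  simp only [brk_def, mul_sub, sub_mul, mul_assoc]; abel

theorem brk_comm (g h : A) (P : Module.End ℂ A) : brk g (brk h P) = brk h (brk g P) := by
  ext u
  simp only [brk_apply, mul_left_comm h g]
  ring

theorem mem_opOrd_succ' {k : ℕ} {P : Module.End ℂ A} :
    P ∈ opOrd A (k + 1) ↔ ∀ g, brk g P ∈ opOrd A k := Iff.rfl

theorem opOrd_zero {P : Module.End ℂ A} : P ∈ opOrd A 0 ↔ P = 0 := Iff.rfl

theorem opOrd_one_apply {P : Module.End ℂ A} (hP : P ∈ opOrd A 1) (u : A) : P u = u * P 1 := by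
  have h := LinearMap.congr_fun (opOrd_zero.1 (mem_opOrd_succ'.1 hP u)) 1
  simpa [brk_apply, sub_eq_zero] using h

theorem opOrd_one_eq {P : Module.End ℂ A} (hP : P ∈ opOrd A 1) : P = LinearMap.mulLeft ℂ (P 1) := by
  ext u
  rw [opOrd_one_apply hP u, LinearMap.mulLeft_apply, mul_comm]

/-- Commutators with functions commute with left multiplication by `g`, so induction reduces to the
zero operator, where `g` cancels. This lets monomials be divided out without any change of order. -/
theorem mem_opOrd_of_mulLeft_mul [IsDomain A] {g : A} (hg : g ≠ 0) {k : ℕ} {P : Module.End ℂ A}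
    (h : LinearMap.mulLeft ℂ g * P ∈ opOrd A k) : P ∈ opOrd A k := by
  induction k generalizing P with
  | zero =>
    ext u
    have := LinearMap.congr_fun (opOrd_zero.1 h) u
    exact (mul_eq_zero.1 (show g * P u = 0 from this)).resolve_left hg
  | succ k ih =>
    intro a
    refine ih ?_
    have := h a
    convert this using 1
    ext u
    simp [mul_sub, mul_left_comm a g]

variable {ι : Type*} [Fintype ι]

/-- The symbol of degree `k` of an operator in the coordinates `w`. -/
def sym (w : ι → A) : ℕ → Module.End ℂ A →ₗ[ℂ] MvPolynomial ι A
  | 0 => (Algebra.linearMap A (MvPolynomial ι A)).restrictScalars ℂ ∘ₗ LinearMap.applyₗ 1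
  | k + 1 => ((k + 1 : ℕ) : ℂ)⁻¹ •
      ∑ i, LinearMap.mulLeft ℂ (X i : MvPolynomial ι A) ∘ₗ sym w k ∘ₗ brk (w i)

theorem sym_zero (w : ι → A) (P : Module.End ℂ A) : sym w 0 P = C (P 1) := rfl

theorem sym_succ (w : ι → A) (k : ℕ) (P : Module.End ℂ A) :
    sym w (k + 1) P = ((k + 1 : ℕ) : ℂ)⁻¹ • ∑ i, X i * sym w k (brk (w i) P) := by
  simp [sym]

theorem sum_X_mul_sym (w : ι → A) (k : ℕ) (P : Module.End ℂ A) :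
    ∑ i, X i * sym w k (brk (w i) P) = ((k + 1 : ℕ) : ℂ) • sym w (k + 1) P := by
  rw [sym_succ, smul_smul, mul_inv_cancel₀ (Nat.cast_ne_zero.2 k.succ_ne_zero), one_smul]

theorem isHomogeneous_smul {k : ℕ} {p : MvPolynomial ι A} (hp : p.IsHomogeneous k) (c : ℂ) :
    (c • p).IsHomogeneous k := by
  rw [← algebraMap_smul A c p, smul_eq_C_mul]
  exact hp.C_mul _

theorem sym_isHomogeneous (w : ι → A) (k : ℕ) (P : Module.End ℂ A) :
    (sym w k P).IsHomogeneous k := by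
  induction k generalizing P with
  | zero => exact isHomogeneous_C _ _
  | succ k ih =>
    rw [sym_succ]
    refine isHomogeneous_smul (IsHomogeneous.sum _ _ _ fun i _ => ?_) _
    rw [add_comm k 1]
    exact (isHomogeneous_X _ _).mul (ih _)

theorem pderiv_smul_complex (i : ι) (c : ℂ) (p : MvPolynomial ι A) :
    pderiv i (c • p) = c • pderiv i p := by
  rw [← algebraMap_smul A c p, Derivation.map_smul, algebraMap_smul]

/-- The recursion for `sym` is Euler's identity for a homogeneous polynomial whose derivatives are
the symbols of the commutators `[P, w_j]`. The derivatives do come out this way because commutators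
with two functions commute. -/
theorem pderiv_sym [DecidableEq ι] (w : ι → A) (k : ℕ) (j : ι) (P : Module.End ℂ A) :
    pderiv j (sym w (k + 1) P) = sym w k (brk (w j) P) := by
  induction k generalizing P with
  | zero =>
    rw [sym_succ, pderiv_smul_complex, map_sum]
    simp [sym_zero, Derivation.leibniz, pderiv_X, Pi.single_apply]
  | succ k ih =>
    rw [sym_succ, pderiv_smul_complex, map_sum]
    simp only [Derivation.leibniz, ih, pderiv_X, smul_eq_mul, Pi.single_apply, mul_ite, mul_one,
      mul_zero, Finset.sum_add_distrib, Finset.sum_ite_eq', Finset.sum_ite_eq, Finset.mem_univ,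
      if_true]
    simp only [brk_comm (w j)]
    rw [sum_X_mul_sym, inv_smul_eq_iff₀ (Nat.cast_ne_zero.2 (k + 1).succ_ne_zero)]
    rw [Nat.cast_succ (k + 1), add_smul, one_smul]

theorem eq_zero_of_pderiv [DecidableEq ι] {k : ℕ} {p : MvPolynomial ι A}
    (hp : p.IsHomogeneous (k + 1)) (h : ∀ i, pderiv i p = 0) : p = 0 := by
  have := hp.sum_X_mul_pderiv
  simp only [h, mul_zero, Finset.sum_const_zero] at this
  rw [← Nat.cast_smul_eq_nsmul ℂ] at this
  exact (smul_eq_zero_iff_right (Nat.cast_ne_zero.2 k.succ_ne_zero : ((k + 1 : ℕ) : ℂ) ≠ 0)).1 this.symm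

theorem sym_eq_zero_of_mem (w : ι → A) {k : ℕ} {P : Module.End ℂ A} (hP : P ∈ opOrd A k) :
    sym w k P = 0 := by
  induction k generalizing P with
  | zero => rw [opOrd_zero.1 hP, map_zero]
  | succ k ih =>
    rw [sym_succ, Finset.sum_eq_zero, smul_zero]
    intro i _
    rw [ih (P := brk (w i) P) (hP (w i)), mul_zero]

variable (𝔠 : Coords A ι)

/-- The order can be tested on the coordinates alone. The essential case is order one: after
subtraction of `P 1` the operator is a derivation, and a derivation that kills the coordinates is
zero. In higher order `[P, g]` inherits the hypothesis. -/
theorem Coords.mem_opOrd_of_brk {k : ℕ} {P : Module.End ℂ A} (hP : P ∈ opOrd A (k + 2))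
    (h : ∀ j, brk (𝔠.w j) P ∈ opOrd A k) : P ∈ opOrd A (k + 1) := by
  induction k generalizing P with
  | zero =>
    intro g
    have key : ∀ a b, P (a * b) = a * P b + b * P a - a * b * P 1 := by
      intro a b
      have h1 := LinearMap.congr_fun (opOrd_one_eq (hP a)) b
      simp only [LinearMap.sub_apply, Module.End.mul_apply, LinearMap.mulLeft_apply, mul_one] at h1
      linear_combination h1
    let θ : Derivation ℂ A A := Derivation.mk' (P - LinearMap.mulLeft ℂ (P 1)) (by
      intro a b
      simp only [LinearMap.sub_apply, LinearMap.mulLeft_apply, smul_eq_mul, key a b]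
      ring)
    have hθ : θ = 0 := 𝔠.der_ext θ fun i => by
      have := LinearMap.congr_fun (opOrd_zero.1 (h i)) 1
      simp only [brk_apply, mul_one, LinearMap.zero_apply] at this
      change P (𝔠.w i) - P 1 * 𝔠.w i = 0
      linear_combination this
    have hP1 : P = LinearMap.mulLeft ℂ (P 1) := by
      ext a
      have := congrArg (fun θ : Derivation ℂ A A => θ a) hθ
      exact sub_eq_zero.1 this
    rw [hP1]
    exact mulLeft_mem _ g
  | succ k ih =>
    intro g
    refine ih (hP g) fun j => ?_
    change brk _ (brk g P) ∈ _
    rw [brk_comm]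
    exact h j g

/-- If the symbol vanishes, so do its derivatives, which are the symbols of the commutators with the
coordinates; by induction these have lower order, and so does the operator. -/
theorem Coords.sym_eq_zero {k : ℕ} {P : Module.End ℂ A} (hP : P ∈ opOrd A (k + 1)) :
    sym 𝔠.w k P = 0 ↔ P ∈ opOrd A k := by
  classical
  refine ⟨fun h => ?_, sym_eq_zero_of_mem _⟩
  induction k generalizing P with
  | zero =>
    rw [sym_zero, C_eq_zero] at h
    rw [opOrd_zero, opOrd_one_eq hP, h, LinearMap.mulLeft_zero_eq_zero]
  | succ k ih =>
    refine 𝔠.mem_opOrd_of_brk hP fun j => ih (hP _) ?_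
    rw [← pderiv_sym, h, map_zero]

/-- In positive degree two homogeneous polynomials agree once their derivatives do, and for the
derivatives the claim is the Leibniz rule for commutators together with induction. -/
theorem sym_mul (w : ι → A) {a b : ℕ} {P Q : Module.End ℂ A} (hP : P ∈ opOrd A (a + 1))
    (hQ : Q ∈ opOrd A (b + 1)) : sym w (a + b) (P * Q) = sym w a P * sym w b Q := by
  classical
  induction hm : a + b generalizing a b P Q with
  | zero =>
    obtain ⟨rfl, rfl⟩ : a = 0 ∧ b = 0 := by omega
    rw [sym_zero, sym_zero, sym_zero, Module.End.mul_apply, opOrd_one_apply hP, map_mul, mul_comm]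
  | succ m ih =>
    rw [← sub_eq_zero]
    refine eq_zero_of_pderiv (k := m) ((sym_isHomogeneous _ _ _).sub
      (hm ▸ (sym_isHomogeneous _ _ _).mul (sym_isHomogeneous _ _ _))) fun i => ?_
    rw [map_sub, Derivation.leibniz, pderiv_sym, brk_mul, map_add, sub_eq_zero, smul_eq_mul,
      smul_eq_mul]
    congr 1
    · rcases b with _ | b
      · rw [show brk (w i) Q = 0 from hQ _, sym_zero, pderiv_C, mul_zero, mul_zero, map_zero]
      · rw [pderiv_sym]
        exact ih hP (hQ _) (by omega)
    · rcases a with _ | a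
      · rw [show brk (w i) P = 0 from hP _, sym_zero, pderiv_C, mul_zero, zero_mul, map_zero]
      · rw [pderiv_sym, mul_comm (sym w b Q)]
        exact ih (hP _) hQ (by omega)

theorem Coords.sym_der (i : ι) : sym 𝔠.w 1 (𝔠.der i : A →ₗ[ℂ] A) = X i := by
  classical
  rw [sym_succ, Finset.sum_eq_single i]
  · simp [sym_zero, brk_apply, 𝔠.der_self]
  · intro j _ hj
    simp [sym_zero, brk_apply, 𝔠.der_ne i j hj.symm]
  · simp

theorem sym_derivation (w : ι → A) (θ : Derivation ℂ A A) :
    sym w 1 (θ : A →ₗ[ℂ] A) = ∑ i, C (θ (w i)) * X i := by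
  classical
  rw [sym_succ]
  simp [sym_zero, brk_apply, mul_comm]

/-- A monomial is the symbol of a function times a product of the `∂_i`. Keeping track of a subring
that contains these generators yields at the same time that they generate all of `D`. -/
theorem Coords.exists_sym_eq_of_generators (T : Subring (D A)) (h1 : ∀ g, toD g ∈ T)
    (h2 : ∀ i, derD (𝔠.der i) ∈ T) {k : ℕ} {p : MvPolynomial ι A} (hp : p.IsHomogeneous k) :
    ∃ P ∈ T, P.toEnd ∈ opOrd A (k + 1) ∧ sym 𝔠.w k P.toEnd = p := by
  classical
  have mono : ∀ (k : ℕ) (s : ι →₀ ℕ) (a : A), s.degree = k →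
      ∃ P ∈ T, P.toEnd ∈ opOrd A (k + 1) ∧ sym 𝔠.w k P.toEnd = monomial s a := by
    intro k
    induction k with
    | zero =>
      intro s a hs
      obtain rfl : s = 0 := (Finsupp.degree_eq_zero_iff s).1 hs
      refine ⟨toD a, h1 a, mulLeft_mem a, ?_⟩
      rw [sym_zero, show (toD a).toEnd 1 = a from mul_one a]
      rfl
    | succ k ih =>
      intro s a hs
      obtain ⟨i, hi⟩ : ∃ i, s i ≠ 0 := by
        by_contra! h
        rw [show s = 0 from Finsupp.ext h] at hs
        simp at hs
      have hle : Finsupp.single i 1 ≤ s := by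
        rw [Finsupp.single_le_iff]; omega
      have hs' : s = (s - Finsupp.single i 1) + Finsupp.single i 1 :=
        (tsub_add_cancel_of_le hle).symm
      obtain ⟨P, hT, hP, e⟩ := ih (s - Finsupp.single i 1) a (by
        have := congrArg Finsupp.degree hs'
        rw [map_add, hs] at this
        simpa using this.symm)
      have hder : (derD (𝔠.der i)).toEnd = (𝔠.der i : A →ₗ[ℂ] A) := rfl
      refine ⟨P * derD (𝔠.der i), mul_mem hT (h2 i), ?_, ?_⟩
      · rw [map_mul]
        exact opOrd_mul (b := 1) hP (derivation_mem (𝔠.der i))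
      · rw [map_mul, hder, sym_mul (b := 1) 𝔠.w hP (derivation_mem (𝔠.der i)), 𝔠.sym_der, e, X,
          monomial_mul, ← hs', mul_one]
  choose! P hT hP e using mono
  have hdeg : ∀ s ∈ p.support, s.degree = k := fun s hs => by
    by_contra h
    exact (mem_support_iff.1 hs) (hp.coeff_eq_zero h)
  refine ⟨∑ s ∈ p.support, P k s (p.coeff s), sum_mem fun s hs => hT _ _ _ (hdeg s hs), ?_, ?_⟩
  · rw [map_sum]
    exact Submodule.sum_mem _ fun s hs => hP _ _ _ (hdeg s hs)
  · rw [map_sum, map_sum]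
    conv_rhs => rw [p.as_sum]
    exact Finset.sum_congr rfl fun s hs => e _ _ _ (hdeg s hs)

theorem Coords.exists_sym_eq {k : ℕ} {p : MvPolynomial ι A} (hp : p.IsHomogeneous k) :
    ∃ P ∈ opOrd A (k + 1), sym 𝔠.w k P = p := by
  obtain ⟨P, -, hP, e⟩ := 𝔠.exists_sym_eq_of_generators ⊤ (fun _ => trivial) (fun _ => trivial) hp
  exact ⟨_, hP, e⟩

theorem Coords.mem_of_generators (T : Subring (D A)) (h1 : ∀ g, toD g ∈ T)
    (h2 : ∀ i, derD (𝔠.der i) ∈ T) (Q : D A) : Q ∈ T := by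
  obtain ⟨k, hk⟩ := Q.2
  change Q.toEnd ∈ opOrd A k at hk
  induction k generalizing Q with
  | zero =>
    rw [show Q = 0 from D.toEnd_injective (a₂ := 0) (opOrd_zero.1 hk)]
    exact zero_mem T
  | succ k ih =>
    obtain ⟨P, hT, hP, e⟩ := 𝔠.exists_sym_eq_of_generators T h1 h2 (sym_isHomogeneous 𝔠.w k Q.toEnd)
    have h3 : (Q - P).toEnd ∈ opOrd A k := by
      rw [← 𝔠.sym_eq_zero (by rw [map_sub]; exact sub_mem hk hP), map_sub, map_sub, e, sub_self]
    rw [← sub_add_cancel Q P]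
    exact add_mem (ih _ h3) hT

theorem sym_eq_zero_of_polynomial {w : ι → A} {Q : Module.End ℂ A}
    (h : ∀ p ∈ Algebra.adjoin ℂ (Set.range w), Q p = 0) (k : ℕ) : sym w k Q = 0 := by
  induction k generalizing Q with
  | zero => rw [sym_zero, h 1 (one_mem _), map_zero]
  | succ k ih =>
    rw [sym_succ, Finset.sum_eq_zero, smul_zero]
    intro i _
    rw [ih, mul_zero]
    intro p hp
    rw [brk_apply, h p hp, h _ (mul_mem (Algebra.subset_adjoin ⟨i, rfl⟩) hp), mul_zero, sub_zero]

/-- All symbols of such an operator vanish, so its order drops until nothing is left. The point of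
testing on polynomials is that, unlike arbitrary germs, they extend over a whole chart. -/
theorem Coords.eq_zero_of_polynomial {Q : D A}
    (h : ∀ p ∈ Algebra.adjoin ℂ (Set.range 𝔠.w), Q.toEnd p = 0) : Q = 0 := by
  obtain ⟨k, hk⟩ := Q.2
  have : ∀ m, Q.toEnd ∈ opOrd A (k - m) := by
    intro m
    induction m with
    | zero => exact hk
    | succ m ih =>
      rcases hkm : k - m with _ | j
      · rw [hkm] at ih
        rwa [show k - (m + 1) = 0 by omega]
      · rw [hkm] at ih
        rw [show k - (m + 1) = j by omega]
        exact (𝔠.sym_eq_zero ih).1 (sym_eq_zero_of_polynomial h j)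
  have h0 := this k
  rw [Nat.sub_self] at h0
  exact D.toEnd_injective (a₂ := 0) h0

end Symbols

end

/-! ### The associated graded ring as a polynomial ring. -/

section
open MvPolynomial

section Graded
variable {A : Type*} [CommRing A] [Algebra ℂ A] {ι : Type*} [Fintype ι]

/-- The operator of right multiplication underlying an element of `DR A`. -/
abbrev DR.toEnd (P : DR A) : Module.End ℂ A := P.unop.toEnd

theorem mem_FD_natCast {k : ℕ} {P : DR A} : P ∈ FD A k ↔ P.toEnd ∈ opOrd A (k + 1) := by
  rw [mem_FD, show ((k : ℤ) + 1).toNat = k + 1 by omega]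

/-- The symbol as an additive map on operators of order at most `k`. -/
def symHom (w : ι → A) (k : ℤ) : FD A k →+ MvPolynomial ι A where
  toFun P := sym w k.toNat P.1.toEnd
  map_zero' := map_zero _
  map_add' P Q := map_add (sym w k.toNat) P.1.toEnd Q.1.toEnd

theorem symHom_neg (w : ι → A) {k : ℤ} (hk : k < 0) (P : FD A k) : symHom w k P = 0 := by
  rw [show P = 0 from Subtype.ext (FD_neg hk P.2), map_zero]

theorem symHom_mul (w : ι → A) {k l : ℤ} (P : FD A k) (Q : FD A l) :
    symHom w (k + l) ⟨P.1 * Q.1, FD_mul P.2 Q.2⟩ = symHom w k P * symHom w l Q := by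
  rcases lt_or_ge k 0 with hk | hk
  · rw [symHom_neg w hk, zero_mul]
    have : (P : DR A) = 0 := FD_neg hk P.2
    change sym w _ (P.1 * Q.1).toEnd = 0
    rw [this, zero_mul]
    exact map_zero _
  rcases lt_or_ge l 0 with hl | hl
  · rw [symHom_neg w hl, mul_zero]
    have : (Q : DR A) = 0 := FD_neg hl Q.2
    change sym w _ (P.1 * Q.1).toEnd = 0
    rw [this, mul_zero]
    exact map_zero _
  lift k to ℕ using hk
  lift l to ℕ using hl
  have h := sym_mul w (mem_FD_natCast.1 Q.2) (mem_FD_natCast.1 P.2)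
  -- Multiplication in `DR A` is composition in the opposite order; on symbols the order does not
  -- matter.
  change sym w _ (Q.1.toEnd * P.1.toEnd) = sym w _ _ * sym w _ _
  rw [show ((k : ℤ) + l).toNat = l + k by omega, h, mul_comm]
  rfl

/-- The symbol map on the Rees ring. -/
def reesSym (w : ι → A) : Rees A →+* MvPolynomial ι A :=
  DirectSum.toSemiring (symHom w)
    (by
      change sym w 0 (1 : DR A).toEnd = 1
      exact C_1)
    (fun P Q => symHom_mul w P Q)

theorem reesSym_of (w : ι → A) (k : ℤ) (P : FD A k) :
    reesSym w (reesOf k P) = sym w k.toNat P.1.toEnd := DirectSum.toSemiring_of _ _ _ _ _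

/-- The part of degree `m` in the Rees ring has symbols homogeneous of degree `m`, so the grading is
not lost under the symbol map. The kernel can therefore be computed degree by degree. -/
theorem homogeneousComponent_reesSym (w : ι → A) (p : Rees A) (m : ℕ) :
    homogeneousComponent m (reesSym w p) = sym w m (p m).1.toEnd := by
  induction p using DirectSum.induction_on with
  | zero =>
    rw [map_zero, map_zero]
    exact (map_zero _).symm
  | add p q hp hq =>
    rw [map_add, map_add, hp, hq]
    exact (map_add (sym w m) (p m).1.toEnd (q m).1.toEnd).symm
  | of k P =>
    change homogeneousComponent m (reesSym w (reesOf k P)) = _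
    rw [reesSym_of]
    by_cases hkm : k = m
    · subst hkm
      rw [DirectSum.of_eq_same]
      exact homogeneousComponent_eq_self (sym_isHomogeneous w m _)
    · rw [DirectSum.of_eq_of_ne _ _ _ (Ne.symm hkm)]
      rcases lt_or_ge k 0 with hk | hk
      · rw [FD_neg hk P.2]
        exact (congrArg _ (map_zero _)).trans ((map_zero _).trans (map_zero _).symm)
      · rw [homogeneousComponent_of_mem (sym_isHomogeneous w k.toNat _), if_neg (by omega)]
        exact (map_zero _).symm

theorem mem_reesIdeal_of {p : Rees A} (h : ∀ k, (p k : DR A) ∈ FD A (k - 1)) :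
    p ∈ reesIdeal A := by
  classical
  rw [← DirectSum.sum_support_of p]
  refine Ideal.sum_mem _ fun k _ => mem_reesIdeal.2 ⟨reesOf (k - 1) ⟨p k, h k⟩, ?_⟩
  change _ * reesOf 1 _ = reesOf k (p k)
  rw [reesOf_mul]
  exact reesOf_congr (by ring) _ _ (mul_one _)

variable (𝔠 : Coords A ι)

theorem Coords.sym_toNat_eq_zero {k : ℤ} {P : DR A} (hP : P ∈ FD A k) :
    sym 𝔠.w k.toNat P.toEnd = 0 ↔ P ∈ FD A (k - 1) := by
  rcases lt_or_ge k 0 with hk | hk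
  · rw [FD_neg hk hP]
    exact iff_of_true (map_zero _) (zero_mem _)
  · lift k to ℕ using hk
    rw [Int.toNat_natCast, 𝔠.sym_eq_zero (mem_FD_natCast.1 hP), mem_FD]
    rw [show ((k : ℤ) - 1 + 1).toNat = k by omega]

theorem Coords.reesSym_eq_zero {p : Rees A} : reesSym 𝔠.w p = 0 ↔ p ∈ reesIdeal A := by
  constructor
  · intro h
    refine mem_reesIdeal_of fun k => ?_
    rw [← 𝔠.sym_toNat_eq_zero (p k).2]
    rcases lt_or_ge k 0 with hk | hk
    · rw [FD_neg hk (p k).2]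
      exact map_zero _
    · lift k to ℕ using hk
      rw [Int.toNat_natCast, ← homogeneousComponent_reesSym, h, map_zero]
  · intro h
    obtain ⟨q, rfl⟩ := mem_reesIdeal.1 h
    rw [map_mul]
    have : reesSym 𝔠.w (reesVar A) = 0 := by
      change reesSym 𝔠.w (reesOf 1 _) = 0
      rw [reesSym_of, 𝔠.sym_toNat_eq_zero (FD_mono zero_le_one one_mem_FD)]
      exact one_mem_FD
    rw [this, mul_zero]

/-- The quotient map from the Rees ring to the associated graded ring. -/
def GrD.mk : Rees A →+* GrD A := Ideal.Quotient.mk (reesIdeal A)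

theorem GrD.mk_surjective : Function.Surjective (GrD.mk (A := A)) := Ideal.Quotient.mk_surjective

theorem GrD.mk_eq_zero {p : Rees A} : GrD.mk p = 0 ↔ p ∈ reesIdeal A :=
  Ideal.Quotient.eq_zero_iff_mem

/-- The symbol map on the associated graded ring. -/
def Coords.grHom : GrD A →+* MvPolynomial ι A :=
  Ideal.Quotient.lift (reesIdeal A) (reesSym 𝔠.w) fun _ h => 𝔠.reesSym_eq_zero.2 h

theorem Coords.grHom_mk (p : Rees A) : 𝔠.grHom (GrD.mk p) = reesSym 𝔠.w p := rfl

theorem Coords.grHom_bijective : Function.Bijective 𝔠.grHom := by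
    constructor
    · refine (injective_iff_map_eq_zero 𝔠.grHom).2 fun a ha => ?_
      obtain ⟨p, rfl⟩ := GrD.mk_surjective a
      exact GrD.mk_eq_zero.2 (𝔠.reesSym_eq_zero.1 ha)
    · intro p
      have key : ∀ m, ∃ a : Rees A, reesSym 𝔠.w a = homogeneousComponent m p := by
        intro m
        obtain ⟨P, hP, e⟩ := 𝔠.exists_sym_eq (homogeneousComponent_isHomogeneous m p)
        refine ⟨reesOf m ⟨D.op ⟨P, m + 1, hP⟩, mem_FD_natCast.2 hP⟩, ?_⟩
        rw [reesSym_of]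
        exact e
      choose a ha using key
      refine ⟨GrD.mk (∑ m ∈ Finset.range (p.totalDegree + 1), a m), ?_⟩
      rw [𝔠.grHom_mk]
      refine (map_sum (reesSym 𝔠.w) _ _).trans ?_
      conv_rhs => rw [← sum_homogeneousComponent p]
      exact Finset.sum_congr rfl fun m _ => ha m

/-- The symbol map identifies the associated graded ring with a polynomial ring. -/
def Coords.grEquiv : GrD A ≃+* MvPolynomial ι A :=
  RingEquiv.ofBijective 𝔠.grHom 𝔠.grHom_bijective

theorem Coords.grEquiv_symb (k : ℤ) (P : FD A k) :
    𝔠.grEquiv (symb k P) = sym 𝔠.w k.toNat P.1.toEnd := reesSym_of 𝔠.w k P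

theorem symb_add {k : ℤ} (P Q : FD A k) : symb k (P + Q) = symb k P + symb k Q := by
  rw [symb, reesOf, map_add, map_add]; rfl

theorem symb_mul {k l : ℤ} (P : FD A k) (Q : FD A l) :
    symb k P * symb l Q = symb (k + l) ⟨P.1 * Q.1, FD_mul P.2 Q.2⟩ := by
  rw [symb, symb, symb, ← reesOf_mul]; rfl

/-- The symbol of a function. -/
def symFun (A : Type*) [CommRing A] [Algebra ℂ A] (g : A) : GrD A := symb 0 ⟨(toD g).op, toD_mem g⟩

/-- The symbol of a vector field. -/
def symDer (θ : Derivation ℂ A A) : GrD A := symb 1 ⟨(derD θ).op, derD_mem θ⟩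

theorem Coords.grEquiv_symFun (g : A) : 𝔠.grEquiv (symFun A g) = C g := by
  rw [symFun, 𝔠.grEquiv_symb]
  change C (g * 1) = _
  rw [mul_one]

theorem Coords.grEquiv_symDer (θ : Derivation ℂ A A) :
    𝔠.grEquiv (symDer θ) = ∑ i, C (θ (𝔠.w i)) * X i := by
  rw [symDer, 𝔠.grEquiv_symb]
  exact sym_derivation _ _

end Graded

end

/-! ### Ideals generated by variables and by products of pairs of variables. -/

/-- A ring with a family of variables which can be set to zero one at a time. -/
structure VarRing (S W : Type*) [CommRing S] where
  var : W → S
  restr : W → S →+* S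
  var_ne_zero : ∀ v, var v ≠ 0
  restr_self : ∀ v, restr v (var v) = 0
  restr_ne : ∀ v w, v ≠ w → restr v (var w) = var w
  restr_sub : ∀ v u, u - restr v u ∈ Ideal.span {var v}

namespace VarRing
section
variable {S W : Type*} [CommRing S] (R : VarRing S W)

/-- The ideal generated by a set of variables. -/
def idl (V : Finset W) : Ideal S := Ideal.span (R.var '' V)

theorem exists_restr [DecidableEq W] (V : Finset W) : ∃ r : S →+* S, (∀ v ∈ V, r (R.var v) = 0) ∧
    (∀ w ∉ V, r (R.var w) = R.var w) ∧ ∀ u, u - r u ∈ R.idl V := by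
  induction V using Finset.induction_on with
  | empty => exact ⟨RingHom.id S, by simp, by simp, by simp [idl]⟩
  | insert v V hv ih =>
    obtain ⟨r, h1, h2, h3⟩ := ih
    refine ⟨(R.restr v).comp r, ?_, ?_, ?_⟩
    · intro w hw
      rcases Finset.mem_insert.1 hw with rfl | hw
      · rw [RingHom.comp_apply, h2 _ hv, R.restr_self]
      · rw [RingHom.comp_apply, h1 _ hw, map_zero]
    · intro w hw
      rw [Finset.mem_insert, not_or] at hw
      rw [RingHom.comp_apply, h2 _ hw.2, R.restr_ne _ _ (Ne.symm hw.1)]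
    · intro u
      rw [show u - ((R.restr v).comp r) u = (u - r u) + (r u - R.restr v (r u)) by simp]
      refine add_mem (Ideal.span_mono ?_ (h3 u)) (Ideal.span_mono ?_ (R.restr_sub v (r u)))
      · exact Set.image_mono (by simp)
      · rintro _ rfl
        exact ⟨v, by simp, rfl⟩

/-- Setting the variables of `V` to zero is an endomorphism with this kernel; over a domain the
kernel is prime. All primality of ideals of variables comes from here. -/
theorem exists_ker [DecidableEq W] (V : Finset W) : ∃ r : S →+* S, RingHom.ker r = R.idl V ∧
    ∀ w ∉ V, r (R.var w) = R.var w := by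
  obtain ⟨r, h1, h2, h3⟩ := R.exists_restr V
  refine ⟨r, le_antisymm (fun u hu => ?_) (Ideal.span_le.2 ?_), h2⟩
  · have := h3 u
    rwa [RingHom.mem_ker.1 hu, sub_zero] at this
  · rintro _ ⟨v, hv, rfl⟩
    exact h1 v hv

theorem idl_isPrime [DecidableEq W] [IsDomain S] (V : Finset W) : (R.idl V).IsPrime := by
  obtain ⟨r, h, -⟩ := R.exists_ker V
  rw [← h]
  exact RingHom.ker_isPrime r

theorem var_mem_idl [DecidableEq W] {V : Finset W} {w : W} : R.var w ∈ R.idl V ↔ w ∈ V := by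
  refine ⟨fun h => ?_, fun h => Ideal.subset_span ⟨w, h, rfl⟩⟩
  by_contra hw
  obtain ⟨r, hr, h2⟩ := R.exists_ker V
  rw [← hr, RingHom.mem_ker, h2 w hw] at h
  exact R.var_ne_zero w h

theorem mem_idl_of_mul [DecidableEq W] [IsDomain S] {V : Finset W} {w : W} (hw : w ∉ V) {u : S}
    (h : R.var w * u ∈ R.idl V) : u ∈ R.idl V :=
  ((R.idl_isPrime V).mem_or_mem h).resolve_left fun h' => hw (R.var_mem_idl.1 h')

end

section Pairs
variable {S ι : Type*} [CommRing S] [IsDomain S] [DecidableEq ι] (R : VarRing S (ι ⊕ ι))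

/-- The ideal generated by the variables in `V` and the products of pairs of variables with index
in `B`. -/
def pairIdl (V : Finset (ι ⊕ ι)) (B : Finset ι) : Ideal S :=
  Ideal.span (R.var '' V ∪ (fun j => R.var (.inl j) * R.var (.inr j)) '' B)

theorem pairIdl_empty (V : Finset (ι ⊕ ι)) : R.pairIdl V ∅ = R.idl V := by
  simp [pairIdl, idl]

theorem pairIdl_insert (V : Finset (ι ⊕ ι)) (j : ι) (B : Finset ι) : R.pairIdl V (insert j B) =
    R.pairIdl V B ⊔ Ideal.span {R.var (.inl j) * R.var (.inr j)} := by
  rw [pairIdl, pairIdl, ← Ideal.span_union, Finset.coe_insert, Set.image_insert_eq]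
  congr 1
  ext x
  simp only [Set.mem_union, Set.mem_insert_iff, Set.mem_singleton_iff]
  tauto

theorem pairIdl_insert_var (v : ι ⊕ ι) (V : Finset (ι ⊕ ι)) (B : Finset ι) :
    R.pairIdl (insert v V) B = R.pairIdl V B ⊔ Ideal.span {R.var v} := by
  rw [pairIdl, pairIdl, ← Ideal.span_union, Finset.coe_insert, Set.image_insert_eq]
  congr 1
  ext x
  simp only [Set.mem_union, Set.mem_insert_iff, Set.mem_singleton_iff]
  tauto

/-- A variable absent from the generators is a non-zero-divisor modulo them. Replacing one product
`x_j ξ_j` by either of its factors gives two larger ideals of the same kind with fewer products; by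
induction both contain `u`, and their intersection is the original ideal. -/
theorem mem_pairIdl_of_mul {B : Finset ι} : ∀ {V : Finset (ι ⊕ ι)} {w : ι ⊕ ι},
    (∀ j ∈ B, Sum.inl j ∉ insert w V ∧ Sum.inr j ∉ insert w V) → w ∉ V → ∀ {u : S},
    R.var w * u ∈ R.pairIdl V B → u ∈ R.pairIdl V B := by
  induction B using Finset.induction_on with
  | empty =>
    intro V w _ hw u hu
    rw [pairIdl_empty] at hu ⊢
    exact R.mem_idl_of_mul hw hu
  | insert j B hj ih =>
    intro V w hB hw u hu
    obtain ⟨hl, hr⟩ := hB j (by simp)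
    simp only [Finset.mem_insert, not_or] at hl hr
    have hB' : ∀ k ∈ B, ∀ v, (v = Sum.inl j ∨ v = Sum.inr j) →
        ∀ w', (w' = w ∨ w' = Sum.inl j) → Sum.inl k ∉ insert w' (insert v V) ∧
        Sum.inr k ∉ insert w' (insert v V) := by
      intro k hk v hv w' hw'
      have := hB k (by simp [hk])
      have hkj : k ≠ j := fun h => hj (h ▸ hk)
      simp only [Finset.mem_insert, not_or] at this ⊢
      rcases hv with rfl | rfl <;> rcases hw' with rfl | rfl <;> simp [this, hkj]
    have h1 : u ∈ R.pairIdl (insert (.inl j) V) B := by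
      refine ih (w := w) (fun k hk => hB' k hk _ (.inl rfl) _ (.inl rfl)) ?_ ?_
      · simp [hw, Ne.symm hl.1]
      · rw [pairIdl_insert_var]
        rw [pairIdl_insert] at hu
        refine SetLike.le_def.1 (sup_le_sup_left ?_ _) hu
        rw [Ideal.span_singleton_le_span_singleton]
        exact Dvd.intro _ rfl
    have h2 : u ∈ R.pairIdl (insert (.inr j) V) B := by
      refine ih (w := w) (fun k hk => hB' k hk _ (.inr rfl) _ (.inl rfl)) ?_ ?_
      · simp [hw, Ne.symm hr.1]
      · rw [pairIdl_insert_var]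
        rw [pairIdl_insert] at hu
        refine SetLike.le_def.1 (sup_le_sup_left ?_ _) hu
        rw [Ideal.span_singleton_le_span_singleton]
        exact Dvd.intro_left _ rfl
    rw [pairIdl_insert_var] at h1
    obtain ⟨i, hi, x, hx, rfl⟩ := Submodule.mem_sup.1 h1
    obtain ⟨a, rfl⟩ := Ideal.mem_span_singleton'.1 hx
    -- Write `u = i + a x_j`. The factor `x_j` is itself absent from the ideal containing `ξ_j`, so
    -- the induction hypothesis moves `a` into that ideal.
    have h3 : R.var (.inl j) * a ∈ R.pairIdl (insert (.inr j) V) B := by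
      have hi' : i ∈ R.pairIdl (insert (.inr j) V) B := by
        rw [pairIdl_insert_var]; exact Ideal.mem_sup_left hi
      rw [mul_comm]
      exact (Ideal.add_mem_iff_right _ hi').1 h2
    have h4 := ih (w := .inl j) (fun k hk => hB' k hk _ (.inr rfl) _ (.inr rfl))
      (by simp [hl]) h3
    rw [pairIdl_insert_var] at h4
    obtain ⟨i', hi', y, hy, rfl⟩ := Submodule.mem_sup.1 h4
    obtain ⟨b, rfl⟩ := Ideal.mem_span_singleton'.1 hy
    rw [pairIdl_insert, add_mul, ← add_assoc]
    refine Submodule.add_mem_sup (add_mem hi (Ideal.mul_mem_right _ _ hi')) ?_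
    exact Ideal.mem_span_singleton'.2 ⟨b, by ring⟩

variable (E : Finset ι) (a : ι → S)

/-- The symbols of a basis of the relative logarithmic fields with base index `i`. -/
def sg (i j : ι) : S :=
  if j ∈ E then a j * (R.var (.inl j) * R.var (.inr j)) - a i * (R.var (.inl i) * R.var (.inr i))
  else R.var (.inr j)

/-- Modulo the base variable the symbol with index `j ∈ E` is a unit times `x_j ξ_j`, so the ideal
is one of those generated by variables and products of pairs. -/
theorem span_sg_eq (ha : ∀ j, IsUnit (a j)) (i : ι) (B : Finset ι) :
    Ideal.span {R.var (.inl i)} ⊔ Ideal.span (R.sg E a i '' B) =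
      R.pairIdl (insert (.inl i) ((B.filter (· ∉ E)).image .inr)) (B.filter (· ∈ E)) := by
  have h0 : R.var (.inl i) ∈
      R.pairIdl (insert (.inl i) ((B.filter (· ∉ E)).image .inr)) (B.filter (· ∈ E)) :=
    Ideal.subset_span (.inl ⟨.inl i, by simp, rfl⟩)
  have h0' : R.var (.inl i) ∈ Ideal.span {R.var (.inl i)} ⊔ Ideal.span (R.sg E a i '' B) :=
    Ideal.mem_sup_left (Ideal.mem_span_singleton_self _)
  refine le_antisymm (sup_le (Ideal.span_le.2 ?_) (Ideal.span_le.2 ?_)) (Ideal.span_le.2 ?_)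
  · rintro _ rfl
    exact h0
  · rintro _ ⟨j, hj, rfl⟩
    by_cases hE : j ∈ E
    · rw [sg, if_pos hE]
      refine sub_mem (Ideal.mul_mem_left _ _ (Ideal.subset_span (.inr ⟨j, ?_, rfl⟩)))
        (Ideal.mul_mem_left _ _ (Ideal.mul_mem_right _ _ h0))
      simpa [hE] using hj
    · rw [sg, if_neg hE]
      exact Ideal.subset_span (.inl ⟨.inr j, by simpa [hE] using hj, rfl⟩)
  · rintro _ (⟨v, hv, rfl⟩ | ⟨j, hj, rfl⟩)
    · simp only [Finset.coe_insert, Finset.coe_image, Set.mem_insert_iff, Set.mem_image,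
        Finset.mem_coe, Finset.mem_filter] at hv
      rcases hv with rfl | ⟨j, ⟨hj, hE⟩, rfl⟩
      · exact h0'
      · refine Ideal.mem_sup_right (Ideal.subset_span ⟨j, hj, ?_⟩)
        rw [sg, if_neg hE]
    · simp only [Finset.coe_filter, Set.mem_ofPred_eq] at hj
      have h1 : R.sg E a i j ∈
          Ideal.span {R.var (.inl i)} ⊔ Ideal.span (R.sg E a i '' B) :=
        Ideal.mem_sup_right (Ideal.subset_span ⟨j, hj.1, rfl⟩)
      obtain ⟨c, hc⟩ := (ha j).exists_left_inv
      rw [sg, if_pos hj.2] at h1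
      have h2 := Ideal.mul_mem_left _ c (add_mem h1 (Ideal.mul_mem_left _ (a i)
        (Ideal.mul_mem_right (R.var (.inr i)) _ h0')))
      rwa [sub_add_cancel, ← mul_assoc, hc, one_mul] at h2

/-- Modulo the base variable, multiplication by a symbol is up to a unit multiplication by one or
two variables that do not occur in the other symbols. Hence the symbols form a regular sequence in
any order. -/
theorem mem_of_sg_mul (ha : ∀ j, IsUnit (a j)) {i m : ι} {B : Finset ι} (hi : i ∉ B)
    (hm : m ∉ B) (him : m ≠ i) {x : S}
    (h : R.sg E a i m * x ∈ Ideal.span {R.var (.inl i)} ⊔ Ideal.span (R.sg E a i '' B)) :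
    x ∈ Ideal.span {R.var (.inl i)} ⊔ Ideal.span (R.sg E a i '' B) := by
  have h0' : R.var (.inl i) ∈ Ideal.span {R.var (.inl i)} ⊔ Ideal.span (R.sg E a i '' B) :=
    Ideal.mem_sup_left (Ideal.mem_span_singleton_self _)
  have hB : ∀ w : ι ⊕ ι, (w = Sum.inl m ∨ w = Sum.inr m) → ∀ j ∈ B.filter (· ∈ E),
      (Sum.inl j : ι ⊕ ι) ∉ insert w (insert (Sum.inl i) ((B.filter (· ∉ E)).image Sum.inr)) ∧
      (Sum.inr j : ι ⊕ ι) ∉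
        insert w (insert (Sum.inl i) ((B.filter (· ∉ E)).image Sum.inr)) := by
    intro w hw j hj
    rw [Finset.mem_filter] at hj
    have h1 : j ≠ m := fun h => hm (h ▸ hj.1)
    have h2 : j ≠ i := fun h => hi (h ▸ hj.1)
    rcases hw with rfl | rfl <;> simp [h1, h2, hj]
  have hw : ∀ w : ι ⊕ ι, (w = Sum.inl m ∨ w = Sum.inr m) →
      w ∉ insert (Sum.inl i) ((B.filter (· ∉ E)).image Sum.inr) := by
    rintro w (rfl | rfl) <;> simp [him, hm]
  by_cases hE : m ∈ E
  · rw [sg, if_pos hE, sub_mul] at h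
    have h1 := add_mem h (Ideal.mul_mem_right x _ (Ideal.mul_mem_left _ (a i)
        (Ideal.mul_mem_right (R.var (.inr i)) _ h0')))
    rw [sub_add_cancel] at h1
    obtain ⟨c, hc⟩ := (ha m).exists_left_inv
    have h2 := Ideal.mul_mem_left _ c h1
    rw [mul_assoc (a m), ← mul_assoc, hc, one_mul, mul_assoc] at h2
    rw [R.span_sg_eq E a ha] at h2 ⊢
    exact R.mem_pairIdl_of_mul (hB _ (.inr rfl)) (hw _ (.inr rfl))
      (R.mem_pairIdl_of_mul (hB _ (.inl rfl)) (hw _ (.inl rfl)) h2)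
  · rw [sg, if_neg hE] at h
    rw [R.span_sg_eq E a ha] at h ⊢
    exact R.mem_pairIdl_of_mul (hB _ (.inr rfl)) (hw _ (.inr rfl)) h

/-- The base variable followed by the symbols is regular; here the base variable is moved to the
last place. A relation `x_i u = c σ_m + y` makes `σ_m c` vanish modulo the base variable and the
remaining symbols, so `c` does too, and subtracting a multiple of `σ_m` from `u` removes `σ_m` from
the relation. -/
theorem mem_span_sg_of_var_mul (ha : ∀ j, IsUnit (a j)) {i : ι} {B : Finset ι} (hi : i ∉ B)
    {u : S} (h : R.var (.inl i) * u ∈ Ideal.span (R.sg E a i '' B)) :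
    u ∈ Ideal.span (R.sg E a i '' B) := by
  induction B using Finset.induction_on generalizing u with
  | empty =>
    simp only [Finset.coe_empty, Set.image_empty, Ideal.span_empty, Ideal.mem_bot] at h ⊢
    exact (mul_eq_zero.1 h).resolve_left (R.var_ne_zero _)
  | insert m B hm ih =>
    rw [Finset.mem_insert, not_or] at hi
    rw [Finset.coe_insert, Set.image_insert_eq] at h ⊢
    obtain ⟨c, y, hy, e⟩ := Ideal.mem_span_insert.1 h
    have h1 : c ∈ Ideal.span {R.var (.inl i)} ⊔ Ideal.span (R.sg E a i '' B) := by
      refine R.mem_of_sg_mul E a ha hi.2 hm (Ne.symm hi.1) ?_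
      rw [show R.sg E a i m * c = u * R.var (.inl i) + -y by rw [mul_comm u, e]; ring]
      exact Submodule.add_mem_sup (Ideal.mul_mem_left _ _ (Ideal.mem_span_singleton_self _))
        (neg_mem hy)
    obtain ⟨x, hx, y', hy', rfl⟩ := Submodule.mem_sup.1 h1
    obtain ⟨c', rfl⟩ := Ideal.mem_span_singleton'.1 hx
    have h2 : u - c' * R.sg E a i m ∈ Ideal.span (R.sg E a i '' B) := by
      refine ih hi.2 ?_
      rw [show R.var (.inl i) * (u - c' * R.sg E a i m) = y' * R.sg E a i m + y by
        rw [mul_sub, e]; ring]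
      exact add_mem (Ideal.mul_mem_right _ _ hy') hy
    exact Ideal.mem_span_insert.2 ⟨c', _, h2, by ring⟩

end Pairs
end VarRing

/-! ### Exactness of Koszul complexes. -/

section Koszul
variable {ι N : Type*} [LinearOrder ι] [AddCommGroup N]

/-- The sign of `i` in `s`. -/
def ksign (i : ι) (s : Finset ι) : ℤ := (-1) ^ (s.filter (· < i)).card

theorem ksign_mul_self (i : ι) (s : Finset ι) : ksign i s * ksign i s = 1 := by
  rw [ksign, ← pow_add, ← two_mul, pow_mul]; simp

/-- The Koszul differential of operators `f`, on cochains given by functions on finite sets. -/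
def kd (f : ι → N →+ N) (c : Finset ι → N) (s : Finset ι) : N :=
  ∑ i ∈ s, ksign i s • f i (c (s.erase i))

theorem kd_congr (f : ι → N →+ N) {c c' : Finset ι → N} {s : Finset ι}
    (h : ∀ i ∈ s, c (s.erase i) = c' (s.erase i)) : kd f c s = kd f c' s :=
  Finset.sum_congr rfl fun i hi => by rw [h i hi]

theorem kd_add (f : ι → N →+ N) (c c' : Finset ι → N) : kd f (c + c') = kd f c + kd f c' := by
  ext s
  simp [kd, Finset.sum_add_distrib]

theorem kd_sub (f : ι → N →+ N) (c c' : Finset ι → N) : kd f (c - c') = kd f c - kd f c' := by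
  ext s
  simp [kd, smul_sub]

theorem kd_zero (f : ι → N →+ N) : kd f 0 = 0 := by
  ext s
  simp [kd]

theorem kd_empty (f : ι → N →+ N) (c : Finset ι → N) : kd f c ∅ = 0 := rfl

theorem kd_map {N' : Type*} [AddCommGroup N'] (f : ι → N →+ N) (f' : ι → N' →+ N') (g : N →+ N')
    (h : ∀ i x, g (f i x) = f' i (g x)) (c : Finset ι → N) (s : Finset ι) :
    g (kd f c s) = kd f' (g ∘ c) s := by
  simp [kd, h]

theorem ksign_erase_swap {s : Finset ι} {i j : ι} (hi : i ∈ s) (hj : j ∈ s) (hij : i ≠ j) :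
    ksign i s * ksign j (s.erase i) = -(ksign j s * ksign i (s.erase j)) := by
  wlog h : i < j generalizing i j with H
  · rw [H hj hi hij.symm (lt_of_le_of_ne (not_lt.1 h) hij.symm), neg_neg]
  have h1 : ksign i (s.erase j) = ksign i s := by
    rw [ksign, ksign, Finset.filter_erase, Finset.erase_eq_of_notMem]
    simp [h.le]
  have h2 : ksign j s = -ksign j (s.erase i) := by
    rw [ksign, ksign, Finset.filter_erase]
    have : i ∈ s.filter (· < j) := by simp [hi, h]
    rw [← Finset.card_erase_add_one this, pow_succ]
    ring
  rw [h1, h2]; ring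

theorem kd_kd (f : ι → N →+ N) (hf : ∀ i j x, f i (f j x) = f j (f i x)) (c : Finset ι → N)
    (s : Finset ι) : kd f (kd f c) s = 0 := by
  have e : kd f (kd f c) s = ∑ q ∈ s.sigma fun i => s.erase i,
      (ksign q.1 s * ksign q.2 (s.erase q.1)) • f q.1 (f q.2 (c ((s.erase q.1).erase q.2))) := by
    rw [Finset.sum_sigma]
    simp only [kd, map_sum, map_zsmul, Finset.smul_sum, smul_smul]
  rw [e]
  refine Finset.sum_involution (fun q _ => ⟨q.2, q.1⟩) ?_ ?_ ?_ ?_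
  · rintro ⟨i, j⟩ h
    simp only [Finset.mem_sigma, Finset.mem_erase] at h
    rw [ksign_erase_swap h.1 h.2.2 (Ne.symm h.2.1), hf i j, Finset.erase_right_comm, neg_smul,
      neg_add_cancel]
  · rintro ⟨i, j⟩ h _ h'
    simp only [Finset.mem_sigma, Finset.mem_erase] at h
    simp only [Sigma.mk.injEq, heq_eq_eq] at h'
    exact h.2.1 h'.1
  · rintro ⟨i, j⟩ h
    simp only [Finset.mem_sigma, Finset.mem_erase] at h ⊢
    exact ⟨h.2.2, Ne.symm h.2.1, h.1⟩
  · rintro ⟨i, j⟩ h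
    rfl

theorem ksign_insert_of_lt {m i : ι} (h : i < m) (s : Finset ι) :
    ksign i (insert m s) = ksign i s := by
  rw [ksign, ksign, Finset.filter_insert, if_neg (not_lt.2 h.le)]

/-- The values of the operators with index in `B`. -/
def kspan (f : ι → N →+ N) (B : Finset ι) : Set N := {y | ∃ x : ι → N, y = ∑ j ∈ B, f j (x j)}

theorem kd_mem_kspan (f : ι → N →+ N) (c : Finset ι → N) (s : Finset ι) : kd f c s ∈ kspan f s :=
  ⟨fun j => ksign j s • c (s.erase j), by simp [kd]⟩

/-- The sets `s.erase i` are distinct for distinct `i ∈ s`, so the values of a cochain on them can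
be prescribed independently. -/
theorem exists_kd_eq (f : ι → N →+ N) {s : Finset ι} {y : N} (h : y ∈ kspan f s) :
    ∃ c, y = kd f c s := by
  obtain ⟨x, rfl⟩ := h
  refine ⟨fun t => ∑ i ∈ s, if t = s.erase i then ksign i s • x i else 0, ?_⟩
  refine Finset.sum_congr rfl fun i hi => ?_
  beta_reduce
  rw [Finset.sum_eq_single i, if_pos rfl, map_zsmul, smul_smul, ksign_mul_self, one_smul]
  · intro j hj hji
    rw [if_neg]
    intro h
    have : j ∈ s.erase i := Finset.mem_erase.2 ⟨hji, hj⟩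
    rw [h] at this
    exact Finset.notMem_erase _ _ this
  · exact fun h => absurd hi h

/-- Induction on the largest index `m`. A cochain splits into its values on subsets of `B` and on
sets `insert m s`. The first part is a coboundary; once it is removed, the second part is closed for
the operators of `B`. Because `m` is the largest index, inserting it does not change the signs of
the others. -/
theorem koszul_exact (f : ι → N →+ N) (hf : ∀ i j x, f i (f j x) = f j (f i x)) (B : Finset ι)
    (hreg : ∀ m ∈ B, ∀ B' ⊆ B, m ∉ B' → ∀ x, f m x ∈ kspan f B' → x ∈ kspan f B') :
    ∀ p < B.card, ∀ c : Finset ι → N, (∀ s ⊆ B, s.card = p + 1 → kd f c s = 0) →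
      ∃ η : Finset ι → N, ∀ s ⊆ B, s.card = p → c s = kd f η s := by
  induction B using Finset.induction_on_max with
  | empty => intro p hp; simp at hp
  | insert m B hB ih =>
    have hmB : m ∉ B := fun h => lt_irrefl _ (hB m h)
    have hne : ∀ s ⊆ B, m ∉ s := fun s hs h => hmB (hs h)
    specialize ih fun k hk B' hB' hk' => hreg k (Finset.mem_insert_of_mem hk) B'
      (hB'.trans (Finset.subset_insert _ _)) hk'
    have kd_insert : ∀ (c : Finset ι → N) (s : Finset ι), s ⊆ B → kd f c (insert m s) =
        ksign m (insert m s) • f m (c s) + kd f (fun t => c (insert m t)) s := by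
      intro c s hs
      rw [kd, Finset.sum_insert (hne s hs), Finset.erase_insert (hne s hs)]
      congr 1
      refine Finset.sum_congr rfl fun i hi => ?_
      have hi' := hB i (hs hi)
      rw [ksign_insert_of_lt hi', Finset.erase_insert_of_ne hi'.ne']
    intro p hp c hc
    rw [Finset.card_insert_of_notMem hmB] at hp
    obtain ⟨η', hη'⟩ : ∃ η' : Finset ι → N, ∀ s ⊆ B, s.card = p → c s = kd f η' s := by
      rcases lt_or_ge p B.card with hpB | hpB
      · exact ih p hpB c fun s hs hsp => hc s (hs.trans (Finset.subset_insert _ _)) hsp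
      · have hpe : p = B.card := by omega
        have h1 := hc (insert m B) subset_rfl (by rw [Finset.card_insert_of_notMem hmB, hpe])
        rw [kd_insert c B subset_rfl] at h1
        -- In degree `B.card` the only value left on `B` is `c B`, and closedness says that `f m (c
        -- B)` lies in the span of the other operators. Regularity of `f m` is used here and nowhere
        -- else in the induction step.
        have h2 : c B ∈ kspan f B := by
          refine hreg m (by simp) B (Finset.subset_insert _ _) hmB _ ?_
          obtain ⟨x, hx⟩ := kd_mem_kspan f (fun t => c (insert m t)) B
          refine ⟨fun j => -(ksign m (insert m B) • x j), ?_⟩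
          simp only [map_neg, map_zsmul, Finset.sum_neg_distrib]
          rw [← Finset.smul_sum, ← hx, ← smul_neg, ← eq_neg_of_add_eq_zero_left h1, smul_smul,
            ksign_mul_self, one_smul]
        obtain ⟨η, hη⟩ := exists_kd_eq f h2
        refine ⟨η, fun s hs hsp => ?_⟩
        rw [Finset.eq_of_subset_of_card_le hs (by omega)]
        exact hη
    set η₁ : Finset ι → N := fun t => if m ∈ t then 0 else η' t with hη₁
    have kd_η₁ : ∀ s ⊆ B, kd f η₁ s = kd f η' s := fun s hs => kd_congr f fun i _ => by
      rw [hη₁]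
      exact if_neg fun h => hne s hs (Finset.mem_of_mem_erase h)
    set c₂ := c - kd f η₁ with hc₂
    have hc₂0 : ∀ s ⊆ B, s.card = p → c₂ s = 0 := fun s hs hsp => by
      rw [hc₂, Pi.sub_apply, kd_η₁ s hs, ← hη' s hs hsp, sub_self]
    have hkc₂ : ∀ s ⊆ insert m B, s.card = p + 1 → kd f c₂ s = 0 := fun s hs hsp => by
      rw [hc₂, kd_sub, Pi.sub_apply, hc s hs hsp, kd_kd f hf, sub_self]
    obtain ⟨η'', hη''⟩ : ∃ η'' : Finset ι → N, ∀ s ⊆ B, s.card + 1 = p →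
        c₂ (insert m s) = kd f η'' s := by
      rcases p with _ | p
      · exact ⟨0, fun s _ h => by omega⟩
      · obtain ⟨η, h⟩ := ih p (by omega) (fun t => c₂ (insert m t)) fun s hs hsp => by
          have h1 := hkc₂ (insert m s) (Finset.insert_subset_insert _ hs)
            (by rw [Finset.card_insert_of_notMem (hne s hs), hsp])
          rw [kd_insert c₂ s hs, hc₂0 s hs hsp, map_zero, smul_zero, zero_add] at h1
          exact h1
        exact ⟨η, fun s hs hsp => h s hs (by omega)⟩
    refine ⟨η₁ + fun t => if m ∈ t then η'' (t.erase m) else 0, fun s hs hsp => ?_⟩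
    rw [kd_add, Pi.add_apply]
    by_cases hms : m ∈ s
    · have hs' : s.erase m ⊆ B := by
        rwa [Finset.subset_insert_iff] at hs
      have e : s = insert m (s.erase m) := (Finset.insert_erase hms).symm
      have h1 := hη'' (s.erase m) hs' (by rw [Finset.card_erase_add_one hms, hsp])
      rw [← e, hc₂, Pi.sub_apply, sub_eq_iff_eq_add'] at h1
      rw [h1]
      congr 1
      conv_rhs => rw [e, kd_insert _ _ hs']
      rw [if_neg (Finset.notMem_erase _ _), map_zero, smul_zero, zero_add]
      refine kd_congr f fun i hi => ?_
      rw [if_pos (Finset.mem_insert_self _ _), Finset.erase_insert]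
      exact fun h => Finset.notMem_erase _ _ (Finset.mem_of_mem_erase h)
    · have hs' : s ⊆ B := (Finset.subset_insert_iff_of_notMem hms).1 hs
      rw [kd_η₁ s hs', ← hη' s hs' hsp]
      have : kd f (fun t => if m ∈ t then η'' (t.erase m) else 0) s = kd f 0 s :=
        kd_congr f fun i _ => if_neg fun h => hms (Finset.mem_of_mem_erase h)
      rw [this, kd_zero, Pi.zero_apply, add_zero]

end Koszul

/-! ### Lengths at a prime and cycles of quotient rings. -/

section Lengths
variable {S : Type*} [CommRing S]

/-- The length of the localization of `G` at `p`. -/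
def locLength (p : Ideal S) [p.IsPrime] (G : Type*) [AddCommGroup G] [Module S G] : ℕ∞ :=
  Module.length (Localization.AtPrime p) (LocalizedModule p.primeCompl G)

variable (p : Ideal S) [p.IsPrime] {G G' G'' : Type*} [AddCommGroup G] [Module S G]
  [AddCommGroup G'] [Module S G'] [AddCommGroup G''] [Module S G'']

theorem locLength_add (g : G' →ₗ[S] G) (h : G →ₗ[S] G'') (hg : Function.Injective g)
    (hh : Function.Surjective h) (ex : Function.Exact g h) :
    locLength p G = locLength p G' + locLength p G'' :=
  Module.length_eq_add_of_exact (LocalizedModule.map p.primeCompl g)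
    (LocalizedModule.map p.primeCompl h)
    (LocalizedModule.map_injective _ _ hg) (LocalizedModule.map_surjective _ _ hh)
    (LocalizedModule.map_exact _ _ _ ex)

theorem locLength_eq_zero (h : ∀ x : G, ∃ s ∉ p, s • x = 0) : locLength p G = 0 := by
  rw [locLength, Module.length_eq_zero_iff]
  refine LocalizedModule.subsingleton_iff.2 fun x => ?_
  obtain ⟨s, hs, e⟩ := h x
  exact ⟨s, hs, e⟩

theorem locLength_congr (e : G ≃ₗ[S] G') : locLength p G = locLength p G' := by
  have := locLength_add p (0 : PUnit →ₗ[S] G) (e : G →ₗ[S] G')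
    (fun _ _ _ => Subsingleton.elim _ _) e.surjective (by
      intro x
      rw [show (e : G →ₗ[S] G') x = 0 ↔ x = 0 from e.map_eq_zero_iff]
      simp [eq_comm])
  rw [this, locLength_eq_zero p fun x => ⟨1, p.one_notMem, Subsingleton.elim _ _⟩, zero_add]

theorem locLength_quotient_self : locLength p (S ⧸ p) = 1 := by
  rw [locLength, Module.length_eq_one_iff]
  let L := Localization.AtPrime p
  let f : L →ₗ[L] LocalizedModule p.primeCompl (S ⧸ p) :=
    LinearMap.toSpanSingleton L _ (LocalizedModule.mk 1 1)
  have hf : Function.Surjective f := by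
    intro x
    induction x using LocalizedModule.induction_on with
    | h m s =>
      obtain ⟨u, rfl⟩ := Ideal.Quotient.mk_surjective m
      refine ⟨IsLocalization.mk' L u s, ?_⟩
      rw [LinearMap.toSpanSingleton_apply, ← Localization.mk_eq_mk', LocalizedModule.mk_smul_mk,
        mul_one]
      congr 1
      change Ideal.Quotient.mk p (u * 1) = _
      rw [mul_one]
  have hne : f 1 ≠ 0 := by
    rw [LinearMap.toSpanSingleton_apply, one_smul]
    intro h
    obtain ⟨s, hs⟩ := LocalizedModule.mk_eq.1 (h.trans (LocalizedModule.zero_mk 1).symm)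
    simp only [one_smul, smul_zero] at hs
    have : Ideal.Quotient.mk p (s : S) = 0 := by
      have e : (s : S) • (1 : S ⧸ p) = 0 := hs
      rwa [Algebra.smul_def, mul_one] at e
    exact s.2 (Ideal.Quotient.eq_zero_iff_mem.1 this)
  have hker : LinearMap.ker f = IsLocalRing.maximalIdeal L := by
    refine le_antisymm (IsLocalRing.le_maximalIdeal fun h => hne ?_) ?_
    · have : (1 : L) ∈ LinearMap.ker f := by rw [h]; trivial
      exact this
    · rw [← Localization.AtPrime.map_eq_maximalIdeal]
      refine Ideal.map_le_iff_le_comap.2 fun u hu => ?_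
      change f (algebraMap S L u) = 0
      rw [LinearMap.toSpanSingleton_apply, algebraMap_smul, LocalizedModule.smul'_mk]
      rw [show u • (1 : S ⧸ p) = 0 from ?_, LocalizedModule.zero_mk]
      rw [Algebra.smul_def, mul_one]
      exact Ideal.Quotient.eq_zero_iff_mem.2 hu
  have e := f.quotKerEquivOfSurjective hf
  have : IsSimpleModule L (L ⧸ LinearMap.ker f) := by
    rw [hker]
    exact (isSimpleModule_iff_isCoatom (m := IsLocalRing.maximalIdeal L)).2
      (IsLocalRing.maximalIdeal.isMaximal L).out
  exact IsSimpleModule.congr e.symm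

/-- Every element of the kernel of `S ⧸ I → S ⧸ p` is killed by something outside `p`, so localizing
at `p` identifies the two quotients. -/
theorem locLength_quotient_eq_one {I : Ideal S} (hI : I ≤ p) (h : ∀ u ∈ p, ∃ s ∉ p, s * u ∈ I) :
    locLength p (S ⧸ I) = 1 := by
  let g : S ⧸ I →ₗ[S] S ⧸ p := Submodule.factor hI
  have hg : Function.Surjective g := Submodule.factor_surjective hI
  rw [locLength_add p (LinearMap.ker g).subtype g Subtype.val_injective hg
    (LinearMap.exact_subtype_ker_map g), locLength_quotient_self, locLength_eq_zero, zero_add]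
  rintro ⟨x, hx⟩
  obtain ⟨u, rfl⟩ := Ideal.Quotient.mk_surjective x
  have hu : u ∈ p := Ideal.Quotient.eq_zero_iff_mem.1 hx
  obtain ⟨s, hs, e⟩ := h u hu
  refine ⟨s, hs, Subtype.ext ?_⟩
  exact Ideal.Quotient.eq_zero_iff_mem.2 e

theorem locLength_quotient_eq_zero {I : Ideal S} (h : ¬ I ≤ p) : locLength p (S ⧸ I) = 0 := by
  obtain ⟨s, hs, hsp⟩ := Set.not_subset.1 h
  refine locLength_eq_zero p fun x => ?_
  obtain ⟨u, rfl⟩ := Ideal.Quotient.mk_surjective x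
  exact ⟨s, hsp, Ideal.Quotient.eq_zero_iff_mem.2 (I.mul_mem_right u hs)⟩

/-- Devissage of the length along multiplication by a non-zero-divisor modulo `σ`. -/
theorem locLength_sup_mul {σ : Ideal S} {z h : S} (hz : ∀ u, z * u ∈ σ → u ∈ σ) :
    locLength p (S ⧸ (Ideal.span {h * z} ⊔ σ)) =
      locLength p (S ⧸ (Ideal.span {h} ⊔ σ)) + locLength p (S ⧸ (Ideal.span {z} ⊔ σ)) := by
  -- This is the injectivity of multiplication by `z` from the quotient by `h` and `σ` to the
  -- quotient by `h z` and `σ`; its cokernel is the quotient by `z` and `σ`.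
  have key : ∀ u, z * u ∈ Ideal.span {h * z} ⊔ σ ↔ u ∈ Ideal.span {h} ⊔ σ := by
    intro u
    constructor
    · intro hu
      obtain ⟨x, hx, y, hy, e⟩ := Submodule.mem_sup.1 hu
      obtain ⟨v, rfl⟩ := Ideal.mem_span_singleton'.1 hx
      have : u - v * h ∈ σ := hz _ (by
        rw [show z * (u - v * h) = y by rw [mul_sub, ← e]; ring]
        exact hy)
      rw [show u = v * h + (u - v * h) by ring]
      exact Submodule.add_mem_sup (Ideal.mem_span_singleton'.2 ⟨v, rfl⟩) this
    · intro hu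
      obtain ⟨x, hx, y, hy, rfl⟩ := Submodule.mem_sup.1 hu
      obtain ⟨v, rfl⟩ := Ideal.mem_span_singleton'.1 hx
      rw [mul_add]
      exact Submodule.add_mem_sup (Ideal.mem_span_singleton'.2 ⟨v, by ring⟩)
        (Ideal.mul_mem_left _ _ hy)
  let f : S ⧸ (Ideal.span {h} ⊔ σ) →ₗ[S] S ⧸ (Ideal.span {h * z} ⊔ σ) :=
    Submodule.mapQ _ _ (LinearMap.mulLeft S z) fun u hu => (key u).2 hu
  have hle : Ideal.span {h * z} ⊔ σ ≤ Ideal.span {z} ⊔ σ :=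
    sup_le_sup_right ((Ideal.span_singleton_le_span_singleton).2 (Dvd.intro_left h rfl)) _
  refine locLength_add p f (Submodule.factor hle) ?_ (Submodule.factor_surjective hle) ?_
  · rw [injective_iff_map_eq_zero]
    intro x hx
    obtain ⟨u, rfl⟩ := Ideal.Quotient.mk_surjective x
    exact Ideal.Quotient.eq_zero_iff_mem.2 ((key u).1 (Ideal.Quotient.eq_zero_iff_mem.1 hx))
  · intro x
    obtain ⟨u, rfl⟩ := Ideal.Quotient.mk_surjective x
    constructor
    · intro hx
      have hu : u ∈ Ideal.span {z} ⊔ σ := Ideal.Quotient.eq_zero_iff_mem.1 hx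
      obtain ⟨x, hx', y, hy, rfl⟩ := Submodule.mem_sup.1 hu
      obtain ⟨v, rfl⟩ := Ideal.mem_span_singleton'.1 hx'
      refine ⟨Ideal.Quotient.mk _ v, ?_⟩
      change Ideal.Quotient.mk _ (z * v) = _
      rw [Ideal.Quotient.eq, mul_comm z v, sub_add_cancel_left]
      exact neg_mem (Ideal.mem_sup_right hy)
    · rintro ⟨y, hy⟩
      obtain ⟨v, rfl⟩ := Ideal.Quotient.mk_surjective y
      rw [← hy]
      change Ideal.Quotient.mk _ (z * v) = 0
      rw [Ideal.Quotient.eq_zero_iff_mem, mul_comm]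
      exact Ideal.mem_sup_left (Ideal.mem_span_singleton'.2 ⟨v, rfl⟩)

theorem mem_support_quotient {I : Ideal S} {q : PrimeSpectrum S} :
    q ∈ Module.support S (S ⧸ I) ↔ I ≤ q.asIdeal := by
  rw [Module.support_eq_zeroLocus, Ideal.annihilator_quotient]
  rfl

theorem cycle_congr (e : G ≃ₗ[S] G') : cycle S G = cycle S G' := by
  funext q
  simp only [cycle]
  rw [e.support_eq]
  split_ifs
  · exact locLength_congr q.asIdeal e
  · rfl

open Classical in
theorem cycle_quotient_prime (P : Ideal S) [P.IsPrime] (q : PrimeSpectrum S) :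
    cycle S (S ⧸ P) q = if q.asIdeal = P then 1 else 0 := by
  simp only [cycle]
  by_cases h : q.asIdeal = P
  · rw [if_pos h, if_pos]
    · subst h
      exact locLength_quotient_self _
    · refine ⟨mem_support_quotient.2 h.ge, fun q' hq' _ => ?_⟩
      exact h.le.trans (mem_support_quotient.1 hq')
  · rw [if_neg h, if_neg]
    intro hm
    have h1 := mem_support_quotient.1 hm.1
    have : q ≤ ⟨P, ‹_›⟩ := hm.2 (y := ⟨P, ‹_›⟩) (mem_support_quotient.2 le_rfl) h1
    exact h (le_antisymm this h1)

end Lengths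

/-- Induction on the sum of the exponents with index in `E`. The other exponents do not enter the
monomials and stay arbitrary in the base case. -/
theorem monomial_induction {ι : Type*} [DecidableEq ι] (E : Finset ι) {Q : (ι → ℕ) → Prop}
    (h0 : ∀ m, (∀ i ∈ E, m i = 0) → Q m) (hs : ∀ m, ∀ i ∈ E, Q m → Q (m + Pi.single i 1)) :
    ∀ m, Q m := by
  intro m
  induction hN : ∑ i ∈ E, m i generalizing m with
  | zero => exact h0 m (Finset.sum_eq_zero_iff.1 hN)
  | succ N ih =>
    obtain ⟨i, hi, hmi⟩ : ∃ i ∈ E, m i ≠ 0 := by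
      by_contra! h
      rw [Finset.sum_eq_zero h] at hN
      omega
    have e : m = (m - Pi.single i 1) + Pi.single i 1 := by
      ext j
      by_cases hj : j = i
      · subst hj; simp; omega
      · simp [Pi.single_apply, hj]
    rw [e]
    refine hs _ i hi (ih _ ?_)
    rw [e] at hN
    simp only [Pi.add_apply, Finset.sum_add_distrib, Finset.sum_pi_single', hi, if_true] at hN
    omega

/-! ### The cycle cut out by a monomial and the symbols of the relative logarithmic fields. -/

namespace VarRing
variable {S ι : Type*} [CommRing S] [IsDomain S] [DecidableEq ι] [Fintype ι]
  (R : VarRing S (ι ⊕ ι))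

/-- The variables cutting out the conormal bundle of the stratum with index set `K`. -/
def conormalVars (K : Finset ι) : Finset (ι ⊕ ι) :=
  K.image .inl ∪ Kᶜ.image .inr

theorem inl_mem_conormalVars {K : Finset ι} {i : ι} : Sum.inl i ∈ conormalVars K ↔ i ∈ K := by
  simp [conormalVars]

theorem inr_mem_conormalVars {K : Finset ι} {i : ι} : Sum.inr i ∈ conormalVars K ↔ i ∉ K := by
  simp [conormalVars]

/-- The ideal of the conormal bundle of the stratum with index set `K`. -/
def conormalPrime (K : Finset ι) : Ideal S := R.idl (conormalVars K)

instance (K : Finset ι) : (R.conormalPrime K).IsPrime := R.idl_isPrime _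

theorem inl_mem_conormalPrime {K : Finset ι} {i : ι} :
    R.var (.inl i) ∈ R.conormalPrime K ↔ i ∈ K := R.var_mem_idl.trans inl_mem_conormalVars

theorem inr_mem_conormalPrime {K : Finset ι} {i : ι} :
    R.var (.inr i) ∈ R.conormalPrime K ↔ i ∉ K := R.var_mem_idl.trans inr_mem_conormalVars

theorem conormalPrime_injective : Function.Injective R.conormalPrime := fun K K' h => by
  ext i
  rw [← R.inl_mem_conormalPrime, h, R.inl_mem_conormalPrime]

theorem conormalPrime_le {K : Finset ι} {q : Ideal S} (h1 : ∀ i ∈ K, R.var (.inl i) ∈ q)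
    (h2 : ∀ i ∉ K, R.var (.inr i) ∈ q) : R.conormalPrime K ≤ q := by
  refine Ideal.span_le.2 ?_
  rintro _ ⟨v | v, hv, rfl⟩
  · exact h1 v (inl_mem_conormalVars.1 hv)
  · exact h2 v (inr_mem_conormalVars.1 hv)

theorem mul_mem_conormalPrime (K : Finset ι) (j : ι) :
    R.var (.inl j) * R.var (.inr j) ∈ R.conormalPrime K := by
  by_cases h : j ∈ K
  · exact Ideal.mul_mem_right _ _ (R.inl_mem_conormalPrime.2 h)
  · exact Ideal.mul_mem_left _ _ (R.inr_mem_conormalPrime.2 h)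

variable (E : Finset ι) (a : ι → S)

/-- The ideal generated by the symbols of the relative logarithmic fields. -/
def sgIdl (i : ι) : Ideal S := Ideal.span (R.sg E a i '' (Finset.univ.erase i : Finset ι))

theorem sg_mem (i : ι) {j : ι} (hj : j ≠ i) : R.sg E a i j ∈ R.sgIdl E a i :=
  Ideal.subset_span ⟨j, by simp [hj], rfl⟩

/-- For indices in `E` the symbols are differences of the elements `a_j x_j ξ_j`, so the span does
not depend on which of these is subtracted. -/
theorem sgIdl_le {i i' : ι} (hi : i ∈ E) (hi' : i' ∈ E) : R.sgIdl E a i ≤ R.sgIdl E a i' := by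
  have h0 : ∀ j ∈ E, R.sg E a i' j ∈ R.sgIdl E a i' := by
    intro j hj
    by_cases h : j = i'
    · rw [h, sg, if_pos hi', sub_self]; exact zero_mem _
    · exact R.sg_mem E a i' h
  refine Ideal.span_le.2 ?_
  rintro _ ⟨j, hj, rfl⟩
  by_cases hE : j ∈ E
  · have : R.sg E a i j = R.sg E a i' j - R.sg E a i' i := by
      simp only [sg, hi, hE, if_true]; ring
    rw [this]
    exact sub_mem (h0 j hE) (h0 i hi)
  · have : R.sg E a i j = R.sg E a i' j := by simp only [sg, hE, if_false]
    rw [this]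
    exact R.sg_mem E a i' fun h => hE (h ▸ hi')

theorem sgIdl_eq {i i' : ι} (hi : i ∈ E) (hi' : i' ∈ E) : R.sgIdl E a i = R.sgIdl E a i' :=
  le_antisymm (R.sgIdl_le E a hi hi') (R.sgIdl_le E a hi' hi)

theorem sgIdl_le_conormalPrime {i : ι} {K : Finset ι} (hK : K ⊆ E) :
    R.sgIdl E a i ≤ R.conormalPrime K := by
  refine Ideal.span_le.2 ?_
  rintro _ ⟨j, -, rfl⟩
  by_cases hE : j ∈ E
  · rw [sg, if_pos hE]
    exact sub_mem (Ideal.mul_mem_left _ _ (R.mul_mem_conormalPrime K j))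
      (Ideal.mul_mem_left _ _ (R.mul_mem_conormalPrime K i))
  · rw [sg, if_neg hE]
    exact R.inr_mem_conormalPrime.2 fun h => hE (hK h)

theorem _root_.LogD.exists_mul_mem_of_span {p : Ideal S} [p.IsPrime] {I : Ideal S} {G : Set S}
    (h : ∀ g ∈ G, ∃ s ∉ p, s * g ∈ I) : ∀ u ∈ Ideal.span G, ∃ s ∉ p, s * u ∈ I := by
  intro u hu
  induction hu using Submodule.span_induction with
  | mem g hg => exact h g hg
  | zero => exact ⟨1, p.one_notMem, by simp⟩
  | add x y _ _ hx hy =>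
    obtain ⟨s, hs, hx⟩ := hx
    obtain ⟨s', hs', hy⟩ := hy
    refine ⟨s * s', fun h => (‹p.IsPrime›.mem_or_mem h).elim hs hs', ?_⟩
    rw [show s * s' * (x + y) = s' * (s * x) + s * (s' * y) by ring]
    exact add_mem (I.mul_mem_left _ hx) (I.mul_mem_left _ hy)
  | smul c x _ hx =>
    obtain ⟨s, hs, hx⟩ := hx
    exact ⟨s, hs, by rw [smul_eq_mul, mul_left_comm]; exact I.mul_mem_left _ hx⟩

/-- Once `x_i` is in the ideal, so are all products `x_j ξ_j` with `j ∈ E`. If `i ∈ K`, each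
generator of the conormal prime is therefore multiplied into the ideal by an element outside the
prime: `x_j` by `ξ_j` for `j ∈ K`, and `ξ_j` by `x_j` for `j ∈ E` outside `K`. The localization is
then the residue field. If `i ∉ K`, then `x_i` becomes a unit. -/
theorem locLength_var (ha : ∀ j, IsUnit (a j)) {K : Finset ι} (hK : K ⊆ E) (i : ι) :
    locLength (R.conormalPrime K) (S ⧸ (Ideal.span {R.var (.inl i)} ⊔ R.sgIdl E a i)) =
      if i ∈ K then 1 else 0 := by
  split_ifs with hi
  · refine locLength_quotient_eq_one _ (sup_le ?_ (R.sgIdl_le_conormalPrime E a hK)) ?_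
    · rw [Ideal.span_singleton_le_iff_mem]
      exact R.inl_mem_conormalPrime.2 hi
    have h0 : ∀ j ∈ E, R.var (.inl j) * R.var (.inr j) ∈
        Ideal.span {R.var (.inl i)} ⊔ R.sgIdl E a i := by
      intro j hj
      have hz : R.var (.inl i) ∈ Ideal.span {R.var (.inl i)} ⊔ R.sgIdl E a i :=
        Ideal.mem_sup_left (Ideal.mem_span_singleton_self _)
      by_cases hji : j = i
      · subst hji
        exact Ideal.mul_mem_right _ _ hz
      obtain ⟨c, hc⟩ := (ha j).exists_left_inv
      have h1 : R.sg E a i j ∈ Ideal.span {R.var (.inl i)} ⊔ R.sgIdl E a i :=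
        Ideal.mem_sup_right (R.sg_mem E a i hji)
      rw [sg, if_pos hj] at h1
      have h2 := Ideal.mul_mem_left _ c (add_mem h1 (Ideal.mul_mem_left _ (a i)
        (Ideal.mul_mem_right (R.var (.inr i)) _ hz)))
      rwa [sub_add_cancel, ← mul_assoc, hc, one_mul] at h2
    refine exists_mul_mem_of_span ?_
    rintro _ ⟨j | j, hj, rfl⟩
    · have hjK := inl_mem_conormalVars.1 hj
      refine ⟨R.var (.inr j), fun h => R.inr_mem_conormalPrime.1 h hjK, ?_⟩
      rw [mul_comm]
      exact h0 j (hK hjK)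
    · have hjK := inr_mem_conormalVars.1 hj
      by_cases hE : j ∈ E
      · exact ⟨R.var (.inl j), fun h => hjK (R.inl_mem_conormalPrime.1 h), h0 j hE⟩
      · refine ⟨1, Ideal.one_notMem _, ?_⟩
        rw [one_mul]
        have := R.sg_mem E a i (j := j) fun h => hjK (h ▸ hi)
        rw [sg, if_neg hE] at this
        exact Ideal.mem_sup_right this
  · refine locLength_quotient_eq_zero _ fun h => hi (R.inl_mem_conormalPrime.1 (h ?_))
    exact Ideal.mem_sup_left (Ideal.mem_span_singleton_self _)

/-- The monomial with exponents `m` in the variables with index in `E`. -/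
def mon (m : ι → ℕ) : S := ∏ i ∈ E, R.var (.inl i) ^ m i

theorem mon_add_single (m : ι → ℕ) {i : ι} (hi : i ∈ E) :
    R.mon E (m + Pi.single i 1) = R.mon E m * R.var (.inl i) := by
  simp only [mon, Pi.add_apply, pow_add, Finset.prod_mul_distrib]
  congr 1
  rw [Finset.prod_eq_single i]
  · simp
  · intro j _ hj
    rw [Pi.single_eq_of_ne hj, pow_zero]
  · exact fun h => absurd hi h

/-- Lengths are additive over the factors of the monomial. The ideal of symbols is independent of
the base index, so each factor can be split off with itself as the base variable. -/
theorem locLength_mon (ha : ∀ j, IsUnit (a j)) {K : Finset ι} (hK : K ⊆ E) {i : ι} (hi : i ∈ E)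
    (m : ι → ℕ) : locLength (R.conormalPrime K) (S ⧸ (Ideal.span {R.mon E m} ⊔ R.sgIdl E a i)) =
      ((∑ j ∈ K, m j : ℕ) : ℕ∞) := by
  induction m using monomial_induction E with
  | h0 m hm =>
    rw [Finset.sum_eq_zero fun j hj => hm j (hK hj), Nat.cast_zero]
    refine locLength_quotient_eq_zero _ fun h => ?_
    refine Ideal.one_notMem (R.conormalPrime K) (h (Ideal.mem_sup_left ?_))
    rw [mon, Finset.prod_congr rfl fun j hj => by rw [hm j hj, pow_zero]]
    simp
  | hs m j hj ih =>
    rw [R.mon_add_single E m hj, locLength_sup_mul, ih, R.sgIdl_eq E a hi hj,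
      R.locLength_var E a ha hK]
    · simp only [Pi.add_apply, Finset.sum_add_distrib, Finset.sum_pi_single', Nat.cast_add]
      split_ifs <;> simp
    · rw [R.sgIdl_eq E a hi hj]
      exact fun u hu => R.mem_span_sg_of_var_mul E a ha (Finset.notMem_erase _ _) hu

/-- A prime containing the monomial and the symbols contains some `x_k` of nonzero exponent, hence
every `x_j ξ_j` with `j ∈ E`, and hence the conormal prime of the set of all `j ∈ E` with `x_j` in
it. So only conormal primes with a nonzero sum of exponents can be minimal. They are minimal,
because a smaller prime of the support must still contain one factor of every `x_j ξ_j`. The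
multiplicities are given by `locLength_mon`. -/
theorem cycle_mon (ha : ∀ j, IsUnit (a j)) {i : ι} (hi : i ∈ E) (m : ι → ℕ) :
    cycle S (S ⧸ (Ideal.span {R.mon E m} ⊔ R.sgIdl E a i)) =
      ∑ K ∈ E.powerset, (∑ j ∈ K, m j) • cycle S (S ⧸ R.conormalPrime K) := by
  classical
  funext q
  rw [Finset.sum_apply]
  simp only [Pi.smul_apply, cycle_quotient_prime]
  by_cases hq : ∃ K ⊆ E, ∑ j ∈ K, m j ≠ 0 ∧ q.asIdeal = R.conormalPrime K
  · obtain ⟨K, hK, hm, e⟩ := hq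
    rw [Finset.sum_eq_single K]
    · rw [if_pos e, cycle, if_pos]
      · have := R.locLength_mon E a ha hK hi m
        rw [nsmul_eq_mul, mul_one, ← this]
        have hqq : q = ⟨R.conormalPrime K, inferInstance⟩ := PrimeSpectrum.ext e
        subst hqq
        rfl
      · obtain ⟨j, hj, hmj⟩ := Finset.exists_ne_zero_of_sum_ne_zero hm
        refine ⟨mem_support_quotient.2 ?_, fun q' hq' hle => ?_⟩
        · rw [e]
          refine sup_le ?_ (R.sgIdl_le_conormalPrime E a hK)
          rw [Ideal.span_singleton_le_iff_mem]
          refine Ideal.mem_of_dvd _ (Finset.dvd_prod_of_mem _ (hK hj)) ?_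
          exact Ideal.pow_mem_of_mem _ (R.inl_mem_conormalPrime.2 hj) _ (Nat.pos_of_ne_zero hmj)
        · have hle' : q'.asIdeal ≤ R.conormalPrime K := fun u hu => e ▸ hle hu
          have hI := mem_support_quotient.1 hq'
          have hz : R.mon E m ∈ q'.asIdeal :=
            hI (Ideal.mem_sup_left (Ideal.mem_span_singleton_self _))
          obtain ⟨k, hk, hzk⟩ := (Ideal.IsPrime.prod_mem_iff).1 hz
          have hzk' := q'.isPrime.mem_of_pow_mem _ hzk
          have hσ : R.sgIdl E a k ≤ q'.asIdeal :=
            (R.sgIdl_eq E a hk hi).le.trans (le_sup_right.trans hI)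
          have hmul : ∀ l ∈ E, R.var (.inl l) * R.var (.inr l) ∈ q'.asIdeal := by
            intro l hl
            by_cases hlk : l = k
            · subst hlk
              exact Ideal.mul_mem_right _ _ hzk'
            have h1 := hσ (R.sg_mem E a k hlk)
            rw [sg, if_pos hl] at h1
            obtain ⟨c, hc⟩ := (ha l).exists_left_inv
            have h2 := Ideal.mul_mem_left _ c (add_mem h1 (Ideal.mul_mem_left _ (a k)
              (Ideal.mul_mem_right (R.var (.inr k)) _ hzk')))
            rwa [sub_add_cancel, ← mul_assoc, hc, one_mul] at h2
          change q.asIdeal ≤ q'.asIdeal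
          rw [e]
          refine R.conormalPrime_le (fun l hl => ?_) fun l hl => ?_
          · refine (q'.isPrime.mem_or_mem (hmul l (hK hl))).resolve_right fun h => ?_
            exact R.inr_mem_conormalPrime.1 (hle' h) hl
          · by_cases hlE : l ∈ E
            · refine (q'.isPrime.mem_or_mem (hmul l hlE)).resolve_left fun h => ?_
              exact hl (R.inl_mem_conormalPrime.1 (hle' h))
            · have := hσ (R.sg_mem E a k (j := l) fun h => hlE (h ▸ hk))
              rwa [sg, if_neg hlE] at this
    · intro K' _ hne
      rw [if_neg fun h => hne (R.conormalPrime_injective (h.symm.trans e)), smul_zero]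
    · exact fun h => absurd (Finset.mem_powerset.2 hK) h
  · rw [Finset.sum_eq_zero, cycle, if_neg]
    · intro hmin
      have hI := mem_support_quotient.1 hmin.1
      have hz : R.mon E m ∈ q.asIdeal :=
        hI (Ideal.mem_sup_left (Ideal.mem_span_singleton_self _))
      obtain ⟨k, hk, hzk⟩ := (Ideal.IsPrime.prod_mem_iff).1 hz
      have hmk : m k ≠ 0 := by
        intro h
        rw [h, pow_zero] at hzk
        exact Ideal.one_notMem _ hzk
      have hzk' := q.isPrime.mem_of_pow_mem _ hzk
      have hσ : R.sgIdl E a k ≤ q.asIdeal :=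
        (R.sgIdl_eq E a hk hi).le.trans (le_sup_right.trans hI)
      let K : Finset ι := E.filter fun j => R.var (.inl j) ∈ q.asIdeal
      have hK : K ⊆ E := Finset.filter_subset _ _
      have hkK : k ∈ K := Finset.mem_filter.2 ⟨hk, hzk'⟩
      have hle : R.conormalPrime K ≤ q.asIdeal := by
        refine R.conormalPrime_le (fun l hl => (Finset.mem_filter.1 hl).2) fun l hl => ?_
        have hlk : l ≠ k := fun h => hl (h ▸ hkK)
        have h1 := hσ (R.sg_mem E a k hlk)
        by_cases hlE : l ∈ E
        · rw [sg, if_pos hlE] at h1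
          obtain ⟨c, hc⟩ := (ha l).exists_left_inv
          have h2 := Ideal.mul_mem_left _ c (add_mem h1 (Ideal.mul_mem_left _ (a k)
            (Ideal.mul_mem_right (R.var (.inr k)) _ hzk')))
          rw [sub_add_cancel, ← mul_assoc, hc, one_mul] at h2
          exact (q.isPrime.mem_or_mem h2).resolve_left fun h => hl (Finset.mem_filter.2 ⟨hlE, h⟩)
        · rwa [sg, if_neg hlE] at h1
      refine hq ⟨K, hK, ?_, ?_⟩
      · exact fun h => hmk (Finset.sum_eq_zero_iff.1 h k hkK)
      · have h1 : (⟨R.conormalPrime K, inferInstance⟩ : PrimeSpectrum S) ∈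
            Module.support S (S ⧸ (Ideal.span {R.mon E m} ⊔ R.sgIdl E a i)) := by
          rw [mem_support_quotient]
          refine sup_le ?_ (R.sgIdl_le_conormalPrime E a hK)
          rw [Ideal.span_singleton_le_iff_mem]
          refine Ideal.mem_of_dvd _ (Finset.dvd_prod_of_mem _ hk) ?_
          exact Ideal.pow_mem_of_mem _ (R.inl_mem_conormalPrime.2 hkK) _ (Nat.pos_of_ne_zero hmk)
        exact le_antisymm (hmin.2 h1 hle) hle
    · intro K hK
      by_cases hm : ∑ j ∈ K, m j = 0
      · rw [hm, zero_smul]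
      · rw [if_neg fun h => hq ⟨K, Finset.mem_powerset.1 hK, hm, h⟩, smul_zero]

end VarRing

/-! ### Koszul exactness for the symbols, modulo the base variable. -/

section
variable {S : Type*} [CommRing S] [IsDomain S] {n : ℕ}

/-- The symbols are regular in any order over the quotient by the base variable, which is what
`koszul_exact` needs. The result is phrased with congruences in `S` so that it can be lifted to
operators. -/
theorem VarRing.koszul_sg (R : VarRing S (Fin (n + 1) ⊕ Fin (n + 1))) (E : Finset (Fin (n + 1)))
    (a : Fin (n + 1) → S) (ha : ∀ j, IsUnit (a j)) (i : Fin (n + 1)) (f : Fin n → S)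
    (hf : ∀ m, f m = R.sg E a i (i.succAbove m)) {p : ℕ} (hp : p < n) (c : Finset (Fin n) → S)
    (hc : ∀ s, s.card = p + 1 →
      kd (fun m => AddMonoidHom.mulLeft (f m)) c s ∈ Ideal.span {R.var (.inl i)}) :
    ∃ η : Finset (Fin n) → S, ∀ s, s.card = p →
      c s - kd (fun m => AddMonoidHom.mulLeft (f m)) η s ∈ Ideal.span {R.var (.inl i)} := by
  set I := Ideal.span {R.var (.inl i)} with hI
  let q : S →+* S ⧸ I := Ideal.Quotient.mk I
  let F : Fin n → (S ⧸ I) →+ (S ⧸ I) := fun m => AddMonoidHom.mulLeft (q (f m))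
  have hq : ∀ c s, q (kd (fun m => AddMonoidHom.mulLeft (f m)) c s) = kd F (q ∘ c) s :=
    kd_map _ F q.toAddMonoidHom fun m x => map_mul q _ _
  obtain ⟨η, hη⟩ := koszul_exact F (fun i j x => mul_left_comm _ _ _) Finset.univ (by
    intro m _ B' _ hm x hx
    obtain ⟨u, rfl⟩ := Ideal.Quotient.mk_surjective x
    have himg : ∀ y : S, q y ∈ kspan F B' ↔
        y ∈ I ⊔ Ideal.span (R.sg E a i '' (B'.image i.succAbove : Finset _)) := by
      intro y
      have hfin : (R.sg E a i '' (B'.image i.succAbove : Finset _)) = f '' (B' : Set (Fin n)) := by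
        rw [Finset.coe_image, Set.image_image]
        simp only [← hf]
      rw [hfin]
      constructor
      · rintro ⟨x, hx⟩
        choose x' hx' using fun j => Ideal.Quotient.mk_surjective (I := I) (x j)
        have h1 : y - ∑ j ∈ B', f j * x' j ∈ I := by
          rw [← Ideal.Quotient.eq_zero_iff_mem, map_sub, map_sum, sub_eq_zero]
          refine hx.trans (Finset.sum_congr rfl fun j _ => ?_)
          rw [map_mul, hx']
          rfl
        rw [← sub_add_cancel y (∑ j ∈ B', f j * x' j)]
        refine Submodule.add_mem_sup h1 (Ideal.sum_mem _ fun j hj => ?_)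
        exact Ideal.mul_mem_right _ _ (Ideal.subset_span ⟨j, hj, rfl⟩)
      · intro h
        obtain ⟨x, hx, y', hy', rfl⟩ := Submodule.mem_sup.1 h
        rw [map_add, Ideal.Quotient.eq_zero_iff_mem.2 hx, zero_add]
        obtain ⟨g, hg⟩ := (Submodule.mem_span_image_finset_iff_exists_fun S).1 hy'
        refine ⟨fun j => if h : j ∈ B' then q (g ⟨j, h⟩) else 0, ?_⟩
        rw [← hg, map_sum, ← Finset.sum_coe_sort B']
        refine Finset.sum_congr rfl fun j _ => ?_
        rw [smul_eq_mul, mul_comm, map_mul]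
        beta_reduce
        rw [dif_pos j.2]
        rfl
    have h1 : q (f m * u) ∈ kspan F B' := by rw [map_mul]; exact hx
    rw [himg, hf] at h1
    refine (himg u).2 (R.mem_of_sg_mul E a ha ?_ ?_ (Fin.succAbove_ne i m) h1)
    · simp [Fin.succAbove_ne]
    · simpa using hm) p (by simpa using hp) (q ∘ c) (by
      intro s _ hs
      rw [← hq]
      exact Ideal.Quotient.eq_zero_iff_mem.2 (hc s hs))
  choose η' hη' using fun s => Ideal.Quotient.mk_surjective (I := I) (η s)
  refine ⟨η', fun s hs => ?_⟩
  rw [← Ideal.Quotient.eq_zero_iff_mem, map_sub, sub_eq_zero]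
  rw [show Ideal.Quotient.mk I _ = _ from hq η' s, show q ∘ η' = η from funext hη']
  exact hη s (Finset.subset_univ _) hs

end

/-! ### Coordinates on the cotangent bundle and conormal ideals. -/

section
open MvPolynomial

/-- Transport of variables along a ring isomorphism. -/
def VarRing.ofEquiv {S S' W : Type*} [CommRing S] [CommRing S'] (R : VarRing S W) (e : S' ≃+* S) :
    VarRing S' W where
  var v := e.symm (R.var v)
  restr v := (e.symm : S →+* S').comp ((R.restr v).comp (e : S' →+* S))
  var_ne_zero v h := R.var_ne_zero v ((map_eq_zero_iff _ e.symm.injective).1 h)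
  restr_self v := by simp [R.restr_self]
  restr_ne v w h := by simp [R.restr_ne v w h]
  restr_sub v u := by
    obtain ⟨a, ha⟩ := Ideal.mem_span_singleton'.1 (R.restr_sub v (e u))
    refine Ideal.mem_span_singleton'.2 ⟨e.symm a, ?_⟩
    rw [← map_mul, ha, map_sub, e.symm_apply_apply]
    rfl

section
variable {A : Type*} [CommRing A] [Algebra ℂ A] {ι : Type*} [DecidableEq ι] (𝔠 : Coords A ι)

theorem Coords.w_ne_zero [Nontrivial A] (i : ι) : 𝔠.w i ≠ 0 := fun h => by
  have := 𝔠.der_self i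
  rw [h, map_zero] at this
  exact zero_ne_one this

/-- The coordinates on the cotangent bundle. -/
def Coords.polyVarRing [Nontrivial A] : VarRing (MvPolynomial ι A) (ι ⊕ ι) where
  var := Sum.elim (fun i => C (𝔠.w i)) X
  restr := Sum.elim (fun i => map (𝔠.restr i))
    (fun j => eval₂Hom C fun k => if k = j then 0 else X k)
  var_ne_zero := by
    rintro (i | i)
    · exact (C_eq_zero).not.2 (𝔠.w_ne_zero i)
    · exact X_ne_zero i
  restr_self := by
    rintro (i | i)
    · simp [𝔠.restr_self]
    · simp
  restr_ne := by
    rintro (i | i) (j | j) h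
    · have : i ≠ j := fun e => h (by rw [e])
      simp [𝔠.restr_ne i j this]
    · simp
    · simp
    · have : j ≠ i := fun e => h (by rw [e])
      simp [this]
  restr_sub := by
    rintro (i | i) u
    · induction u using MvPolynomial.induction_on with
      | C a =>
        obtain ⟨b, hb⟩ := Ideal.mem_span_singleton'.1 (𝔠.restr_sub i a)
        refine Ideal.mem_span_singleton'.2 ⟨C b, ?_⟩
        simp only [Sum.elim_inl, map_C, ← map_mul, hb, map_sub]
      | add p q hp hq =>
        rw [map_add, add_sub_add_comm]
        exact add_mem hp hq
      | mul_X p j hp =>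
        simp only [Sum.elim_inl, map_mul, map_X, ← sub_mul] at hp ⊢
        exact Ideal.mul_mem_right _ _ hp
    · induction u using MvPolynomial.induction_on with
      | C a => simp
      | add p q hp hq =>
        rw [map_add, add_sub_add_comm]
        exact add_mem hp hq
      | mul_X p j hp =>
        simp only [Sum.elim_inr, map_mul, coe_eval₂Hom, eval₂_X] at hp ⊢
        by_cases hj : j = i
        · subst hj
          simp only [if_true, mul_zero, sub_zero]
          exact Ideal.mul_mem_left _ _ (Ideal.mem_span_singleton_self _)
        · rw [if_neg hj, ← sub_mul]
          exact Ideal.mul_mem_right _ _ hp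

variable [Fintype ι]

theorem Coords.isDomain_GrD (𝔠 : Coords A ι) [IsDomain A] : IsDomain (GrD A) :=
  MulEquiv.isDomain (MvPolynomial ι A) 𝔠.grEquiv.toMulEquiv

/-- The coordinates on the cotangent bundle, in the associated graded ring. -/
def Coords.grVarRing [Nontrivial A] : VarRing (GrD A) (ι ⊕ ι) :=
  𝔠.polyVarRing.ofEquiv 𝔠.grEquiv

theorem Coords.grVarRing_inl [Nontrivial A] (i : ι) :
    𝔠.grVarRing.var (.inl i) = symFun A (𝔠.w i) := by
  change 𝔠.grEquiv.symm (C (𝔠.w i)) = _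
  rw [RingEquiv.symm_apply_eq, 𝔠.grEquiv_symFun]

theorem Coords.grVarRing_inr [Nontrivial A] (i : ι) :
    𝔠.grVarRing.var (.inr i) = symDer (𝔠.der i) := by
  change 𝔠.grEquiv.symm (X i) = _
  rw [RingEquiv.symm_apply_eq, 𝔠.grEquiv_symDer]
  rw [Finset.sum_eq_single i]
  · rw [𝔠.der_self, C_1, one_mul]
  · intro j _ hj
    rw [𝔠.der_ne i j hj.symm, C_0, zero_mul]
  · simp

theorem symFun_mul (g h : A) : symFun A (g * h) = symFun A g * symFun A h := by
  rw [symFun, symFun, symFun, symb_mul]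
  congr 1
  refine Subtype.ext ?_
  change (toD (g * h)).op = (toD g).op * (toD h).op
  rw [mul_comm g h, map_mul]
  rfl

/-- The symbol of a field is `∑ θ(w_i) ξ_i`, and tangency to the stratum puts `θ(w_i)` in its ideal
for `i ∈ K`. Conversely `∂_i` with `i ∉ K` is tangent and has symbol `ξ_i`. -/
theorem Coords.conormalIdeal_eq [IsDomain A] (K : Finset ι) :
    conormalIdeal (Ideal.span (𝔠.w '' K)) = 𝔠.grVarRing.conormalPrime K := by
  have hsym : ∀ u : A, u ∈ Ideal.span (𝔠.w '' K) → symFun A u ∈ 𝔠.grVarRing.conormalPrime K := by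
    intro u hu
    induction hu using Submodule.span_induction with
    | mem g hg =>
      obtain ⟨i, hi, rfl⟩ := hg
      rw [← 𝔠.grVarRing_inl]
      exact Ideal.subset_span ⟨.inl i, VarRing.inl_mem_conormalVars.2 hi, rfl⟩
    | zero =>
      rw [show symFun A 0 = 0 from 𝔠.grEquiv.injective (by rw [𝔠.grEquiv_symFun, C_0, map_zero])]
      exact zero_mem _
    | add x y _ _ hx hy =>
      rw [show symFun A (x + y) = symFun A x + symFun A y from 𝔠.grEquiv.injective (by
        rw [map_add, 𝔠.grEquiv_symFun, 𝔠.grEquiv_symFun, 𝔠.grEquiv_symFun, C_add])]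
      exact add_mem hx hy
    | smul c x _ hx =>
      rw [smul_eq_mul, symFun_mul]
      exact Ideal.mul_mem_left _ _ hx
  refine le_antisymm (Ideal.span_le.2 ?_) (Ideal.span_le.2 ?_)
  · rintro σ (⟨g, hg, rfl⟩ | ⟨θ, hθ, rfl⟩)
    · exact hsym g hg
    · have e : symDer θ = ∑ i, symFun A (θ (𝔠.w i)) * symDer (𝔠.der i) := by
        refine 𝔠.grEquiv.injective ?_
        rw [map_sum, 𝔠.grEquiv_symDer]
        refine Finset.sum_congr rfl fun i _ => ?_
        rw [map_mul, 𝔠.grEquiv_symFun, ← 𝔠.grVarRing_inr]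
        congr 1
        exact (𝔠.grEquiv.apply_symm_apply _).symm
      change symDer θ ∈ _
      rw [e]
      refine Ideal.sum_mem _ fun i _ => ?_
      by_cases hi : i ∈ K
      · exact Ideal.mul_mem_right _ _ (hsym _ (hθ _ (Ideal.subset_span ⟨i, hi, rfl⟩)))
      · rw [← 𝔠.grVarRing_inr]
        exact Ideal.mul_mem_left _ _
          (Ideal.subset_span ⟨.inr i, VarRing.inr_mem_conormalVars.2 hi, rfl⟩)
  · rintro _ ⟨i | i, hi, rfl⟩
    · have hi' := VarRing.inl_mem_conormalVars.1 hi
      rw [𝔠.grVarRing_inl]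
      exact Ideal.subset_span (.inl ⟨_, Ideal.subset_span ⟨i, hi', rfl⟩, rfl⟩)
    · have hi' := VarRing.inr_mem_conormalVars.1 hi
      rw [𝔠.grVarRing_inr]
      refine Ideal.subset_span (.inr ⟨𝔠.der i, fun g hg => ?_, rfl⟩)
      induction hg using Submodule.span_induction with
      | mem g hg =>
        obtain ⟨j, hj, rfl⟩ := hg
        rw [𝔠.der_ne i j fun h => hi' (h ▸ hj)]
        exact zero_mem _
      | zero => rw [map_zero]; exact zero_mem _
      | add x y _ _ hx hy => rw [map_add]; exact add_mem hx hy
      | smul c x hx hx' =>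
        rw [smul_eq_mul, Derivation.leibniz]
        exact add_mem (Ideal.mul_mem_left _ _ hx') (Ideal.mul_mem_right _ _ hx)

theorem conormalIdeal_top [IsDomain A] : conormalIdeal (⊤ : Ideal A) = ⊤ := by
  rw [Ideal.eq_top_iff_one]
  refine Ideal.subset_span (.inl ⟨1, trivial, ?_⟩)
  change GrD.mk 1 = GrD.mk (reesOf 0 _)
  refine congrArg _ (reesOf_congr rfl _ _ ?_)
  exact (congrArg D.op (map_one toD)).symm

theorem conormalCycle_top [IsDomain A] : conormalCycle (⊤ : Ideal A) = 0 := by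
  rw [conormalCycle, conormalIdeal_top]
  funext q
  rw [cycle, if_neg]
  · rfl
  · intro h
    exact q.isPrime.ne_top (top_le_iff.1 (mem_support_quotient.1 h.1))

end

end

/-! ### Cartan calculus for forms with values in `D`. -/

section
variable {A : Type*} [CommRing A] [Algebra ℂ A]

theorem D_ext {P Q : D A} (h : ∀ u, P.toEnd u = Q.toEnd u) : P = Q :=
  D.toEnd_injective (LinearMap.ext h)

theorem derD_mul_smul (θ : Derivation ℂ A A) (c : A) (P : D A) :
    derD θ * c • P = c • (derD θ * P) + θ c • P := by
  refine D_ext fun u => ?_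
  rw [map_add]
  change θ (c * P.toEnd u) = c * θ (P.toEnd u) + θ c * P.toEnd u
  rw [Derivation.leibniz, smul_eq_mul, smul_eq_mul, mul_comm (θ c)]

theorem derD_add (θ η : Derivation ℂ A A) : derD (θ + η) = derD θ + derD η := D_ext fun _ => rfl

theorem derD_smul (c : A) (θ : Derivation ℂ A A) : derD (c • θ) = c • derD θ := D_ext fun _ => rfl

end

namespace Fields
variable {A : Type*} [CommRing A] [Algebra ℂ A] {L : Fields A}

theorem br_add_left (θ θ' η : L.T) : L.br (θ + θ') η = L.br θ η + L.br θ' η :=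
  Subtype.ext (add_lie _ _ _)

theorem br_add_right (θ η η' : L.T) : L.br θ (η + η') = L.br θ η + L.br θ η' :=
  Subtype.ext (lie_add _ _ _)

theorem br_smul_right (c : A) (θ η : L.T) :
    L.br θ (c • η) = c • L.br θ η + (θ : Derivation ℂ A A) c • η := by
  refine Subtype.ext (Derivation.ext fun u => ?_)
  change ⁅(θ : Derivation ℂ A A), c • (η : Derivation ℂ A A)⁆ u =
    c * ⁅(θ : Derivation ℂ A A), (η : Derivation ℂ A A)⁆ u + θ.1 c * η.1 u
  simp only [Derivation.commutator_apply, Derivation.smul_apply, smul_eq_mul, Derivation.leibniz]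
  ring

theorem br_smul_left (c : A) (θ η : L.T) :
    L.br (c • θ) η = c • L.br θ η - (η : Derivation ℂ A A) c • θ := by
  refine Subtype.ext (Derivation.ext fun u => ?_)
  change ⁅c • (θ : Derivation ℂ A A), (η : Derivation ℂ A A)⁆ u =
    c * ⁅(θ : Derivation ℂ A A), (η : Derivation ℂ A A)⁆ u - η.1 c * θ.1 u
  simp only [Derivation.commutator_apply, Derivation.smul_apply, smul_eq_mul, Derivation.leibniz]
  ring

theorem br_self (θ : L.T) : L.br θ θ = 0 := Subtype.ext (lie_self _)

theorem Form.map_update_add {p : ℕ} (φ : L.Form p) (v : Fin p → L.T) (k : Fin p) (x y : L.T) :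
    φ (Function.update v k (x + y)) = φ (Function.update v k x) + φ (Function.update v k y) :=
  AlternatingMap.map_update_add (φ : L.T [⋀^Fin p]→ₗ[A] D A) v k x y

theorem Form.map_update_smul {p : ℕ} (φ : L.Form p) (v : Fin p → L.T) (k : Fin p) (c : A)
    (x : L.T) : φ (Function.update v k (c • x)) = c • φ (Function.update v k x) :=
  AlternatingMap.map_update_smul (φ : L.T [⋀^Fin p]→ₗ[A] D A) v k c x

theorem Form.eq_zero_of_eq {p : ℕ} (φ : L.Form p) {v : Fin p → L.T} {i j : Fin p} (h : v i = v j)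
    (hij : i ≠ j) : φ v = 0 :=
  AlternatingMap.map_eq_zero_of_eq (φ : L.T [⋀^Fin p]→ₗ[A] D A) v h hij

theorem Form.map_swap {p : ℕ} (φ : L.Form p) (v : Fin p → L.T) {i j : Fin p} (hij : i ≠ j) :
    φ (v ∘ Equiv.swap i j) = -φ v :=
  AlternatingMap.map_swap (φ : L.T [⋀^Fin p]→ₗ[A] D A) v hij

theorem Form.ext {p : ℕ} {φ ψ : L.Form p} (h : ∀ v, φ v = ψ v) : φ = ψ := AlternatingMap.ext h

theorem Form.sub_apply {p : ℕ} (φ ψ : L.Form p) (θ : Fin p → L.T) : (φ - ψ) θ = φ θ - ψ θ := rfl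

theorem Form.zero_apply {p : ℕ} (θ : Fin p → L.T) : (0 : L.Form p) θ = 0 := rfl

theorem Form.smulA_apply {p : ℕ} (c : A) (φ : L.Form p) (θ : Fin p → L.T) :
    (c • φ) θ = c • φ θ := rfl

/-- Contraction of a form with a field. -/
def contr {p : ℕ} (φ : L.Form (p + 1)) : L.T →ₗ[A] L.Form p :=
  AlternatingMap.curryLeft (φ : L.T [⋀^Fin (p + 1)]→ₗ[A] D A)

theorem contr_apply {p : ℕ} (φ : L.Form (p + 1)) (θ : L.T) (v : Fin p → L.T) :
    contr φ θ v = φ (Fin.cons θ v) := rfl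

/-- The values of the Lie derivative of a form. -/
def lieVal {p : ℕ} (θ : L.T) (φ : L.Form p) (v : Fin p → L.T) : D A :=
  derD (θ : Derivation ℂ A A) * φ v - ∑ j, φ (Function.update v j (L.br θ (v j)))

theorem lieVal_update_add {p : ℕ} (θ : L.T) (φ : L.Form p) (v : Fin p → L.T) (k : Fin p)
    (x y : L.T) : lieVal θ φ (Function.update v k (x + y)) =
      lieVal θ φ (Function.update v k x) + lieVal θ φ (Function.update v k y) := by
  simp only [lieVal, Form.map_update_add, mul_add]
  rw [sub_add_sub_comm, ← Finset.sum_add_distrib]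
  congr 1
  refine Finset.sum_congr rfl fun j _ => ?_
  by_cases h : j = k
  · subst h
    simp only [Function.update_self, Function.update_idem, br_add_right, Form.map_update_add]
  · simp only [Function.update_of_ne h, Function.update_comm (Ne.symm h), Form.map_update_add]

/-- The term with `θ c` that comes from differentiating the product cancels against the one in `[θ,
c x]`. -/
theorem lieVal_update_smul {p : ℕ} (θ : L.T) (φ : L.Form p) (v : Fin p → L.T) (k : Fin p)
    (c : A) (x : L.T) : lieVal θ φ (Function.update v k (c • x)) =
      c • lieVal θ φ (Function.update v k x) := by
  simp only [lieVal, Form.map_update_smul, derD_mul_smul, smul_sub, Finset.smul_sum]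
  rw [← Finset.add_sum_erase _ _ (Finset.mem_univ k), ← Finset.add_sum_erase _ _ (Finset.mem_univ k)]
  simp only [Function.update_self, Function.update_idem, br_smul_right, Form.map_update_add,
    Form.map_update_smul]
  rw [Finset.sum_congr rfl fun j hj => show φ (Function.update (Function.update v k (c • x)) j
      (L.br θ (Function.update v k (c • x) j))) = c • φ (Function.update (Function.update v k x) j
      (L.br θ (Function.update v k x j))) from ?_]
  · abel
  · have h : j ≠ k := (Finset.mem_erase.1 hj).1
    simp only [Function.update_of_ne h, Function.update_comm (Ne.symm h), Form.map_update_smul]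

theorem lieVal_eq_zero_of_eq {p : ℕ} (θ : L.T) (φ : L.Form p) {v : Fin p → L.T} {i j : Fin p}
    (h : v i = v j) (hij : i ≠ j) : lieVal θ φ v = 0 := by
  rw [lieVal, φ.eq_zero_of_eq h hij, mul_zero, zero_sub, neg_eq_zero,
    ← Finset.add_sum_erase _ _ (Finset.mem_univ i),
    ← Finset.add_sum_erase _ _ (Finset.mem_erase.2 ⟨hij.symm, Finset.mem_univ j⟩),
    Finset.sum_eq_zero, add_zero]
  · have : Function.update v j (L.br θ (v j)) =
        Function.update v i (L.br θ (v i)) ∘ Equiv.swap i j := by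
      ext1 k
      by_cases hki : k = i
      · subst hki; simp [hij, hij.symm, h]
      · by_cases hkj : k = j
        · subst hkj; simp [h]
        · simp [hki, hkj, Equiv.swap_apply_of_ne_of_ne]
    rw [this, φ.map_swap _ hij, add_neg_cancel]
  · intro k hk
    simp only [Finset.mem_erase, Finset.mem_univ, and_true] at hk
    refine φ.eq_zero_of_eq (i := i) (j := j) ?_ hij
    rw [Function.update_of_ne hk.2.symm, Function.update_of_ne hk.1.symm, h]

/-- The Lie derivative of a form. -/
def lieForm {p : ℕ} (θ : L.T) (φ : L.Form p) : L.Form p :=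
  ({ toFun := lieVal θ φ
     map_update_add' := fun {inst} v k x y => by
       rw [Subsingleton.elim inst (instDecidableEqFin p)]
       exact lieVal_update_add θ φ v k x y
     map_update_smul' := fun {inst} v k c x => by
       rw [Subsingleton.elim inst (instDecidableEqFin p)]
       exact lieVal_update_smul θ φ v k c x
     map_eq_zero_of_eq' := fun _ _ _ h hij => lieVal_eq_zero_of_eq θ φ h hij } :
    L.T [⋀^Fin p]→ₗ[A] D A)

theorem lieForm_apply {p : ℕ} (θ : L.T) (φ : L.Form p) (v : Fin p → L.T) :
    lieForm θ φ v = lieVal θ φ v := rfl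

/-- Cartan's formula. In the definition of `d` the bracket of the arguments `i < j` stands in place
of argument `j`, so the terms with `i = 0` make up the Lie derivative exactly, and the others are
the derivative of the contraction with the opposite sign. -/
theorem d_cons {p : ℕ} (φ : L.Form (p + 1)) (θ : L.T) (v : Fin (p + 1) → L.T) :
    d φ (Fin.cons θ v) = lieVal θ φ v - d (contr φ θ) v := by
  have hcons : ∀ (i : Fin (p + 1)) (w : Fin (p + 1) → L.T),
      i.succ.removeNth (Fin.cons θ w : Fin (p + 2) → L.T) = Fin.cons θ (i.removeNth w) := by
    intro i w
    ext1 k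
    refine Fin.cases ?_ (fun k => ?_) k
    · simp [Fin.removeNth]
    · simp [Fin.removeNth]
  rw [d, Fin.sum_univ_succ]
  rw [Fin.sum_Ioi_zero]
  simp only [Fin.val_zero, pow_zero, one_smul, Fin.cons_zero, Fin.removeNth_zero, Fin.tail_cons,
    Fin.cons_succ, Fin.sum_Ioi_succ, hcons, ← Fin.cons_update]
  rw [lieVal, sub_eq_add_neg _ (d (contr φ θ) v), d, ← Finset.sum_neg_distrib]
  congr 1
  refine Finset.sum_congr rfl fun i _ => ?_
  simp only [contr_apply, Fin.val_succ, pow_succ, mul_neg, mul_one, neg_smul]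

theorem d_smulA {p : ℕ} (c : A) (ψ : L.Form p) (v : Fin (p + 1) → L.T) :
    d (c • ψ) v = c • d ψ v +
      ∑ j : Fin (p + 1), (-1 : ℤ) ^ (j : ℕ) • (v j : Derivation ℂ A A) c • ψ (j.removeNth v) := by
  simp only [d, Form.smulA_apply, derD_mul_smul]
  rw [Finset.smul_sum, ← Finset.sum_add_distrib]
  refine Finset.sum_congr rfl fun i _ => ?_
  rw [smul_comm c, ← smul_add]
  congr 1
  rw [smul_sub, Finset.smul_sum]
  abel

/-- The correction is the wedge of the differential of `c` with the contraction of `φ`. The same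
term occurs in `d_smulA` for the contraction, so that `d φ` is linear in its first argument. -/
theorem lieVal_smul_left {p : ℕ} (c : A) (θ : L.T) (φ : L.Form (p + 1)) (v : Fin (p + 1) → L.T) :
    lieVal (c • θ) φ v = c • lieVal θ φ v + ∑ j : Fin (p + 1),
      (-1 : ℤ) ^ (j : ℕ) • (v j : Derivation ℂ A A) c • φ (Fin.cons θ (j.removeNth v)) := by
  have h : ∀ j : Fin (p + 1), φ (Function.update v j θ) =
      (-1 : ℤ) ^ (j : ℕ) • φ (Fin.cons θ (j.removeNth v)) := by
    intro j
    have := AlternatingMap.map_insertNth (φ : L.T [⋀^Fin (p + 1)]→ₗ[A] D A) j θ (j.removeNth v)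
    rw [Fin.insertNth_removeNth] at this
    exact this
  simp only [lieVal, br_smul_left, smul_sub, Finset.smul_sum]
  have h2 : ∀ j, φ (Function.update v j (c • L.br θ (v j) - (v j : Derivation ℂ A A) c • θ)) =
      c • φ (Function.update v j (L.br θ (v j))) -
        (-1 : ℤ) ^ (j : ℕ) • (v j : Derivation ℂ A A) c • φ (Fin.cons θ (j.removeNth v)) := by
    intro j
    rw [show c • L.br θ (v j) - (v j : Derivation ℂ A A) c • θ =
      c • L.br θ (v j) + (-(v j : Derivation ℂ A A) c) • θ from
        (sub_eq_add_neg _ _).trans (congrArg _ (neg_smul _ _).symm),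
      Form.map_update_add, Form.map_update_smul,
      Form.map_update_smul, h, neg_smul, ← sub_eq_add_neg, smul_comm ((v j : Derivation ℂ A A) c)]
  simp only [h2, Finset.sum_sub_distrib]
  rw [show derD ((c • θ : L.T) : Derivation ℂ A A) = c • derD (θ : Derivation ℂ A A) from
    derD_smul _ _, smul_D_def, smul_D_def, mul_assoc]
  abel

theorem lieVal_add_left {p : ℕ} (θ θ' : L.T) (φ : L.Form p) (v : Fin p → L.T) :
    lieVal (θ + θ') φ v = lieVal θ φ v + lieVal θ' φ v := by
  simp only [lieVal, br_add_left, Form.map_update_add, Finset.sum_add_distrib]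
  rw [show derD ((θ + θ' : L.T) : Derivation ℂ A A) =
    derD (θ : Derivation ℂ A A) + derD (θ' : Derivation ℂ A A) from derD_add _ _, add_mul]
  abel

theorem lieVal_cons {p : ℕ} (θ : L.T) (φ : L.Form (p + 1)) (u : Fin p → L.T) :
    lieVal θ φ (Fin.cons θ u) = lieVal θ (contr φ θ) u := by
  rw [lieVal, lieVal, Fin.sum_univ_succ]
  simp only [Fin.cons_zero, br_self, Fin.cons_succ, ← Fin.cons_update, contr_apply]
  rw [show φ (Function.update (Fin.cons θ u) 0 0) = 0 from
    AlternatingMap.map_coord_zero (φ : L.T [⋀^Fin (p + 1)]→ₗ[A] D A) 0 (by simp), zero_add]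

/-- A form of degree `p + 1` from a linear family of forms of degree `p`. -/
theorem exists_form_of_family {p : ℕ} (F : L.T →ₗ[A] L.Form p)
    (h : ∀ (v : Fin (p + 1) → L.T) i j, v i = v j → i ≠ j → F (v 0) (Fin.tail v) = 0) :
    ∃ Φ : L.Form (p + 1), ∀ v, Φ v = F (v 0) (Fin.tail v) := by
  let G : L.T →ₗ[A] MultilinearMap A (fun _ : Fin p => L.T) (D A) :=
    (AlternatingMap.toMultilinearMapLM : (L.T [⋀^Fin p]→ₗ[A] D A) →ₗ[A] _) ∘ₗ
      (F : L.T →ₗ[A] (L.T [⋀^Fin p]→ₗ[A] D A))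
  let U : MultilinearMap A (fun _ : Fin (p + 1) => L.T) (D A) :=
    LinearMap.uncurryLeft (M := fun _ => L.T) G
  let Φ : L.T [⋀^Fin (p + 1)]→ₗ[A] D A :=
    AlternatingMap.mk U fun v i j hv hij => h v i j hv hij
  exact ⟨Φ, fun v => rfl⟩

/-- The content is that `d φ` is multilinear over `A` and alternating. By Cartan's formula it is the
family `θ ↦ L_θ φ - d (ι_θ φ)` of forms of one degree less, which are available by induction;
Cartan's formula for `ι_θ φ` gives the vanishing when `θ` is repeated. -/
theorem exists_dForm : ∀ {p : ℕ} (φ : L.Form p), ∃ Φ : L.Form (p + 1), ∀ v, Φ v = d φ v := by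
  intro p
  induction p with
  | zero =>
    intro φ
    have hd : ∀ v : Fin 1 → L.T, d φ v = derD (v 0 : Derivation ℂ A A) * φ (Fin.tail v) := by
      intro v
      simp [d]
    have hφ : ∀ v w : Fin 0 → L.T, φ v = φ w := fun v w => congrArg φ (Subsingleton.elim v w)
    obtain ⟨Φ, hΦ⟩ := exists_form_of_family (L := L) (p := 0)
      { toFun := fun θ => (AlternatingMap.constOfIsEmpty A L.T (Fin 0)
          (derD (θ : Derivation ℂ A A) * φ 0) : L.T [⋀^Fin 0]→ₗ[A] D A)
        map_add' := fun θ θ' => Form.ext fun v => by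
          change derD (θ.1 + θ'.1) * φ 0 = derD θ.1 * φ 0 + derD θ'.1 * φ 0
          rw [derD_add, add_mul]
        map_smul' := fun c θ => Form.ext fun v => by
          change derD (c • (θ : Derivation ℂ A A)) * φ 0 = c • (derD θ.1 * φ 0)
          rw [derD_smul, smul_D_def, smul_D_def, mul_assoc] }
      fun v i j _ hij => absurd (Subsingleton.elim (α := Fin 1) i j) hij
    refine ⟨Φ, fun v => ?_⟩
    rw [hΦ, hd, hφ (Fin.tail v) 0]
    rfl
  | succ p ih =>
    intro φ
    choose Ψ hΨ using fun θ => ih (contr φ θ)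
    have hF : ∀ θ v, (lieForm θ φ - Ψ θ) v = d φ (Fin.cons θ v) := fun θ v => by
      rw [Form.sub_apply, hΨ, lieForm_apply, d_cons]
    obtain ⟨Φ, hΦ⟩ := exists_form_of_family (L := L) (p := p + 1)
      { toFun := fun θ => lieForm θ φ - Ψ θ
        map_add' := fun θ θ' => Form.ext fun v => by
          rw [Form.add_apply, hF, hF, hF, d_cons, d_cons, d_cons, map_add, d_add, lieVal_add_left]
          abel
        map_smul' := fun c θ => Form.ext fun v => by
          rw [RingHom.id_apply, Form.smulA_apply, hF, hF, d_cons, d_cons, map_smul, d_smulA,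
            lieVal_smul_left, smul_sub]
          simp only [contr_apply]
          abel }
      (by
        have alt0 : ∀ θ (v : Fin (p + 1) → L.T), v 0 = θ → (lieForm θ φ - Ψ θ) v = 0 := by
          intro θ v hv
          rw [hF, d_cons, ← Fin.cons_self_tail v, hv, lieVal_cons]
          -- `d_cons` applies to the contraction only in positive degree, hence the separate case.
          rcases p with _ | p
          · have e : d (contr φ θ) (Fin.cons θ (Fin.tail v)) =
                derD (θ : Derivation ℂ A A) * contr φ θ (Fin.tail v) := by
              simp [d]
            rw [e, lieVal]
            simp
          · rw [d_cons]
            have : contr (contr φ θ) θ = 0 := Form.ext fun w => by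
              rw [contr_apply, contr_apply, Form.zero_apply]
              exact φ.eq_zero_of_eq (i := 0) (j := 1) rfl (by simp)
            rw [this]
            have h0 : d (0 : L.Form p) (Fin.tail v) = 0 := by simp [d, Form.zero_apply]
            rw [h0, sub_zero, sub_self]
        have alt : ∀ θ (v : Fin (p + 1) → L.T) k, v k = θ → (lieForm θ φ - Ψ θ) v = 0 := by
          intro θ v k hv
          by_cases hk : k = 0
          · exact alt0 θ v (hk ▸ hv)
          · rw [← neg_eq_zero, ← Form.map_swap _ _ (Ne.symm hk)]
            exact alt0 θ _ (by simp [hv])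
        intro v i j hv hij
        change (lieForm (v 0) φ - Ψ (v 0)) (Fin.tail v) = 0
        induction i using Fin.cases with
        | zero =>
          induction j using Fin.cases with
          | zero => exact absurd rfl hij
          | succ j => exact alt _ _ j hv.symm
        | succ i =>
          induction j using Fin.cases with
          | zero => exact alt _ _ i hv
          | succ j => exact Form.eq_zero_of_eq _ (i := i) (j := j) hv fun h => hij (h ▸ rfl))
    refine ⟨Φ, fun v => ?_⟩
    rw [hΦ]
    change (lieForm (v 0) φ - Ψ (v 0)) (Fin.tail v) = _
    rw [hF, Fin.cons_self_tail]

/-- The exterior derivative as a form. -/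
def dForm {p : ℕ} (φ : L.Form p) : L.Form (p + 1) := (exists_dForm φ).choose

theorem dForm_apply {p : ℕ} (φ : L.Form p) (v : Fin (p + 1) → L.T) : dForm φ v = d φ v :=
  (exists_dForm φ).choose_spec v

end Fields

/-! ### Components in a basis of commuting fields, and extensions of filtered acyclic complexes. -/

namespace Fields
variable {A : Type*} [CommRing A] [Algebra ℂ A] {L : Fields A} {n : ℕ}

theorem mem_FD_smul {k : ℤ} {P : D A} (g : A) (h : P.op ∈ FD A k) : (g • P).op ∈ FD A k := by
  have := FD_mul h (toD_mem g)
  rwa [add_zero] at this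

theorem mem_FD_derD_mul {k : ℤ} {P : D A} (θ : Derivation ℂ A A) (h : P.op ∈ FD A k) :
    (derD θ * P).op ∈ FD A (k + 1) := FD_mul h (derD_mem θ)

theorem exists_mem_FD (P : D A) : ∃ k : ℤ, P.op ∈ FD A k := by
  obtain ⟨k, hk⟩ := P.2
  exact ⟨k, mem_FD.2 (opOrd_mono (by omega : k ≤ ((k : ℤ) + 1).toNat) hk)⟩

theorem mem_FD_sum {ι : Type*} {s : Finset ι} {f : ι → D A} {k : ℤ}
    (h : ∀ i ∈ s, (f i).op ∈ FD A k) : (∑ i ∈ s, f i).op ∈ FD A k := by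
  classical
  induction s using Finset.induction_on with
  | empty => exact zero_mem (FD A k)
  | insert i s hi ih =>
    rw [Finset.sum_insert hi]
    exact add_mem (h i (by simp)) (ih fun j hj => h j (by simp [hj]))

theorem mem_FD_zsmul {k : ℤ} {P : D A} (m : ℤ) (h : P.op ∈ FD A k) : (m • P).op ∈ FD A k :=
  zsmul_mem h m

variable (b : Module.Basis (Fin n) A L.T)

/-- The components of a form in a basis. -/
def coc {p : ℕ} (φ : L.Form p) (s : Finset (Fin n)) : D A :=
  if h : s.card = p then φ fun k => b (s.orderEmbOfFin h k) else 0

theorem coc_of_card {p : ℕ} (φ : L.Form p) {s : Finset (Fin n)} (h : s.card = p) :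
    coc b φ s = φ fun k => b (s.orderEmbOfFin h k) := dif_pos h

theorem coc_of_card_ne {p : ℕ} (φ : L.Form p) {s : Finset (Fin n)} (h : s.card ≠ p) :
    coc b φ s = 0 := dif_neg h

theorem coc_add {p : ℕ} (φ ψ : L.Form p) (s : Finset (Fin n)) :
    coc b (φ + ψ) s = coc b φ s + coc b ψ s := by
  by_cases h : s.card = p
  · simp only [coc_of_card b _ h, Form.add_apply]
  · simp only [coc_of_card_ne b _ h, add_zero]

theorem coc_sub {p : ℕ} (φ ψ : L.Form p) (s : Finset (Fin n)) :
    coc b (φ - ψ) s = coc b φ s - coc b ψ s := by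
  by_cases h : s.card = p
  · simp only [coc_of_card b _ h, Form.sub_apply]
  · simp only [coc_of_card_ne b _ h, sub_zero]

theorem coc_smulA {p : ℕ} (g : A) (φ : L.Form p) (s : Finset (Fin n)) :
    coc b (g • φ) s = g • coc b φ s := by
  by_cases h : s.card = p
  · simp only [coc_of_card b _ h, Form.smulA_apply]
  · simp only [coc_of_card_ne b _ h, smul_zero]

theorem ext_coc {p : ℕ} {φ ψ : L.Form p} (h : ∀ s : Finset (Fin n), s.card = p →
    coc b φ s = coc b ψ s) : φ = ψ := by
  refine Module.Basis.ext_alternating (f := (φ : L.T [⋀^Fin p]→ₗ[A] D A))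
    (g := (ψ : L.T [⋀^Fin p]→ₗ[A] D A)) b fun v hv => ?_
  let σ := Tuple.sort v
  have hmono : StrictMono (v ∘ σ) :=
    (Tuple.monotone_sort v).strictMono_of_injective (hv.comp σ.injective)
  let s := Finset.univ.image v
  have hs : s.card = p := by
    rw [Finset.card_image_of_injective _ hv, Finset.card_univ, Fintype.card_fin]
  have e : v ∘ σ = s.orderEmbOfFin hs :=
    Finset.orderEmbOfFin_unique hs (fun x => Finset.mem_image_of_mem _ (Finset.mem_univ _)) hmono
  have h1 := h s hs
  rw [coc_of_card b _ hs, coc_of_card b _ hs, ← e] at h1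
  have h2 : ∀ φ : L.Form p, φ (fun k => b ((v ∘ σ) k)) = Equiv.Perm.sign σ • φ fun k => b (v k) :=
    fun φ => AlternatingMap.map_perm (φ : L.T [⋀^Fin p]→ₗ[A] D A) (fun k => b (v k)) σ
  rw [h2, h2] at h1
  exact smul_left_cancel _ h1

/-- The form with given components in a basis. -/
def formOf (c : Finset (Fin n) → D A) (p : ℕ) : L.Form p :=
  ∑ s : {s : Finset (Fin n) // s.card = p},
    ((LinearMap.toSpanSingleton A (D A) (c s)).compAlternatingMap
      ((Matrix.detRowAlternating : (Fin p → A) [⋀^Fin p]→ₗ[A] A).compLinearMap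
        (LinearMap.pi fun k => b.coord (s.1.orderEmbOfFin s.2 k))) : L.T [⋀^Fin p]→ₗ[A] D A)

theorem Form.sum_apply {ι : Type*} (t : Finset ι) {p : ℕ} (φ : ι → L.Form p) (v : Fin p → L.T) :
    (∑ i ∈ t, φ i) v = ∑ i ∈ t, φ i v := by
  classical
  induction t using Finset.induction_on with
  | empty => rfl
  | insert i t hi ih => rw [Finset.sum_insert hi, Finset.sum_insert hi, Form.add_apply, ih]

theorem formOf_apply (c : Finset (Fin n) → D A) (p : ℕ) (v : Fin p → L.T) :
    formOf b c p v = ∑ s : {s : Finset (Fin n) // s.card = p},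
      Matrix.det (Matrix.of fun i k => b.coord (s.1.orderEmbOfFin s.2 k) (v i)) • c s :=
  Form.sum_apply _ _ _

theorem coc_formOf (c : Finset (Fin n) → D A) (p : ℕ) {s : Finset (Fin n)} (hs : s.card = p) :
    coc b (formOf b c p) s = c s := by
  rw [coc_of_card b _ hs, formOf_apply, Finset.sum_eq_single ⟨s, hs⟩]
  · have : (Matrix.of fun i k => b.coord (s.orderEmbOfFin hs k) (b (s.orderEmbOfFin hs i))) =
        (1 : Matrix (Fin p) (Fin p) A) := by
      ext i k
      simp [Matrix.one_apply, Finsupp.single_apply]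
    rw [this, Matrix.det_one, one_smul]
  · rintro ⟨s', hs'⟩ _ hne
    obtain ⟨m, hm, hm'⟩ : ∃ m ∈ s', m ∉ s := by
      by_contra! h
      exact hne (Subtype.ext (Finset.eq_of_subset_of_card_le h (hs.trans hs'.symm).le))
    have hm2 : m ∈ Set.range (s'.orderEmbOfFin hs') := by
      rw [Finset.range_orderEmbOfFin]; exact hm
    obtain ⟨k, hk⟩ := hm2
    rw [Matrix.det_eq_zero_of_column_eq_zero k, zero_smul]
    intro i
    rw [Matrix.of_apply, hk, Module.Basis.coord_apply, b.repr_self, Finsupp.single_apply, if_neg]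
    intro h
    exact hm' (h ▸ Finset.orderEmbOfFin_mem s hs i)
  · exact fun h => absurd (Finset.mem_univ _) h

theorem formOf_coc {p : ℕ} (φ : L.Form p) : formOf b (coc b φ) p = φ :=
  ext_coc b fun _ hs => coc_formOf b _ p hs

theorem order_iff {p : ℕ} (φ : L.Form p) (k : ℤ) :
    (∀ v, (φ v).op ∈ FD A k) ↔ ∀ s, (coc b φ s).op ∈ FD A k := by
  refine ⟨fun h s => ?_, fun h v => ?_⟩
  · by_cases hs : s.card = p
    · rw [coc_of_card b _ hs]; exact h _
    · rw [coc_of_card_ne b _ hs]; exact zero_mem (FD A k)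
  · rw [← formOf_coc b φ, formOf_apply]
    exact mem_FD_sum fun s _ => mem_FD_smul _ (h s)

theorem mem_K_span {p : ℕ} {g : A} {φ : L.Form p} :
    φ ∈ L.K (Ideal.span {g}) p ↔ ∃ ψ, φ = g • ψ := by
  rw [mem_K, Submodule.ideal_span_singleton_smul, Submodule.mem_smul_pointwise_iff_exists]
  exact ⟨fun ⟨ψ, _, h⟩ => ⟨ψ, h.symm⟩, fun ⟨ψ, h⟩ => ⟨ψ, trivial, h.symm⟩⟩

theorem mem_K_span_iff {p : ℕ} {g : A} {φ : L.Form p} :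
    φ ∈ L.K (Ideal.span {g}) p ↔ ∀ s, ∃ Q, coc b φ s = g • Q := by
  rw [mem_K_span]
  constructor
  · rintro ⟨ψ, rfl⟩ s
    exact ⟨_, coc_smulA b g ψ s⟩
  · intro h
    choose Q hQ using h
    refine ⟨formOf b Q p, ext_coc b fun s hs => ?_⟩
    rw [coc_smulA, coc_formOf b Q p hs, hQ]

/-- The Koszul operators of a basis. -/
def kop (m : Fin n) : D A →+ D A := AddMonoidHom.mulLeft (derD (b m : Derivation ℂ A A))

/-- For commuting fields all bracket terms vanish, and the exterior derivative becomes the Koszul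
differential of the left multiplications by the basis fields. -/
theorem coc_dForm (hb : ∀ i j, L.br (b i) (b j) = 0) {p : ℕ} (φ : L.Form p)
    {s : Finset (Fin n)} (hs : s.card = p + 1) : coc b (dForm φ) s = kd (kop b) (coc b φ) s := by
  rw [coc_of_card b _ hs, dForm_apply, d, kd]
  set e := s.orderEmbOfFin hs with he
  have hse : s = Finset.univ.map e.toEmbedding := (Finset.map_orderEmbOfFin_univ s hs).symm
  have hsum : ∀ F : Fin n → D A, ∑ m ∈ s, F m = ∑ i, F (e i) := by
    intro F
    conv_lhs => rw [hse]
    rw [Finset.sum_map]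
    rfl
  rw [hsum]
  refine Finset.sum_congr rfl fun i _ => ?_
  have hei : e i ∈ s := Finset.orderEmbOfFin_mem s hs i
  have hsign : ksign (e i) s = (-1) ^ (i : ℕ) := by
    rw [ksign]
    congr 1
    have : s.filter (· < e i) = (Finset.Iio i).map e.toEmbedding := by
      ext m
      simp only [Finset.mem_filter, Finset.mem_map, Finset.mem_Iio]
      constructor
      · rintro ⟨hm, hlt⟩
        rw [hse, Finset.mem_map] at hm
        obtain ⟨k, -, rfl⟩ := hm
        exact ⟨k, e.lt_iff_lt.1 hlt, rfl⟩
      · rintro ⟨k, hk, rfl⟩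
        exact ⟨Finset.orderEmbOfFin_mem s hs k, e.lt_iff_lt.2 hk⟩
    rw [this, Finset.card_map, Fin.card_Iio]
  have hcard : (s.erase (e i)).card = p := by rw [Finset.card_erase_of_mem hei, hs]; rfl
  have hemb : e ∘ i.succAbove = (s.erase (e i)).orderEmbOfFin hcard := by
    refine Finset.orderEmbOfFin_unique hcard (fun k => ?_) ?_
    · refine Finset.mem_erase.2 ⟨fun h => Fin.succAbove_ne i k (e.injective h), ?_⟩
      exact Finset.orderEmbOfFin_mem s hs _
    · exact e.strictMono.comp (Fin.strictMono_succAbove i)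
  rw [hsign, coc_of_card b _ hcard, ← hemb]
  congr 1
  rw [Finset.sum_eq_zero, sub_zero]
  · rfl
  · intro j hj
    rw [hb]
    obtain ⟨k, rfl⟩ := Fin.exists_succAbove_eq (Finset.mem_Ioi.1 hj).ne'
    rw [Fin.removeNth_update_succAbove]
    exact AlternatingMap.map_coord_zero (φ : L.T [⋀^Fin p]→ₗ[A] D A) k (by simp)

theorem kop_comm (hb : ∀ i j, L.br (b i) (b j) = 0) (i j : Fin n) (P : D A) :
    kop b i (kop b j P) = kop b j (kop b i P) := by
  refine D_ext fun u => ?_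
  have h : ⁅(b i : Derivation ℂ A A), (b j : Derivation ℂ A A)⁆ = 0 := congrArg Subtype.val (hb i j)
  have := congrArg (fun θ : Derivation ℂ A A => θ (P.toEnd u)) h
  simp only [Derivation.commutator_apply, Derivation.zero_apply] at this
  exact sub_eq_zero.1 this

theorem dForm_dForm (hb : ∀ i j, L.br (b i) (b j) = 0) {p : ℕ} (φ : L.Form p) :
    dForm (dForm φ) = 0 := by
  refine ext_coc b fun s hs => ?_
  rw [coc_dForm b hb _ hs]
  have : kd (kop b) (coc b (dForm φ)) s = kd (kop b) (kd (kop b) (coc b φ)) s :=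
    kd_congr _ fun i hi => coc_dForm b hb φ (by rw [Finset.card_erase_of_mem hi, hs]; rfl)
  rw [this, kd_kd _ (kop_comm b hb), coc_of_card b _ hs]
  rfl

theorem dForm_add {p : ℕ} (φ ψ : L.Form p) : dForm (φ + ψ) = dForm φ + dForm ψ :=
  Form.ext fun v => by rw [Form.add_apply, dForm_apply, dForm_apply, dForm_apply, d_add]

/-- The exterior derivative as an additive map. -/
def dHom (p : ℕ) : L.Form p →+ L.Form (p + 1) where
  toFun := dForm
  map_zero' := by
    have := dForm_add (0 : L.Form p) 0
    rw [add_zero] at this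
    exact left_eq_add.1 this
  map_add' := dForm_add

theorem dForm_sub {p : ℕ} (φ ψ : L.Form p) : dForm (φ - ψ) = dForm φ - dForm ψ :=
  map_sub (dHom p) φ ψ

theorem dForm_order (b : Module.Basis (Fin n) A L.T) (hb : ∀ i j, L.br (b i) (b j) = 0) {p : ℕ}
    {φ : L.Form p} {k : ℤ}
    (h : ∀ v, (φ v).op ∈ FD A k) : ∀ v, (dForm φ v).op ∈ FD A (k + 1) := by
  rw [order_iff b] at h ⊢
  intro s
  by_cases hs : s.card = p + 1
  · rw [coc_dForm b hb _ hs]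
    exact mem_FD_sum fun i _ => mem_FD_zsmul _ (mem_FD_derD_mul _ (h _))
  · rw [coc_of_card_ne b _ hs]
    exact zero_mem (FD A (k + 1))

theorem eq_dForm_iff {p : ℕ} {φ : L.Form p} {ψ : L.Form (p + 1)} :
    (∀ θ, ψ θ = d φ θ) ↔ ψ = dForm φ :=
  ⟨fun h => Form.ext fun v => by rw [h, dForm_apply], fun h θ => by rw [h, dForm_apply]⟩

theorem FK_mono {a a' : Ideal A} (h : a ≤ a') {p : ℕ} {l : ℤ} {φ : L.Form p}
    (hφ : φ ∈ L.FK a p l) : φ ∈ L.FK a' p l :=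
  ⟨Submodule.smul_mono_left h hφ.1, hφ.2⟩

theorem FB_mono {a a' : Ideal A} (h : a ≤ a') {p : ℕ} {l : ℤ} {φ : L.Form p}
    (hφ : φ ∈ L.FB a l p) : φ ∈ L.FB a' l p := by
  rcases p with _ | p
  · exact hφ
  · obtain ⟨ψ, hψ, e⟩ := hφ
    exact ⟨ψ, FK_mono h hψ, e⟩

theorem FK_add {a : Ideal A} {p : ℕ} {l : ℤ} {φ ψ : L.Form p} (h : φ ∈ L.FK a p l)
    (h' : ψ ∈ L.FK a p l) : φ + ψ ∈ L.FK a p l :=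
  ⟨add_mem h.1 h'.1, fun θ => add_mem (h.2 θ) (h'.2 θ)⟩

theorem FB_add {a : Ideal A} {p : ℕ} {l : ℤ} {φ ψ : L.Form p} (h : φ ∈ L.FB a l p)
    (h' : ψ ∈ L.FB a l p) : φ + ψ ∈ L.FB a l p := by
  rcases p with _ | p
  · rw [Set.mem_singleton_iff.1 h, Set.mem_singleton_iff.1 h']
    exact add_zero _
  · obtain ⟨φ', hφ, e⟩ := h
    obtain ⟨ψ', hψ, e'⟩ := h'
    exact ⟨φ' + ψ', FK_add hφ hψ, fun θ => by rw [d_add, Form.add_apply, e, e']⟩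

theorem FB_subset_bdry {a : Ideal A} {p : ℕ} {l : ℤ} {φ : L.Form p} (h : φ ∈ L.FB a l p) :
    φ ∈ L.bdry a p := by
  rcases p with _ | p
  · rw [Set.mem_singleton_iff.1 h]; exact zero_mem _
  · obtain ⟨ψ, hψ, e⟩ := h
    exact ⟨ψ, hψ.1, e⟩

theorem dForm_FB (hb : ∀ i j, L.br (b i) (b j) = 0) {a : Ideal A} {p : ℕ} {l : ℤ} {φ : L.Form p}
    (h : φ ∈ L.FB a l p) : dForm φ = 0 := by
  rcases p with _ | p
  · rw [Set.mem_singleton_iff.1 h]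
    exact map_zero (dHom 0)
  · obtain ⟨ψ, -, e⟩ := h
    rw [eq_dForm_iff.1 e, dForm_dForm b hb]

theorem exists_FK {a : Ideal A} {p : ℕ} {φ : L.Form p} (b : Module.Basis (Fin n) A L.T)
    (h : φ ∈ L.K a p) : ∃ l, φ ∈ L.FK a p l := by
  choose k hk using fun s => exists_mem_FD (coc b φ s)
  obtain ⟨K, hK⟩ := (Set.finite_range k).bddAbove
  refine ⟨K - p, h, (order_iff b φ _).2 fun s => FD_mono ?_ (hk s)⟩
  have := hK ⟨s, rfl⟩
  omega

/-- Exactness composes directly. For strictness one needs that a form with coefficients in `c` which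
modulo `e` is the derivative of a form in `a` is, modulo `e`, the derivative of a form in `c`;
exactness of the quotient of `a` by `c` in degree `n - 1` replaces the primitive. -/
theorem FilteredAcyclic.trans {a c e : Ideal A} (b : Module.Basis (Fin n) A L.T)
    (hb : ∀ i j, L.br (b i) (b j) = 0) (hca : c ≤ a) (hec : e ≤ c)
    (h1 : L.FilteredAcyclic a c n) (h2 : L.FilteredAcyclic c e n) : L.FilteredAcyclic a e n where
  exact l p hp φ hφ := by
    rintro ⟨χ, hχ, eχ⟩
    obtain ⟨χ₁, hχ₁, hB⟩ := h1.exact l p hp φ hφ ⟨χ, FK_mono hec hχ, eχ⟩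
    have hd : dForm χ₁ = dForm φ := by
      have := dForm_FB b hb hB
      rw [dForm_sub, sub_eq_zero] at this
      exact this.symm
    obtain ⟨χ₂, hχ₂, hB'⟩ := h2.exact l p hp χ₁ hχ₁
      ⟨χ, hχ, fun θ => by rw [← eχ, ← dForm_apply, hd, dForm_apply]⟩
    exact ⟨χ₂, hχ₂, by simpa using FB_add hB (FB_mono hca hB')⟩
  strict l φ hφ hmem := by
    obtain ⟨κ, hκ, β, hβ, rfl⟩ := Submodule.mem_sup.1 hmem
    obtain ⟨χ, hχ, hB⟩ := h1.strict l _ hφ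
      (Submodule.add_mem_sup (Submodule.smul_mono_left hec hκ) hβ)
    -- The degree is made a variable because `bdry` and `FB` are defined by cases on it.
    have key : ∀ (m : ℕ) (hm : m = n) (κ β χ : L.Form m), κ ∈ L.K e m → β ∈ L.bdry a m →
        χ ∈ L.FK c m l → κ + β - χ ∈ L.FB a l m → χ ∈ L.K e m ⊔ L.bdry c m := by
      intro m hm κ β χ hκ hβ hχ hB
      rcases m with _ | p
      · have h1 : β = 0 := hβ
        have h2 : κ + β - χ = 0 := hB
        rw [h1, add_zero, sub_eq_zero] at h2
        rw [← h2]
        exact Submodule.mem_sup_left hκ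
      · obtain ⟨ξ, hξ, eξ⟩ := sub_mem hβ (FB_subset_bdry hB)
        have eβ := eq_dForm_iff.1 eξ
        obtain ⟨l', hl'⟩ := exists_FK b hξ
        have hξc : dForm ξ ∈ L.FK c (p + 1) l' := by
          refine ⟨?_, fun v => ?_⟩
          · rw [← eβ, show β - (κ + β - χ) = χ - κ by abel]
            exact sub_mem hχ.1 (Submodule.smul_mono_left hec hκ)
          · have := dForm_order b hb hl'.2 v
            rwa [add_assoc, ← Nat.cast_succ] at this
        obtain ⟨ξ', hξ', hBξ⟩ := h1.exact l' p (by omega) ξ hl' ⟨_, hξc, fun θ => by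
          rw [dForm_apply]⟩
        have hd : dForm ξ' = dForm ξ := by
          have := dForm_FB b hb hBξ
          rw [dForm_sub, sub_eq_zero] at this
          exact this.symm
        rw [show χ = κ + (β - (κ + β - χ)) by abel, eβ, ← hd]
        exact Submodule.add_mem_sup hκ ⟨ξ', hξ'.1, fun θ => dForm_apply _ _⟩
    obtain ⟨χ₂, hχ₂, hB₂⟩ := h2.strict l χ hχ (key n rfl κ β χ hκ hβ hχ hB)
    exact ⟨χ₂, hχ₂, by simpa using FB_add hB (FB_mono hca hB₂)⟩

end Fields

/-! ### Lifting Koszul exactness from symbols to operators. -/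

section
open MvPolynomial

section
variable {A : Type*} [CommRing A] [Algebra ℂ A]

variable (A) in
/-- The operators of order less than `k`. -/
def DO (k : ℕ) : AddSubgroup (D A) where
  carrier := {P | P.toEnd ∈ opOrd A k}
  add_mem' hP hQ := (opOrd A _).add_mem hP hQ
  zero_mem' := (opOrd A _).zero_mem
  neg_mem' hP := (opOrd A _).neg_mem hP

theorem mem_DO {k : ℕ} {P : D A} : P ∈ DO A k ↔ P.toEnd ∈ opOrd A k := Iff.rfl

theorem op_mem_FD {k : ℤ} {P : D A} : P.op ∈ FD A k ↔ P ∈ DO A (k + 1).toNat := Iff.rfl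

theorem DO_mono : Monotone (DO A) := fun _ _ h _ hP => opOrd_mono h hP

theorem DO_zero {P : D A} (h : P ∈ DO A 0) : P = 0 := D.toEnd_injective (opOrd_zero.1 h)

theorem DO_mul {a b : ℕ} {P Q : D A} (hP : P ∈ DO A (a + 1)) (hQ : Q ∈ DO A b) :
    P * Q ∈ DO A (a + b) := by
  rcases b with _ | b
  · rw [DO_zero hQ, mul_zero]; exact zero_mem _
  · have := opOrd_mul (a := a + 1) (b := b) hP hQ
    rw [show a + (b + 1) = a + 1 + b by omega]
    exact this

theorem DO_smul {k : ℕ} {P : D A} (g : A) (hP : P ∈ DO A k) : g • P ∈ DO A k := by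
  have := DO_mul (a := 0) (P := toD g) (mulLeft_mem g) hP
  rwa [zero_add] at this

theorem exists_mem_DO (P : D A) : ∃ k, P ∈ DO A k := P.2

theorem DO_smul_iff [IsDomain A] {k : ℕ} {g : A} (hg : g ≠ 0) {P : D A} :
    g • P ∈ DO A k ↔ P ∈ DO A k := ⟨mem_opOrd_of_mulLeft_mul hg, DO_smul g⟩

theorem smul_D_cancel [IsDomain A] {g : A} (hg : g ≠ 0) {P Q : D A} (h : g • P = g • Q) :
    P = Q :=
  D_ext fun u => mul_left_cancel₀ hg (congrArg (fun R : D A => R.toEnd u) h)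

theorem smul_mul_D (g : A) (P Q : D A) : g • P * Q = g • (P * Q) := by
  rw [smul_D_def, smul_D_def, mul_assoc]

variable {ι : Type*} [Fintype ι] [DecidableEq ι]

theorem sym_smul (w : ι → A) (k : ℕ) (g : A) {P : D A} (hP : P ∈ DO A (k + 1)) :
    sym w k (g • P).toEnd = C g * sym w k P.toEnd := by
  have := sym_mul w (a := 0) (b := k) (mulLeft_mem g) hP
  rw [zero_add, sym_zero, LinearMap.mulLeft_apply, mul_one] at this
  exact this

theorem Coords.exists_DO_sym_eq (𝔠 : Coords A ι) [IsDomain A] {k : ℕ} {p : MvPolynomial ι A}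
    (hp : p.IsHomogeneous k) : ∃ P ∈ DO A (k + 1), sym 𝔠.w k P.toEnd = p := by
  obtain ⟨P, hP, h⟩ := 𝔠.exists_sym_eq hp
  exact ⟨⟨P, k + 1, hP⟩, hP, h⟩

end

section Koszul
variable {A : Type*} [CommRing A] [Algebra ℂ A] [IsDomain A] {n : ℕ}
  (𝔠 : Coords A (Fin (n + 1))) (E : Finset (Fin (n + 1))) (a : Fin (n + 1) → MvPolynomial (Fin (n + 1)) A)
  (i : Fin (n + 1)) (τ : Fin n → D A)

/-- The Koszul operators of left multiplications. -/
abbrev kmul (m : Fin n) : D A →+ D A := AddMonoidHom.mulLeft (τ m)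

/-- Commuting operators of order one, with symbols those of relative logarithmic fields, which
preserve the operators divisible by the base coordinate. -/
structure KoszulData : Prop where
  isUnit : ∀ j, IsUnit (a j)
  order : ∀ m, τ m ∈ DO A 2
  symbol : ∀ m, sym 𝔠.w 1 (τ m).toEnd = 𝔠.polyVarRing.sg E a i (i.succAbove m)
  comm : ∀ m m', τ m * τ m' = τ m' * τ m
  base : ∀ m P, ∃ Q, τ m * 𝔠.w i • P = 𝔠.w i • Q

variable {𝔠 E a i τ}

theorem kd_mem_DO (hτ : ∀ m, τ m ∈ DO A 2) {k p : ℕ} {c : Finset (Fin n) → D A}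
    (hc : ∀ s, s.card = p → c s ∈ DO A k) {s : Finset (Fin n)} (hs : s.card = p + 1) :
    kd (kmul τ) c s ∈ DO A (k + 1) := by
  refine sum_mem fun m hm => zsmul_mem ?_ _
  rw [add_comm]
  exact DO_mul (hτ m) (hc _ (by rw [Finset.card_erase_of_mem hm, hs]; rfl))

namespace KoszulData

theorem sym_kd (H : KoszulData 𝔠 E a i τ) {k p : ℕ} {c : Finset (Fin n) → D A}
    (hc : ∀ s, s.card = p → c s ∈ DO A (k + 1)) {s : Finset (Fin n)} (hs : s.card = p + 1) :
    sym 𝔠.w (k + 1) (kd (kmul τ) c s).toEnd =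
      kd (fun m => AddMonoidHom.mulLeft (sym 𝔠.w 1 (τ m).toEnd))
        (fun s => sym 𝔠.w k (c s).toEnd) s := by
  simp only [kd, map_sum, map_zsmul]
  refine Finset.sum_congr rfl fun m hm => ?_
  congr 1
  rw [add_comm k 1]
  exact sym_mul 𝔠.w (a := 1) (b := k) (H.order m)
    (hc _ (by rw [Finset.card_erase_of_mem hm, hs]; rfl))

theorem kd_base (H : KoszulData 𝔠 E a i τ) {p : ℕ} {c : Finset (Fin n) → D A} (hc : ∀ s, s.card = p → ∃ Q, c s = 𝔠.w i • Q)
    {s : Finset (Fin n)} (hs : s.card = p + 1) : ∃ Q, kd (kmul τ) c s = 𝔠.w i • Q := by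
  have : ∀ m ∈ s, ∃ Q, ksign m s • kmul τ m (c (s.erase m)) = 𝔠.w i • Q := by
    intro m hm
    obtain ⟨Q, hQ⟩ := hc (s.erase m) (by rw [Finset.card_erase_of_mem hm, hs]; rfl)
    obtain ⟨Q', hQ'⟩ := H.base m Q
    refine ⟨ksign m s • Q', ?_⟩
    rw [hQ, AddMonoidHom.coe_mulLeft, hQ', smul_comm]
  choose! Q hQ using this
  exact ⟨∑ m ∈ s, Q m, by rw [Finset.smul_sum]; exact Finset.sum_congr rfl hQ⟩

theorem kd_kd (H : KoszulData 𝔠 E a i τ) (c : Finset (Fin n) → D A) (s : Finset (Fin n)) :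
    kd (kmul τ) (kd (kmul τ) c) s = 0 :=
  LogD.kd_kd _ (fun m m' x => by
    simp only [AddMonoidHom.coe_mulLeft, ← mul_assoc, H.comm m m']) c s

/-- One step of descent in the order. On symbols the hypothesis gives a cocycle of the Koszul
complex modulo the base variable, hence a coboundary; lifting the primitive and the multiple of the
base variable to operators leaves an error of smaller order. -/
theorem lower (H : KoszulData 𝔠 E a i τ) {k p : ℕ} (hp : p < n) {c : Finset (Fin n) → D A}
    (hc : ∀ s, s.card = p → c s ∈ DO A (k + 1))
    (hk : ∀ s, s.card = p + 1 → ∃ Q, kd (kmul τ) c s - 𝔠.w i • Q ∈ DO A (k + 1)) :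
    ∃ χ η : Finset (Fin n) → D A, (∀ s, χ s ∈ DO A (k + 1)) ∧ (∀ s, η s ∈ DO A k) ∧
      ∀ s, s.card = p → c s - 𝔠.w i • χ s - kd (kmul τ) η s ∈ DO A k := by
  have hw := 𝔠.w_ne_zero i
  let R := 𝔠.polyVarRing
  let f : Fin n → MvPolynomial (Fin (n + 1)) A := fun m => sym 𝔠.w 1 (τ m).toEnd
  have hfh : ∀ m, (f m).IsHomogeneous 1 := fun m => sym_isHomogeneous _ _ _
  obtain ⟨η₀, hη₀⟩ := R.koszul_sg E a H.isUnit i f H.symbol hp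
    (fun s => sym 𝔠.w k (c s).toEnd) (by
      intro s hs
      obtain ⟨Q, hQ⟩ := hk s hs
      have h1 := kd_mem_DO H.order hc hs
      -- Dividing by the coordinate does not change the order, so `Q` has a symbol in the degree
      -- where the comparison takes place.
      have h2 : Q ∈ DO A (k + 1 + 1) := by
        rw [← DO_smul_iff hw]
        have := sub_mem h1 (DO_mono (Nat.le_succ _) hQ)
        rwa [sub_sub_cancel] at this
      rw [← H.sym_kd hc hs]
      have h3 := (𝔠.sym_eq_zero (k := k + 1) (mem_DO.1 (sub_mem h1 (DO_smul _ h2)))).2 hQ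
      rw [map_sub, map_sub, sub_eq_zero, sym_smul _ _ _ h2] at h3
      rw [h3]
      exact Ideal.mul_mem_right _ _ (Ideal.mem_span_singleton_self _))
  choose! χ₀ hχ₀ using fun s (hs : s.card = p) => Ideal.mem_span_singleton'.1 (hη₀ s hs)
  choose χ hχ eχ using fun s => 𝔠.exists_DO_sym_eq (homogeneousComponent_isHomogeneous k (χ₀ s))
  have hCk : ∀ q : MvPolynomial (Fin (n + 1)) A, homogeneousComponent k (q * C (𝔠.w i)) = homogeneousComponent k q * C (𝔠.w i) := by
    intro q
    rw [mul_comm, homogeneousComponent_C_mul, mul_comm]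
  -- The primitive `η₀` need not be homogeneous. As the `f m` have degree one, only its component
  -- one degree below `k` matters. For `k = 0` there is none, and the boundary has no constant term.
  obtain ⟨η, hη, eη⟩ : ∃ η : Finset (Fin n) → D A, (∀ s, η s ∈ DO A k) ∧
      ∀ s, s.card = p → sym 𝔠.w k (kd (kmul τ) η s).toEnd =
        homogeneousComponent k (kd (fun m => AddMonoidHom.mulLeft (f m)) η₀ s) := by
    rcases k with _ | k
    · refine ⟨0, fun s => zero_mem _, fun s _ => ?_⟩
      rw [kd_zero]
      have : (0 : Finset (Fin n) → D A) s = 0 := rfl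
      rw [this, map_zero, map_zero, kd, map_sum, eq_comm]
      refine Finset.sum_eq_zero fun m _ => ?_
      rw [map_zsmul, AddMonoidHom.coe_mulLeft, homogeneousComponent_zero, coeff_mul]
      have : coeff 0 (f m) = 0 := by
        rw [← MvPolynomial.constantCoeff_eq]
        by_contra h
        have := hfh m (d := 0) h
        simp at this
      simp [this]
    · choose η hη eη using fun s =>
        𝔠.exists_DO_sym_eq (homogeneousComponent_isHomogeneous k (η₀ s))
      refine ⟨η, hη, fun s hs => ?_⟩
      rcases p with _ | p
      · rw [Finset.card_eq_zero.1 hs]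
        simp [kd_empty]
      rw [H.sym_kd (p := p) (fun s _ => hη s) hs]
      simp only [kd, map_sum, map_zsmul, AddMonoidHom.coe_mulLeft, eη]
      refine Finset.sum_congr rfl fun m _ => ?_
      congr 1
      conv_rhs => rw [← sum_homogeneousComponent (η₀ (s.erase m)), Finset.mul_sum, map_sum]
      by_cases hd : k ∈ Finset.range ((η₀ (s.erase m)).totalDegree + 1)
      · rw [Finset.sum_eq_single k]
        · have h := (hfh m).mul (homogeneousComponent_isHomogeneous k (η₀ (s.erase m)))
          rw [add_comm 1 k] at h
          rw [homogeneousComponent_of_mem h, if_pos rfl]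
        · intro j _ hj
          have h := (hfh m).mul (homogeneousComponent_isHomogeneous j (η₀ (s.erase m)))
          rw [homogeneousComponent_of_mem h, if_neg (by omega)]
        · exact fun h => absurd hd h
      · rw [homogeneousComponent_eq_zero _ _ (by simpa using hd), mul_zero,
          Finset.sum_eq_zero]
        intro j hj
        have h := (hfh m).mul (homogeneousComponent_isHomogeneous j (η₀ (s.erase m)))
        rw [homogeneousComponent_of_mem h, if_neg]
        rintro h
        exact hd (by rwa [show k = j by omega])
  have hkη : ∀ s, s.card = p → kd (kmul τ) η s ∈ DO A (k + 1) := by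
    intro s hs
    rcases p with _ | p
    · rw [Finset.card_eq_zero.1 hs, kd_empty]; exact zero_mem _
    · exact kd_mem_DO (p := p) H.order (fun s _ => hη s) hs
  refine ⟨χ, η, hχ, hη, fun s hs => ?_⟩
  refine (𝔠.sym_eq_zero (mem_DO.1
    (sub_mem (sub_mem (hc s hs) (DO_smul _ (hχ s))) (hkη s hs)))).1 ?_
  rw [map_sub, map_sub, map_sub, map_sub, sym_smul _ _ _ (hχ s), eχ, eη s hs]
  have h4 := congrArg (homogeneousComponent k) (hχ₀ s hs)
  rw [map_sub, show R.var (.inl i) = C (𝔠.w i) from rfl, hCk] at h4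
  have h5 : homogeneousComponent k (sym 𝔠.w k (c s).toEnd) = sym 𝔠.w k (c s).toEnd := by
    rw [homogeneousComponent_of_mem (sym_isHomogeneous _ _ _), if_pos rfl]
  rw [h5] at h4
  rw [mul_comm, h4]
  ring

/-- Apply `lower` until the order is exhausted. Since `DO A k` means order less than `k` and the
operators have order one, the primitive ends up in `DO A (k - 1)`. -/
theorem exact (H : KoszulData 𝔠 E a i τ) {p : ℕ} (hp : p < n) : ∀ {k : ℕ} {c : Finset (Fin n) → D A},
    (∀ s, s.card = p → c s ∈ DO A k) →
    (∀ s, s.card = p + 1 → ∃ Q, kd (kmul τ) c s = 𝔠.w i • Q) →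
    ∃ χ η : Finset (Fin n) → D A, (∀ s, χ s ∈ DO A k) ∧ (∀ s, η s ∈ DO A (k - 1)) ∧
      ∀ s, s.card = p → c s = 𝔠.w i • χ s + kd (kmul τ) η s := by
  intro k
  induction k with
  | zero =>
    intro c hc _
    refine ⟨0, 0, fun s => zero_mem _, fun s => zero_mem _, fun s hs => ?_⟩
    rw [DO_zero (hc s hs), kd_zero]
    simp
  | succ k ih =>
    intro c hc hk
    obtain ⟨χ, η, hχ, hη, h⟩ := H.lower hp hc fun s hs => by
      obtain ⟨Q, hQ⟩ := hk s hs
      exact ⟨Q, by rw [hQ, sub_self]; exact zero_mem _⟩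
    obtain ⟨χ', η', hχ', hη', h'⟩ := ih (c := c - (fun s => 𝔠.w i • χ s) - kd (kmul τ) η) h (by
      intro s hs
      obtain ⟨Q, hQ⟩ := hk s hs
      obtain ⟨Q', hQ'⟩ := H.kd_base (p := p) (c := fun s => 𝔠.w i • χ s) (fun s _ => ⟨_, rfl⟩) hs
      refine ⟨Q - Q', ?_⟩
      rw [kd_sub, kd_sub, Pi.sub_apply, Pi.sub_apply, H.kd_kd, hQ, hQ', sub_zero, smul_sub])
    refine ⟨χ + χ', η + η', fun s => add_mem (hχ s) (DO_mono (Nat.le_succ k) (hχ' s)),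
      fun s => add_mem (hη s) (DO_mono (by omega) (hη' s)), fun s hs => ?_⟩
    have := h' s hs
    rw [Pi.sub_apply, Pi.sub_apply, sub_eq_iff_eq_add, sub_eq_iff_eq_add] at this
    rw [this, kd_add, Pi.add_apply, Pi.add_apply, smul_add]
    abel

/-- Let `η` exceed the expected order by `N`. Up to lower order its boundary is divisible by the
base coordinate, so `lower` applies to `η` itself and replaces it by an operator cochain of smaller
order with the same boundary modulo the base coordinate. -/
theorem strict (H : KoszulData 𝔠 E a i τ) {p : ℕ} (hp : p < n) {k : ℕ} {c : Finset (Fin n) → D A}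
    (hc : ∀ s, s.card = p + 1 → c s ∈ DO A k) {χ η : Finset (Fin n) → D A}
    (h : ∀ s, s.card = p + 1 → c s = 𝔠.w i • χ s + kd (kmul τ) η s) :
    ∃ χ η : Finset (Fin n) → D A, (∀ s, s.card = p + 1 → χ s ∈ DO A k) ∧
      (∀ s, s.card = p → η s ∈ DO A (k - 1)) ∧
      ∀ s, s.card = p + 1 → c s = 𝔠.w i • χ s + kd (kmul τ) η s := by
  obtain ⟨N, hN⟩ : ∃ N, ∀ s, η s ∈ DO A (k - 1 + N) := by
    choose k' hk' using fun s => exists_mem_DO (η s)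
    obtain ⟨K, hK⟩ := (Set.finite_range k').bddAbove
    exact ⟨K, fun s => DO_mono (by have := hK ⟨s, rfl⟩; omega) (hk' s)⟩
  have hN' : ∀ s, s.card = p → η s ∈ DO A (k - 1 + N) := fun s _ => hN s
  clear hN
  rcases k with _ | k
  · exact ⟨0, 0, fun s _ => zero_mem _, fun s _ => zero_mem _, fun s hs => by
      rw [DO_zero (hc s hs), kd_zero]; simp⟩
  rw [Nat.add_sub_cancel] at *
  induction N generalizing χ η with
  | zero =>
    refine ⟨χ, η, fun s hs => ?_, hN', h⟩
    -- With `η` of the right order, `w_i χ` is a difference of two cochains of the right order.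
    rw [← DO_smul_iff (𝔠.w_ne_zero i), ← sub_eq_iff_eq_add.2 (h s hs)]
    exact sub_mem (hc s hs) (kd_mem_DO H.order hN' hs)
  | succ N ih =>
    obtain ⟨χ₁, η₁, -, -, h₁⟩ := H.lower (k := k + N) hp hN' fun s hs => by
      refine ⟨-χ s, ?_⟩
      rw [smul_neg, sub_neg_eq_add, add_comm (kd _ _ _), ← h s hs]
      exact DO_mono (by omega) (hc s hs)
    choose! Q hQ using fun (s : Finset (Fin n)) (hs : s.card = p + 1) =>
      H.kd_base (p := p) (c := fun s => 𝔠.w i • χ₁ s) (fun s _ => ⟨_, rfl⟩) hs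
    refine ih (χ := χ + Q) (η := η - (fun s => 𝔠.w i • χ₁ s) - kd (kmul τ) η₁)
      (fun s hs => ?_) h₁
    rw [h s hs, kd_sub, kd_sub, Pi.sub_apply, Pi.sub_apply, H.kd_kd, hQ s hs, Pi.add_apply,
      smul_add]
    abel

end KoszulData
end Koszul

end

/-! ### Logarithmic coordinates and the basis of the relative logarithmic fields. -/

section
open MvPolynomial

theorem derivation_sum_apply {A ι : Type*} [CommRing A] [Algebra ℂ A] (s : Finset ι)
    (θ : ι → Derivation ℂ A A) (g : A) : (∑ l ∈ s, θ l) g = ∑ l ∈ s, θ l g := by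
  classical
  induction s using Finset.induction_on with
  | empty => rfl
  | insert i s hi ih => rw [Finset.sum_insert hi, Finset.sum_insert hi, Derivation.add_apply, ih]

theorem Coords.apply_eq_sum {A ι : Type*} [CommRing A] [Algebra ℂ A] [Fintype ι] [DecidableEq ι]
    (𝔠 : Coords A ι) (θ : Derivation ℂ A A) (g : A) : θ g = ∑ l, θ (𝔠.w l) * 𝔠.der l g := by
  have h : θ - ∑ l, θ (𝔠.w l) • 𝔠.der l = 0 := by
    refine 𝔠.der_ext _ fun i => ?_
    rw [Derivation.sub_apply, derivation_sum_apply, Finset.sum_eq_single i]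
    · simp [𝔠.der_self]
    · intro j _ hj
      simp [𝔠.der_ne j i hj]
    · simp
  have h' := congrArg (fun η : Derivation ℂ A A => η g) (sub_eq_zero.1 h)
  simpa [derivation_sum_apply] using h'

/-- Coordinates together with shifted coordinates `u`, some of which are the equations of the
components of a divisor, with multiplicities. -/
structure LogCoords (A : Type*) [CommRing A] [Algebra ℂ A] (n : ℕ) extends
    Coords A (Fin (n + 1)) where
  E : Finset (Fin (n + 1))
  u : Fin (n + 1) → A
  e : Fin (n + 1) → ℕ
  e_pos : ∀ l, 0 < e l
  der_u : ∀ j l, der j (u l) = if j = l then 1 else 0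

namespace LogCoords
variable {A : Type*} [CommRing A] [Algebra ℂ A] {n : ℕ} (ℓ : LogCoords A n)

theorem apply_u (θ : Derivation ℂ A A) (l : Fin (n + 1)) : θ (ℓ.u l) = θ (ℓ.w l) := by
  rw [ℓ.toCoords.apply_eq_sum]
  simp [ℓ.der_u]

theorem ext_u {θ η : Derivation ℂ A A} (h : ∀ l, θ (ℓ.u l) = η (ℓ.u l)) : θ = η := by
  refine sub_eq_zero.1 (ℓ.der_ext _ fun l => ?_)
  rw [← ℓ.apply_u, Derivation.sub_apply, h, sub_self]

theorem u_ne_zero [Nontrivial A] (l : Fin (n + 1)) : ℓ.u l ≠ 0 := fun h => by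
  have := ℓ.der_u l l
  rw [h, map_zero, if_pos rfl] at this
  exact zero_ne_one this

/-- The equations of the components of the divisor, and `1` for the other indices. -/
def v (l : Fin (n + 1)) : A := if l ∈ ℓ.E then ℓ.u l else 1

theorem v_ne_zero [Nontrivial A] (l : Fin (n + 1)) : ℓ.v l ≠ 0 := by
  rw [v]
  split_ifs
  · exact ℓ.u_ne_zero l
  · exact one_ne_zero

/-- The monomials in the equations of the components. -/
def mono (m : Fin (n + 1) → ℕ) : A := ∏ l ∈ ℓ.E, ℓ.u l ^ m l

theorem mono_ne_zero [IsDomain A] (m : Fin (n + 1) → ℕ) : ℓ.mono m ≠ 0 :=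
  Finset.prod_ne_zero_iff.2 fun l _ => pow_ne_zero _ (ℓ.u_ne_zero l)

theorem mono_add_single (m : Fin (n + 1) → ℕ) {i : Fin (n + 1)} (hi : i ∈ ℓ.E) :
    ℓ.mono (m + Pi.single i 1) = ℓ.mono m * ℓ.u i := by
  simp only [mono, Pi.add_apply, pow_add, Finset.prod_mul_distrib]
  congr 1
  rw [Finset.prod_eq_single i]
  · simp
  · intro j _ hj
    rw [Pi.single_eq_of_ne hj, pow_zero]
  · exact fun h => absurd hi h

theorem mono_add (m m' : Fin (n + 1) → ℕ) : ℓ.mono (m + m') = ℓ.mono m * ℓ.mono m' := by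
  simp only [mono, Pi.add_apply, pow_add, Finset.prod_mul_distrib]

theorem mono_congr {m m' : Fin (n + 1) → ℕ} (h : ∀ l ∈ ℓ.E, m l = m' l) : ℓ.mono m = ℓ.mono m' :=
  Finset.prod_congr rfl fun l hl => by rw [h l hl]

theorem derivation_mono (θ : Derivation ℂ A A) {c : Fin (n + 1) → A}
    (h : ∀ l ∈ ℓ.E, θ (ℓ.u l) = c l * ℓ.u l) (m : Fin (n + 1) → ℕ) :
    θ (ℓ.mono m) = (∑ l ∈ ℓ.E, c l * m l) * ℓ.mono m := by
  have key : ∀ s ⊆ ℓ.E, θ (∏ l ∈ s, ℓ.u l ^ m l) =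
      (∑ l ∈ s, c l * m l) * ∏ l ∈ s, ℓ.u l ^ m l := by
    intro s
    induction s using Finset.induction_on with
    | empty => intro _; simp
    | insert i s hi ih =>
      intro hs
      rw [Finset.prod_insert hi, Finset.sum_insert hi, Derivation.leibniz,
        ih fun x hx => hs (Finset.mem_insert_of_mem hx), Derivation.leibniz_pow,
        h i (hs (Finset.mem_insert_self _ _))]
      rcases hm : m i with _ | k
      · simp
      · simp only [smul_eq_mul, nsmul_eq_mul, Nat.add_sub_cancel, pow_succ]
        ring
  exact key _ subset_rfl

/-- The field `∑ c_l v_l ∂_l`. -/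
def diag (c : Fin (n + 1) → ℂ) : Derivation ℂ A A :=
  ∑ l, (algebraMap ℂ A (c l) * ℓ.v l) • ℓ.der l

theorem diag_u (c : Fin (n + 1) → ℂ) (l : Fin (n + 1)) :
    ℓ.diag c (ℓ.u l) = algebraMap ℂ A (c l) * ℓ.v l := by
  simp [diag, derivation_sum_apply, ℓ.der_u]

theorem diag_u_mem (c : Fin (n + 1) → ℂ) {l : Fin (n + 1)} (hl : l ∈ ℓ.E) :
    ℓ.diag c (ℓ.u l) = algebraMap ℂ A (c l) * ℓ.u l := by
  rw [diag_u, v, if_pos hl]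

theorem diag_v (c : Fin (n + 1) → ℂ) (l : Fin (n + 1)) :
    ℓ.diag c (ℓ.v l) = algebraMap ℂ A (if l ∈ ℓ.E then c l else 0) * ℓ.v l := by
  rw [v]
  split_ifs with h
  · rw [diag_u_mem _ _ h]
  · simp

/-- The eigenvalue of `diag c` on the monomial `m`. -/
def wgt (c : Fin (n + 1) → ℂ) (m : Fin (n + 1) → ℕ) : ℂ := ∑ l ∈ ℓ.E, c l * m l

theorem diag_mono (c : Fin (n + 1) → ℂ) (m : Fin (n + 1) → ℕ) :
    ℓ.diag c (ℓ.mono m) = algebraMap ℂ A (ℓ.wgt c m) * ℓ.mono m := by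
  rw [ℓ.derivation_mono _ (fun l hl => ℓ.diag_u_mem c hl), wgt]
  simp

theorem diag_comm (c c' : Fin (n + 1) → ℂ) : ⁅ℓ.diag c, ℓ.diag c'⁆ = 0 := by
  refine ℓ.ext_u fun l => ?_
  have hc : ∀ (c : Fin (n + 1) → ℂ) (k : ℂ) (a : A), ℓ.diag c (algebraMap ℂ A k * a) =
      algebraMap ℂ A k * ℓ.diag c a := by
    intro c k a
    rw [← Algebra.smul_def, Derivation.map_smul, Algebra.smul_def]
  rw [Derivation.commutator_apply, diag_u, diag_u, hc, hc, diag_v, diag_v, Derivation.zero_apply]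
  split_ifs <;> (try simp only [map_zero]) <;> ring

theorem derD_diag_comm (c c' : Fin (n + 1) → ℂ) :
    derD (ℓ.diag c) * derD (ℓ.diag c') = derD (ℓ.diag c') * derD (ℓ.diag c) := by
  refine D_ext fun a => ?_
  have := congrArg (fun η : Derivation ℂ A A => η a) (ℓ.diag_comm c c')
  rw [Derivation.commutator_apply] at this
  exact sub_eq_zero.1 this

theorem wgt_sub (c c' : Fin (n + 1) → ℂ) (m : Fin (n + 1) → ℕ) :
    ℓ.wgt (c - c') m = ℓ.wgt c m - ℓ.wgt c' m := by
  simp [wgt, sub_mul, Finset.sum_sub_distrib]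

/-- The coefficients of the field `u_j ∂_j / e_j`. -/
def eul (j : Fin (n + 1)) : Fin (n + 1) → ℂ := Pi.single j (ℓ.e j : ℂ)⁻¹

theorem wgt_eul {j : Fin (n + 1)} (hj : j ∈ ℓ.E) (m : Fin (n + 1) → ℕ) :
    ℓ.wgt (ℓ.eul j) m = m j / ℓ.e j := by
  rw [wgt, Finset.sum_eq_single j]
  · simp [eul, div_eq_inv_mul]
  · intro k _ hk
    simp [eul, hk]
  · exact fun h => absurd hj h

theorem e_ne_zero (j : Fin (n + 1)) : (ℓ.e j : ℂ) ≠ 0 := Nat.cast_ne_zero.2 (ℓ.e_pos j).ne'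

theorem wgt_eul_e {j : Fin (n + 1)} (hj : j ∈ ℓ.E) : ℓ.wgt (ℓ.eul j) ℓ.e = 1 := by
  rw [ℓ.wgt_eul hj, div_self (ℓ.e_ne_zero j)]

/-- The coefficients of the relative logarithmic fields with base index `i`. -/
def wt (i j : Fin (n + 1)) : Fin (n + 1) → ℂ :=
  if j ∈ ℓ.E then ℓ.eul j - ℓ.eul i else Pi.single j 1

theorem wgt_wt {i : Fin (n + 1)} (hi : i ∈ ℓ.E) (j : Fin (n + 1)) : ℓ.wgt (ℓ.wt i j) ℓ.e = 0 := by
  rw [wt]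
  split_ifs with h
  · rw [wgt_sub, wgt_eul_e _ h, wgt_eul_e _ hi, sub_self]
  · rw [wgt, Finset.sum_eq_zero]
    intro l hl
    have hlj : l ≠ j := fun h' => h (h' ▸ hl)
    rw [Pi.single_eq_of_ne hlj, zero_mul]

/-- The logarithmic fields of the divisor with reduced ideal `J`, and the function `t`, are
described by the logarithmic coordinates. -/
structure Adapted (J : Ideal A) (t : A) : Prop where
  mem_log : ∀ θ : Derivation ℂ A A, θ ∈ (logFields J).T ↔ ∀ l ∈ ℓ.E, ℓ.u l ∣ θ (ℓ.u l)
  t_eq : t = ℓ.mono ℓ.e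

variable {ℓ} {J : Ideal A} {t : A} (H : ℓ.Adapted J t)

theorem Adapted.diag_mem_log (H : ℓ.Adapted J t) (c : Fin (n + 1) → ℂ) :
    ℓ.diag c ∈ (logFields J).T :=
  (H.mem_log _).2 fun l hl => ⟨algebraMap ℂ A (c l), by rw [diag_u_mem _ _ hl, mul_comm]⟩

theorem Adapted.diag_mem_rel (H : ℓ.Adapted J t) {c : Fin (n + 1) → ℂ} (hc : ℓ.wgt c ℓ.e = 0) :
    ℓ.diag c ∈ (relFields J t).T :=
  ⟨H.diag_mem_log c, by rw [H.t_eq, diag_mono, hc, map_zero, zero_mul]⟩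

theorem Adapted.exists_coeff (H : ℓ.Adapted J t) {θ : Derivation ℂ A A}
    (hθ : θ ∈ (logFields J).T) : ∃ c : Fin (n + 1) → A, ∀ l, θ (ℓ.u l) = c l * ℓ.v l := by
  have : ∀ l, ∃ c : A, θ (ℓ.u l) = c * ℓ.v l := by
    intro l
    rw [v]
    split_ifs with h
    · obtain ⟨c, hc⟩ := (H.mem_log θ).1 hθ l h
      exact ⟨c, by rw [hc, mul_comm]⟩
    · exact ⟨θ (ℓ.u l), (mul_one _).symm⟩
  choose c hc using this
  exact ⟨c, hc⟩

theorem Adapted.apply_t (H : ℓ.Adapted J t) {θ : Derivation ℂ A A} {c : Fin (n + 1) → A}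
    (hc : ∀ l, θ (ℓ.u l) = c l * ℓ.v l) : θ t = (∑ l ∈ ℓ.E, c l * ℓ.e l) * t := by
  rw [H.t_eq]
  exact ℓ.derivation_mono θ (fun l hl => by rw [hc, v, if_pos hl]) _

variable [IsDomain A] {i : Fin (n + 1)}

theorem wt_succAbove (i : Fin (n + 1)) (m m' : Fin n) :
    ℓ.wt i (i.succAbove m) (i.succAbove m') =
      if m' = m then (if i.succAbove m ∈ ℓ.E then (ℓ.e (i.succAbove m) : ℂ)⁻¹ else 1) else 0 := by
  have h1 : i.succAbove m' ≠ i := Fin.succAbove_ne i m'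
  rw [wt]
  by_cases h : m' = m
  · subst h
    rw [if_pos rfl]
    split_ifs <;> simp [eul, h1]
  · have h2 : i.succAbove m' ≠ i.succAbove m := fun h' => h (Fin.succAbove_right_injective h')
    split_ifs <;> simp [eul, h1, h2]

theorem wt_succAbove_base (i : Fin (n + 1)) (m : Fin n) :
    ℓ.wt i (i.succAbove m) i = if i.succAbove m ∈ ℓ.E then -(ℓ.e i : ℂ)⁻¹ else 0 := by
  have h1 : i ≠ i.succAbove m := (Fin.succAbove_ne i m).symm
  rw [wt]
  split_ifs <;> simp [eul, h1]

/-- A logarithmic field `∑ c_l v_l ∂_l` multiplies `t` by the sum of `c_l e_l` over `E`, so it is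
relative exactly when this sum vanishes. The coefficients away from the base index are then free,
and they determine the one at the base index. -/
theorem Adapted.exists_basis (H : ℓ.Adapted J t) (hi : i ∈ ℓ.E) :
    ∃ b : Module.Basis (Fin n) A (relFields J t).T, ∀ m,
      (b m : Derivation ℂ A A) = ℓ.diag (ℓ.wt i (i.succAbove m)) := by
  let f : Fin n → (relFields J t).T :=
    fun m => ⟨ℓ.diag (ℓ.wt i (i.succAbove m)), H.diag_mem_rel (ℓ.wgt_wt hi _)⟩
  have hf : ∀ (g : Fin n → A) (a : A),
      ((∑ m, g m • f m : (relFields J t).T) : Derivation ℂ A A) a =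
        ∑ m, g m * ℓ.diag (ℓ.wt i (i.succAbove m)) a := by
    intro g a
    rw [AddSubmonoidClass.coe_finsetSum, derivation_sum_apply]
    rfl
  have hli : LinearIndependent A f := by
    rw [Fintype.linearIndependent_iff]
    intro g hg m
    have h := hf g (ℓ.u (i.succAbove m))
    rw [hg] at h
    simp only [diag_u, wt_succAbove] at h
    rw [Finset.sum_eq_single m] at h
    · have h0 : (0 : A) = g m * (algebraMap ℂ A (if i.succAbove m ∈ ℓ.E then
          (ℓ.e (i.succAbove m) : ℂ)⁻¹ else 1) * ℓ.v (i.succAbove m)) := by simpa using h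
      rcases mul_eq_zero.1 h0.symm with h1 | h1
      · exact h1
      · exfalso
        rcases mul_eq_zero.1 h1 with h2 | h2
        · rw [map_eq_zero] at h2
          split_ifs at h2
          · exact inv_ne_zero (ℓ.e_ne_zero _) h2
          · exact one_ne_zero h2
        · exact ℓ.v_ne_zero _ h2
    · intro m' _ hm'
      simp [hm'.symm]
    · simp
  have hsp : ⊤ ≤ Submodule.span A (Set.range f) := by
    rintro ⟨θ, hθ⟩ -
    obtain ⟨c, hc⟩ := H.exists_coeff hθ.1
    have ht : ∑ l ∈ ℓ.E, c l * ℓ.e l = 0 := by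
      have := H.apply_t hc
      rw [hθ.2] at this
      refine (mul_eq_zero.1 this.symm).resolve_right ?_
      rw [H.t_eq]
      exact ℓ.mono_ne_zero _
    rw [Submodule.mem_span_range_iff_exists_fun]
    -- The factor `e_j` compensates for the `1 / e_j` in the basis field with index `j ∈ E`.
    refine ⟨fun m => c (i.succAbove m) *
      if i.succAbove m ∈ ℓ.E then (ℓ.e (i.succAbove m) : A) else 1, ?_⟩
    refine Subtype.ext (ℓ.ext_u fun l => ?_)
    rw [hf]
    change _ = θ (ℓ.u l)
    rw [hc]
    simp only [diag_u]
    have hcast : ∀ j, ((ℓ.e j : ℕ) : A) * algebraMap ℂ A (ℓ.e j : ℂ)⁻¹ = 1 := by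
      intro j
      rw [← map_natCast (algebraMap ℂ A), ← map_mul, mul_inv_cancel₀ (ℓ.e_ne_zero j), map_one]
    -- Only the base coordinate needs the linear relation between the coefficients.
    rcases Fin.eq_self_or_eq_succAbove i l with rfl | ⟨m, rfl⟩
    · have h2 : ∑ m : Fin n, c (l.succAbove m) *
          (if l.succAbove m ∈ ℓ.E then (ℓ.e (l.succAbove m) : A) else 0) = -(c l * ℓ.e l) := by
        have h3 : ∑ j : Fin (n + 1), c j * (if j ∈ ℓ.E then (ℓ.e j : A) else 0) = 0 := by
          simp only [mul_ite, mul_zero, Finset.sum_ite_mem, Finset.univ_inter]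
          exact ht
        rw [Fin.sum_univ_succAbove _ l, if_pos hi] at h3
        exact (neg_eq_of_add_eq_zero_right h3).symm
      have h4 : ∀ m : Fin n, (c (l.succAbove m) *
          if l.succAbove m ∈ ℓ.E then (ℓ.e (l.succAbove m) : A) else 1) *
            (algebraMap ℂ A (ℓ.wt l (l.succAbove m) l) * ℓ.v l) =
          c (l.succAbove m) * (if l.succAbove m ∈ ℓ.E then (ℓ.e (l.succAbove m) : A) else 0) *
            (algebraMap ℂ A (-(ℓ.e l : ℂ)⁻¹) * ℓ.v l) := by
        intro m
        rw [wt_succAbove_base]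
        split_ifs <;> simp
      rw [Finset.sum_congr rfl fun m _ => h4 m, ← Finset.sum_mul, h2, map_neg]
      linear_combination (c l * ℓ.v l) * hcast l
    · rw [Finset.sum_eq_single m]
      · rw [wt_succAbove, if_pos rfl]
        split_ifs
        · linear_combination (c (i.succAbove m) * ℓ.v (i.succAbove m)) * hcast (i.succAbove m)
        · simp
      · intro m' _ hm'
        rw [wt_succAbove, if_neg hm'.symm]
        simp
      · simp
  exact ⟨Module.Basis.mk hli hsp, fun m => by rw [Module.Basis.mk_apply]⟩

/-- The basis of the relative logarithmic fields with base index `i`. -/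
def Adapted.basis (H : ℓ.Adapted J t) (hi : i ∈ ℓ.E) : Module.Basis (Fin n) A (relFields J t).T :=
  (H.exists_basis hi).choose

theorem Adapted.basis_apply (H : ℓ.Adapted J t) (hi : i ∈ ℓ.E) (m : Fin n) :
    (H.basis hi m : Derivation ℂ A A) = ℓ.diag (ℓ.wt i (i.succAbove m)) :=
  (H.exists_basis hi).choose_spec m

theorem Adapted.basis_comm (H : ℓ.Adapted J t) (hi : i ∈ ℓ.E) (m m' : Fin n) :
    (relFields J t).br (H.basis hi m) (H.basis hi m') = 0 := by
  refine Subtype.ext ?_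
  change ⁅(H.basis hi m : Derivation ℂ A A), (H.basis hi m' : Derivation ℂ A A)⁆ = 0
  rw [H.basis_apply, H.basis_apply, diag_comm]

end LogCoords

end

/-! ### Filtered acyclicity of quotients given by monomials. -/

section
open MvPolynomial

namespace LogCoords
variable {A : Type*} [CommRing A] [Algebra ℂ A] {n : ℕ} {ℓ : LogCoords A n}

variable (ℓ) in
/-- The divisor consists of coordinate hyperplanes. -/
def Centered : Prop := ∀ l ∈ ℓ.E, ℓ.u l = ℓ.w l

variable (ℓ) in
/-- The operator `θ` with `diag c * g = g * θ`, for the monomial `g` with exponents `m`. -/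
def twist (c : Fin (n + 1) → ℂ) (m : Fin (n + 1) → ℕ) : D A :=
  derD (ℓ.diag c) + algebraMap ℂ (D A) (ℓ.wgt c m)

theorem algebraMap_apply (k : ℂ) (a : A) :
    (algebraMap ℂ (D A) k).toEnd a = algebraMap ℂ A k * a := by
  rw [← Algebra.smul_def]
  rfl

theorem algebraMap_eq (k : ℂ) : algebraMap ℂ (D A) k = toD (algebraMap ℂ A k) :=
  D_ext fun a => algebraMap_apply k a

theorem derD_mul_mono (c : Fin (n + 1) → ℂ) (m : Fin (n + 1) → ℕ) (P : D A) :
    derD (ℓ.diag c) * ℓ.mono m • P = ℓ.mono m • (ℓ.twist c m * P) := by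
  rw [derD_mul_smul, diag_mono, twist, add_mul, smul_add, algebraMap_eq, ← smul_D_def, smul_smul,
    mul_comm (ℓ.mono m)]

theorem twist_comm (c c' : Fin (n + 1) → ℂ) (m : Fin (n + 1) → ℕ) :
    ℓ.twist c m * ℓ.twist c' m = ℓ.twist c' m * ℓ.twist c m := by
  simp only [twist, add_mul, mul_add, ℓ.derD_diag_comm c c', Algebra.commutes, ← map_mul]
  rw [mul_comm (ℓ.wgt c m)]
  abel

theorem twist_mem_DO (c : Fin (n + 1) → ℂ) (m : Fin (n + 1) → ℕ) : ℓ.twist c m ∈ DO A 2 :=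
  add_mem (derivation_mem _) (DO_mono one_le_two (by rw [algebraMap_eq]; exact mulLeft_mem _))

/-- The coefficients of the symbols. -/
def symCoeff (ℓ : LogCoords A n) (j : Fin (n + 1)) : A := algebraMap ℂ A (ℓ.e j : ℂ)⁻¹

theorem isUnit_symCoeff (j : Fin (n + 1)) : IsUnit (ℓ.symCoeff j) :=
  (isUnit_iff_ne_zero.2 (inv_ne_zero (ℓ.e_ne_zero j))).map (algebraMap ℂ A)

theorem diag_wt_w (hE : ℓ.Centered) {i : Fin (n + 1)} (hi : i ∈ ℓ.E) {j : Fin (n + 1)}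
    (hj : j ≠ i) (l : Fin (n + 1)) : ℓ.diag (ℓ.wt i j) (ℓ.w l) =
      if j ∈ ℓ.E then (if l = j then ℓ.symCoeff j * ℓ.w j else 0) -
        (if l = i then ℓ.symCoeff i * ℓ.w i else 0) else if l = j then 1 else 0 := by
  rw [← ℓ.apply_u, diag_u, v, wt]
  by_cases hjE : j ∈ ℓ.E
  · rw [if_pos hjE, if_pos hjE, Pi.sub_apply, eul, eul]
    by_cases h1 : l = j
    · subst h1
      rw [if_pos hjE, hE _ hjE]
      simp [hj, symCoeff]
    · by_cases h2 : l = i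
      · subst h2
        rw [if_pos hi, hE _ hi]
        simp [h1, symCoeff]
      · simp [h1, h2]
  · rw [if_neg hjE, if_neg hjE]
    by_cases h1 : l = j
    · subst h1
      simp [hjE]
    · simp [h1]

variable [IsDomain A]

/-- The constant added by the twist has order zero and is invisible in degree one, so the symbols do
not depend on the monomial. -/
theorem sym_twist (hE : ℓ.Centered) {i : Fin (n + 1)} (hi : i ∈ ℓ.E) {j : Fin (n + 1)}
    (hj : j ≠ i) (m : Fin (n + 1) → ℕ) : sym ℓ.w 1 (ℓ.twist (ℓ.wt i j) m).toEnd =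
      ℓ.toCoords.polyVarRing.sg ℓ.E (fun j => C (ℓ.symCoeff j)) i j := by
  have h0 : sym ℓ.w 1 (algebraMap ℂ (D A) (ℓ.wgt (ℓ.wt i j) m)).toEnd = 0 := by
    refine sym_eq_zero_of_mem _ ?_
    rw [algebraMap_eq]
    exact mulLeft_mem _
  have h1 : (derD (ℓ.diag (ℓ.wt i j))).toEnd = (ℓ.diag (ℓ.wt i j) : A →ₗ[ℂ] A) := rfl
  rw [twist, map_add, map_add, h0, add_zero, h1, sym_derivation]
  simp only [diag_wt_w hE hi hj]
  have hv : ∀ l, ℓ.toCoords.polyVarRing.var (.inl l) = C (ℓ.w l) := fun _ => rfl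
  have hv' : ∀ l, ℓ.toCoords.polyVarRing.var (.inr l) = X l := fun _ => rfl
  rw [VarRing.sg, hv, hv, hv', hv']
  split_ifs
  · simp only [map_sub, sub_mul, Finset.sum_sub_distrib]
    rw [Finset.sum_eq_single j, Finset.sum_eq_single i]
    · simp [mul_assoc]
    · intro k _ hk; simp [hk]
    · simp
    · intro k _ hk; simp [hk]
    · simp
  · rw [Finset.sum_eq_single j]
    · simp
    · intro k _ hk; simp [hk]
    · simp

theorem koszulData (hE : ℓ.Centered) {i : Fin (n + 1)} (hi : i ∈ ℓ.E) (m : Fin (n + 1) → ℕ) :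
    KoszulData ℓ.toCoords ℓ.E (fun j => C (ℓ.symCoeff j)) i
      (fun k => ℓ.twist (ℓ.wt i (i.succAbove k)) m) where
  isUnit j := (isUnit_symCoeff j).map C
  order k := twist_mem_DO _ _
  symbol k := sym_twist hE hi (Fin.succAbove_ne i k) m
  comm k k' := twist_comm _ _ _
  base k P := by
    refine ⟨(ℓ.twist (ℓ.wt i (i.succAbove k)) m +
      algebraMap ℂ (D A) (ℓ.wt i (i.succAbove k) i)) * P, ?_⟩
    rw [← hE i hi, twist, add_mul, derD_mul_smul, diag_u_mem _ _ hi, add_mul, add_mul, smul_add,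
      smul_add, algebraMap_eq, algebraMap_eq, ← smul_D_def, ← smul_D_def, ← smul_D_def, smul_smul,
      smul_smul, smul_smul, mul_comm (ℓ.u i), mul_comm (ℓ.u i)]
    abel

variable {J : Ideal A} {t : A} (H : ℓ.Adapted J t)

theorem Adapted.kd_smul (H : ℓ.Adapted J t) {i : Fin (n + 1)} (hi : i ∈ ℓ.E)
    (m : Fin (n + 1) → ℕ) (c : Finset (Fin n) → D A) (s : Finset (Fin n)) :
    kd (Fields.kop (H.basis hi)) (fun s => ℓ.mono m • c s) s =
      ℓ.mono m • kd (kmul fun k => ℓ.twist (ℓ.wt i (i.succAbove k)) m) c s := by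
  simp only [kd, Finset.smul_sum, Fields.kop, AddMonoidHom.coe_mulLeft, H.basis_apply,
    derD_mul_mono]
  exact Finset.sum_congr rfl fun k _ => smul_comm _ _ _

theorem dForm_coc_smul (H : ℓ.Adapted J t) {i : Fin (n + 1)} (hi : i ∈ ℓ.E)
    (m : Fin (n + 1) → ℕ) {p : ℕ} {φ : (relFields J t).Form p} {c : Finset (Fin n) → D A}
    (hc : ∀ s, s.card = p → Fields.coc (H.basis hi) φ s = ℓ.mono m • c s) {s : Finset (Fin n)}
    (hs : s.card = p + 1) : Fields.coc (H.basis hi) (Fields.dForm φ) s =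
      ℓ.mono m • kd (kmul fun k => ℓ.twist (ℓ.wt i (i.succAbove k)) m) c s := by
  rw [Fields.coc_dForm _ (H.basis_comm hi) _ hs, ← H.kd_smul hi]
  exact kd_congr _ fun k hk => hc _ (by rw [Finset.card_erase_of_mem hk, hs]; rfl)

open Fields

/-- The base index of the basis is chosen to be the index whose exponent is raised. Dividing by the
monomial turns `d` into the Koszul differential of the twisted fields and the quotient into
reduction modulo the base coordinate, so `KoszulData.exact` and `KoszulData.strict` apply. -/
theorem Adapted.filteredAcyclic_single (H : ℓ.Adapted J t) (hE : ℓ.Centered) {i : Fin (n + 1)}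
    (hi : i ∈ ℓ.E) (m : Fin (n + 1) → ℕ) : (relFields J t).FilteredAcyclic
      (Ideal.span {ℓ.mono m}) (Ideal.span {ℓ.mono (m + Pi.single i 1)}) n := by
  set b := H.basis hi with hb
  have hg : ℓ.mono m ≠ 0 := ℓ.mono_ne_zero m
  have Kz := koszulData hE hi m
  have hmul : ∀ P : D A, ℓ.mono (m + Pi.single i 1) • P = ℓ.mono m • ℓ.w i • P := fun P => by
    rw [mono_add_single _ _ hi, hE i hi, smul_smul]
  have mk_b : ∀ {p : ℕ} {l : ℤ} {χ : Finset (Fin n) → D A},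
      (∀ s, s.card = p → χ s ∈ DO A (l + p + 1).toNat) →
      formOf b (fun s => ℓ.mono (m + Pi.single i 1) • χ s) p ∈
        (relFields J t).FK (Ideal.span {ℓ.mono (m + Pi.single i 1)}) p l := by
    intro p l χ hχ
    refine ⟨(mem_K_span_iff b).2 fun s => ?_, (order_iff b _ _).2 fun s => ?_⟩
    · by_cases hs : s.card = p
      · exact ⟨_, coc_formOf b _ p hs⟩
      · exact ⟨0, by rw [coc_of_card_ne b _ hs, smul_zero]⟩
    · by_cases hs : s.card = p
      · rw [coc_formOf b _ p hs]
        exact DO_smul _ (hχ s hs)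
      · rw [coc_of_card_ne b _ hs]
        exact zero_mem (FD A _)
  have mk_a : ∀ {p : ℕ} {l : ℤ} {χ : Finset (Fin n) → D A},
      (∀ s, s.card = p → χ s ∈ DO A (l + p + 1).toNat) →
      formOf b (fun s => ℓ.mono m • χ s) p ∈
        (relFields J t).FK (Ideal.span {ℓ.mono m}) p l := by
    intro p l χ hχ
    refine ⟨(mem_K_span_iff b).2 fun s => ?_, (order_iff b _ _).2 fun s => ?_⟩
    · by_cases hs : s.card = p
      · exact ⟨_, coc_formOf b _ p hs⟩
      · exact ⟨0, by rw [coc_of_card_ne b _ hs, smul_zero]⟩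
    · by_cases hs : s.card = p
      · rw [coc_formOf b _ p hs]
        exact DO_smul _ (hχ s hs)
      · rw [coc_of_card_ne b _ hs]
        exact zero_mem (FD A _)
  refine ⟨fun l p hp φ hφ hd => ?_, fun l φ hφ hmem => ?_⟩
  · obtain ⟨χ₀, hχ₀, e₀⟩ := hd
    choose c hc using (mem_K_span_iff b).1 hφ.1
    have hcO : ∀ s, s.card = p → c s ∈ DO A (l + p + 1).toNat := fun s _ => by
      rw [← DO_smul_iff hg, ← hc]
      exact (order_iff b φ _).1 hφ.2 s
    obtain ⟨χ, η, hχ, hη, h⟩ := Kz.exact hp hcO fun s hs => by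
      obtain ⟨Q, hQ⟩ := (mem_K_span_iff b).1 hχ₀.1 s
      refine ⟨Q, smul_D_cancel hg ?_⟩
      rw [← dForm_coc_smul H hi m (fun s _ => hc s) hs, ← hb,
        show dForm φ = χ₀ from Form.ext fun v => by rw [dForm_apply, e₀], hQ, hmul]
    refine ⟨_, mk_b fun s _ => hχ s, ?_⟩
    -- In form degree zero there are no boundaries, and the Koszul part vanishes on the empty set.
    rcases p with _ | p
    · refine Set.mem_singleton_iff.2 (sub_eq_zero.2 (ext_coc b fun s hs => ?_))
      rw [coc_formOf b _ _ hs, hc, h s hs, hmul, Finset.card_eq_zero.1 hs, kd_empty, add_zero]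
    · refine ⟨_, mk_a (χ := η) fun s _ => DO_mono (by push_cast; omega) (hη s), fun θ => ?_⟩
      rw [← dForm_apply]
      refine congrArg (fun ψ : (relFields J t).Form (p + 1) => ψ θ) (ext_coc b fun s hs => ?_)
      rw [coc_sub, coc_formOf b _ _ hs, dForm_coc_smul H hi m (c := η)
        (fun s hs => coc_formOf b _ _ hs) hs, hc, h s hs, hmul, smul_add]
      abel
  · obtain ⟨κ, hκ, β, hβ, rfl⟩ := Submodule.mem_sup.1 hmem
    rcases n with _ | p
    · rw [show β = 0 from hβ] at *
      refine ⟨κ, ⟨hκ, ?_⟩, ?_⟩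
      · have := hφ.2
        rwa [add_zero] at this
      · rw [add_zero, sub_self]
        rfl
    · obtain ⟨ξ, hξ, eξ⟩ := hβ
      choose χ hχ using (mem_K_span_iff b).1 hκ
      choose η hη using (mem_K_span_iff b).1 hξ
      choose c hc using (mem_K_span_iff b).1 hφ.1
      have hcO : ∀ s, s.card = p + 1 → c s ∈ DO A (l + (p + 1 : ℕ) + 1).toNat := fun s _ => by
        rw [← DO_smul_iff hg, ← hc]
        exact (order_iff b _ _).1 hφ.2 s
      obtain ⟨χ', η', hχ', hη', h⟩ := Kz.strict (Nat.lt_succ_self p) hcO (χ := χ) (η := η) (by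
        intro s hs
        refine smul_D_cancel hg ?_
        rw [← hc, coc_add, hχ, eq_dForm_iff.1 eξ, dForm_coc_smul H hi m (fun s _ => hη s) hs,
          hmul, smul_add])
      refine ⟨_, mk_b hχ', _, mk_a (χ := η')
        fun s hs => DO_mono (by push_cast; omega) (hη' s hs), fun θ => ?_⟩
      rw [← dForm_apply]
      refine congrArg (fun ψ : (relFields J t).Form (p + 1) => ψ θ) (ext_coc b fun s hs => ?_)
      rw [coc_sub, coc_formOf b _ _ hs, dForm_coc_smul H hi m (c := η')
        (fun s hs => coc_formOf b _ _ hs) hs, hc, h s hs, hmul, smul_add]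
      abel

theorem filteredAcyclic_self {L : Fields A} (a : Ideal A) {p : ℕ} : L.FilteredAcyclic a a p where
  exact l p hp φ hφ _ := ⟨φ, hφ, by
    rw [sub_self]
    rcases p with _ | p
    · rfl
    · exact ⟨0, ⟨zero_mem _, fun θ => zero_mem (FD A _)⟩, fun θ => by
        rw [← dForm_apply, show dForm (0 : L.Form p) = 0 from map_zero (dHom p)]⟩⟩
  strict l φ hφ _ := ⟨φ, hφ, by
    rw [sub_self]
    rcases p with _ | p
    · rfl
    · exact ⟨0, ⟨zero_mem _, fun θ => zero_mem (FD A _)⟩, fun θ => by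
        rw [← dForm_apply, show dForm (0 : L.Form p) = 0 from map_zero (dHom p)]⟩⟩

theorem span_mono_add_le (m k : Fin (n + 1) → ℕ) :
    Ideal.span {ℓ.mono (m + k)} ≤ Ideal.span {ℓ.mono m} := by
  rw [Ideal.span_singleton_le_span_singleton, mono_add]
  exact dvd_mul_right _ _

/-- Raise the exponents one at a time. At each step the index being raised serves as base index; the
complex itself does not depend on that choice. -/
theorem Adapted.filteredAcyclic (H : ℓ.Adapted J t) (hE : ℓ.Centered)
    (m k : Fin (n + 1) → ℕ) : (relFields J t).FilteredAcyclic
      (Ideal.span {ℓ.mono m}) (Ideal.span {ℓ.mono (m + k)}) n := by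
  induction k using monomial_induction ℓ.E with
  | h0 k hk =>
    rw [show ℓ.mono (m + k) = ℓ.mono m from ℓ.mono_congr fun l hl => by simp [hk l hl]]
    exact filteredAcyclic_self _
  | hs k i hi ih =>
    have h := H.filteredAcyclic_single hE hi (m + k)
    rw [add_assoc] at h
    refine FilteredAcyclic.trans (H.basis hi) (H.basis_comm hi) (span_mono_add_le _ _) ?_ ih h
    rw [← add_assoc]
    exact span_mono_add_le _ _

end LogCoords

end

/-! ### Cyclic filtered modules and their associated graded modules. -/

namespace Filt
variable {A : Type*} [CommRing A] [Algebra ℂ A] {M : Type*} [AddCommGroup M] [Module (DR A) M]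
  (Φ : Filt A M)

/-- The homogeneous element of the Rees module given by an element of `F l`. -/
def of (l : ℤ) (m : Φ.F l) : Φ.Rees := DirectSum.of (fun l : ℤ => Φ.F l) l m

/-- The component of degree `l` of an element of the Rees module. -/
def comp (l : ℤ) : Φ.Rees →+ M where
  toFun y := ((show ⨁ l : ℤ, Φ.F l from y) l : M)
  map_zero' := rfl
  map_add' y y' := congrArg Subtype.val
    (DirectSum.add_apply (show ⨁ l : ℤ, Φ.F l from y) (show ⨁ l : ℤ, Φ.F l from y') l)

theorem comp_of (k l : ℤ) (m : Φ.F k) : Φ.comp l (Φ.of k m) = if k = l then (m : M) else 0 := by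
  change ((DirectSum.of (fun l : ℤ => Φ.F l) k m) l : M) = _
  rw [DirectSum.coe_of_apply]
  split_ifs <;> rfl

theorem induction_on {p : Φ.Rees → Prop} (y : Φ.Rees) (h0 : p 0) (h1 : ∀ l m, p (Φ.of l m))
    (h2 : ∀ y y', p y → p y' → p (y + y')) : p y := DirectSum.induction_on y h0 h1 h2

theorem of_congr {k l : ℤ} (h : k = l) (m : Φ.F k) (m' : Φ.F l) (e : (m : M) = m') :
    Φ.of k m = Φ.of l m' := by
  subst h; rw [Subtype.ext e]

theorem smul_of (k l : ℤ) (P : FD A k) (m : Φ.F l) :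
    reesOf k P • Φ.of l m = Φ.of (k + l) ⟨P.1 • m.1, Φ.smul_mem P.2 m.2⟩ :=
  DirectSum.Gmodule.of_smul_of (fun k : ℤ => FD A k) (fun l : ℤ => Φ.F l) (i := k) (j := l) P m

theorem comp_reesVar_smul (l : ℤ) (y : Φ.Rees) : Φ.comp l (reesVar A • y) = Φ.comp (l - 1) y := by
  induction y using Φ.induction_on with
  | h0 => rw [smul_zero, map_zero, map_zero]
  | h1 k m =>
    change Φ.comp l (reesOf 1 _ • Φ.of k m) = _
    rw [smul_of, comp_of, comp_of]
    by_cases h : 1 + k = l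
    · rw [if_pos h, if_pos (by omega)]; exact one_smul _ _
    · rw [if_neg h, if_neg (by omega)]
  | h2 y y' hy hy' => rw [smul_add, map_add, map_add, hy, hy']

theorem comp_mem (l : ℤ) (y : Φ.Rees) : Φ.comp l y ∈ Φ.F l :=
  ((show ⨁ l : ℤ, Φ.F l from y) l).2

/-- The quotient map from the Rees module to the associated graded module. -/
def grMk : Φ.Rees →+ Φ.Gr :=
  (Submodule.mkQ (reesIdeal A • (⊤ : Submodule (LogD.Rees A) Φ.Rees))).toAddMonoidHom

theorem grMk_surjective : Function.Surjective Φ.grMk := Submodule.mkQ_surjective _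

theorem comp_mem_of_grMk_eq_zero {y : Φ.Rees} (h : Φ.grMk y = 0) (l : ℤ) :
    Φ.comp l y ∈ Φ.F (l - 1) := by
  have h' : y ∈ reesIdeal A • (⊤ : Submodule (LogD.Rees A) Φ.Rees) :=
    (Submodule.Quotient.mk_eq_zero _).1 h
  refine Submodule.smul_induction_on (p := fun y => Φ.comp l y ∈ Φ.F (l - 1)) h' ?_ ?_
  · intro r hr y _
    obtain ⟨q, rfl⟩ := mem_reesIdeal.1 hr
    rw [← reesVar_comm, mul_smul, comp_reesVar_smul]
    exact Φ.comp_mem _ _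
  · intro y y' hy hy'
    rw [map_add]
    exact add_mem hy hy'

theorem grMk_of_eq_zero {l : ℤ} {m : Φ.F l} (h : (m : M) ∈ Φ.F (l - 1)) :
    Φ.grMk (Φ.of l m) = 0 := by
  refine (Submodule.Quotient.mk_eq_zero _).2 ?_
  have : Φ.of l m = reesVar A • Φ.of (l - 1) ⟨m, h⟩ := by
    change _ = reesOf 1 _ • _
    rw [smul_of]
    exact Φ.of_congr (by ring) _ _ (one_smul _ _).symm
  rw [this]
  exact Submodule.smul_mem_smul (Ideal.mem_span_singleton_self _) trivial

/-- A cyclic filtered module, with generator `e` in degree `-N`, and generators `G` of the ideal of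
the associated graded module. -/
structure Cyclic (e : M) (N : ℤ) (G : Set (GrD A)) : Prop where
  exists_smul : ∀ m : M, ∃ P : DR A, m = P • e
  mem_iff : ∀ l m, m ∈ Φ.F l ↔ ∃ P ∈ FD A (l + N), m = P • e
  mem_of_gen : ∀ σ ∈ G, ∃ (k : ℤ) (P : FD A k), σ = symb k P ∧ P.1 • e ∈ Φ.F (k - 1 - N)
  symb_mem : ∀ (k : ℤ) (P : FD A k), P.1 • e ∈ Φ.F (k - 1 - N) → symb k P ∈ Ideal.span G

variable {Φ}

/-- Transport along a filtered isomorphism; through it one computation covers both the cohomology of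
`C_α` and `M_α`. -/
theorem Cyclic.map {e : M} {N : ℤ} {G : Set (GrD A)} (C : Φ.Cyclic e N G) {M' : Type*}
    [AddCommGroup M'] [Module (DR A) M'] {Φ' : Filt A M'} (ψ : M ≃ₗ[DR A] M')
    (hψ : ∀ l m, m ∈ Φ.F l ↔ ψ m ∈ Φ'.F l) : Φ'.Cyclic (ψ e) N G where
  exists_smul m := by
    obtain ⟨P, hP⟩ := C.exists_smul (ψ.symm m)
    exact ⟨P, by rw [← map_smul, ← hP, ψ.apply_symm_apply]⟩
  mem_iff l m := by
    rw [← ψ.apply_symm_apply m, ← hψ, C.mem_iff]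
    exact exists_congr fun P => and_congr_right fun _ => by
      rw [← map_smul]
      exact ψ.injective.eq_iff.symm
  mem_of_gen σ hσ := by
    obtain ⟨k, P, h, hP⟩ := C.mem_of_gen σ hσ
    exact ⟨k, P, h, by rw [← map_smul, ← hψ]; exact hP⟩
  symb_mem k P h := C.symb_mem k P (by rwa [hψ, map_smul])

/-- The class of the generator gives a surjection from `GrD A` onto the associated graded module. A
homogeneous element of its kernel is the symbol of an operator that sends the generator into a
smaller step, so the kernel is the ideal spanned by `G`. -/
theorem Cyclic.isGood_charCycle {e : M} {N : ℤ} {G : Set (GrD A)} (C : Φ.Cyclic e N G) :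
    Φ.IsGood ∧ Φ.charCycle = cycle (GrD A) (GrD A ⧸ Ideal.span G) := by
  obtain ⟨hs, hF, hG, hI⟩ := C
  have he : e ∈ Φ.F (-N) := (hF _ _).2 ⟨1, by rw [neg_add_cancel]; exact one_mem_FD,
    (one_smul _ _).symm⟩
  let f : GrD A →ₗ[GrD A] Φ.Gr := LinearMap.toSpanSingleton (GrD A) _ (Φ.grMk (Φ.of (-N) ⟨e, he⟩))
  have hf : ∀ p : LogD.Rees A, f (GrD.mk p) = Φ.grMk (p • Φ.of (-N) ⟨e, he⟩) := fun p => rfl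
  have hcomp : ∀ (p : LogD.Rees A) (k : ℤ),
      Φ.comp (k - N) (p • Φ.of (-N) ⟨e, he⟩) = (p k).1 • e := by
    intro p k
    induction p using DirectSum.induction_on with
    | zero =>
      rw [zero_smul, map_zero]
      exact (zero_smul (DR A) e).symm
    | of l P =>
      change Φ.comp _ (reesOf l P • _) = _
      rw [smul_of, comp_of, DirectSum.coe_of_apply]
      by_cases h : l = k
      · subst h
        rw [if_pos rfl, if_pos (by ring)]
      · rw [if_neg h, if_neg (by omega)]
        exact (zero_smul (DR A) e).symm
    | add p q hp hq =>
      rw [add_smul, map_add, hp, hq, DirectSum.add_apply]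
      exact (add_smul _ _ _).symm
  have hsurj : Function.Surjective f := by
    intro x
    obtain ⟨y, rfl⟩ := Φ.grMk_surjective x
    induction y using Φ.induction_on with
    | h0 => exact ⟨0, by rw [map_zero, map_zero]⟩
    | h1 l m =>
      obtain ⟨P, hP, hm⟩ := (hF l m).1 m.2
      refine ⟨GrD.mk (reesOf (l + N) ⟨P, hP⟩), ?_⟩
      rw [hf, smul_of]
      exact congrArg _ (Φ.of_congr (by ring) _ _ hm.symm)
    | h2 y y' hy hy' =>
      obtain ⟨a, ha⟩ := hy
      obtain ⟨a', ha'⟩ := hy'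
      exact ⟨a + a', by rw [map_add, map_add, ha, ha']⟩
  have hker : LinearMap.ker f = Ideal.span G := by
    refine le_antisymm (fun x hx => ?_) (Ideal.span_le.2 fun σ hσ => ?_)
    · obtain ⟨p, rfl⟩ := GrD.mk_surjective x
      classical
      rw [← DirectSum.sum_support_of p, map_sum]
      refine Ideal.sum_mem _ fun k _ => hI k (p k) ?_
      have := Φ.comp_mem_of_grMk_eq_zero ((hf p).symm.trans hx) (k - N)
      rwa [hcomp, show k - N - 1 = k - 1 - N by ring] at this
    · obtain ⟨k, P, rfl, hP⟩ := hG σ hσ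
      change f (GrD.mk (reesOf k P)) = 0
      rw [hf, smul_of]
      refine Φ.grMk_of_eq_zero ?_
      rwa [show k + -N - 1 = k - 1 - N by ring]
  refine ⟨⟨fun m => ?_, ?_, Module.Finite.of_surjective f hsurj⟩, ?_⟩
  · obtain ⟨P, rfl⟩ := hs m
    obtain ⟨k, hk⟩ := Fields.exists_mem_FD P.unop
    exact ⟨k - N, (hF _ _).2 ⟨P, by rwa [sub_add_cancel], rfl⟩⟩
  · refine ⟨-N - 1, (AddSubgroup.eq_bot_iff_forall _).2 fun m hm => ?_⟩
    obtain ⟨P, hP, rfl⟩ := (hF _ _).1 hm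
    rw [FD_neg (by omega) hP, zero_smul]
  · exact (cycle_congr ((Submodule.quotEquivOfEq _ _ hker).symm.trans
      (f.quotKerEquivOfSurjective hsurj))).symm

end Filt

/-! ### Forms of top degree as single operators. -/

namespace Fields
variable {A : Type*} [CommRing A] [Algebra ℂ A] {L : Fields A} {n : ℕ}
  (b : Module.Basis (Fin n) A L.T)

/-- The value of a form of top degree on a basis. -/
def ev (φ : L.Form n) : D A := coc b φ Finset.univ

/-- The form of top degree with given value on a basis. -/
def topForm (P : D A) : L.Form n := formOf b (fun _ => P) n

theorem ev_eq (φ : L.Form n) : ev b φ = φ b := by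
  rw [ev, coc_of_card b φ (Finset.card_fin n)]
  congr 1
  ext1 k
  rw [← Finset.orderEmbOfFin_unique (f := id) (Finset.card_fin n) (fun _ => Finset.mem_univ _)
    strictMono_id]
  rfl

theorem ev_topForm (P : D A) : ev b (topForm b P) = P := coc_formOf b _ n (Finset.card_fin n)

theorem ev_injective : Function.Injective (ev b) := fun φ ψ h => ext_coc b fun s hs => by
  rw [(Finset.card_eq_iff_eq_univ s).1 (hs.trans (Fintype.card_fin n).symm)]
  exact h

theorem topForm_ev (φ : L.Form n) : topForm b (ev b φ) = φ := ev_injective b (ev_topForm b _)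

theorem ev_add (φ ψ : L.Form n) : ev b (φ + ψ) = ev b φ + ev b ψ := coc_add b _ _ _

theorem ev_sub (φ ψ : L.Form n) : ev b (φ - ψ) = ev b φ - ev b ψ := coc_sub b _ _ _

theorem ev_smulA (g : A) (φ : L.Form n) : ev b (g • φ) = g • ev b φ := coc_smulA b _ _ _

theorem ev_smul (P : DR A) (φ : L.Form n) : ev b (P • φ) = ev b φ * P.unop := by
  rw [ev_eq, ev_eq]; rfl

theorem ev_mem_FD (φ : L.Form n) (k : ℤ) : (∀ v, (φ v).op ∈ FD A k) ↔ (ev b φ).op ∈ FD A k := by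
  rw [order_iff b]
  refine ⟨fun h => h _, fun h s => ?_⟩
  by_cases hs : s.card = n
  · rw [(Finset.card_eq_iff_eq_univ s).1 (hs.trans (Fintype.card_fin n).symm)]
    exact h
  · rw [coc_of_card_ne b _ hs]
    exact zero_mem (FD A k)

theorem mem_K_iff_ev {g : A} {φ : L.Form n} :
    φ ∈ L.K (Ideal.span {g}) n ↔ ∃ Q, ev b φ = g • Q := by
  rw [mem_K_span]
  constructor
  · rintro ⟨ψ, rfl⟩
    exact ⟨_, ev_smulA b g ψ⟩
  · rintro ⟨Q, hQ⟩
    exact ⟨topForm b Q, ev_injective b (by rw [hQ, ev_smulA, ev_topForm])⟩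

theorem exists_of_mem_FB (hb : ∀ i j, L.br (b i) (b j) = 0) {g : A} {φ : L.Form n} {l : ℤ}
    (h : φ ∈ L.FB (Ideal.span {g}) l n) : ∃ η : Fin n → D A, (∀ k, (g • η k).op ∈ FD A (l + n - 1)) ∧
      ev b φ = ∑ k, derD (b k : Derivation ℂ A A) * g • η k := by
  rcases n with _ | p
  · refine ⟨0, fun k => k.elim0, ?_⟩
    rw [Set.mem_singleton_iff.1 h, Finset.univ_eq_empty, Finset.sum_empty, ev_eq]
    rfl
  · obtain ⟨ξ, hξ, eξ⟩ := h
    choose η hη using (mem_K_span_iff b).1 hξ.1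
    have h2 := (order_iff b ξ _).1 hξ.2
    refine ⟨fun k => ksign k Finset.univ • η (Finset.univ.erase k), fun k => ?_, ?_⟩
    · rw [smul_comm, ← hη]
      refine mem_FD_zsmul _ ?_
      have := h2 (Finset.univ.erase k)
      rwa [show l + ((p + 1 : ℕ) : ℤ) - 1 = l + p by push_cast; ring]
    · rw [eq_dForm_iff.1 eξ, ev, coc_dForm b hb _ (Finset.card_fin _), kd]
      refine Finset.sum_congr rfl fun k _ => ?_
      rw [hη, smul_comm g, mul_smul_comm]
      rfl

theorem mem_bdry_of_ev (hb : ∀ i j, L.br (b i) (b j) = 0) {g : A} {φ : L.Form n}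
    {η : Fin n → D A} (h : ev b φ = ∑ k, derD (b k : Derivation ℂ A A) * g • η k) :
    φ ∈ L.bdry (Ideal.span {g}) n := by
  rcases n with _ | p
  · have : φ = 0 := ev_injective b (by
      rw [h, Finset.univ_eq_empty, Finset.sum_empty, ev_eq]
      rfl)
    rw [this]
    exact zero_mem _
  · obtain ⟨c, hc⟩ := exists_kd_eq (kop b) (s := Finset.univ) ⟨fun k => g • η k, h⟩
    refine ⟨formOf b (fun s => g • ∑ k, if s = Finset.univ.erase k then
      ksign k Finset.univ • η k else 0) p, (mem_K_span_iff b).2 fun s => ?_, fun θ => ?_⟩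
    · by_cases hs : s.card = p
      · exact ⟨_, coc_formOf b _ p hs⟩
      · exact ⟨0, by rw [coc_of_card_ne b _ hs, smul_zero]⟩
    · rw [← dForm_apply]
      refine congrArg (fun ψ : L.Form (p + 1) => ψ θ) (ev_injective b ?_)
      rw [h, ev, coc_dForm b hb _ (Finset.card_fin _), kd]
      refine Finset.sum_congr rfl fun k _ => ?_
      have hcard : (Finset.univ.erase k).card = p := by
        rw [Finset.card_erase_of_mem (Finset.mem_univ _), Finset.card_fin]; rfl
      rw [coc_formOf b _ p hcard, Finset.sum_eq_single k, if_pos rfl, smul_comm g]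
      · rw [← map_zsmul, smul_smul, ksign_mul_self, one_smul]
        rfl
      · intro k' _ hk'
        rw [if_neg]
        intro e
        have h1 : k' ∉ Finset.univ.erase k' := Finset.notMem_erase _ _
        rw [← e] at h1
        exact h1 (Finset.mem_erase.2 ⟨hk', Finset.mem_univ _⟩)
      · simp

theorem mem_bdry_iff_ev (hb : ∀ i j, L.br (b i) (b j) = 0) {g : A} {φ : L.Form n} :
    φ ∈ L.bdry (Ideal.span {g}) n ↔
      ∃ η : Fin n → D A, ev b φ = ∑ k, derD (b k : Derivation ℂ A A) * g • η k := by
  refine ⟨fun h => ?_, fun ⟨η, h⟩ => mem_bdry_of_ev b hb h⟩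
  have : ∃ l, φ ∈ L.FB (Ideal.span {g}) l n := by
    rcases n with _ | p
    · exact ⟨0, h⟩
    · obtain ⟨ξ, hξ, e⟩ := h
      obtain ⟨l, hl⟩ := exists_FK b hξ
      exact ⟨l, ξ, hl, e⟩
  obtain ⟨l, hl⟩ := this
  obtain ⟨η, -, h⟩ := exists_of_mem_FB b hb hl
  exact ⟨η, h⟩

theorem cls_eq_zero_iff {a c : Ideal A} {φ : L.Form n} (h : φ ∈ L.K a n) :
    L.cls c φ h = 0 ↔ φ ∈ L.K c n ⊔ L.bdry a n := Submodule.Quotient.mk_eq_zero _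

theorem cls_surjective {a c : Ideal A} (x : L.H0 a c n) :
    ∃ (φ : L.Form n) (h : φ ∈ L.K a n), x = L.cls c φ h := by
  obtain ⟨⟨φ, h⟩, rfl⟩ := Submodule.Quotient.mk_surjective _ x
  exact ⟨φ, h, rfl⟩

theorem cls_smul {a : Ideal A} (c : Ideal A) {φ : L.Form n} (h : φ ∈ L.K a n) (P : DR A) :
    P • L.cls c φ h = L.cls c (P • φ) (Submodule.smul_mem _ P h) := rfl

theorem cls_sub {a : Ideal A} (c : Ideal A) {φ ψ : L.Form n} (h : φ ∈ L.K a n) (h' : ψ ∈ L.K a n) :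
    L.cls c φ h - L.cls c ψ h' = L.cls c (φ - ψ) (sub_mem h h') := rfl

theorem mem_H0Filt {a c : Ideal A} {l : ℤ} {x : L.H0 a c n} : x ∈ (L.H0Filt a c n).F l ↔
    ∃ (φ : L.Form n) (h : φ ∈ L.K a n), (∀ v, (φ v).op ∈ FD A (l + n)) ∧ x = L.cls c φ h :=
  ⟨fun ⟨⟨φ, h⟩, hφ, e⟩ => ⟨φ, h, hφ, e.symm⟩, fun ⟨φ, h, hφ, e⟩ => ⟨⟨φ, h⟩, hφ, e.symm⟩⟩

end Fields

/-! ### The characteristic cycle of the cohomology in degree zero. -/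

section
variable {A : Type*} [CommRing A] [Algebra ℂ A] {n : ℕ} [IsDomain A] {ℓ : LogCoords A n}
  {J : Ideal A} {t : A}
open Fields

theorem symb_mem_of_eq {k : ℤ} {P : FD A k} {I : Ideal (GrD A)} {Q : FD A k}
    (h : (P : DR A) - Q ∈ FD A (k - 1)) (hQ : symb k Q ∈ I) : symb k P ∈ I := by
  have : P = Q + (P - Q) := by abel
  rw [this, symb_add]
  refine add_mem hQ ?_
  have h0 : symb k (P - Q) = 0 := by
    refine GrD.mk_eq_zero.2 (mem_reesIdeal.2 ⟨reesOf (k - 1) ⟨_, h⟩, ?_⟩)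
    change _ * reesOf 1 _ = reesOf k (P - Q)
    rw [reesOf_mul]
    exact reesOf_congr (by ring) _ _ (mul_one _)
  rw [h0]
  exact zero_mem _

theorem symb_sum_mem {ι : Type*} (s : Finset ι) {k : ℤ} {I : Ideal (GrD A)} {f : ι → FD A k}
    (h : ∀ i ∈ s, symb k (f i) ∈ I) : symb k (∑ i ∈ s, f i) ∈ I := by
  classical
  induction s using Finset.induction_on with
  | empty =>
    rw [Finset.sum_empty]
    have : symb k (0 : FD A k) = 0 := by
      have := symb_add (0 : FD A k) 0
      rw [add_zero] at this
      exact left_eq_add.1 this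
    rw [this]
    exact zero_mem _
  | insert i s hi ih =>
    rw [Finset.sum_insert hi, symb_add]
    exact add_mem (h i (by simp)) (ih fun j hj => h j (by simp [hj]))

namespace LogCoords

/-- The class generating the cohomology in degree zero. -/
def Adapted.gen (H : ℓ.Adapted J t) {i : Fin (n + 1)} (hi : i ∈ ℓ.E) (m : Fin (n + 1) → ℕ)
    (c : Ideal A) : (relFields J t).H0 (Ideal.span {ℓ.mono m}) c n :=
  (relFields J t).cls c (ℓ.mono m • topForm (H.basis hi) 1)
    ((mem_K_iff_ev (H.basis hi)).2 ⟨1, by rw [ev_smulA, ev_topForm]⟩)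

theorem Adapted.smul_gen_eq (H : ℓ.Adapted J t) {i : Fin (n + 1)} (hi : i ∈ ℓ.E)
    (m : Fin (n + 1) → ℕ) (c : Ideal A) {φ : (relFields J t).Form n}
    (h : φ ∈ (relFields J t).K (Ideal.span {ℓ.mono m}) n) {Q : D A}
    (hQ : ev (H.basis hi) φ = ℓ.mono m • Q) :
    (relFields J t).cls c φ h = Q.op • H.gen hi m c := by
  rw [gen, cls_smul]
  congr 1
  refine ev_injective (H.basis hi) ?_
  rw [hQ, ev_smul, ev_smulA, ev_topForm, smul_mul_D, one_mul]
  rfl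

theorem Adapted.mem_H0Filt_iff (H : ℓ.Adapted J t) {i : Fin (n + 1)} (hi : i ∈ ℓ.E)
    (m : Fin (n + 1) → ℕ) (c : Ideal A) (l : ℤ)
    (x : (relFields J t).H0 (Ideal.span {ℓ.mono m}) c n) :
    x ∈ ((relFields J t).H0Filt (Ideal.span {ℓ.mono m}) c n).F l ↔
      ∃ P ∈ FD A (l + n), x = P • H.gen hi m c := by
  rw [mem_H0Filt]
  constructor
  · rintro ⟨φ, h, hφ, rfl⟩
    obtain ⟨Q, hQ⟩ := (mem_K_iff_ev (H.basis hi)).1 h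
    refine ⟨Q.op, ?_, H.smul_gen_eq hi m c h hQ⟩
    rw [op_mem_FD, ← DO_smul_iff (ℓ.mono_ne_zero m), ← hQ, ← op_mem_FD]
    exact (ev_mem_FD (H.basis hi) φ _).1 hφ
  · rintro ⟨P, hP, rfl⟩
    have hQ : ev (H.basis hi) (P • ℓ.mono m • topForm (H.basis hi) 1) = ℓ.mono m • P.unop := by
      rw [ev_smul, ev_smulA, ev_topForm, smul_mul_D, one_mul]
    refine ⟨P • ℓ.mono m • topForm (H.basis hi) 1, (mem_K_iff_ev (H.basis hi)).2 ⟨_, hQ⟩,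
      (ev_mem_FD (H.basis hi) _ _).2 ?_, rfl⟩
    rw [hQ]
    exact mem_FD_smul _ hP

theorem Adapted.exists_smul_gen (H : ℓ.Adapted J t) {i : Fin (n + 1)} (hi : i ∈ ℓ.E)
    (m : Fin (n + 1) → ℕ) (c : Ideal A) (x : (relFields J t).H0 (Ideal.span {ℓ.mono m}) c n) :
    ∃ P : DR A, x = P • H.gen hi m c := by
  obtain ⟨φ, h, rfl⟩ := cls_surjective x
  obtain ⟨Q, hQ⟩ := (mem_K_iff_ev (H.basis hi)).1 h
  exact ⟨Q.op, H.smul_gen_eq hi m c h hQ⟩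

/-- The symbols of the relative logarithmic fields, as elements of the graded ring. -/
theorem symDer_diag (hE : ℓ.Centered) {i : Fin (n + 1)} (hi : i ∈ ℓ.E) {j : Fin (n + 1)}
    (hj : j ≠ i) : symDer (ℓ.diag (ℓ.wt i j)) =
      ℓ.toCoords.grVarRing.sg ℓ.E (fun j => symFun A (ℓ.symCoeff j)) i j := by
  refine ℓ.toCoords.grEquiv.injective ?_
  have h1 := sym_twist hE hi hj 0
  have h2 : ℓ.twist (ℓ.wt i j) 0 = derD (ℓ.diag (ℓ.wt i j)) := by
    rw [twist, show ℓ.wgt (ℓ.wt i j) 0 = 0 by simp [wgt], map_zero, add_zero]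
  have h3 : (derD (ℓ.diag (ℓ.wt i j))).toEnd = (ℓ.diag (ℓ.wt i j) : A →ₗ[ℂ] A) := rfl
  rw [h2, h3, sym_derivation] at h1
  rw [ℓ.toCoords.grEquiv_symDer, h1, VarRing.sg, VarRing.sg]
  have hv : ∀ k, ℓ.toCoords.grEquiv (ℓ.toCoords.grVarRing.var k) = ℓ.toCoords.polyVarRing.var k :=
    fun k => ℓ.toCoords.grEquiv.apply_symm_apply _
  split_ifs <;> simp only [map_sub, map_mul, hv, ℓ.toCoords.grEquiv_symFun]

theorem symFun_one' (𝔠 : Coords A (Fin (n + 1))) : symFun A 1 = 1 :=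
  𝔠.grEquiv.injective (by rw [𝔠.grEquiv_symFun, map_one, map_one])

theorem symFun_mono (hE : ℓ.Centered) (k : Fin (n + 1) → ℕ) :
    symFun A (ℓ.mono k) = ℓ.toCoords.grVarRing.mon ℓ.E k := by
  refine ℓ.toCoords.grEquiv.injective ?_
  rw [ℓ.toCoords.grEquiv_symFun, mono, VarRing.mon, map_prod, map_prod]
  refine Finset.prod_congr rfl fun l hl => ?_
  rw [map_pow, map_pow, ℓ.toCoords.grVarRing_inl, ℓ.toCoords.grEquiv_symFun, hE l hl]

theorem isUnit_symFun (𝔠 : Coords A (Fin (n + 1))) {g : A} (hg : IsUnit g) :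
    IsUnit (symFun A g) := by
  obtain ⟨u, rfl⟩ := hg
  refine IsUnit.of_mul_eq_one (symFun A ↑u⁻¹) ?_
  rw [← symFun_mul, Units.mul_inv, symFun_one' 𝔠]

/-- The generator is the monomial times the top form with value `1` on the basis. It is killed by
the monomial `mono k` and by the twisted fields. That the symbols of these relations generate the
whole ideal is strictness: an operator of order `l` that sends the generator into a smaller step is,
up to lower order, a combination of the relations in which no term exceeds order `l`. The module
`M'` is left free so that the result also applies to filtered modules isomorphic to the cohomology.
-/
theorem Adapted.cycle_H0 (H : ℓ.Adapted J t) (hE : ℓ.Centered) (hne : ℓ.E.Nonempty)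
    (m k : Fin (n + 1) → ℕ) {M' : Type*} [AddCommGroup M'] [Module (DR A) M'] (Φ' : Filt A M')
    (ψ : (relFields J t).H0 (Ideal.span {ℓ.mono m}) (Ideal.span {ℓ.mono (m + k)}) n ≃ₗ[DR A] M')
    (hψ : ∀ l x, x ∈ ((relFields J t).H0Filt _ _ n).F l ↔ ψ x ∈ Φ'.F l) :
    Φ'.IsGood ∧ Φ'.charCycle =
      ∑ K ∈ ℓ.E.powerset, (∑ j ∈ K, k j) • conormalCycle (Ideal.span (ℓ.w '' K)) := by
  obtain ⟨i, hi⟩ := hne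
  set b := H.basis hi with hb
  have hg : ℓ.mono m ≠ 0 := ℓ.mono_ne_zero m
  have : IsDomain (GrD A) := ℓ.toCoords.isDomain_GrD
  let R := ℓ.toCoords.grVarRing
  let a : Fin (n + 1) → GrD A := fun j => symFun A (ℓ.symCoeff j)
  have hG : Ideal.span ({symFun A (ℓ.mono k)} ∪ Set.range fun j : Fin n =>
      symDer (ℓ.diag (ℓ.wt i (i.succAbove j)))) =
      Ideal.span {R.mon ℓ.E k} ⊔ R.sgIdl ℓ.E a i := by
    rw [Ideal.span_union, symFun_mono hE, VarRing.sgIdl]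
    congr 2
    ext σ
    constructor
    · rintro ⟨j, rfl⟩
      exact ⟨i.succAbove j, by simp [Fin.succAbove_ne],
        (symDer_diag hE hi (Fin.succAbove_ne i j)).symm⟩
    · rintro ⟨j, hj, rfl⟩
      obtain ⟨j', rfl⟩ := Fin.exists_succAbove_eq (y := i) (x := j) (by simpa using hj)
      exact ⟨j', symDer_diag hE hi (Fin.succAbove_ne i j')⟩
  have hcyc := R.cycle_mon ℓ.E a (fun j => isUnit_symFun ℓ.toCoords (isUnit_symCoeff j)) hi k
  have C : Filt.Cyclic ((relFields J t).H0Filt (Ideal.span {ℓ.mono m})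
    (Ideal.span {ℓ.mono (m + k)}) n) (H.gen hi m _) n ({symFun A (ℓ.mono k)} ∪
      Set.range fun j : Fin n => symDer (ℓ.diag (ℓ.wt i (i.succAbove j)))) := by
    refine ⟨H.exists_smul_gen hi m _, H.mem_H0Filt_iff hi m _, ?_, ?_⟩
    · rintro σ (rfl | ⟨j, rfl⟩)
      · refine ⟨0, ⟨(toD (ℓ.mono k)).op, toD_mem _⟩, rfl, ?_⟩
        convert zero_mem (((relFields J t).H0Filt (Ideal.span {ℓ.mono m})
          (Ideal.span {ℓ.mono (m + k)}) n).F _) using 1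
        rw [gen, cls_smul, cls_eq_zero_iff]
        refine Submodule.mem_sup_left ((mem_K_iff_ev b).2 ⟨1, ?_⟩)
        rw [ev_smul, ev_smulA, ev_topForm, mono_add, smul_mul_D, one_mul, mul_smul]
        congr 1
      · refine ⟨1, ⟨(derD (ℓ.diag (ℓ.wt i (i.succAbove j)))).op, derD_mem _⟩, rfl, ?_⟩
        set κ := ℓ.wgt (ℓ.wt i (i.succAbove j)) m with hκ
        -- The twisted field kills the generator, so the field itself acts on it through the
        -- constant `-κ`, an operator of order zero instead of one.
        have h0 : (ℓ.twist (ℓ.wt i (i.succAbove j)) m).op • H.gen hi m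
            (Ideal.span {ℓ.mono (m + k)}) = 0 := by
          rw [gen, cls_smul, cls_eq_zero_iff]
          refine Submodule.mem_sup_right (mem_bdry_of_ev b (H.basis_comm hi) (η := Pi.single j 1) ?_)
          rw [ev_smul, ev_smulA, ev_topForm, Finset.sum_eq_single j, Pi.single_eq_same,
            H.basis_apply, derD_mul_mono, smul_mul_D, one_mul, mul_one]
          · rfl
          · intro j' _ hj'
            rw [Pi.single_eq_of_ne hj', smul_zero, mul_zero]
          · simp
        have h1 : (derD (ℓ.diag (ℓ.wt i (i.succAbove j)))).op • H.gen hi m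
            (Ideal.span {ℓ.mono (m + k)}) = (-(algebraMap ℂ (D A) κ)).op • H.gen hi m _ := by
          rw [← sub_eq_zero, ← sub_smul, ← h0]
          congr 1
          change (derD _ - -algebraMap ℂ (D A) κ).op = _
          rw [sub_neg_eq_add]
          rfl
        rw [h1, H.mem_H0Filt_iff hi]
        refine ⟨_, ?_, rfl⟩
        rw [show (1 : ℤ) - 1 - n + n = 0 by ring]
        refine (FD A 0).neg_mem (x := (algebraMap ℂ (D A) κ).op) ?_
        rw [algebraMap_eq]
        exact toD_mem _
    · intro l P hP
      obtain ⟨Q, hQ, e⟩ := (H.mem_H0Filt_iff hi m _ _ _).1 hP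
      rw [show l - 1 - (n : ℤ) + n = l - 1 by ring] at hQ
      rw [← sub_eq_zero, ← sub_smul, gen, cls_smul, cls_eq_zero_iff] at e
      have hev : ev b ((P.1 - Q) • ℓ.mono m • topForm b 1) = ℓ.mono m • (P.1 - Q).unop := by
        rw [ev_smul, ev_smulA, ev_topForm, smul_mul_D, one_mul]
      have hPQ : P.1 - Q ∈ FD A l := sub_mem P.2 (FD_mono (by omega) hQ)
      obtain ⟨χ, hχ, hB⟩ := (H.filteredAcyclic hE m k).strict (l - n) _
        ⟨(mem_K_iff_ev b).2 ⟨_, hev⟩, (ev_mem_FD b _ _).2 (by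
          rw [hev, sub_add_cancel]; exact mem_FD_smul _ hPQ)⟩ e
      obtain ⟨S, hS⟩ := (mem_K_iff_ev b).1 hχ.1
      obtain ⟨η, hη, eη⟩ := exists_of_mem_FB b (H.basis_comm hi) hB
      have hSO : S.op ∈ FD A l := by
        rw [op_mem_FD, ← DO_smul_iff (ℓ.mono_ne_zero (m + k)), ← hS, ← op_mem_FD]
        have := (ev_mem_FD b _ _).1 hχ.2
        rwa [sub_add_cancel] at this
      have hηO : ∀ j, (η j).op ∈ FD A (l - 1) := by
        intro j
        rw [op_mem_FD, ← DO_smul_iff hg, ← op_mem_FD]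
        have := hη j
        rwa [sub_add_cancel] at this
      -- Dividing by the monomial turns the decomposition of forms into one of operators, and the
      -- bounds on `S` and `η` survive because this division preserves orders.
      have eP : (P.1 - Q).unop = ℓ.mono k • S +
          ∑ j, ℓ.twist (ℓ.wt i (i.succAbove j)) m * η j := by
        refine smul_D_cancel hg ?_
        rw [ev_sub, hev, hS, sub_eq_iff_eq_add'] at eη
        rw [eη, smul_add, smul_smul, mono_add, Finset.smul_sum]
        congr 1
        refine Finset.sum_congr rfl fun j _ => ?_
        rw [H.basis_apply, derD_mul_mono]
      let P₁ : FD A l := ⟨(ℓ.mono k • S).op, mem_FD_smul _ hSO⟩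
      have hθ : ∀ j, (derD (ℓ.diag (ℓ.wt i (i.succAbove j))) * η j).op ∈ FD A l := fun j => by
        have := mem_FD_derD_mul (ℓ.diag (ℓ.wt i (i.succAbove j))) (hηO j)
        rwa [sub_add_cancel] at this
      let P₂ : Fin n → FD A l := fun j => ⟨_, hθ j⟩
      -- `Q` and the constants in the twists only contribute in order less than `l`, so they drop
      -- out of the symbol.
      refine symb_mem_of_eq (Q := P₁ + ∑ j, P₂ j) ?_ ?_
      · have e3 : P.1 - ((P₁ + ∑ j, P₂ j : FD A l) : DR A) = Q + (∑ j,
            algebraMap ℂ (D A) (ℓ.wgt (ℓ.wt i (i.succAbove j)) m) * η j).op := by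
          have e4 : ((∑ j, P₂ j : FD A l) : DR A) =
              (∑ j, derD (ℓ.diag (ℓ.wt i (i.succAbove j))) * η j).op := by
            rw [AddSubmonoidClass.coe_finsetSum]
            exact (map_sum (MulOpposite.opAddEquiv : D A ≃+ (D A)ᵐᵒᵖ)
              (fun j => derD (ℓ.diag (ℓ.wt i (i.succAbove j))) * η j) Finset.univ).symm
          rw [AddSubgroup.coe_add, e4]
          refine MulOpposite.unop_injective ?_
          change P.1.unop - (ℓ.mono k • S + ∑ j, derD (ℓ.diag (ℓ.wt i (i.succAbove j))) * η j) =
            Q.unop + ∑ j, algebraMap ℂ (D A) (ℓ.wgt (ℓ.wt i (i.succAbove j)) m) * η j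
          have e5 : P.1.unop - Q.unop = _ := eP
          simp only [twist, add_mul, Finset.sum_add_distrib] at e5
          rw [sub_eq_iff_eq_add] at e5
          rw [e5]
          abel
        rw [e3]
        refine add_mem hQ (mem_FD_sum fun j _ => ?_)
        rw [algebraMap_eq]
        exact mem_FD_smul _ (hηO j)
      · rw [symb_add]
        refine add_mem ?_ (symb_sum_mem _ fun j _ => ?_)
        · have : symb l P₁ = symb l ⟨_, hSO⟩ * symFun A (ℓ.mono k) := by
            rw [symFun, symb_mul]
            exact congrArg GrD.mk (reesOf_congr (by ring) _ _ rfl)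
          rw [this]
          exact Ideal.mul_mem_left _ _ (Ideal.subset_span (.inl rfl))
        · have : symb l (P₂ j) = symb (l - 1) ⟨_, hηO j⟩ *
              symDer (ℓ.diag (ℓ.wt i (i.succAbove j))) := by
            rw [symDer, symb_mul]
            exact congrArg GrD.mk (reesOf_congr (by ring) _ _ rfl)
          rw [this]
          exact Ideal.mul_mem_left _ _ (Ideal.subset_span (.inr ⟨j, rfl⟩))
  have key := (C.map ψ hψ).isGood_charCycle
  refine ⟨key.1, key.2.trans ?_⟩
  rw [hG, hcyc]
  refine Finset.sum_congr rfl fun K _ => ?_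
  rw [conormalCycle, ℓ.toCoords.conormalIdeal_eq]

end LogCoords
end

/-! ### The operator `R` as left multiplication by an Euler field. -/

namespace Fields
variable {A : Type*} [CommRing A] [Algebra ℂ A] {L : Fields A}

theorem d_of_comm {p : ℕ} (φ : L.Form p) {θ : Fin (p + 1) → L.T}
    (h : ∀ i j, L.br (θ i) (θ j) = 0) : d φ θ = ∑ i : Fin (p + 1),
      (-1 : ℤ) ^ (i : ℕ) • (derD (θ i : Derivation ℂ A A) * φ (i.removeNth θ)) := by
  rw [d]
  refine Finset.sum_congr rfl fun i _ => ?_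
  rw [Finset.sum_eq_zero, sub_zero]
  intro j hj
  rw [h]
  obtain ⟨k, rfl⟩ := Fin.exists_succAbove_eq (Finset.mem_Ioi.1 hj).ne'
  rw [Fin.removeNth_update_succAbove]
  exact AlternatingMap.map_coord_zero (φ : L.T [⋀^Fin p]→ₗ[A] D A) k (by simp)

theorem form_apply_eq_det {n : ℕ} (b : Module.Basis (Fin n) A L.T) (φ : L.Form n)
    (v : Fin n → L.T) : φ v = b.det v • φ b := by
  let ψ : L.Form n := ((LinearMap.toSpanSingleton A (D A) (φ b)).compAlternatingMap b.det :
    L.T [⋀^Fin n]→ₗ[A] D A)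
  have h : φ = ψ := ev_injective b (by
    rw [ev_eq, ev_eq]
    change φ b = b.det b • φ b
    rw [Module.Basis.det_self, one_smul])
  exact congrArg (fun χ : L.Form n => χ v) h

end Fields

section
variable {A : Type*} [CommRing A] [Algebra ℂ A] [IsDomain A] {n : ℕ} {ℓ : LogCoords A n}
  {J : Ideal A} {t : A}
open Fields

namespace LogCoords

variable (ℓ) in
/-- The logarithmic field `u_i ∂_i / e_i`. -/
def eulD (i : Fin (n + 1)) : D A := derD (ℓ.diag (ℓ.eul i))

/-- The basis of the logarithmic fields extending that of the relative logarithmic fields. -/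
theorem Adapted.exists_logBasis (H : ℓ.Adapted J t) {i : Fin (n + 1)} (hi : i ∈ ℓ.E) :
    ∃ b : Module.Basis (Fin (n + 1)) A (logFields J).T,
      (b 0 : Derivation ℂ A A) = ℓ.diag (ℓ.eul i) ∧
      (∀ m : Fin n, (b m.succ : Derivation ℂ A A) = H.basis hi m) ∧
      ∀ θ : (logFields J).T, (θ : Derivation ℂ A A) t = b.repr θ 0 * t := by
  have ht : t ≠ 0 := by rw [H.t_eq]; exact ℓ.mono_ne_zero _
  have h0 : ℓ.diag (ℓ.eul i) t = t := by
    rw [H.t_eq, diag_mono, ℓ.wgt_eul_e hi, map_one, one_mul]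
  let N : Submodule A (logFields J).T := (relFields J t).T.comap (logFields J).T.subtype
  let bN : Module.Basis (Fin n) A N :=
    (H.basis hi).map (Submodule.comapSubtypeEquivOfLe (relFields_le J t)).symm
  let θ₀ : (logFields J).T := ⟨ℓ.diag (ℓ.eul i), H.diag_mem_log _⟩
  let b : Module.Basis (Fin (n + 1)) A (logFields J).T := Module.Basis.mkFinCons θ₀ bN (by
      intro c x hx h
      have h1 : (x : Derivation ℂ A A) t = 0 := hx.2
      have h2 := congrArg (fun θ : (logFields J).T => (θ : Derivation ℂ A A) t) h
      change c * ℓ.diag (ℓ.eul i) t + (x : Derivation ℂ A A) t = 0 at h2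
      rw [h0, h1, add_zero] at h2
      exact (mul_eq_zero.1 h2).resolve_right ht) (by
      intro θ
      obtain ⟨c, hc⟩ := H.exists_coeff θ.2
      refine ⟨-∑ l ∈ ℓ.E, c l * ℓ.e l, ⟨(θ + (-∑ l ∈ ℓ.E, c l * ℓ.e l) • θ₀).2, ?_⟩⟩
      change (θ : Derivation ℂ A A) t + -(∑ l ∈ ℓ.E, c l * ℓ.e l) * ℓ.diag (ℓ.eul i) t = 0
      rw [H.apply_t hc, h0]
      ring)
  have hb0 : b 0 = θ₀ := by rw [Module.Basis.coe_mkFinCons]; rfl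
  have hbs : ∀ m : Fin n, (b m.succ : Derivation ℂ A A) = H.basis hi m := fun m => by
    rw [Module.Basis.coe_mkFinCons]; rfl
  -- The Euler field fixes `t` and the relative fields kill it, so the coefficient of the Euler
  -- field is the value of `dt/t`.
  refine ⟨b, by rw [hb0], hbs, fun θ => ?_⟩
  have h3 : (θ : Derivation ℂ A A) t = ∑ k, b.repr θ k * (b k : Derivation ℂ A A) t := by
    conv_lhs => rw [← b.sum_repr θ]
    rw [AddSubmonoidClass.coe_finsetSum, derivation_sum_apply]
    rfl
  rw [h3, Fin.sum_univ_succ, hb0, Finset.sum_eq_zero, add_zero]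
  · exact congrArg _ h0
  · intro k _
    rw [hbs, (H.basis hi k).2.2, mul_zero]

theorem Adapted.mk_eq_iff (H : ℓ.Adapted J t) {i : Fin (n + 1)} (hi : i ∈ ℓ.E)
    (φ ψ : (relFields J t).Form n) : M.mk J t φ = M.mk J t ψ ↔ ∃ (Q : D A) (η : Fin n → D A),
      ev (H.basis hi) φ - ev (H.basis hi) ψ =
        t • Q + ∑ k, derD (H.basis hi k : Derivation ℂ A A) * η k := by
  rw [← sub_eq_zero, M.mk, M.mk, cls_sub, cls_eq_zero_iff, Submodule.mem_sup]
  constructor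
  · rintro ⟨κ, hκ, β, hβ, e⟩
    obtain ⟨Q, hQ⟩ := (mem_K_iff_ev (H.basis hi)).1 hκ
    rw [← Ideal.span_singleton_one, mem_bdry_iff_ev (H.basis hi) (H.basis_comm hi)] at hβ
    obtain ⟨η, hη⟩ := hβ
    refine ⟨Q, η, ?_⟩
    rw [← ev_sub, ← e, ev_add, hQ, hη]
    simp only [one_smul]
  · rintro ⟨Q, η, e⟩
    refine ⟨topForm (H.basis hi) (t • Q), (mem_K_iff_ev (H.basis hi)).2 ⟨Q, ev_topForm _ _⟩,
      topForm (H.basis hi) (∑ k, derD (H.basis hi k : Derivation ℂ A A) * η k), ?_, ?_⟩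
    · rw [← Ideal.span_singleton_one, mem_bdry_iff_ev (H.basis hi) (H.basis_comm hi)]
      exact ⟨η, by simp only [ev_topForm, one_smul]⟩
    · exact ev_injective (H.basis hi) (by rw [ev_add, ev_topForm, ev_topForm, ev_sub, e])

theorem Adapted.eulD_mul_t (H : ℓ.Adapted J t) (i : Fin (n + 1)) (Q : D A) :
    ℓ.eulD i * t • Q = t • (ℓ.twist (ℓ.eul i) ℓ.e * Q) := by
  rw [H.t_eq, eulD, derD_mul_mono]

theorem Adapted.eulD_mul_basis (H : ℓ.Adapted J t) {i : Fin (n + 1)} (hi : i ∈ ℓ.E)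
    (j : Fin (n + 1)) (k : Fin n) :
    ℓ.eulD j * derD (H.basis hi k : Derivation ℂ A A) =
      derD (H.basis hi k : Derivation ℂ A A) * ℓ.eulD j := by
  rw [eulD, H.basis_apply, derD_diag_comm]

theorem M.mk_add (φ ψ : (relFields J t).Form n) : M.mk J t (φ + ψ) = M.mk J t φ + M.mk J t ψ := rfl

theorem M.mk_smul (P : DR A) (φ : (relFields J t).Form n) : M.mk J t (P • φ) = P • M.mk J t φ := rfl

theorem M.mk_surjective : Function.Surjective (M.mk J t (n := n)) := fun x => by
  obtain ⟨φ, h, rfl⟩ := cls_surjective x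
  exact ⟨φ, rfl⟩

/-- The operator induced by left multiplication with the Euler field. -/
theorem Adapted.exists_eulOp (H : ℓ.Adapted J t) {i : Fin (n + 1)} (hi : i ∈ ℓ.E) :
    ∃ R : M J t n →ₗ[DR A] M J t n, ∀ φ : (relFields J t).Form n,
      R (M.mk J t φ) = M.mk J t (topForm (H.basis hi) (ℓ.eulD i * ev (H.basis hi) φ)) := by
  let b := H.basis hi
  choose f hf using M.mk_surjective (J := J) (t := t) (n := n)
  have key : ∀ φ ψ, M.mk J t φ = M.mk J t ψ →
      M.mk J t (topForm b (ℓ.eulD i * ev b φ)) = M.mk J t (topForm b (ℓ.eulD i * ev b ψ)) := by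
    intro φ ψ h
    rw [H.mk_eq_iff hi] at h ⊢
    obtain ⟨Q, η, e⟩ := h
    -- The Euler field commutes with the basis fields and maps `t D` into itself, so left
    -- multiplication by it respects the relations of `M`.
    refine ⟨ℓ.twist (ℓ.eul i) ℓ.e * Q, fun k => ℓ.eulD i * η k, ?_⟩
    rw [ev_topForm, ev_topForm, ← mul_sub, e, mul_add, H.eulD_mul_t, Finset.mul_sum]
    simp only [← mul_assoc, H.eulD_mul_basis hi]
  refine ⟨{ toFun := fun x => M.mk J t (topForm b (ℓ.eulD i * ev b (f x)))
            map_add' := fun x y => ?_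
            map_smul' := fun P x => ?_ }, fun φ => key _ _ (hf _)⟩
  · rw [← M.mk_add, key (f (x + y)) (f x + f y) (by rw [M.mk_add, hf, hf, hf])]
    congr 1
    exact ev_injective b (by
      rw [ev_topForm, ev_add, mul_add, ev_add, ev_topForm, ev_topForm])
  · rw [RingHom.id_apply, ← M.mk_smul, key (f (P • x)) (P • f x) (by rw [M.mk_smul, hf, hf])]
    congr 1
    exact ev_injective b (by
      rw [ev_topForm, ev_smul, ev_smul, ev_topForm, mul_assoc])

/-- Evaluate the relation between `α` and `β` on the Euler field followed by the relative basis. As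
`dt/t` is `1` on the first and `0` on the others, the right side is the value of `β` on the relative
basis. The left side is the Euler field times that of `α`, plus multiples from the left by relative
fields, which are boundaries. -/
theorem Adapted.isResidue_of_eul (H : ℓ.Adapted J t) {i : Fin (n + 1)} (hi : i ∈ ℓ.E)
    {R : M J t n →ₗ[DR A] M J t n} (hR : ∀ φ : (relFields J t).Form n,
      R (M.mk J t φ) = M.mk J t (topForm (H.basis hi) (ℓ.eulD i * ev (H.basis hi) φ))) :
    IsResidue J t n R := by
  intro α β h
  obtain ⟨b, hb0, hbs, hbt⟩ := H.exists_logBasis hi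
  have ht : t ≠ 0 := by rw [H.t_eq]; exact ℓ.mono_ne_zero _
  have hcomm : ∀ k l, (logFields J).br (b k) (b l) = 0 := by
    have hd : ∀ k, ∃ c, (b k : Derivation ℂ A A) = ℓ.diag c := by
      intro k
      refine Fin.cases ⟨_, hb0⟩ (fun m => ⟨_, (hbs m).trans (H.basis_apply hi m)⟩) k
    intro k l
    obtain ⟨c, hc⟩ := hd k
    obtain ⟨c', hc'⟩ := hd l
    refine Subtype.ext ?_
    change ⁅(b k : Derivation ℂ A A), (b l : Derivation ℂ A A)⁆ = 0
    rw [hc, hc', diag_comm]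
  have h1 := h b (fun k => if k = 0 then 1 else 0) (fun k => by
    rw [hbt, b.repr_self, Finsupp.single_apply])
  rw [d_of_comm α hcomm, Fin.sum_univ_succ, Fin.sum_univ_succ] at h1
  have hres : ∀ γ : (logFields J).Form n,
      ev (H.basis hi) (res J t γ) = γ ((0 : Fin (n + 1)).removeNth b) := by
    intro γ
    rw [ev_eq]
    change γ (fun k => Submodule.inclusion (relFields_le J t) (H.basis hi k)) = _
    congr 1
    ext1 k
    exact Subtype.ext (hbs k).symm
  rw [hR, H.mk_eq_iff hi, ev_topForm, hres, hres]
  simp only [Fin.val_zero, pow_zero, one_smul, if_true, Fin.succ_ne_zero, if_false, zero_smul,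
    smul_zero, Finset.sum_const_zero, add_zero] at h1
  refine ⟨0, fun k => -((-1 : ℤ) ^ (k.succ : ℕ) • α (k.succ.removeNth b)), ?_⟩
  rw [← h1, hb0, smul_zero, zero_add]
  simp only [hbs, mul_neg, mul_smul_comm, Finset.sum_neg_distrib]
  rw [eulD]
  abel

/-- Uniqueness requires that every class of `M` be reached by an admissible pair. Let `δ` be the
`n`-form that is `1` on the relative basis and is annihilated by the Euler field. For a coefficient
`P` the pair is `δ • P` and `δ` times the Euler field composed with `P`. -/
theorem Adapted.eq_eul_of_isResidue (H : ℓ.Adapted J t) {i : Fin (n + 1)} (hi : i ∈ ℓ.E)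
    {R : M J t n →ₗ[DR A] M J t n} (hR : IsResidue J t n R) (φ : (relFields J t).Form n) :
    R (M.mk J t φ) = M.mk J t (topForm (H.basis hi) (ℓ.eulD i * ev (H.basis hi) φ)) := by
  obtain ⟨b, hb0, hbs, hbt⟩ := H.exists_logBasis hi
  have ht : t ≠ 0 := by rw [H.t_eq]; exact ℓ.mono_ne_zero _
  let δ : (logFields J).T [⋀^Fin n]→ₗ[A] A :=
    (Matrix.detRowAlternating : (Fin n → A) [⋀^Fin n]→ₗ[A] A).compLinearMap
      (LinearMap.pi fun k : Fin n => b.coord k.succ)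
  have hδ : ∀ v, δ v = Matrix.det (Matrix.of fun r k : Fin n => b.repr (v r) k.succ) :=
    fun v => rfl
  let mk : D A → (logFields J).Form n := fun P =>
    ((LinearMap.toSpanSingleton A (D A) P).compAlternatingMap δ :
      (logFields J).T [⋀^Fin n]→ₗ[A] D A)
  have hmk : ∀ P v, mk P v = δ v • P := fun P v => rfl
  have hδ1 : δ ((0 : Fin (n + 1)).removeNth b) = 1 := by
    rw [hδ]
    convert Matrix.det_one (n := Fin n) (R := A)
    ext r k
    simp [Fin.removeNth, Matrix.one_apply, Finsupp.single_apply]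
  have hδ0 : ∀ k : Fin n, δ (k.succ.removeNth b) = 0 := by
    intro k
    rcases n with _ | n
    · exact k.elim0
    rw [hδ]
    refine Matrix.det_eq_zero_of_row_eq_zero 0 fun l => ?_
    simp [Fin.removeNth]
  have hres : ∀ P, res J t (mk P) = topForm (H.basis hi) P := by
    intro P
    refine ev_injective (H.basis hi) ?_
    rw [ev_topForm, ev_eq]
    change mk P (fun k => Submodule.inclusion (relFields_le J t) (H.basis hi k)) = P
    rw [hmk, show (fun k => Submodule.inclusion (relFields_le J t) (H.basis hi k)) =
      (0 : Fin (n + 1)).removeNth b from funext fun k => Subtype.ext (hbs k).symm, hδ1, one_smul]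
  have hcomm : ∀ k l, (logFields J).br (b k) (b l) = 0 := by
    have hd : ∀ k, ∃ c, (b k : Derivation ℂ A A) = ℓ.diag c := by
      intro k
      refine Fin.cases ⟨_, hb0⟩ (fun m => ⟨_, (hbs m).trans (H.basis_apply hi m)⟩) k
    intro k l
    obtain ⟨c, hc⟩ := hd k
    obtain ⟨c', hc'⟩ := hd l
    refine Subtype.ext ?_
    change ⁅(b k : Derivation ℂ A A), (b l : Derivation ℂ A A)⁆ = 0
    rw [hc, hc', diag_comm]
  have := hR (mk (ev (H.basis hi) φ)) (mk (ℓ.eulD i * ev (H.basis hi) φ)) (by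
    intro θ c hc
    have hc' : ∀ k, c k = b.repr (θ k) 0 := fun k =>
      mul_right_cancel₀ ht ((hc k).symm.trans (hbt (θ k)))
    rw [← dForm_apply, form_apply_eq_det b, dForm_apply, d_of_comm _ hcomm, Fin.sum_univ_succ]
    simp only [hmk, hδ0, hδ1, zero_smul, mul_zero, smul_zero, Finset.sum_const_zero, add_zero,
      Fin.val_zero, pow_zero, one_smul]
    rw [hb0, Module.Basis.det_apply, Matrix.det_succ_row_zero, Finset.sum_smul]
    refine Finset.sum_congr rfl fun k _ => ?_
    have hz : ∀ x : D A, (-1 : ℤ) ^ (k : ℕ) • x = (-1 : A) ^ (k : ℕ) • x := fun x => by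
      rcases Nat.even_or_odd (k : ℕ) with h | h <;> simp [h.neg_one_pow]
    rw [hz, hc', hδ, ← Matrix.det_transpose, mul_smul, mul_smul]
    rfl)
  rwa [hres, hres, topForm_ev] at this

end LogCoords
end

/-! ### Generalized eigenspaces and polynomials in an endomorphism. -/

section
variable {A : Type*} [CommRing A] [Algebra ℂ A] {M : Type*} [AddCommGroup M] [Module (DR A) M]

theorem scalar_apply (c : ℂ) (m : M) : scalar (A := A) c m = algebraMap ℂ (DR A) c • m := rfl

/-- Polynomials in an endomorphism. -/
def polyEnd (R : Module.End (DR A) M) : Polynomial ℂ →+* Module.End (DR A) M :=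
  Polynomial.eval₂RingHom'
    { toFun := scalar
      map_one' := LinearMap.ext fun m => by rw [scalar_apply, map_one, one_smul]; rfl
      map_mul' := fun c c' => LinearMap.ext fun m => by
        rw [scalar_apply, map_mul, mul_smul]; rfl
      map_zero' := LinearMap.ext fun m => by rw [scalar_apply, map_zero, zero_smul]; rfl
      map_add' := fun c c' => LinearMap.ext fun m => by
        rw [scalar_apply, map_add, add_smul]; rfl } R
    fun c => LinearMap.ext fun m => (map_smul R (algebraMap ℂ (DR A) c) m).symm

/-- The polynomial `X - c`. -/
abbrev lin (c : ℝ) : Polynomial ℂ := Polynomial.X - Polynomial.C (c : ℂ)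

theorem polyEnd_lin (R : Module.End (DR A) M) (c : ℝ) : polyEnd R (lin c) = R - scalar (c : ℂ) := by
  rw [map_sub]
  congr 1
  · exact Polynomial.eval₂_X _ _
  · exact Polynomial.eval₂_C _ _

theorem lin_coprime {c c' : ℝ} (h : c ≠ c') (a b : ℕ) : IsCoprime (lin c ^ a) (lin c' ^ b) := by
  refine IsCoprime.pow (Polynomial.isCoprime_X_sub_C_of_isUnit_sub ?_)
  exact (sub_ne_zero.2 fun e => h (Complex.ofReal_injective e)).isUnit

theorem ker_le_genEigen (R : Module.End (DR A) M) {S : Set ℝ} {c : ℝ} (hc : c ∈ S) (k : ℕ) :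
    LinearMap.ker ((R - scalar (c : ℂ)) ^ k) ≤ genEigen R S :=
  le_trans (le_iSup (fun k => LinearMap.ker ((R - scalar (c : ℂ)) ^ k)) k)
    (le_iSup₂ (f := fun c (_ : c ∈ S) => ⨆ k : ℕ, LinearMap.ker ((R - scalar (c : ℂ)) ^ k)) c hc)

/-- Distinct linear factors are coprime; a Bézout relation splits `x` into a part killed by a power
of one factor and a part killed by the product of the others. -/
theorem mem_genEigen_of_finset (R : Module.End (DR A) M) {S : Set ℝ} (k : ℝ → ℕ) (T : Finset ℝ)
    (hT : ∀ c ∈ T, c ∈ S) {x : M} (h : polyEnd R (∏ c ∈ T, lin c ^ k c) x = 0) :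
    x ∈ genEigen R S := by
  classical
  induction T using Finset.induction_on generalizing x with
  | empty =>
    rw [Finset.prod_empty, map_one] at h
    rw [show x = 0 from h]
    exact zero_mem _
  | insert c T hc ih =>
    rw [Finset.prod_insert hc] at h
    obtain ⟨a, b, e⟩ : IsCoprime (lin c ^ k c) (∏ c ∈ T, lin c ^ k c) :=
      IsCoprime.prod_right fun c' hc' => lin_coprime (fun e : c = c' => hc (by rw [e]; exact hc')) _ _
    have hx : x = polyEnd R (a * lin c ^ k c) x + polyEnd R (b * ∏ c ∈ T, lin c ^ k c) x := by
      rw [← LinearMap.add_apply, ← map_add, e, map_one]; rfl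
    rw [hx]
    refine add_mem (ih (fun c hc => hT c (Finset.mem_insert_of_mem hc)) ?_)
      (ker_le_genEigen R (hT c (Finset.mem_insert_self _ _)) (k c) ?_)
    · rw [← Module.End.mul_apply, ← map_mul, mul_left_comm, map_mul, Module.End.mul_apply,
        mul_comm (∏ c ∈ T, lin c ^ k c), h, map_zero]
    · rw [LinearMap.mem_ker, ← polyEnd_lin, ← map_pow, ← Module.End.mul_apply, ← map_mul,
        mul_left_comm, map_mul, Module.End.mul_apply, h, map_zero]

theorem mem_genEigen_of_multiset (R : Module.End (DR A) M) {S : Set ℝ} (s : Multiset ℝ)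
    (hs : ∀ c ∈ s, c ∈ S) {x : M} (h : polyEnd R (s.map lin).prod x = 0) : x ∈ genEigen R S := by
  classical
  rw [Finset.prod_multiset_map_count] at h
  exact mem_genEigen_of_finset R (fun c => s.count c) _ (fun c hc => hs c (by simpa using hc)) h

/-- The product of the factors from `s` maps everything into `N`, and it is coprime to the powers of
`X - c` for `c ∈ S`. By Bézout, a vector killed by such a power is a polynomial in `R` applied to a
vector of `N`, and `N` is stable. -/
theorem genEigen_le (R : Module.End (DR A) M) {S : Set ℝ} {N : Submodule (DR A) M}
    (hN : ∀ x ∈ N, R x ∈ N) (s : Multiset ℝ) (hs : ∀ c ∈ s, c ∉ S)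
    (h : ∀ x, polyEnd R (s.map lin).prod x ∈ N) : genEigen R S ≤ N := by
  classical
  have hp : ∀ (p : Polynomial ℂ), ∀ x ∈ N, polyEnd R p x ∈ N := by
    intro p
    induction p using Polynomial.induction_on with
    | C a =>
      intro x hx
      rw [show polyEnd R (Polynomial.C a) = scalar a from Polynomial.eval₂_C _ _]
      exact N.smul_mem _ hx
    | add p q hp hq =>
      intro x hx
      rw [map_add]
      exact add_mem (hp x hx) (hq x hx)
    | monomial k a ih =>
      intro x hx
      rw [pow_succ, ← mul_assoc, map_mul,
        show polyEnd R Polynomial.X = R from Polynomial.eval₂_X _ _]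
      exact ih _ (hN x hx)
  refine iSup₂_le fun c hc => iSup_le fun k x hx => ?_
  obtain ⟨a, b, e⟩ : IsCoprime (lin c ^ k) (s.map lin).prod := by
    rw [Finset.prod_multiset_map_count]
    exact IsCoprime.prod_right fun c' hc' =>
      lin_coprime (fun e : c = c' => hs c' (by simpa using hc') (by rw [← e]; exact hc)) _ _
  have hx' : x = polyEnd R (a * lin c ^ k) x + polyEnd R (b * (s.map lin).prod) x := by
    rw [← LinearMap.add_apply, ← map_add, e, map_one]; rfl
  rw [hx', map_mul, map_mul, Module.End.mul_apply, Module.End.mul_apply, map_pow, polyEnd_lin,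
    LinearMap.mem_ker.1 hx, map_zero, zero_add]
  exact hp _ _ (h x)

end

/-! ### The filtration of `M` by monomials and the eigenvalues of `R`. -/

section
variable {A : Type*} [CommRing A] [Algebra ℂ A] [IsDomain A] {n : ℕ} {ℓ : LogCoords A n}
  {J : Ideal A} {t : A}
open Fields

namespace LogCoords

theorem Adapted.existsUnique_residue (H : ℓ.Adapted J t) {i : Fin (n + 1)} (hi : i ∈ ℓ.E) :
    ∃! R, IsResidue J t n R := by
  obtain ⟨R, hR⟩ := H.exists_eulOp hi
  refine ⟨R, H.isResidue_of_eul hi hR, fun R' hR' => LinearMap.ext fun x => ?_⟩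
  obtain ⟨φ, rfl⟩ := M.mk_surjective x
  rw [H.eq_eul_of_isResidue hi hR', hR]

theorem Adapted.residue_mk (H : ℓ.Adapted J t) {i : Fin (n + 1)} (hi : i ∈ ℓ.E)
    (φ : (relFields J t).Form n) : residue J t n (M.mk J t φ) =
      M.mk J t (topForm (H.basis hi) (ℓ.eulD i * ev (H.basis hi) φ)) := by
  have h := (H.existsUnique_residue hi).exists
  refine H.eq_eul_of_isResidue hi ?_ φ
  rw [residue, dif_pos h]
  exact h.choose_spec

variable (ℓ J t) in
/-- The image in `M` of the forms with coefficients in the ideal of the monomial `m`. -/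
def imageM (m : Fin (n + 1) → ℕ) : Submodule (DR A) (M J t n) :=
  ((relFields J t).K (Ideal.span {ℓ.mono m}) n).map
    ({ toFun := M.mk J t, map_add' := fun _ _ => rfl, map_smul' := fun _ _ => rfl } :
      (relFields J t).Form n →ₗ[DR A] M J t n)

theorem mem_imageM {m : Fin (n + 1) → ℕ} {x : M J t n} : x ∈ ℓ.imageM J t m ↔
    ∃ φ ∈ (relFields J t).K (Ideal.span {ℓ.mono m}) n, M.mk J t φ = x := Iff.rfl

theorem imageM_congr {m m' : Fin (n + 1) → ℕ} (h : ∀ l ∈ ℓ.E, m l = m' l) :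
    ℓ.imageM J t m = ℓ.imageM J t m' := by
  rw [imageM, imageM, ℓ.mono_congr h]

theorem imageM_zero : ℓ.imageM J t 0 = ⊤ := by
  refine eq_top_iff.2 fun x _ => ?_
  obtain ⟨φ, rfl⟩ := M.mk_surjective x
  refine ⟨φ, ?_, rfl⟩
  have : ℓ.mono 0 = 1 := by simp [mono]
  rw [this, Ideal.span_singleton_one]
  exact (relFields J t).mem_K_top φ

theorem Adapted.imageM_e (H : ℓ.Adapted J t) : ℓ.imageM J t ℓ.e = ⊥ := by
  refine (Submodule.eq_bot_iff _).2 ?_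
  rintro _ ⟨φ, hφ, rfl⟩
  refine (cls_eq_zero_iff _).2 (Submodule.mem_sup_left ?_)
  have h : Ideal.span {t} = Ideal.span {ℓ.mono ℓ.e} := by rw [← H.t_eq]
  rw [h]
  exact hφ

theorem Adapted.residue_mem (H : ℓ.Adapted J t) (hne : ℓ.E.Nonempty) (m : Fin (n + 1) → ℕ) :
    ∀ x ∈ ℓ.imageM J t m, residue J t n x ∈ ℓ.imageM J t m := by
  obtain ⟨i, hi⟩ := hne
  rintro _ ⟨φ, hφ, rfl⟩
  obtain ⟨Q, hQ⟩ := (mem_K_iff_ev (H.basis hi)).1 hφ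
  refine ⟨_, (mem_K_iff_ev (H.basis hi)).2 ⟨ℓ.twist (ℓ.eul i) m * Q, ?_⟩,
    (H.residue_mk hi φ).symm⟩
  rw [ev_topForm, hQ, eulD, derD_mul_mono]

/-- With base index `i`, the operator `R` is left multiplication by `u_i ∂_i / e_i`. Moved past the
monomial it acquires the constant `m_i / e_i`, and what remains after subtracting that constant has
the additional factor `u_i` in front. -/
theorem Adapted.residue_sub_mem (H : ℓ.Adapted J t) {i : Fin (n + 1)} (hi : i ∈ ℓ.E)
    (m : Fin (n + 1) → ℕ) : ∀ x ∈ ℓ.imageM J t m,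
      (residue J t n - scalar (((m i / ℓ.e i : ℝ) : ℂ)) : Module.End (DR A) (M J t n)) x ∈
        ℓ.imageM J t (m + Pi.single i 1) := by
  rintro _ ⟨φ, hφ, rfl⟩
  obtain ⟨Q, hQ⟩ := (mem_K_iff_ev (H.basis hi)).1 hφ
  set κ : ℂ := ((m i / ℓ.e i : ℝ) : ℂ) with hκ
  have hw : ℓ.wgt (ℓ.eul i) m = κ := by
    rw [ℓ.wgt_eul hi, hκ]
    push_cast
    rfl
  refine ⟨topForm (H.basis hi) (ℓ.eulD i * ev (H.basis hi) φ) - algebraMap ℂ (DR A) κ • φ,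
    (mem_K_iff_ev (H.basis hi)).2 ⟨algebraMap ℂ A (ℓ.e i : ℂ)⁻¹ • (derD (ℓ.der i) * Q), ?_⟩, ?_⟩
  · have h1 : (algebraMap ℂ (DR A) κ).unop = algebraMap ℂ (D A) κ := rfl
    rw [ev_sub, ev_topForm, ev_smul, hQ, h1, ← Algebra.commutes, eulD, derD_mul_mono, twist, hw,
      add_mul, smul_add, algebraMap_eq, ← smul_D_def, ← smul_D_def, smul_comm (ℓ.mono m),
      add_sub_cancel_right, mono_add_single _ _ hi, mul_smul]
    congr 1
    rw [smul_smul, ← smul_mul_D]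
    congr 1
    refine D_ext fun u => ?_
    change ℓ.diag (ℓ.eul i) u = _ * ℓ.der i u
    rw [diag, derivation_sum_apply, Finset.sum_eq_single i]
    · rw [v, if_pos hi, eul, Pi.single_eq_same, mul_comm (ℓ.u i)]
      rfl
    · intro k _ hk
      rw [eul, Pi.single_eq_of_ne hk, map_zero, zero_mul, zero_smul]
      rfl
    · simp
  · change M.mk J t _ = residue J t n (M.mk J t φ) - algebraMap ℂ (DR A) κ • M.mk J t φ
    rw [H.residue_mk hi]
    rfl

/-- Raising the exponents from `m` to `m + k` one at a time, each intermediate exponent `r` of an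
index `j` contributes the root `r / e_j`. -/
theorem Adapted.exists_roots (H : ℓ.Adapted J t) (m k : Fin (n + 1) → ℕ) :
    ∃ s : Multiset ℝ, (∀ c ∈ s, ∃ j ∈ ℓ.E, ∃ r : ℕ, m j ≤ r ∧ r < m j + k j ∧ c = r / ℓ.e j) ∧
      ∀ x ∈ ℓ.imageM J t m, polyEnd (residue J t n) (s.map lin).prod x ∈
        ℓ.imageM J t (m + k) := by
  induction k using monomial_induction ℓ.E with
  | h0 k hk =>
    refine ⟨0, by simp, fun x hx => ?_⟩
    rw [Multiset.map_zero, Multiset.prod_zero, map_one,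
      imageM_congr (m := m + k) (m' := m) fun l hl => by simp [hk l hl]]
    exact hx
  | hs k i hi ih =>
    obtain ⟨s, hs, h⟩ := ih
    refine ⟨((m + k) i / ℓ.e i : ℝ) ::ₘ s, fun c hc => ?_, fun x hx => ?_⟩
    · rcases Multiset.mem_cons.1 hc with rfl | hc
      · exact ⟨i, hi, (m + k) i, by simp, by simp, rfl⟩
      · obtain ⟨j, hj, r, h1, h2, e⟩ := hs c hc
        exact ⟨j, hj, r, h1, lt_of_lt_of_le h2 (by simp), e⟩
    · rw [Multiset.map_cons, Multiset.prod_cons, map_mul, polyEnd_lin, Module.End.mul_apply,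
        ← add_assoc]
      exact H.residue_sub_mem hi (m + k) _ (h x hx)

/-- Modulo the image of the forms divisible by `mono m`, a product of factors `R - r / e_j` with `r
< m j` vanishes, and these roots lie outside `S`. On that image the product with `m j ≤ r < e_j`
vanishes, because forms divisible by `t` are zero in `M`, and these roots lie in `S`. -/
theorem Adapted.genEigen_eq (H : ℓ.Adapted J t) (hne : ℓ.E.Nonempty) {m : Fin (n + 1) → ℕ}
    (hm : ∀ j, m j ≤ ℓ.e j) {S : Set ℝ} (h1 : ∀ j ∈ ℓ.E, ∀ r : ℕ, r < m j → (r / ℓ.e j : ℝ) ∉ S)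
    (h2 : ∀ j ∈ ℓ.E, ∀ r : ℕ, m j ≤ r → r < ℓ.e j → (r / ℓ.e j : ℝ) ∈ S) :
    genEigen (residue J t n) S = ℓ.imageM J t m := by
  refine le_antisymm ?_ fun x hx => ?_
  · obtain ⟨s, hs, h⟩ := H.exists_roots 0 m
    refine genEigen_le _ (H.residue_mem hne m) s (fun c hc => ?_) fun x => ?_
    · obtain ⟨j, hj, r, _, hr, rfl⟩ := hs c hc
      exact h1 j hj r (by simpa using hr)
    · have := h x (by rw [imageM_zero]; trivial)
      rwa [zero_add] at this
  · obtain ⟨s, hs, h⟩ := H.exists_roots m (ℓ.e - m)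
    refine mem_genEigen_of_multiset _ s (fun c hc => ?_) ?_
    · obtain ⟨j, hj, r, hr, hr', rfl⟩ := hs c hc
      exact h2 j hj r hr (by have := hm j; rw [Pi.sub_apply] at hr'; omega)
    · have := h x hx
      rwa [show m + (ℓ.e - m) = ℓ.e from add_tsub_cancel_of_le (a := m) (b := ℓ.e) hm, H.imageM_e,
        Submodule.mem_bot] at this

end LogCoords
end

/-! ### Comparison of the cohomology with subquotients of `M`. -/

namespace Fields
variable {A : Type*} [CommRing A] [Algebra ℂ A] {L : Fields A} {n : ℕ}

theorem K_mono {a a' : Ideal A} (h : a ≤ a') {p : ℕ} : L.K a p ≤ L.K a' p :=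
  fun _ hφ => Submodule.smul_mono_left h hφ

theorem bdry_mono {a a' : Ideal A} (h : a ≤ a') {p : ℕ} : L.bdry a p ≤ L.bdry a' p := by
  rcases p with _ | p
  · exact le_refl _
  · rintro φ ⟨ξ, hξ, e⟩
    exact ⟨ξ, K_mono h hξ, e⟩

/-- The primitive is closed modulo `c`, so exactness in degree `n - 1` replaces it by a primitive
with coefficients in `c`. -/
theorem mem_bdry_of_filteredAcyclic (b : Module.Basis (Fin n) A L.T)
    (hb : ∀ i j, L.br (b i) (b j) = 0) {a c : Ideal A} (h : L.FilteredAcyclic a c n)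
    {φ : L.Form n} (hφ : φ ∈ L.K c n) (hβ : φ ∈ L.bdry a n) : φ ∈ L.bdry c n := by
  have key : ∀ (m : ℕ) (_ : m = n) (φ : L.Form m), φ ∈ L.K c m → φ ∈ L.bdry a m →
      φ ∈ L.bdry c m := by
    intro m hm φ hφ hβ
    rcases m with _ | p
    · exact hβ
    · obtain ⟨ξ, hξ, eξ⟩ := hβ
      have eφ := eq_dForm_iff.1 eξ
      obtain ⟨l, hl⟩ := exists_FK b hξ
      obtain ⟨ξ', hξ', hB⟩ := h.exact l p (by omega) ξ hl ⟨φ, ⟨hφ, fun v => by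
        have := dForm_order b hb hl.2 v
        rwa [add_assoc, ← Nat.cast_succ, ← eφ] at this⟩, fun θ => (eξ θ).symm⟩
      have hd := dForm_FB b hb hB
      rw [dForm_sub, sub_eq_zero] at hd
      exact ⟨ξ', hξ'.1, eq_dForm_iff.2 (eφ.trans hd)⟩
  exact key n rfl φ hφ hβ

end Fields

section
variable {A : Type*} [CommRing A] [Algebra ℂ A] [IsDomain A] {n : ℕ} {ℓ : LogCoords A n}
  {J : Ideal A} {t : A}
open Fields

namespace LogCoords

theorem mono_zero : ℓ.mono 0 = 1 := by simp [mono]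

theorem Adapted.filteredAcyclic_top (H : ℓ.Adapted J t) (hE : ℓ.Centered)
    (m : Fin (n + 1) → ℕ) : (relFields J t).FilteredAcyclic ⊤ (Ideal.span {ℓ.mono m}) n := by
  have := H.filteredAcyclic hE 0 m
  rwa [mono_zero, Ideal.span_singleton_one, zero_add] at this

theorem M.mk_eq_mk_iff {φ ψ : (relFields J t).Form n} : M.mk J t φ = M.mk J t ψ ↔
    φ - ψ ∈ (relFields J t).K (Ideal.span {t}) n ⊔ (relFields J t).bdry ⊤ n := by
  rw [← sub_eq_zero, M.mk, M.mk, cls_sub, cls_eq_zero_iff]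

/-- The cohomology of a quotient of subcomplexes given by monomials is a subquotient of `M`. -/
theorem Adapted.exists_equiv (H : ℓ.Adapted J t) (hE : ℓ.Centered) (hne : ℓ.E.Nonempty)
    {m k : Fin (n + 1) → ℕ} (hmk : ∀ l, m l + k l ≤ ℓ.e l) {N₁ N₂ : Submodule (DR A) (M J t n)}
    (h1 : N₁ = ℓ.imageM J t m) (h2 : N₂ = ℓ.imageM J t (m + k)) :
    ∃ ψ : (relFields J t).H0 (Ideal.span {ℓ.mono m}) (Ideal.span {ℓ.mono (m + k)}) n ≃ₗ[DR A]
        N₁ ⧸ N₂.comap N₁.subtype,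
      (∀ (φ : (relFields J t).Form n) (h : φ ∈ (relFields J t).K (Ideal.span {ℓ.mono m}) n),
        ∃ h' : M.mk J t φ ∈ N₁, ψ ((relFields J t).cls _ φ h) = Submodule.Quotient.mk ⟨_, h'⟩) ∧
      ∀ l x, x ∈ ((relFields J t).H0Filt _ _ n).F l ↔
        ψ x ∈ (((MFilt J t n).restrict N₁).quotient (N₂.comap N₁.subtype)).F l := by
  obtain ⟨i, hi⟩ := hne
  set L := relFields J t with hL
  set a := Ideal.span {ℓ.mono m} with ha
  set c := Ideal.span {ℓ.mono (m + k)} with hc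
  have hca : c ≤ a := ℓ.span_mono_add_le m k
  have htc : Ideal.span {t} ≤ c := by
    have := ℓ.span_mono_add_le (m + k) (ℓ.e - (m + k))
    rwa [add_tsub_cancel_of_le (a := m + k) (b := ℓ.e) hmk, ← H.t_eq] at this
  have hac := H.filteredAcyclic_top hE m
  have hmem : ∀ φ ∈ L.K a n, M.mk J t φ ∈ N₁ := fun φ h => by rw [h1]; exact ⟨φ, h, rfl⟩
  -- Equality in `M` allows boundaries of arbitrary forms. Such a boundary has coefficients in `a`
  -- here, so by acyclicity of all forms modulo those in `a` it is the boundary of a form in `a`.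
  -- Multiples of `t` are harmless, since `t` lies in `c`.
  have hN₂ : ∀ φ : L.Form n, φ ∈ L.K a n → (M.mk J t φ ∈ N₂ ↔ φ ∈ L.K c n ⊔ L.bdry a n) := by
    intro φ hφ
    rw [h2, mem_imageM]
    constructor
    · rintro ⟨χ, hχ, e⟩
      obtain ⟨κ, hκ, β, hβ, e'⟩ := Submodule.mem_sup.1 (M.mk_eq_mk_iff.1 e.symm)
      have hκ' := K_mono htc hκ
      have hβa : β ∈ L.K a n := by
        rw [show β = φ - χ - κ by rw [← e']; abel]
        exact sub_mem (sub_mem hφ (K_mono hca hχ)) (K_mono hca hκ')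
      rw [show φ = (χ + κ) + β by rw [add_assoc, e']; abel]
      exact Submodule.add_mem_sup (add_mem hχ hκ')
        (mem_bdry_of_filteredAcyclic (H.basis hi) (H.basis_comm hi) hac hβa hβ)
    · intro h
      obtain ⟨χ, hχ, β, hβ, rfl⟩ := Submodule.mem_sup.1 h
      exact ⟨χ, hχ, M.mk_eq_mk_iff.2 (Submodule.mem_sup_right (by
        rw [sub_add_cancel_left]
        exact neg_mem (bdry_mono le_top hβ)))⟩
  let f₀ : L.K a n →ₗ[DR A] N₁ :=
    { toFun := fun φ => ⟨M.mk J t φ.1, hmem _ φ.2⟩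
      map_add' := fun _ _ => rfl
      map_smul' := fun _ _ => rfl }
  let N := N₂.comap N₁.subtype
  have hker : ∀ φ : L.K a n, N.mkQ (f₀ φ) = 0 ↔ φ.1 ∈ L.K c n ⊔ L.bdry a n := fun φ => by
    rw [Submodule.mkQ_apply, Submodule.Quotient.mk_eq_zero, ← hN₂ _ φ.2]
    rfl
  let f : L.H0 a c n →ₗ[DR A] N₁ ⧸ N :=
    Submodule.liftQ _ (N.mkQ ∘ₗ f₀) fun φ hφ => (hker φ).2 hφ
  have hf : ∀ (φ : L.Form n) (h : φ ∈ L.K a n),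
      f (L.cls c φ h) = Submodule.Quotient.mk ⟨M.mk J t φ, hmem φ h⟩ := fun φ h => rfl
  have hinj : Function.Injective f := by
    refine (injective_iff_map_eq_zero f).2 fun x hx => ?_
    obtain ⟨φ, h, rfl⟩ := cls_surjective x
    exact (cls_eq_zero_iff h).2 ((hker ⟨φ, h⟩).1 hx)
  have hsurj : Function.Surjective f := by
    intro y
    obtain ⟨⟨y, hy⟩, rfl⟩ := Submodule.Quotient.mk_surjective _ y
    have hy' := hy
    rw [h1] at hy'
    obtain ⟨φ, hφ, rfl⟩ := hy'
    exact ⟨L.cls c φ hφ, hf φ hφ⟩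
  refine ⟨LinearEquiv.ofBijective f ⟨hinj, hsurj⟩, fun φ h => ⟨hmem φ h, hf φ h⟩, fun l x => ?_⟩
  change _ ↔ f x ∈ _
  constructor
  · intro hx
    obtain ⟨φ, h, hφ, rfl⟩ := mem_H0Filt.1 hx
    exact ⟨⟨M.mk J t φ, hmem φ h⟩, mem_H0Filt.2 ⟨φ, mem_K_top _ φ, hφ, rfl⟩, (hf φ h).symm⟩
  · rintro ⟨⟨y, hy⟩, hyl, e⟩
    obtain ⟨φ, hφ, hφl, rfl⟩ := mem_H0Filt.1 hyl
    have hy' := hy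
    rw [h1] at hy'
    obtain ⟨φ₁, hφ₁, e₁⟩ := hy'
    have hmem' : φ ∈ L.K a n ⊔ L.bdry ⊤ n := by
      have h3 := M.mk_eq_mk_iff.1 (show M.mk J t φ = M.mk J t φ₁ from e₁.symm)
      obtain ⟨κ, hκ, β, hβ, e'⟩ := Submodule.mem_sup.1 h3
      rw [show φ = (φ₁ + κ) + β by rw [add_assoc, e']; abel]
      exact Submodule.add_mem_sup (add_mem hφ₁ (K_mono (htc.trans hca) hκ)) hβ
    -- A class of `N₁` in the step `F l` has a representative of the right order and one with
    -- coefficients in `a`, but these may differ. Strictness yields a representative with both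
    -- properties.
    obtain ⟨χ, hχ, hB⟩ := hac.strict l φ ⟨hφ, hφl⟩ hmem'
    refine mem_H0Filt.2 ⟨χ, hχ.1, hχ.2, hinj ?_⟩
    rw [← e, hf]
    have h4 : M.mk J t φ = M.mk J t χ :=
      M.mk_eq_mk_iff.2 (Submodule.mem_sup_right (FB_subset_bdry hB))
    exact congrArg (fun z : N₁ => (Submodule.Quotient.mk z : N₁ ⧸ N)) (Subtype.ext h4)

theorem Adapted.cycle_M (H : ℓ.Adapted J t) (hE : ℓ.Centered) (hne : ℓ.E.Nonempty) :
    (MFilt J t n).IsGood ∧ (MFilt J t n).charCycle =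
      ∑ K ∈ ℓ.E.powerset, (∑ j ∈ K, ℓ.e j) • conormalCycle (Ideal.span (ℓ.w '' K)) := by
  have ha : Ideal.span {ℓ.mono 0} = ⊤ := by rw [mono_zero, Ideal.span_singleton_one]
  have hb : Ideal.span {ℓ.mono (0 + ℓ.e)} = Ideal.span {t} := by rw [zero_add, H.t_eq]
  -- The ideals are made variables because the type of `H0` depends on them.
  have key : ∀ a b : Ideal A, Ideal.span {ℓ.mono 0} = a → Ideal.span {ℓ.mono (0 + ℓ.e)} = b →
      ((relFields J t).H0Filt a b n).IsGood ∧ ((relFields J t).H0Filt a b n).charCycle =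
      ∑ K ∈ ℓ.E.powerset, (∑ j ∈ K, ℓ.e j) • conormalCycle (Ideal.span (ℓ.w '' K)) := by
    rintro _ _ rfl rfl
    exact H.cycle_H0 hE hne 0 ℓ.e _ (LinearEquiv.refl _ _) fun _ _ => Iff.rfl
  exact key _ _ ha hb

end LogCoords
end

/-! ### Holomorphic functions of several variables. -/

section
open MeasureTheory

section
variable {V : Type*} [NormedAddCommGroup V] [NormedSpace ℂ V]

/-- Holomorphic near the point `p`. -/
def HolAt (F : V → ℂ) (p : V) : Prop := ∀ᶠ v in 𝓝 p, DifferentiableAt ℂ F v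

theorem HolAt.differentiableAt {F : V → ℂ} {p : V} (h : HolAt F p) : DifferentiableAt ℂ F p :=
  h.self_of_nhds

theorem HolAt.congr {F G : V → ℂ} {p : V} (h : HolAt F p) (e : G =ᶠ[𝓝 p] F) : HolAt G p := by
  filter_upwards [eventually_eventuallyEq_nhds.2 e, h] with v h1 h2
  exact h2.congr_of_eventuallyEq h1

theorem holAt_const (c : ℂ) (p : V) : HolAt (fun _ => c) p :=
  Eventually.of_forall fun _ => differentiableAt_const c

theorem HolAt.add {F G : V → ℂ} {p : V} (hF : HolAt F p) (hG : HolAt G p) :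
    HolAt (fun v => F v + G v) p := by
  filter_upwards [hF, hG] with v h1 h2 using h1.add h2

theorem HolAt.mul {F G : V → ℂ} {p : V} (hF : HolAt F p) (hG : HolAt G p) :
    HolAt (fun v => F v * G v) p := by
  filter_upwards [hF, hG] with v h1 h2 using h1.mul h2

/-- Cauchy's estimate on discs of radius `r` in the complex lines through points of the small ball
bounds the derivative by `M / r`. -/
theorem lipschitzOnWith_of_bound {F : V → ℂ} {p : V} {r M : ℝ} (hr : 0 < r)
    (hF : ∀ v ∈ Metric.ball p (3 * r), DifferentiableAt ℂ F v)
    (hM : ∀ v ∈ Metric.ball p (3 * r), ‖F v‖ ≤ M) :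
    LipschitzOnWith (Real.toNNReal (M / r)) F (Metric.ball p r) := by
  have hM0 : 0 ≤ M := (norm_nonneg _).trans (hM p (Metric.mem_ball_self (by positivity)))
  refine Convex.lipschitzOnWith_of_nnnorm_fderiv_le (𝕜 := ℂ) (fun v hv => hF v
    (Metric.ball_subset_ball (by linarith) hv)) (fun v hv => ?_) (convex_ball p r)
  rw [← NNReal.coe_le_coe, coe_nnnorm, Real.coe_toNNReal _ (by positivity)]
  refine ContinuousLinearMap.opNorm_le_bound _ (by positivity) fun u => ?_
  by_cases hu : u = 0
  · simp [hu]
  have hu' : 0 < ‖u‖ := norm_pos_iff.2 hu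
  have hmem : ∀ s : ℂ, ‖s‖ ≤ r / ‖u‖ → v + s • u ∈ Metric.ball p (3 * r) := by
    intro s hs
    rw [mem_ball_iff_norm] at hv ⊢
    have h1 : ‖s • u‖ ≤ r := by
      rw [norm_smul]
      calc ‖s‖ * ‖u‖ ≤ r / ‖u‖ * ‖u‖ := by gcongr
        _ = r := by field_simp
    calc ‖v + s • u - p‖ = ‖(v - p) + s • u‖ := by congr 1; abel
      _ ≤ ‖v - p‖ + ‖s • u‖ := norm_add_le _ _
      _ < 3 * r := by linarith
  have hline : ∀ s : ℂ, HasDerivAt (fun s : ℂ => v + s • u) u s := fun s => by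
    simpa using ((hasDerivAt_id s).smul_const u).const_add v
  have hd : ∀ s : ℂ, ‖s‖ ≤ r / ‖u‖ →
      HasDerivAt (fun s : ℂ => F (v + s • u)) (fderiv ℂ F (v + s • u) u) s := fun s hs =>
    (hF _ (hmem s hs)).hasFDerivAt.comp_hasDerivAt s (hline s)
  have hR : 0 < r / ‖u‖ := by positivity
  have h0 := (hd 0 (by simpa using hR.le)).deriv
  have hle := Complex.norm_deriv_le_of_forall_mem_sphere_norm_le (c := (0 : ℂ)) (C := M) hR
    (f := fun s : ℂ => F (v + s • u)) ?_ ?_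
  · rw [h0] at hle
    simp only [zero_smul, add_zero] at hle
    calc _ ≤ _ := hle
      _ = _ := by field_simp
  · refine DifferentiableOn.diffContOnCl fun s hs => ?_
    rw [closure_ball _ hR.ne', mem_closedBall_zero_iff] at hs
    exact (hd s hs).differentiableAt.differentiableWithinAt
  · intro s hs
    exact hM _ (hmem s (mem_sphere_zero_iff_norm.1 hs).le)

theorem HolAt.exists_lipschitz {F : V → ℂ} {p : V} (h : HolAt F p) :
    ∃ r > 0, ∃ K, (∀ v ∈ Metric.ball p r, DifferentiableAt ℂ F v) ∧
      LipschitzOnWith K F (Metric.ball p r) := by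
  have hb : ∀ᶠ v in 𝓝 p, ‖F v‖ < ‖F p‖ + 1 :=
    h.differentiableAt.continuousAt.norm.eventually_lt_const (lt_add_one _)
  obtain ⟨ε, hε, he⟩ := Metric.eventually_nhds_iff_ball.1 (hb.and h)
  refine ⟨ε / 3, by positivity, _, fun v hv => (he v (Metric.ball_subset_ball (by linarith) hv)).2,
    lipschitzOnWith_of_bound (M := ‖F p‖ + 1) (by positivity) (fun v hv => (he v ?_).2)
      fun v hv => (he v ?_).1.le⟩
  all_goals rwa [show 3 * (ε / 3) = ε by ring] at hv

/-- Differentiation under the integral sign. The uniform Lipschitz bound supplies the dominating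
function, so the derivative of `F` need only be measurable. Cauchy's formula and the quotient in
Hadamard's lemma are both integrals of this shape. -/
theorem differentiableAt_integral [FiniteDimensional ℂ V] {F : V → ℂ} {B W : Set V} {K : NNReal}
    (hF : ∀ v ∈ B, DifferentiableAt ℂ F v) (hK : LipschitzOnWith K F B) (hW : IsOpen W)
    {α β : ℝ} {k : ℝ → ℂ} (hk : Continuous k) {c : ℝ → V} (hc : Continuous c)
    {L : ℝ → V →L[ℂ] V} (hL : Continuous L)
    (hB : ∀ v ∈ W, ∀ s, s ∈ Set.uIcc α β → c s + L s v ∈ B) {v : V} (hv : v ∈ W) :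
    DifferentiableAt ℂ (fun v => ∫ s in α..β, k s * F (c s + L s v)) v := by
  borelize V
  have : ProperSpace (V →L[ℂ] ℂ) := FiniteDimensional.proper ℂ _
  have hcont : ∀ x ∈ W, ContinuousOn (fun s => k s * F (c s + L s x)) (Set.uIcc α β) := by
    intro x hx
    refine hk.continuousOn.mul fun s hs => ?_
    have h1 : ContinuousAt (fun s => c s + L s x) s :=
      (hc.add (hL.clm_apply continuous_const)).continuousAt
    exact (ContinuousAt.comp (f := fun s => c s + L s x) (g := F)
      (hF _ (hB x hx s hs)).continuousAt h1).continuousWithinAt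
  have key := intervalIntegral.hasFDerivAt_integral_of_dominated_loc_of_lip (𝕜 := ℂ)
    (μ := volume) (a := α) (b := β) (s := W) (x₀ := v)
    (F := fun v s => k s * F (c s + L s v))
    (F' := fun s => k s • (fderiv ℂ F (c s + L s v)).comp (L s))
    (bound := fun s => ‖k s‖ * (K * ‖L s‖)) (hW.mem_nhds hv) ?_ ?_ ?_ ?_ ?_ ?_
  · exact key.2.differentiableAt
  · filter_upwards [hW.mem_nhds hv] with x hx
    exact ((hcont x hx).mono Set.uIoc_subset_uIcc).aestronglyMeasurable measurableSet_uIoc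
  · exact (hcont v hv).intervalIntegrable
  · refine AEStronglyMeasurable.smul hk.aestronglyMeasurable ?_
    have h1 : AEStronglyMeasurable (fun s => fderiv ℂ F (c s + L s v))
        (volume.restrict (Set.uIoc α β)) :=
      ((measurable_fderiv ℂ F).comp
        (hc.add (hL.clm_apply continuous_const)).measurable).aestronglyMeasurable
    exact (isBoundedBilinearMap_comp (𝕜 := ℂ) (E := V) (F := V) (G := ℂ)).continuous.comp_aestronglyMeasurable
      (h1.prodMk hL.aestronglyMeasurable)
  · refine Eventually.of_forall fun s hs => LipschitzOnWith.of_dist_le_mul fun x hx y hy => ?_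
    have hs' := Set.uIoc_subset_uIcc hs
    have h1 := hK.dist_le_mul _ (hB x hx s hs') _ (hB y hy s hs')
    rw [dist_add_left, dist_eq_norm, dist_eq_norm, ← map_sub] at h1
    have h2 := (L s).le_opNorm (x - y)
    rw [dist_eq_norm, ← mul_sub, norm_mul, Real.coe_nnabs, abs_of_nonneg (by positivity),
      dist_eq_norm]
    calc ‖k s‖ * ‖F (c s + L s x) - F (c s + L s y)‖ ≤ ‖k s‖ * (K * (‖L s‖ * ‖x - y‖)) := by
          gcongr
          exact h1.trans (by gcongr)
      _ = _ := by ring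
  · exact (hk.norm.mul (continuous_const.mul hL.norm)).intervalIntegrable _ _
  · refine Eventually.of_forall fun s hs => ?_
    have hs' := Set.uIoc_subset_uIcc hs
    exact (((hF _ (hB v hv s hs')).hasFDerivAt.comp v
      ((L s).hasFDerivAt.const_add (c s))).const_mul (k s))

/-- Near `p` the derivative in direction `u` is Cauchy's integral over a circle of fixed radius in
the complex line through the point with that direction, and this integral is differentiable in the
point. -/
theorem HolAt.fderiv_apply [FiniteDimensional ℂ V] {F : V → ℂ} {p : V} (h : HolAt F p) (u : V) :
    HolAt (fun v => fderiv ℂ F v u) p := by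
  obtain ⟨r, hr, K, hF, hK⟩ := h.exists_lipschitz
  -- The circles of radius `ρ` around points of the ball of radius `r / 2` must stay in the ball of
  -- radius `r`.
  obtain ⟨ρ, hρ, hρu⟩ : ∃ ρ > 0, ρ * ‖u‖ < r / 2 := by
    refine ⟨r / 2 / (‖u‖ + 1), by positivity, ?_⟩
    rw [div_mul_eq_mul_div, div_lt_iff₀ (by positivity)]
    nlinarith [norm_nonneg u]
  have hmem : ∀ v ∈ Metric.ball p (r / 2), ∀ s : ℂ, ‖s‖ * ‖u‖ < r / 2 →
      v + s • u ∈ Metric.ball p r := by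
    intro v hv s hs
    rw [mem_ball_iff_norm] at hv ⊢
    rw [← norm_smul] at hs
    calc ‖v + s • u - p‖ = ‖(v - p) + s • u‖ := by congr 1; abel
      _ ≤ ‖v - p‖ + ‖s • u‖ := norm_add_le _ _
      _ < r := by linarith
  have hcirc : ∀ θ : ℝ, ‖circleMap 0 ρ θ‖ = ρ := fun θ => by
    rw [norm_circleMap_zero, abs_of_pos hρ]
  have hne : ∀ θ, circleMap 0 ρ θ ≠ 0 := fun θ => by
    rw [← norm_pos_iff, hcirc]
    exact hρ
  let k : ℝ → ℂ := fun θ => (2 * Real.pi * Complex.I : ℂ)⁻¹ *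
    (deriv (circleMap 0 ρ) θ * ((circleMap 0 ρ θ - 0) ^ 2)⁻¹)
  have hk : Continuous k := by
    refine continuous_const.mul (Continuous.mul ?_ (Continuous.inv₀ ?_ fun θ => ?_))
    · rw [show deriv (circleMap 0 ρ) = fun θ => circleMap 0 ρ θ * Complex.I from
        funext fun θ => deriv_circleMap _ _ _]
      fun_prop
    · fun_prop
    · rw [sub_zero]
      exact pow_ne_zero 2 (hne θ)
  have hline : ∀ (v : V) (s : ℂ), HasDerivAt (fun s : ℂ => v + s • u) u s := fun v s => by
    simpa using ((hasDerivAt_id s).smul_const u).const_add v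
  have hev : ∀ v ∈ Metric.ball p (r / 2), fderiv ℂ F v u =
      ∫ θ in (0 : ℝ)..(2 * Real.pi), k θ * F (circleMap 0 ρ θ • u + ContinuousLinearMap.id ℂ V v) := by
    intro v hv
    have hUo : IsOpen {s : ℂ | ‖s‖ * ‖u‖ < r / 2} :=
      isOpen_lt (continuous_norm.mul continuous_const) continuous_const
    have hd : ∀ s ∈ {s : ℂ | ‖s‖ * ‖u‖ < r / 2},
        HasDerivAt (fun s : ℂ => F (v + s • u)) (fderiv ℂ F (v + s • u) u) s := fun s hs =>
      (hF _ (hmem v hv s hs)).hasFDerivAt.comp_hasDerivAt s (hline v s)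
    have hcb : Metric.closedBall (0 : ℂ) ρ ⊆ {s : ℂ | ‖s‖ * ‖u‖ < r / 2} := by
      intro s hs
      rw [mem_closedBall_zero_iff] at hs
      exact lt_of_le_of_lt (by gcongr) hρu
    have h1 := Complex.two_pi_I_inv_smul_circleIntegral_sub_sq_inv_smul_of_differentiable
      hUo hcb (fun s hs => (hd s hs).differentiableAt.differentiableWithinAt)
      (Metric.mem_ball_self hρ)
    rw [(hd 0 (hcb (Metric.mem_closedBall_self hρ.le))).deriv, zero_smul, add_zero] at h1
    rw [← h1, circleIntegral, smul_eq_mul, ← intervalIntegral.integral_const_mul]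
    refine intervalIntegral.integral_congr fun θ _ => ?_
    simp only [k, smul_eq_mul, ContinuousLinearMap.id_apply]
    rw [add_comm v]
    ring
  have hball := Metric.ball_mem_nhds p (half_pos hr)
  refine HolAt.congr (F := fun v => ∫ θ in (0 : ℝ)..(2 * Real.pi),
    k θ * F (circleMap 0 ρ θ • u + ContinuousLinearMap.id ℂ V v)) ?_
    (by filter_upwards [hball] with v hv using hev v hv)
  filter_upwards [hball] with v hv
  refine differentiableAt_integral hF hK Metric.isOpen_ball hk (by fun_prop) continuous_const
    (fun v hv s _ => ?_) hv
  rw [ContinuousLinearMap.id_apply, add_comm]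
  exact hmem v hv _ (by rwa [hcirc])

/-- Hadamard's lemma: integrate the derivative along the segment from `v - lam (v - p) • u` to `v`
and pull out the factor `lam (v - p)`. -/
theorem HolAt.exists_quotient [FiniteDimensional ℂ V] {F : V → ℂ} {p : V} (h : HolAt F p)
    (lam : V →L[ℂ] ℂ) (u : V) : ∃ G : V → ℂ, HolAt G p ∧
      ∀ᶠ v in 𝓝 p, F v - F (v - lam (v - p) • u) = lam (v - p) * G v := by
  have hH := h.fderiv_apply u
  obtain ⟨r, hr, K, hFd, hK⟩ := hH.exists_lipschitz
  obtain ⟨r', hr', hF⟩ := Metric.eventually_nhds_iff_ball.1 h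
  set ε := min r r' with hε
  have hε0 : 0 < ε := lt_min hr hr'
  -- The point of the segment with parameter `s` is affine in `v`; it is split into a constant and a
  -- linear part, as `differentiableAt_integral` asks.
  let c : ℝ → V := fun s => -(((s : ℂ) - 1) * lam p) • u
  let L : ℝ → V →L[ℂ] V := fun s => ContinuousLinearMap.id ℂ V +
    ((s : ℂ) - 1) • lam.smulRight u
  have ha : ∀ s v, c s + L s v = v + (((s : ℂ) - 1) * lam (v - p)) • u := by
    intro s v
    simp only [c, L, add_apply, ContinuousLinearMap.id_apply,
      smul_apply, ContinuousLinearMap.smulRight_apply, map_sub]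
    module
  let C := 1 + ‖lam‖ * ‖u‖
  have hC : 0 < C := by positivity
  have hmem : ∀ v ∈ Metric.ball p (ε / C), ∀ s ∈ Set.uIcc (0 : ℝ) 1, c s + L s v ∈
      Metric.ball p ε := by
    intro v hv s hs
    rw [Set.uIcc_of_le zero_le_one] at hs
    rw [mem_ball_iff_norm] at hv ⊢
    have h1 : ‖(s : ℂ) - 1‖ ≤ 1 := by
      rw [← Complex.ofReal_one, ← Complex.ofReal_sub, Complex.norm_real, Real.norm_eq_abs, abs_le]
      constructor <;> linarith [hs.1, hs.2]
    rw [ha]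
    calc ‖v + (((s : ℂ) - 1) * lam (v - p)) • u - p‖
        = ‖(v - p) + (((s : ℂ) - 1) * lam (v - p)) • u‖ := by congr 1; abel
      _ ≤ ‖v - p‖ + ‖(((s : ℂ) - 1) * lam (v - p)) • u‖ := norm_add_le _ _
      _ = ‖v - p‖ + ‖(s : ℂ) - 1‖ * ‖lam (v - p)‖ * ‖u‖ := by rw [norm_smul, norm_mul]
      _ ≤ ‖v - p‖ + 1 * (‖lam‖ * ‖v - p‖) * ‖u‖ := by
          gcongr
          exact lam.le_opNorm _
      _ = C * ‖v - p‖ := by simp only [C]; ring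
      _ < C * (ε / C) := by gcongr
      _ = ε := by field_simp
  have hLc : Continuous L := by
    exact continuous_const.add (Continuous.smul (f := fun s : ℝ => (s : ℂ) - 1)
      (g := fun _ => lam.smulRight u) (by fun_prop) continuous_const)
  have hcc : Continuous c := by
    refine Continuous.smul ?_ continuous_const
    fun_prop
  have hball : Metric.ball p (ε / C) ∈ 𝓝 p := Metric.ball_mem_nhds p (by positivity)
  refine ⟨fun v => ∫ s in (0 : ℝ)..1, (1 : ℂ) * fderiv ℂ F (c s + L s v) u, ?_, ?_⟩
  · filter_upwards [hball] with v hv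
    exact differentiableAt_integral (F := fun v => fderiv ℂ F v u) (k := fun _ => (1 : ℂ)) hFd hK
      Metric.isOpen_ball continuous_const hcc hLc
      (fun v hv s hs => Metric.ball_subset_ball (min_le_left _ _) (hmem v hv s hs)) hv
  · filter_upwards [hball] with v hv
    have hder : ∀ s ∈ Set.uIcc (0 : ℝ) 1, HasDerivAt (fun s : ℝ => F (c s + L s v))
        (fderiv ℂ F (c s + L s v) (lam (v - p) • u)) s := by
      intro s hs
      have hd := hF _ (Metric.ball_subset_ball (min_le_right _ _) (hmem v hv s hs))
      have hl : HasDerivAt (fun s : ℝ => c s + L s v) (lam (v - p) • u) s := by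
        simp only [ha]
        have := ((((hasDerivAt_id s).ofReal_comp.sub_const (1 : ℂ)).mul_const
          (lam (v - p))).smul_const u).const_add v
        simpa using this
      exact (hd.hasFDerivAt.restrictScalars ℝ).comp_hasDerivAt s hl
    have hint : IntervalIntegrable (fun s : ℝ => fderiv ℂ F (c s + L s v) (lam (v - p) • u))
        volume 0 1 := by
      refine ContinuousOn.intervalIntegrable fun s hs => ?_
      have h1 : ContinuousAt (fun s => c s + L s v) s :=
        (hcc.add (hLc.clm_apply continuous_const)).continuousAt
      have h2 : ContinuousAt (fun v => fderiv ℂ F v u) (c s + L s v) :=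
        (hFd _ (Metric.ball_subset_ball (min_le_left _ _) (hmem v hv s hs))).continuousAt
      simp only [map_smul]
      exact ((ContinuousAt.comp (f := fun s => c s + L s v) (g := fun v => fderiv ℂ F v u)
        h2 h1).const_smul (lam (v - p))).continuousWithinAt
    have := intervalIntegral.integral_eq_sub_of_hasDerivAt hder hint
    rw [ha, ha] at this
    simp only [map_smul, smul_eq_mul, Complex.ofReal_one, sub_self, zero_mul, zero_smul, add_zero,
      Complex.ofReal_zero, zero_sub, neg_mul, one_mul, neg_smul,
      intervalIntegral.integral_const_mul] at this
    rw [sub_eq_add_neg v, ← this]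
    simp only [one_mul]

/-- The complex line through `q` and `v` meets the convex set `U` in a convex set, where the
identity theorem in one variable applies. -/
theorem eqOn_zero_of_eventuallyEq {F : V → ℂ} {U : Set V} (hU : IsOpen U) (hc : Convex ℝ U)
    (hF : ∀ v ∈ U, DifferentiableAt ℂ F v) {q : V} (hq : q ∈ U) (h : F =ᶠ[𝓝 q] 0) :
    ∀ v ∈ U, F v = 0 := by
  intro v hv
  let g : ℂ → V := fun s => q + s • (v - q)
  have hg : Continuous g := by fun_prop
  have hconv : Convex ℝ (g ⁻¹' U) := by
    intro s hs s' hs' a b ha hb hab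
    have := hc hs hs' ha hb hab
    change g (a • s + b • s') ∈ U
    convert this using 1
    simp only [g, smul_add, add_smul, smul_assoc]
    rw [add_add_add_comm, ← add_smul, hab, one_smul]
  have hd : DifferentiableOn ℂ (F ∘ g) (g ⁻¹' U) := fun s hs =>
    ((hF _ hs).comp s (by fun_prop : DifferentiableAt ℂ g s)).differentiableWithinAt
  have h0 : (0 : ℂ) ∈ g ⁻¹' U := by simpa [g] using hq
  have h1 : (1 : ℂ) ∈ g ⁻¹' U := by simpa [g] using hv
  have hev : F ∘ g =ᶠ[𝓝 0] 0 := by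
    have : Tendsto g (𝓝 0) (𝓝 q) := by
      have := hg.tendsto 0
      simpa [g] using this
    exact this.eventually h
  have := (hd.analyticOnNhd (hU.preimage hg)).eqOn_zero_of_preconnected_of_eventuallyEq_zero
    hconv.isPreconnected h0 hev h1
  simpa [g] using this

/-- On every complex line through `p` the restricted function of one variable has a zero of infinite
order at `p`, so it vanishes along that line. -/
theorem eventuallyEq_zero_of_isBigO {F : V → ℂ} {p : V} (hF : HolAt F p)
    (h : ∀ N : ℕ, F =O[𝓝 p] fun v => ‖v - p‖ ^ N) : F =ᶠ[𝓝 p] 0 := by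
  obtain ⟨r, hr, hr'⟩ := Metric.eventually_nhds_iff_ball.1 hF
  filter_upwards [Metric.ball_mem_nhds p hr] with v hv
  let g : ℂ → V := fun s => p + s • (v - p)
  have hg : Continuous g := by fun_prop
  have hconv : Convex ℝ (g ⁻¹' Metric.ball p r) := by
    intro s hs s' hs' a b ha hb hab
    have := convex_ball p r hs hs' ha hb hab
    change g (a • s + b • s') ∈ Metric.ball p r
    convert this using 1
    simp only [g, smul_add, add_smul, smul_assoc]
    rw [add_add_add_comm, ← add_smul, hab, one_smul]
  have hd : DifferentiableOn ℂ (F ∘ g) (g ⁻¹' Metric.ball p r) := fun s hs =>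
    ((hr' _ hs).comp s (by fun_prop : DifferentiableAt ℂ g s)).differentiableWithinAt
  have h0 : (0 : ℂ) ∈ g ⁻¹' Metric.ball p r := by simpa [g] using hr
  have h1 : (1 : ℂ) ∈ g ⁻¹' Metric.ball p r := by simpa [g] using hv
  have hA := hd.analyticOnNhd (Metric.isOpen_ball.preimage hg)
  have hev : F ∘ g =ᶠ[𝓝 0] 0 := by
    by_contra hne
    have hfin : analyticOrderAt (F ∘ g) 0 ≠ ⊤ := fun e => hne (analyticOrderAt_eq_top.1 e)
    obtain ⟨k, hk⟩ := ENat.ne_top_iff_exists.1 hfin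
    obtain ⟨G, hG, hG0, hGe⟩ := ((hA 0 h0).analyticOrderAt_eq_natCast).1 hk.symm
    have ht : Tendsto g (𝓝 0) (𝓝 p) := by
      have := hg.tendsto 0
      simpa [g] using this
    have hO : (fun s : ℂ => s ^ k * G s) =O[𝓝 0] fun s : ℂ => s ^ (k + 1) := by
      have h2 := ((h (k + 1)).comp_tendsto ht)
      have h3 : (fun s : ℂ => s ^ k * G s) =ᶠ[𝓝 0] F ∘ g := by
        filter_upwards [hGe] with s hs
        rw [hs, sub_zero, smul_eq_mul]
      refine (h2.congr' h3.symm EventuallyEq.rfl).trans ?_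
      refine Asymptotics.IsBigO.of_bound (‖v - p‖ ^ (k + 1)) (Eventually.of_forall fun s => ?_)
      simp only [Function.comp, g, add_sub_cancel_left, norm_smul, norm_pow, norm_mul, norm_norm,
        mul_pow]
      rw [mul_comm]
    obtain ⟨C, hC⟩ := hO.bound
    have hlim : Tendsto (fun s : ℂ => ‖G s‖) (𝓝[≠] 0) (𝓝 ‖G 0‖) :=
      (hG.continuousAt.norm.tendsto).mono_left nhdsWithin_le_nhds
    have hlim' : Tendsto (fun s : ℂ => C * ‖s‖) (𝓝[≠] 0) (𝓝 (C * ‖(0 : ℂ)‖)) :=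
      ((continuous_const.mul continuous_norm).tendsto 0).mono_left nhdsWithin_le_nhds
    have hle : ∀ᶠ s : ℂ in 𝓝[≠] 0, ‖G s‖ ≤ C * ‖s‖ := by
      filter_upwards [nhdsWithin_le_nhds hC, self_mem_nhdsWithin] with s hs hs0
      have hs1 : 0 < ‖s‖ ^ k := pow_pos (norm_pos_iff.2 hs0) k
      rw [norm_mul, norm_pow, norm_pow, pow_succ] at hs
      refine le_of_mul_le_mul_left ?_ hs1
      linarith
    have := le_of_tendsto_of_tendsto hlim hlim' hle
    rw [norm_zero, mul_zero] at this
    exact hG0 (norm_le_zero_iff.1 this)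
  have := hA.eqOn_zero_of_preconnected_of_eventuallyEq_zero hconv.isPreconnected h0 hev h1
  simpa [g] using this

end

end

/-! ### Partial derivatives and slices of holomorphic functions. -/

section
variable {n : ℕ}

/-- The functions which are holomorphic near `p`. -/
def holFun (p : Model n) : Subalgebra ℂ (Model n → ℂ) where
  carrier := {F | HolAt F p}
  mul_mem' := HolAt.mul
  add_mem' := HolAt.add
  algebraMap_mem' c := holAt_const c p

variable {p : Model n}

/-- The coordinate functions. -/
def holFun.coord (p : Model n) (l : Fin (n + 1)) : holFun p :=
  ⟨fun v => v l, Eventually.of_forall fun v =>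
    (EuclideanSpace.proj l : Model n →L[ℂ] ℂ).differentiableAt (x := v)⟩

/-- The partial derivatives. -/
def holFun.partial (j : Fin (n + 1)) (F : holFun p) : holFun p :=
  ⟨fun v => fderiv ℂ F.1 v (EuclideanSpace.single j 1), F.2.fderiv_apply _⟩

/-- The projection to the hyperplane through `p` on which the coordinate `j` is constant. -/
def slicePt (p : Model n) (j : Fin (n + 1)) (v : Model n) : Model n :=
  v - (EuclideanSpace.proj j : Model n →L[ℂ] ℂ) (v - p) • EuclideanSpace.single j 1

theorem slicePt_apply (p : Model n) (j l : Fin (n + 1)) (v : Model n) :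
    slicePt p j v l = if l = j then p j else v l := by
  by_cases h : l = j
  · subst h
    simp [slicePt]
  · simp [slicePt, h]

theorem tendsto_slicePt (p : Model n) (j : Fin (n + 1)) : Tendsto (slicePt p j) (𝓝 p) (𝓝 p) := by
  have h : Continuous (slicePt p j) := by unfold slicePt; fun_prop
  have := h.tendsto p
  rwa [show slicePt p j p = p by simp [slicePt]] at this

/-- The restriction to the hyperplane through `p` on which the coordinate `j` is constant. -/
def holFun.slice (j : Fin (n + 1)) (F : holFun p) : holFun p :=
  ⟨fun v => F.1 (slicePt p j v), by
    filter_upwards [(tendsto_slicePt p j).eventually F.2] with v hv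
    exact hv.comp v (by unfold slicePt; fun_prop)⟩

theorem holFun.exists_slice (j : Fin (n + 1)) (F : holFun p) : ∃ G : holFun p,
    (F - (holFun.slice j F)).1 =ᶠ[𝓝 p] ((holFun.coord p j - algebraMap ℂ (holFun p) (p j)) * G).1 := by
  obtain ⟨G, hG, h⟩ := F.2.exists_quotient (EuclideanSpace.proj j) (EuclideanSpace.single j 1)
  exact ⟨⟨G, hG⟩, h⟩

/-- Slice in the coordinates of `S` one after another. Each correction is a multiple of a shifted
coordinate, and the remainder no longer depends on the coordinates of `S`. -/
theorem holFun.exists_const (F : holFun p) (S : Finset (Fin (n + 1))) : ∃ F' : holFun p,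
    (∃ G : Fin (n + 1) → holFun p, (F - F').1 =ᶠ[𝓝 p]
      (∑ l ∈ S, (holFun.coord p l - algebraMap ℂ (holFun p) (p l)) * G l).1) ∧
    ∀ v v' : Model n, (∀ l ∉ S, v l = v' l) → F'.1 v = F'.1 v' := by
  induction S using Finset.induction_on with
  | empty =>
    refine ⟨F, ⟨0, by simp⟩, fun v v' h => ?_⟩
    rw [show v = v' from PiLp.ext fun l => h l (by simp)]
  | insert j S hj ih =>
    obtain ⟨F', ⟨G, hG⟩, h⟩ := ih
    obtain ⟨H, hH⟩ := holFun.exists_slice j F'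
    refine ⟨(holFun.slice j F'), ⟨Function.update G j H, ?_⟩, fun v v' hv => h _ _ fun l hl => ?_⟩
    · have e : F - (holFun.slice j F') = (F' - (holFun.slice j F')) + (F - F') := by abel
      rw [e, Finset.sum_insert hj, Function.update_self, Finset.sum_congr rfl fun l hl => by
        rw [Function.update_of_ne fun e : l = j => hj (by rwa [← e])]]
      exact hH.add hG
    · rw [slicePt_apply, slicePt_apply]
      split_ifs with hlj
      · rfl
      · exact hv l (by simp [hlj, hl])

/-- If `F` is nonzero at some point of a small ball, then `G` vanishes near that point and hence on
the ball. This is why rings of germs are domains. -/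
theorem holFun.eventuallyEq_zero_or {F G : holFun p} (h : (F * G).1 =ᶠ[𝓝 p] 0) :
    F.1 =ᶠ[𝓝 p] 0 ∨ G.1 =ᶠ[𝓝 p] 0 := by
  by_contra! hne
  obtain ⟨r, hr, hr'⟩ := Metric.eventually_nhds_iff_ball.1 (h.and (F.2.and G.2))
  have : ∃ q ∈ Metric.ball p r, F.1 q ≠ 0 := by
    by_contra! h0
    exact hne.1 (by filter_upwards [Metric.ball_mem_nhds p hr] with v hv using h0 v hv)
  obtain ⟨q, hq, hq0⟩ := this
  refine hne.2 ?_
  have hz : G.1 =ᶠ[𝓝 q] 0 := by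
    filter_upwards [(hr' q hq).2.1.continuousAt.eventually_ne hq0,
      Metric.isOpen_ball.mem_nhds hq] with v hv hvr
    exact (mul_eq_zero.1 (hr' v hvr).1).resolve_left hv
  filter_upwards [Metric.ball_mem_nhds p hr] with v hv
  exact eqOn_zero_of_eventuallyEq Metric.isOpen_ball (convex_ball p r)
    (fun v hv => (hr' v hv).2.2) hq hz v hv

end

/-! ### The coordinates on a ring of germs given by a chart. -/

section
variable {n : ℕ} {X : Type*} [TopologicalSpace X] [ChartedSpace (Model n) X]
  [IsManifold 𝓘(ℂ, Model n) ω X]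
  {z : OpenPartialHomeomorph X (Model n)} (hz : z ∈ IsManifold.maximalAtlas 𝓘(ℂ, Model n) ω X)
  {y : X} (hy : y ∈ z.source)

theorem mem_maximalAtlas_one (hz : z ∈ IsManifold.maximalAtlas 𝓘(ℂ, Model n) ω X) :
    z ∈ IsManifold.maximalAtlas 𝓘(ℂ, Model n) 1 X :=
  IsManifold.maximalAtlas_subset_of_le le_top hz

theorem HolAt.mdifferentiableAt_comp {F : Model n → ℂ}
    (hz : z ∈ IsManifold.maximalAtlas 𝓘(ℂ, Model n) ω X) (hy : y ∈ z.source)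
    (hF : HolAt F (z y)) : ∀ᶠ x in 𝓝 y, MDifferentiableAt 𝓘(ℂ, Model n) 𝓘(ℂ) (F ∘ z) x := by
  filter_upwards [(z.continuousAt hy).eventually hF, z.open_source.mem_nhds hy] with x h hx
  exact MDifferentiableAt.comp (g := F) x h.mdifferentiableAt
    (mdifferentiableAt_of_mem_maximalAtlas (mem_maximalAtlas_one hz) hx)

theorem holAt_comp_symm {h : X → ℂ} (hz : z ∈ IsManifold.maximalAtlas 𝓘(ℂ, Model n) ω X)
    (hy : y ∈ z.source) (hh : ∀ᶠ x in 𝓝 y, MDifferentiableAt 𝓘(ℂ, Model n) 𝓘(ℂ) h x) :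
    HolAt (h ∘ z.symm) (z y) := by
  have ht : Tendsto z.symm (𝓝 (z y)) (𝓝 y) := z.tendsto_symm hy
  filter_upwards [ht.eventually hh, z.open_target.mem_nhds (z.map_source hy)] with v hv hvt
  exact mdifferentiableAt_iff_differentiableAt.1 (hv.comp v
    (mdifferentiableAt_symm_of_mem_maximalAtlas (mem_maximalAtlas_one hz) hvt))

/-- The germ of a function of the coordinates. -/
def ofHol : holFun (z y) →ₐ[ℂ] O n y where
  toFun F := ⟨((F.1 ∘ z : X → ℂ) : Germ (𝓝 y) ℂ), F.1 ∘ z, rfl, F.2.mdifferentiableAt_comp hz hy⟩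
  map_one' := rfl
  map_mul' _ _ := rfl
  map_zero' := rfl
  map_add' _ _ := rfl
  commutes' _ := rfl

theorem O.ext {g g' : O n y} (h : g.germ = g'.germ) : g = g' := Subtype.ext h

theorem ofHol_eq_iff {F G : holFun (z y)} :
    ofHol hz hy F = ofHol hz hy G ↔ F.1 =ᶠ[𝓝 (z y)] G.1 := by
  constructor
  · intro h
    have h' : F.1 ∘ z =ᶠ[𝓝 y] G.1 ∘ z := Germ.coe_eq.1 (congrArg O.germ h)
    have ht : Tendsto z.symm (𝓝 (z y)) (𝓝 y) := z.tendsto_symm hy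
    filter_upwards [ht.eventually h', z.open_target.mem_nhds (z.map_source hy)] with v hv hvt
    simpa [z.right_inv hvt] using hv
  · intro h
    exact O.ext (Germ.coe_eq.2 ((z.continuousAt hy).eventually h))

theorem ofHol_eq_zero_iff {F : holFun (z y)} : ofHol hz hy F = 0 ↔ F.1 =ᶠ[𝓝 (z y)] 0 := by
  rw [← map_zero (ofHol hz hy), ofHol_eq_iff]
  rfl

theorem eq_ofHol_of_germ {g : O n y} {h : X → ℂ} (hg : g.germ = (h : Germ (𝓝 y) ℂ)) :
    ∃ hF : HolAt (h ∘ z.symm) (z y), g = ofHol hz hy ⟨h ∘ z.symm, hF⟩ := by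
  obtain ⟨k, hk, hk'⟩ := g.2
  have e : h =ᶠ[𝓝 y] k := Germ.coe_eq.1 (hg.symm.trans hk)
  have hF : HolAt (h ∘ z.symm) (z y) := by
    refine holAt_comp_symm hz hy ?_
    filter_upwards [hk', eventually_eventuallyEq_nhds.2 e] with x h1 h2
    exact h1.congr_of_eventuallyEq h2
  refine ⟨hF, O.ext (hg.trans (Germ.coe_eq.2 ?_))⟩
  filter_upwards [z.open_source.mem_nhds hy] with x hx
  simp [z.left_inv hx]

theorem ofHol_surjective : Function.Surjective (ofHol hz hy) := fun g => by
  obtain ⟨k, hk, -⟩ := g.2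
  obtain ⟨hF, e⟩ := eq_ofHol_of_germ hz hy (g := g) hk
  exact ⟨_, e.symm⟩

/-- The map on germs induced by a local operation on functions. -/
def descend (T : holFun (z y) → holFun (z y)) (g : O n y) : O n y :=
  ofHol hz hy (T (ofHol_surjective hz hy g).choose)

theorem descend_ofHol {T : holFun (z y) → holFun (z y)}
    (hT : ∀ F G : holFun (z y), F.1 =ᶠ[𝓝 (z y)] G.1 → (T F).1 =ᶠ[𝓝 (z y)] (T G).1)
    (F : holFun (z y)) : descend hz hy T (ofHol hz hy F) = ofHol hz hy (T F) := by
  rw [descend, ofHol_eq_iff]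
  exact hT _ _ ((ofHol_eq_iff hz hy).1 (ofHol_surjective hz hy (ofHol hz hy F)).choose_spec)

theorem holFun.partial_congr (j : Fin (n + 1)) {p : Model n} (F G : holFun p)
    (h : F.1 =ᶠ[𝓝 p] G.1) : ((holFun.partial j F)).1 =ᶠ[𝓝 p] ((holFun.partial j G)).1 := by
  filter_upwards [h.fderiv (𝕜 := ℂ)] with v hv
  change fderiv ℂ F.1 v _ = fderiv ℂ G.1 v _
  rw [hv]

theorem holFun.slice_congr (j : Fin (n + 1)) {p : Model n} (F G : holFun p)
    (h : F.1 =ᶠ[𝓝 p] G.1) : ((holFun.slice j F)).1 =ᶠ[𝓝 p] ((holFun.slice j G)).1 :=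
  (tendsto_slicePt p j).eventually h

/-- The derivation `∂_j` of the ring of germs. -/
def derAt (j : Fin (n + 1)) : Derivation ℂ (O n y) (O n y) :=
  have hT := descend_ofHol hz hy (holFun.partial_congr j (p := z y))
  Derivation.mk'
    { toFun := descend hz hy (holFun.partial j)
      map_add' := fun g g' => by
        obtain ⟨F, rfl⟩ := ofHol_surjective hz hy g
        obtain ⟨G, rfl⟩ := ofHol_surjective hz hy g'
        rw [← map_add, hT, hT, hT, ← map_add, ofHol_eq_iff]
        filter_upwards [F.2, G.2] with v h1 h2
        change fderiv ℂ (F.1 + G.1) v _ = fderiv ℂ F.1 v _ + fderiv ℂ G.1 v _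
        rw [fderiv_add h1 h2, add_apply]
      map_smul' := fun c g => by
        obtain ⟨F, rfl⟩ := ofHol_surjective hz hy g
        rw [RingHom.id_apply, ← map_smul, hT, hT, ← map_smul, ofHol_eq_iff]
        filter_upwards [F.2] with v h1
        change fderiv ℂ (c • F.1) v _ = c • fderiv ℂ F.1 v _
        rw [fderiv_const_smul h1, smul_apply] }
    fun g g' => by
      obtain ⟨F, rfl⟩ := ofHol_surjective hz hy g
      obtain ⟨G, rfl⟩ := ofHol_surjective hz hy g'
      change descend hz hy (holFun.partial j) _ = _ • descend hz hy (holFun.partial j) _ +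
        _ • descend hz hy (holFun.partial j) _
      rw [← map_mul, hT, hT, hT, smul_eq_mul, smul_eq_mul, ← map_mul, ← map_mul, ← map_add,
        ofHol_eq_iff]
      filter_upwards [F.2, G.2] with v h1 h2
      change fderiv ℂ (F.1 * G.1) v _ = F.1 v * fderiv ℂ G.1 v _ + G.1 v * fderiv ℂ F.1 v _
      rw [fderiv_mul h1 h2]
      rfl

theorem derAt_ofHol (j : Fin (n + 1)) (F : holFun (z y)) :
    derAt hz hy j (ofHol hz hy F) = ofHol hz hy ((holFun.partial j F)) :=
  descend_ofHol hz hy (holFun.partial_congr j) F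

/-- The restriction of germs to a coordinate hyperplane. -/
def restrAt (j : Fin (n + 1)) : O n y →+* O n y :=
  have hT := descend_ofHol hz hy (holFun.slice_congr j (p := z y))
  { toFun := descend hz hy (holFun.slice j)
    map_one' := hT 1
    map_zero' := hT 0
    map_add' := fun g g' => by
      obtain ⟨F, rfl⟩ := ofHol_surjective hz hy g
      obtain ⟨G, rfl⟩ := ofHol_surjective hz hy g'
      rw [← map_add, hT, hT, hT]
      rfl
    map_mul' := fun g g' => by
      obtain ⟨F, rfl⟩ := ofHol_surjective hz hy g
      obtain ⟨G, rfl⟩ := ofHol_surjective hz hy g'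
      rw [← map_mul, hT, hT, hT]
      rfl }

theorem restrAt_ofHol (j : Fin (n + 1)) (F : holFun (z y)) :
    restrAt hz hy j (ofHol hz hy F) = ofHol hz hy ((holFun.slice j F)) :=
  descend_ofHol hz hy (holFun.slice_congr j) F

/-- The germ of a coordinate function. -/
def coordAt (l : Fin (n + 1)) : O n y := ofHol hz hy (holFun.coord _ l)

/-- The germ of a coordinate function, shifted to vanish at the point. -/
def centeredAt (l : Fin (n + 1)) : O n y := coordAt hz hy l - algebraMap ℂ (O n y) (z y l)

theorem centeredAt_eq (l : Fin (n + 1)) : centeredAt hz hy l =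
    ofHol hz hy (holFun.coord _ l - algebraMap ℂ _ (z y l)) := by
  rw [map_sub, AlgHom.commutes]; rfl

theorem derAt_coordAt (j l : Fin (n + 1)) :
    derAt hz hy j (coordAt hz hy l) = if j = l then 1 else 0 := by
  have : derAt hz hy j (coordAt hz hy l) =
      algebraMap ℂ (O n y) (if j = l then 1 else 0) := by
    rw [coordAt, derAt_ofHol, ← AlgHom.commutes (ofHol hz hy), ofHol_eq_iff]
    refine Eventually.of_forall fun v => ?_
    change fderiv ℂ (EuclideanSpace.proj l : Model n →L[ℂ] ℂ) v (EuclideanSpace.single j 1) =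
      if j = l then 1 else 0
    rw [ContinuousLinearMap.fderiv]
    simp [Pi.single_apply, eq_comm]
  rw [this]
  split_ifs <;> simp

theorem derAt_centeredAt (j l : Fin (n + 1)) :
    derAt hz hy j (centeredAt hz hy l) = if j = l then 1 else 0 := by
  rw [centeredAt, map_sub, derAt_coordAt, Derivation.map_algebraMap, sub_zero]

theorem exists_eq_sum_centeredAt (g : O n y) : ∃ (c : ℂ) (k : Fin (n + 1) → O n y),
    g = algebraMap ℂ (O n y) c + ∑ l, centeredAt hz hy l * k l := by
  obtain ⟨F, rfl⟩ := ofHol_surjective hz hy g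
  obtain ⟨F', ⟨G, hG⟩, h⟩ := holFun.exists_const F Finset.univ
  have hF' : F' = algebraMap ℂ _ (F'.1 (z y)) :=
    Subtype.ext (funext fun v => h _ _ (by simp))
  refine ⟨F'.1 (z y), fun l => ofHol hz hy (G l), ?_⟩
  have h1 := (ofHol_eq_iff hz hy).2 hG
  rw [map_sub, hF', AlgHom.commutes, map_sum, sub_eq_iff_eq_add'] at h1
  rw [h1]
  simp only [map_mul, ← centeredAt_eq]

/-- From `g = c + ∑ w_l k_l` one gets `θ g = ∑ w_l θ(k_l)`. Iterating, `θ g` vanishes to every order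
at the point and is therefore zero; no continuity of `θ` is needed. -/
theorem derivation_ext_at (θ : Derivation ℂ (O n y) (O n y))
    (h : ∀ l, θ (centeredAt hz hy l) = 0) : θ = 0 := by
  have key : ∀ (N : ℕ) (g : O n y) (F : holFun (z y)), θ g = ofHol hz hy F →
      F.1 =O[𝓝 (z y)] fun v => ‖v - z y‖ ^ N := by
    intro N
    induction N with
    | zero =>
      intro g F _
      simp only [pow_zero]
      exact F.2.differentiableAt.continuousAt.isBigO_one ℝ
    | succ N ih =>
      intro g F hF
      obtain ⟨c, k, hk⟩ := exists_eq_sum_centeredAt hz hy g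
      choose G hG using fun l => ofHol_surjective hz hy (θ (k l))
      have h1 : F.1 =ᶠ[𝓝 (z y)]
          (∑ l, (holFun.coord _ l - algebraMap ℂ _ (z y l)) * G l : holFun (z y)).1 := by
        rw [← ofHol_eq_iff hz hy, ← hF, hk, map_sum, map_add, Derivation.map_algebraMap, map_sum,
          zero_add]
        refine Finset.sum_congr rfl fun l _ => ?_
        rw [Derivation.leibniz, h, smul_zero, add_zero, map_mul, hG, centeredAt_eq, smul_eq_mul]
      refine h1.trans_isBigO ?_
      have h2 : (∑ l, (holFun.coord _ l - algebraMap ℂ _ (z y l)) * G l : holFun (z y)).1 =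
          fun v => ∑ l, (v l - z y l) * (G l).1 v := by
        funext v
        rw [AddSubmonoidClass.coe_finsetSum, Finset.sum_apply]
        rfl
      rw [h2]
      refine Asymptotics.IsBigO.fun_sum fun l _ => ?_
      simp only [pow_succ']
      refine Asymptotics.IsBigO.mul (Asymptotics.IsBigO.of_bound 1 (Eventually.of_forall
        fun v => ?_)) (ih _ _ (hG l).symm)
      rw [one_mul, norm_norm]
      exact PiLp.norm_apply_le (v - z y) l
  refine Derivation.ext fun g => ?_
  obtain ⟨F, hF⟩ := ofHol_surjective hz hy (θ g)
  rw [← hF, Derivation.zero_apply, ofHol_eq_zero_iff]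
  exact eventuallyEq_zero_of_isBigO F.2 fun N => key N g F hF.symm

/-- The coordinates on the ring of germs given by a chart. -/
def coordsAt : Coords (O n y) (Fin (n + 1)) where
  w := centeredAt hz hy
  der := derAt hz hy
  restr := restrAt hz hy
  der_self i := by rw [derAt_centeredAt, if_pos rfl]
  der_ne i j h := by rw [derAt_centeredAt, if_neg h]
  der_ext := derivation_ext_at hz hy
  restr_self i := by
    rw [centeredAt_eq, restrAt_ofHol, ofHol_eq_zero_iff]
    refine Eventually.of_forall fun v => ?_
    change slicePt (z y) i v i - z y i = 0
    rw [slicePt_apply, if_pos rfl, sub_self]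
  restr_ne i j h := by
    rw [centeredAt_eq, restrAt_ofHol, ofHol_eq_iff]
    refine Eventually.of_forall fun v => ?_
    change slicePt (z y) i v j - z y j = v j - z y j
    rw [slicePt_apply, if_neg h.symm]
  restr_sub i a := by
    obtain ⟨F, rfl⟩ := ofHol_surjective hz hy a
    obtain ⟨G, hG⟩ := holFun.exists_slice i F
    rw [restrAt_ofHol, ← map_sub, (ofHol_eq_iff hz hy).2 hG, map_mul, ← centeredAt_eq]
    exact Ideal.mul_mem_right _ _ (Ideal.mem_span_singleton_self _)

instance isDomain_O (y : X) : IsDomain (O n y) := by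
  have hz : chartAt (Model n) y ∈ IsManifold.maximalAtlas 𝓘(ℂ, Model n) ω X :=
    IsManifold.chart_mem_maximalAtlas y
  have hy := mem_chart_source (Model n) y
  have : Nontrivial (O n y) := ⟨0, 1, fun h => by
    have h' : (0 : X → ℂ) =ᶠ[𝓝 y] 1 := Germ.coe_eq.1 (congrArg O.germ h)
    exact zero_ne_one h'.self_of_nhds⟩
  have : NoZeroDivisors (O n y) := ⟨fun {a b} h => by
    obtain ⟨F, rfl⟩ := ofHol_surjective hz hy a
    obtain ⟨G, rfl⟩ := ofHol_surjective hz hy b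
    rw [← map_mul, ofHol_eq_zero_iff] at h
    rw [ofHol_eq_zero_iff, ofHol_eq_zero_iff]
    exact holFun.eventuallyEq_zero_or h⟩
  exact NoZeroDivisors.to_isDomain _

end

/-! ### Logarithmic fields along coordinate hyperplanes. -/

namespace Coords
variable {A ι : Type*} [CommRing A] [Algebra ℂ A] (𝔠 : Coords A ι)

theorem dvd_iff_restr (i : ι) (a : A) : 𝔠.w i ∣ a ↔ 𝔠.restr i a = 0 := by
  constructor
  · rintro ⟨c, rfl⟩
    rw [map_mul, 𝔠.restr_self, zero_mul]
  · intro h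
    have := 𝔠.restr_sub i a
    rwa [h, sub_zero, Ideal.mem_span_singleton] at this

theorem restr_prod {K : Finset ι} {i : ι} (hi : i ∉ K) :
    𝔠.restr i (∏ l ∈ K, 𝔠.w l) = ∏ l ∈ K, 𝔠.w l := by
  rw [map_prod]
  exact Finset.prod_congr rfl fun l hl => 𝔠.restr_ne _ _ fun e => hi (by rwa [e])

theorem w_ne_zero' [Nontrivial A] (i : ι) : 𝔠.w i ≠ 0 := fun h => by
  have := 𝔠.der_self i
  rw [h, map_zero] at this
  exact zero_ne_one this

variable [IsDomain A]

theorem prod_ne_zero (K : Finset ι) : ∏ l ∈ K, 𝔠.w l ≠ 0 :=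
  Finset.prod_ne_zero_iff.2 fun l _ => 𝔠.w_ne_zero' l

theorem dvd_of_dvd_mul_prod {K : Finset ι} {i : ι} (hi : i ∉ K) {a : A}
    (h : 𝔠.w i ∣ a * ∏ l ∈ K, 𝔠.w l) : 𝔠.w i ∣ a := by
  rw [dvd_iff_restr, map_mul, 𝔠.restr_prod hi] at h
  rw [dvd_iff_restr]
  exact (mul_eq_zero.1 h).resolve_right (𝔠.prod_ne_zero K)

theorem prod_dvd (K : Finset ι) {a : A} (h : ∀ l ∈ K, 𝔠.w l ∣ a) : ∏ l ∈ K, 𝔠.w l ∣ a := by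
  classical
  induction K using Finset.induction_on with
  | empty => simp
  | insert i K hi ih =>
    obtain ⟨c, hc⟩ := ih fun l hl => h l (Finset.mem_insert_of_mem hl)
    have h1 := h i (Finset.mem_insert_self _ _)
    rw [hc, mul_comm] at h1
    obtain ⟨c', rfl⟩ := 𝔠.dvd_of_dvd_mul_prod hi h1
    rw [Finset.prod_insert hi, hc]
    exact ⟨c', by ring⟩

/-- By the Leibniz rule `w_l` divides `θ(w_l)` times the product of the other coordinates;
restriction to `w_l = 0` does not kill that product, so `w_l` divides `θ(w_l)`. -/
theorem mem_logFields_iff (K : Finset ι) (θ : Derivation ℂ A A) :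
    θ ∈ (logFields (Ideal.span {∏ l ∈ K, 𝔠.w l})).T ↔ ∀ l ∈ K, 𝔠.w l ∣ θ (𝔠.w l) := by
  classical
  constructor
  · intro h l hl
    have h1 := h _ (Ideal.mem_span_singleton_self _)
    rw [Ideal.mem_span_singleton, ← Finset.mul_prod_erase K _ hl, Derivation.leibniz] at h1
    have h2 : 𝔠.w l ∣ θ (𝔠.w l) * ∏ k ∈ K.erase l, 𝔠.w k := by
      rw [smul_eq_mul, smul_eq_mul] at h1
      have h3 := (dvd_add_right (dvd_mul_right (𝔠.w l) (θ (∏ k ∈ K.erase l, 𝔠.w k)))).1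
        ((dvd_mul_right _ _).trans h1)
      rwa [mul_comm] at h3
    exact 𝔠.dvd_of_dvd_mul_prod (Finset.notMem_erase _ _) h2
  · intro h g hg
    rw [Ideal.mem_span_singleton] at hg ⊢
    refine 𝔠.prod_dvd K fun l hl => ?_
    obtain ⟨c, rfl⟩ := (Finset.dvd_prod_of_mem 𝔠.w hl).trans hg
    rw [Derivation.leibniz, smul_eq_mul, smul_eq_mul]
    exact dvd_add (dvd_mul_right _ _) (Dvd.dvd.mul_left (h l hl) _)

end Coords

/-! ### Ideals of germs vanishing on unions and intersections of coordinate hyperplanes. -/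

section
variable {n : ℕ} {X : Type*} [TopologicalSpace X] [ChartedSpace (Model n) X]

theorem vanish_anti {W W' : Set X} {y : X} (h : ∀ᶠ x in 𝓝 y, x ∈ W → x ∈ W') :
    vanish n W' y ≤ vanish n W y := by
  rintro g ⟨k, hk, hk'⟩
  exact ⟨k, hk, by filter_upwards [hk', h] with x h1 h2 hx using h1 (h2 hx)⟩

theorem vanish_eq_top {W : Set X} {y : X} (h : ∀ᶠ x in 𝓝 y, x ∉ W) : vanish n W y = ⊤ :=
  (Ideal.eq_top_iff_one _).2
    ⟨1, rfl, by filter_upwards [h] with x h1 hx using absurd hx h1⟩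

variable [IsManifold 𝓘(ℂ, Model n) ω X]
  {z : OpenPartialHomeomorph X (Model n)} (hz : z ∈ IsManifold.maximalAtlas 𝓘(ℂ, Model n) ω X)
  {y : X} (hy : y ∈ z.source)

theorem ofHol_mem_vanish {W : Set X} {F : holFun (z y)} :
    ofHol hz hy F ∈ vanish n W y ↔ ∀ᶠ x in 𝓝 y, x ∈ W → F.1 (z x) = 0 := by
  constructor
  · rintro ⟨k, hk, hk'⟩
    have e : F.1 ∘ z =ᶠ[𝓝 y] k := Germ.coe_eq.1 hk
    filter_upwards [e, hk'] with x h1 h2 hx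
    exact h1.trans (h2 hx)
  · intro h
    exact ⟨_, rfl, h⟩

/-- Modulo the shifted coordinates of `K` a germ does not depend on these coordinates, so it is
determined by its values on the subspace, where it vanishes. -/
theorem vanish_eq_span {W : Set X} (K : Finset (Fin (n + 1)))
    (hW : ∀ᶠ x in 𝓝 y, x ∈ W ↔ ∀ l ∈ K, z x l = z y l) :
    vanish n W y = Ideal.span (centeredAt hz hy '' K) := by
  classical
  refine le_antisymm (fun g hg => ?_) (Ideal.span_le.2 ?_)
  · obtain ⟨F, rfl⟩ := ofHol_surjective hz hy g
    obtain ⟨F', ⟨G, hG⟩, h⟩ := holFun.exists_const F K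
    have h0 : ofHol hz hy F' = 0 := by
      rw [ofHol_eq_zero_iff]
      -- Projection onto the subspace through `z y`; the remainder `F'` takes the same value at `v`
      -- and at `π v`.
      let π : Model n → Model n := fun v => WithLp.toLp 2 fun l => if l ∈ K then z y l else v l
      have hπ : ∀ v l, π v l = if l ∈ K then z y l else v l := fun v l => rfl
      have hπc : Continuous π := by
        refine (PiLp.continuous_toLp 2 _).comp (continuous_pi fun l => ?_)
        by_cases hl : l ∈ K
        · simp only [if_pos hl]
          exact continuous_const
        · simp only [if_neg hl]
          exact (EuclideanSpace.proj l : Model n →L[ℂ] ℂ).continuous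
      have hπy : π (z y) = z y := PiLp.ext fun l => by rw [hπ]; split_ifs <;> rfl
      have ht : Tendsto π (𝓝 (z y)) (𝓝 (z y)) := by
        have := hπc.tendsto (z y)
        rwa [hπy] at this
      have hs : Tendsto z.symm (𝓝 (z y)) (𝓝 y) := z.tendsto_symm hy
      filter_upwards [ht.eventually hG, ht.eventually (hs.eventually hW),
        ht.eventually (hs.eventually ((ofHol_mem_vanish hz hy).1 hg)),
        ht.eventually (z.open_target.mem_nhds (z.map_source hy))] with v h1 h2 h3 h4
      rw [z.right_inv h4] at h2 h3
      have h5 := h3 (h2.2 fun l hl => by rw [hπ, if_pos hl])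
      have h6 : F.1 (π v) - F'.1 (π v) = 0 := by
        refine h1.trans ?_
        rw [AddSubmonoidClass.coe_finsetSum, Finset.sum_apply]
        refine Finset.sum_eq_zero fun l hl => ?_
        change (π v l - z y l) * _ = 0
        rw [hπ, if_pos hl, sub_self, zero_mul]
      rw [h5, zero_sub, neg_eq_zero] at h6
      exact (h v (π v) fun l hl => by rw [hπ, if_neg hl]).trans h6
    have h1 := (ofHol_eq_iff hz hy).2 hG
    rw [map_sub, h0, sub_zero, map_sum] at h1
    rw [h1]
    refine Ideal.sum_mem _ fun l hl => ?_
    rw [map_mul, ← centeredAt_eq]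
    exact Ideal.mul_mem_right _ _ (Ideal.subset_span ⟨l, hl, rfl⟩)
  · rintro _ ⟨l, hl, rfl⟩
    rw [centeredAt_eq]
    refine (ofHol_mem_vanish hz hy).2 ?_
    filter_upwards [hW] with x h1 hx
    exact sub_eq_zero.2 (h1.1 hx l hl)

theorem vanish_eq_span_prod {W : Set X} (K : Finset (Fin (n + 1)))
    (hW : ∀ᶠ x in 𝓝 y, x ∈ W ↔ ∃ l ∈ K, z x l = z y l) :
    vanish n W y = Ideal.span {∏ l ∈ K, centeredAt hz hy l} := by
  refine le_antisymm (fun g hg => Ideal.mem_span_singleton.2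
    ((coordsAt hz hy).prod_dvd K fun l hl => ?_)) ?_
  · have h1 : g ∈ vanish n {x | z x l = z y l} y := vanish_anti (by
      filter_upwards [hW] with x h2 hx
      exact h2.2 ⟨l, hl, hx⟩) hg
    rw [vanish_eq_span hz hy {l} (by simp)] at h1
    rw [Finset.coe_singleton, Set.image_singleton, Ideal.mem_span_singleton] at h1
    exact h1
  · rw [Ideal.span_singleton_le_iff_mem]
    have h1 : ∏ l ∈ K, centeredAt hz hy l =
        ofHol hz hy (∏ l ∈ K, (holFun.coord _ l - algebraMap ℂ _ (z y l))) := by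
      rw [map_prod]
      exact Finset.prod_congr rfl fun l _ => centeredAt_eq hz hy l
    rw [h1]
    refine (ofHol_mem_vanish hz hy).2 ?_
    filter_upwards [hW] with x h2 hx
    obtain ⟨l, hl, e⟩ := h2.1 hx
    rw [SubmonoidClass.coe_finsetProd, Finset.prod_apply]
    exact Finset.prod_eq_zero hl (sub_eq_zero.2 e)

theorem isUnit_ofHol {F : holFun (z y)} (h : F.1 (z y) ≠ 0) : IsUnit (ofHol hz hy F) := by
  have hc := F.2.differentiableAt.continuousAt.eventually_ne h
  let G : holFun (z y) := ⟨fun v => (F.1 v)⁻¹, by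
    filter_upwards [F.2, hc] with v h1 h2 using h1.inv h2⟩
  refine IsUnit.of_mul_eq_one (ofHol hz hy G) ?_
  rw [← map_mul, ← map_one (ofHol hz hy), ofHol_eq_iff]
  filter_upwards [hc] with v h1
  exact mul_inv_cancel₀ h1

theorem isUnit_coordAt {l : Fin (n + 1)} (h : z y l ≠ 0) : IsUnit (coordAt hz hy l) :=
  isUnit_ofHol hz hy h

theorem coordAt_eq_centeredAt {l : Fin (n + 1)} (h : z y l = 0) :
    coordAt hz hy l = centeredAt hz hy l := by
  rw [centeredAt, h, map_zero, sub_zero]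

theorem eventually_coord_ne {l : Fin (n + 1)} (hy : y ∈ z.source) (h : z y l ≠ 0) :
    ∀ᶠ x in 𝓝 y, z x l ≠ 0 :=
  ((EuclideanSpace.proj l : Model n →L[ℂ] ℂ).continuous.continuousAt.comp
    (z.continuousAt hy)).eventually_ne h

end

/-! ### Coordinates adapted to a degeneration. -/

namespace Degeneration

variable {n : ℕ} {X : Type*} [TopologicalSpace X] [ChartedSpace (Model n) X]
  {I : Type*} [Fintype I] [DecidableEq I] (S : Degeneration n X I)

/-- Coordinates near a point in which the degeneration is a monomial. -/
structure Frame (x : X) where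
  z : OpenPartialHomeomorph X (Model n)
  mem : z ∈ IsManifold.maximalAtlas 𝓘(ℂ, Model n) ω X
  hx : x ∈ z.source
  B : Finset I
  mem_B : ∀ i, i ∈ B ↔ x ∈ S.Y i
  σ : I → Fin (n + 1)
  inj : Set.InjOn σ B
  mem_Y : ∀ i ∈ B, ∀ y ∈ z.source, y ∈ S.Y i ↔ z y (σ i) = 0
  notMem_Y : ∀ i ∉ B, ∀ y ∈ z.source, y ∉ S.Y i
  f_eq : ∀ y ∈ z.source, S.f y = ∏ i ∈ B, z y (σ i) ^ S.e i

theorem exists_frame [IsManifold 𝓘(ℂ, Model n) ω X] {x : X} (h : S.f x = 0) :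
    Nonempty (S.Frame x) := by
  classical
  obtain ⟨z, hz, hx, σ, hσ, hY, hf⟩ := S.local_form x h
  -- The chart is shrunk to avoid the finitely many closed components that do not pass through `x`;
  -- then only components through the centre occur anywhere in it.
  let N : Set X := ⋂ i ∈ {i | x ∉ S.Y i}, (S.Y i)ᶜ
  have hN : IsOpen N := Set.Finite.isOpen_biInter (Set.toFinite _) fun i _ => (S.isClosed i).isOpen_compl
  have hxN : x ∈ N := Set.mem_iInter₂.2 fun i hi => hi
  have hs : (z.restr N).source = z.source ∩ N := by rw [z.restr_source, hN.interior_eq]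
  refine ⟨{
    z := z.restr N
    mem := restr_mem_maximalAtlas (contDiffGroupoid ω 𝓘(ℂ, Model n)) hz hN
    hx := by rw [hs]; exact ⟨hx, hxN⟩
    B := {i | x ∈ S.Y i}
    mem_B := fun i => by simp
    σ := σ
    inj := by simpa using hσ
    mem_Y := fun i hi y hy => ?_
    notMem_Y := fun i hi y hy => ?_
    f_eq := fun y hy => ?_ }⟩
  · rw [hs] at hy
    exact hY i (by simpa using hi) y hy.1
  · rw [hs] at hy
    exact Set.mem_iInter₂.1 hy.2 i (by simpa using hi)
  · rw [hs] at hy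
    rw [hf y hy.1]
    exact Finset.prod_congr (by ext; simp) fun _ _ => rfl

variable {S} [IsManifold 𝓘(ℂ, Model n) ω X]

namespace Frame
variable {x : X} (𝔣 : S.Frame x)

/-- The indices of the coordinates which are equations of components. -/
def E : Finset (Fin (n + 1)) := 𝔣.B.image 𝔣.σ

/-- The multiplicities as a function of the coordinates. -/
def push (m : I → ℕ) (l : Fin (n + 1)) : ℕ := ∑ i ∈ 𝔣.B with 𝔣.σ i = l, m i

theorem push_σ (m : I → ℕ) {i : I} (hi : i ∈ 𝔣.B) : 𝔣.push m (𝔣.σ i) = m i := by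
  have : 𝔣.B.filter (fun j => 𝔣.σ j = 𝔣.σ i) = {i} := by
    ext j
    rw [Finset.mem_filter, Finset.mem_singleton]
    exact ⟨fun ⟨h1, h2⟩ => 𝔣.inj h1 hi h2, fun h => by rw [h]; exact ⟨hi, rfl⟩⟩
  rw [push, this, Finset.sum_singleton]

theorem push_of_notMem (m : I → ℕ) {l : Fin (n + 1)} (hl : l ∉ 𝔣.E) : 𝔣.push m l = 0 := by
  rw [push, Finset.sum_eq_zero]
  intro i hi
  rw [Finset.mem_filter] at hi
  exact absurd (Finset.mem_image.2 ⟨i, hi.1, hi.2⟩) hl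

variable {y : X} (hy : y ∈ 𝔣.z.source)

/-- The logarithmic coordinates at a point near the centre. -/
def log : LogCoords (O n y) n where
  toCoords := coordsAt 𝔣.mem hy
  E := 𝔣.E
  u := coordAt 𝔣.mem hy
  -- The value `1` off `E` is a default that keeps `e` positive; no monomial involves it.
  e l := if l ∈ 𝔣.E then 𝔣.push S.e l else 1
  e_pos l := by
    split_ifs with h
    · obtain ⟨i, hi, rfl⟩ := Finset.mem_image.1 h
      rw [𝔣.push_σ _ hi]
      exact S.e_pos i
    · exact one_pos
  der_u := derAt_coordAt 𝔣.mem hy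

theorem log_e {l : Fin (n + 1)} (h : l ∈ 𝔣.E) : (𝔣.log hy).e l = 𝔣.push S.e l := if_pos h

theorem mono_push (m : I → ℕ) :
    (𝔣.log hy).mono (𝔣.push m) = ∏ i ∈ 𝔣.B, coordAt 𝔣.mem hy (𝔣.σ i) ^ m i := by
  refine (Finset.prod_image 𝔣.inj).trans (Finset.prod_congr rfl fun i hi => ?_)
  rw [𝔣.push_σ _ hi]
  rfl

theorem t_eq : S.t y = (𝔣.log hy).mono (𝔣.log hy).e := by
  rw [(𝔣.log hy).mono_congr fun l hl => 𝔣.log_e hy hl, mono_push]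
  have h1 : ∏ i ∈ 𝔣.B, coordAt 𝔣.mem hy (𝔣.σ i) ^ S.e i =
      ofHol 𝔣.mem hy (∏ i ∈ 𝔣.B, holFun.coord _ (𝔣.σ i) ^ S.e i) := by
    rw [map_prod]
    exact Finset.prod_congr rfl fun i _ => (map_pow _ _ _).symm
  rw [h1]
  refine O.ext (Germ.coe_eq.2 ?_)
  filter_upwards [𝔣.z.open_source.mem_nhds hy] with x' hx'
  rw [𝔣.f_eq x' hx', Function.comp, SubmonoidClass.coe_finsetProd, Finset.prod_apply]
  rfl

-- Near `y` only the components through `y` are met, that is, those whose coordinate vanishes at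
-- `y`.
open Classical in
theorem J_eq : S.J y =
    Ideal.span {∏ l ∈ 𝔣.E with 𝔣.z y l = 0, centeredAt 𝔣.mem hy l} := by
  refine vanish_eq_span_prod 𝔣.mem hy _ ?_
  have h1 : ∀ᶠ x' in 𝓝 y, ∀ l, 𝔣.z y l ≠ 0 → 𝔣.z x' l ≠ 0 := by
    refine eventually_all.2 fun l => ?_
    by_cases h : 𝔣.z y l = 0
    · exact Eventually.of_forall fun _ h' => absurd h h'
    · filter_upwards [eventually_coord_ne hy h] with x' hx' _ using hx'
  filter_upwards [h1, 𝔣.z.open_source.mem_nhds hy] with x' h2 hx'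
  rw [Set.mem_iUnion]
  constructor
  · rintro ⟨i, hi⟩
    have hiB : i ∈ 𝔣.B := by
      by_contra h
      exact 𝔣.notMem_Y i h x' hx' hi
    have h3 := (𝔣.mem_Y i hiB x' hx').1 hi
    have h4 : 𝔣.z y (𝔣.σ i) = 0 := by
      by_contra h
      exact h2 _ h h3
    exact ⟨𝔣.σ i, Finset.mem_filter.2 ⟨Finset.mem_image_of_mem _ hiB, h4⟩, h3.trans h4.symm⟩
  · rintro ⟨l, hl, e⟩
    rw [Finset.mem_filter] at hl
    obtain ⟨i, hi, rfl⟩ := Finset.mem_image.1 hl.1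
    exact ⟨i, (𝔣.mem_Y i hi x' hx').2 (e.trans hl.2)⟩

/-- At a point `y` off the centre some coordinates with index in `E` are units. Divisibility by a
unit is no condition, so the same set `E` describes the logarithmic fields at every point of the
chart. Sections over a neighbourhood can thus use one basis. -/
theorem adapted : (𝔣.log hy).Adapted (S.J y) (S.t y) where
  t_eq := 𝔣.t_eq hy
  mem_log θ := by
    classical
    rw [𝔣.J_eq hy]
    refine ((coordsAt 𝔣.mem hy).mem_logFields_iff _ θ).trans ?_
    constructor
    · intro h l hl
      by_cases h0 : 𝔣.z y l = 0
      · have h1 := h l (Finset.mem_filter.2 ⟨hl, h0⟩)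
        change coordAt 𝔣.mem hy l ∣ θ (coordAt 𝔣.mem hy l)
        rw [coordAt_eq_centeredAt _ _ h0]
        exact h1
      · exact (isUnit_coordAt 𝔣.mem hy h0).dvd
    · intro h l hl
      obtain ⟨hl, h0⟩ := Finset.mem_filter.1 hl
      have h1 := h l hl
      change coordAt 𝔣.mem hy l ∣ θ (coordAt 𝔣.mem hy l) at h1
      rwa [coordAt_eq_centeredAt _ _ h0] at h1

theorem z_center {l : Fin (n + 1)} (hl : l ∈ 𝔣.E) : 𝔣.z x l = 0 := by
  obtain ⟨i, hi, rfl⟩ := Finset.mem_image.1 hl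
  exact (𝔣.mem_Y i hi x 𝔣.hx).1 ((𝔣.mem_B i).1 hi)

theorem centered : (𝔣.log 𝔣.hx).Centered :=
  fun _ hl => coordAt_eq_centeredAt _ _ (𝔣.z_center hl)

theorem vanish_Y {i : I} (hi : i ∈ 𝔣.B) :
    vanish n (S.Y i) y = Ideal.span {coordAt 𝔣.mem hy (𝔣.σ i)} := by
  by_cases h0 : 𝔣.z y (𝔣.σ i) = 0
  · rw [coordAt_eq_centeredAt _ _ h0, vanish_eq_span 𝔣.mem hy {𝔣.σ i}]
    · simp
    · filter_upwards [𝔣.z.open_source.mem_nhds hy] with x' hx'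
      rw [𝔣.mem_Y i hi x' hx']
      simp [h0]
  · rw [Ideal.span_singleton_eq_top.2 (isUnit_coordAt 𝔣.mem hy h0)]
    refine vanish_eq_top ?_
    filter_upwards [𝔣.z.open_source.mem_nhds hy, eventually_coord_ne hy h0] with x' hx' h1
    rwa [𝔣.mem_Y i hi x' hx']

theorem vanish_Y_of_notMem {i : I} (hy : y ∈ 𝔣.z.source) (hi : i ∉ 𝔣.B) :
    vanish n (S.Y i) y = ⊤ :=
  vanish_eq_top (by
    filter_upwards [𝔣.z.open_source.mem_nhds hy] with x' hx' using 𝔣.notMem_Y i hi x' hx')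

theorem divIdeal_eq (m : I → ℕ) :
    S.divIdeal m y = Ideal.span {(𝔣.log hy).mono (𝔣.push m)} := by
  rw [divIdeal, mono_push, ← Ideal.prod_span_singleton, ← Finset.prod_subset (Finset.subset_univ 𝔣.B)]
  · refine Finset.prod_congr rfl fun i hi => ?_
    rw [𝔣.vanish_Y hy hi, Ideal.span_singleton_pow]
  · intro i _ hi
    rw [𝔣.vanish_Y_of_notMem hy hi, Ideal.top_pow, Ideal.one_eq_top]

theorem conormal_eq {K : Finset I} (hK : K ⊆ 𝔣.B) :
    S.conormal K x = conormalCycle (Ideal.span ((𝔣.log 𝔣.hx).w '' (K.image 𝔣.σ : Finset _))) := by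
  rw [conormal]
  congr 1
  refine vanish_eq_span 𝔣.mem 𝔣.hx (K.image 𝔣.σ) ?_
  filter_upwards [𝔣.z.open_source.mem_nhds 𝔣.hx] with x' hx'
  rw [YK, Set.mem_iInter₂]
  constructor
  · intro h l hl
    obtain ⟨i, hi, rfl⟩ := Finset.mem_image.1 hl
    rw [𝔣.z_center (Finset.mem_image_of_mem _ (hK hi))]
    exact (𝔣.mem_Y i (hK hi) x' hx').1 (h i hi)
  · intro h i hi
    refine (𝔣.mem_Y i (hK hi) x' hx').2 ((h _ (Finset.mem_image_of_mem _ hi)).trans ?_)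
    exact 𝔣.z_center (Finset.mem_image_of_mem _ (hK hi))

end Frame

theorem conormal_eq_zero {x : X} {K : Finset I} {i : I} (hi : i ∈ K) (hx : x ∉ S.Y i) :
    S.conormal K x = 0 := by
  rw [conormal, vanish_eq_top, conormalCycle_top]
  filter_upwards [(S.isClosed i).isOpen_compl.mem_nhds hx] with x' h h'
  exact h (Set.mem_iInter₂.1 h' i hi)

namespace Frame
variable {x : X} (𝔣 : S.Frame x)

/-- Strata with an index outside `B` do not pass through `x` and contribute nothing; the other index
sets correspond to the subsets of `E` under `σ`. -/
theorem sum_conormal (k : I → ℕ) {k' : Fin (n + 1) → ℕ} (hk : ∀ l ∈ 𝔣.E, k' l = 𝔣.push k l) :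
    ∑ K : Finset I, (∑ j ∈ K, k j) • S.conormal K x =
      ∑ K ∈ 𝔣.E.powerset, (∑ j ∈ K, k' j) •
        conormalCycle (Ideal.span ((𝔣.log 𝔣.hx).w '' K)) := by
  rw [← Finset.sum_subset (Finset.subset_univ 𝔣.B.powerset)]
  · refine Finset.sum_bij (fun K _ => K.image 𝔣.σ) ?_ ?_ ?_ ?_
    · intro K hK
      exact Finset.mem_powerset.2 (Finset.image_subset_image (Finset.mem_powerset.1 hK))
    · intro K hK K' hK' h
      ext i
      have key : ∀ {K K' : Finset I}, K ⊆ 𝔣.B → K' ⊆ 𝔣.B → K.image 𝔣.σ = K'.image 𝔣.σ →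
          i ∈ K → i ∈ K' := by
        intro K K' hK hK' h hi
        have := Finset.mem_image_of_mem 𝔣.σ hi
        rw [h] at this
        obtain ⟨j, hj, e⟩ := Finset.mem_image.1 this
        rwa [← 𝔣.inj (hK' hj) (hK hi) e]
      rw [Finset.mem_powerset] at hK hK'
      exact ⟨key hK hK' h, key hK' hK h.symm⟩
    · intro L hL
      rw [Finset.mem_powerset] at hL
      obtain ⟨K, hK, rfl⟩ := Finset.subset_image_iff.1 hL
      exact ⟨K, Finset.mem_powerset.2 (by exact_mod_cast hK), rfl⟩
    · intro K hK
      rw [Finset.mem_powerset] at hK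
      rw [𝔣.conormal_eq hK, Finset.sum_image (𝔣.inj.mono hK)]
      congr 1
      refine Finset.sum_congr rfl fun j hj => ?_
      rw [hk _ (Finset.mem_image_of_mem _ (hK hj)), 𝔣.push_σ _ (hK hj)]
  · intro K _ hK
    rw [Finset.mem_powerset, Finset.not_subset] at hK
    obtain ⟨i, hi, hiB⟩ := hK
    rw [conormal_eq_zero hi fun h => hiB ((𝔣.mem_B i).2 h), smul_zero]

end Frame
end Degeneration

/-! ### Points off the central fibre, and the exponents attached to `α`. -/

section
variable {A : Type*} [CommRing A] [Algebra ℂ A]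

theorem Filt.isGood_of_subsingleton {M : Type*} [AddCommGroup M] [Module (DR A) M]
    [Subsingleton M] (Φ : Filt A M) : Φ.IsGood ∧ Φ.charCycle = 0 := by
  have h0 : Subsingleton Φ.Gr := by
    refine subsingleton_of_forall_eq 0 fun x => ?_
    obtain ⟨y, rfl⟩ := Φ.grMk_surjective x
    induction y using Φ.induction_on with
    | h0 => exact map_zero _
    | h1 l m => exact Φ.grMk_of_eq_zero (by
        rw [Subsingleton.elim (m : M) 0]
        exact zero_mem (Φ.F (l - 1)))
    | h2 y y' hy hy' => rw [map_add, hy, hy', add_zero]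
  refine ⟨⟨fun m => ⟨0, ?_⟩, ⟨0, ?_⟩, inferInstance⟩, ?_⟩
  · rw [Subsingleton.elim m 0]
    exact zero_mem (Φ.F 0)
  · exact Subsingleton.elim _ _
  · funext q
    rw [Filt.charCycle, cycle, if_neg]
    · rfl
    · intro h
      have := h.1
      rw [Module.support_eq_empty] at this
      exact this

theorem Fields.subsingleton_H0 {L : Fields A} {a c : Ideal A} (h : a ≤ c) (n : ℕ) :
    Subsingleton (L.H0 a c n) := by
  refine subsingleton_of_forall_eq 0 fun x => ?_
  obtain ⟨φ, hφ, rfl⟩ := Fields.cls_surjective x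
  exact (Fields.cls_eq_zero_iff hφ).2 (Submodule.mem_sup_left (Fields.K_mono h hφ))

end

namespace Degeneration

variable {n : ℕ} {X : Type*} [TopologicalSpace X] [ChartedSpace (Model n) X]
  {I : Type*} [Fintype I] [DecidableEq I] (S : Degeneration n X I)
  [IsManifold 𝓘(ℂ, Model n) ω X] {x : X}

section off
variable (h : S.f x ≠ 0)

theorem notMem_of_ne (h : S.f x ≠ 0) (i : I) : x ∉ S.Y i := fun hi =>
  h ((S.fiber x).2 ⟨i, hi⟩)

theorem divIdeal_of_ne (h : S.f x ≠ 0) (m : I → ℕ) : S.divIdeal m x = ⊤ := by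
  rw [divIdeal, ← Ideal.one_eq_top]
  refine Finset.prod_eq_one fun i _ => ?_
  rw [vanish_eq_top, Ideal.top_pow, Ideal.one_eq_top]
  filter_upwards [(S.isClosed i).isOpen_compl.mem_nhds (S.notMem_of_ne h i)] with y hy using hy

theorem isUnit_t (h : S.f x ≠ 0) : IsUnit (S.t x) := by
  have hz : chartAt (Model n) x ∈ IsManifold.maximalAtlas 𝓘(ℂ, Model n) ω X :=
    IsManifold.chart_mem_maximalAtlas x
  have hx := mem_chart_source (Model n) x
  obtain ⟨hF, e⟩ := eq_ofHol_of_germ hz hx (g := S.t x) (h := S.f) rfl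
  rw [e]
  refine isUnit_ofHol hz hx ?_
  change S.f ((chartAt (Model n) x).symm (chartAt (Model n) x x)) ≠ 0
  rwa [OpenPartialHomeomorph.left_inv _ hx]

theorem subsingleton_stalkM (h : S.f x ≠ 0) : Subsingleton (S.stalkM x) :=
  Fields.subsingleton_H0 (by rw [Ideal.span_singleton_eq_top.2 (S.isUnit_t h)]) n

theorem sum_conormal_of_ne (h : S.f x ≠ 0) (c : Finset I → ℕ) (hc : c ∅ = 0) :
    ∑ K : Finset I, c K • S.conormal K x = 0 := by
  refine Finset.sum_eq_zero fun K _ => ?_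
  rcases K.eq_empty_or_nonempty with rfl | ⟨i, hi⟩
  · rw [hc, zero_smul]
  · rw [conormal_eq_zero hi (S.notMem_of_ne h i), smul_zero]

theorem subsingleton_stalkH0 (h : S.f x ≠ 0) (α : ℚ) : Subsingleton (S.stalkH0 α x) :=
  Fields.subsingleton_H0 (by rw [idealGt, S.divIdeal_of_ne h]; exact le_top) n

theorem subsingleton_stalkEig (h : S.f x ≠ 0) (α : ℚ) : Subsingleton (S.stalkEig α x) := by
  have := S.subsingleton_stalkM h
  exact (Submodule.Quotient.mk_surjective _).subsingleton

end off

/-- The indicator function of the indices with `α e_i` an integer. -/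
def jump (α : ℚ) (i : I) : ℕ := if i ∈ S.indices α then 1 else 0

theorem sum_jump (α : ℚ) (K : Finset I) : ∑ j ∈ K, S.jump α j = (S.indices α ∩ K).card := by
  simp only [jump]
  rw [Finset.sum_ite_mem, Finset.sum_const, smul_eq_mul, mul_one, Finset.inter_comm]

/-- The exponents of the two divisors differ by one exactly where `α e_i` is an integer. This is
what makes `I_α` appear in the cycles. -/
theorem ceil_add_jump {α : ℚ} (h0 : 0 ≤ α) (i : I) :
    ⌈α * S.e i⌉₊ + S.jump α i = ⌊α * S.e i⌋₊ + 1 := by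
  have hnn : 0 ≤ α * S.e i := by positivity
  rw [jump]
  split_ifs with h
  · simp only [indices, Finset.mem_filter, Finset.mem_univ, true_and] at h
    obtain ⟨k, hk⟩ := h
    have hk0 : 0 ≤ k := by
      have : (0 : ℚ) ≤ k := hk ▸ hnn
      exact_mod_cast this
    obtain ⟨m, rfl⟩ := Int.eq_ofNat_of_zero_le hk0
    rw [hk]
    simp
  · simp only [indices, Finset.mem_filter, Finset.mem_univ, true_and, not_exists] at h
    rw [add_zero]
    refine (Nat.ceil_eq_iff (Nat.succ_ne_zero _)).2 ⟨?_, ?_⟩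
    · rw [Nat.succ_sub_one]
      refine lt_of_le_of_ne (Nat.floor_le hnn) fun e => h ⌊α * S.e i⌋₊ ?_
      rw [← e]
      simp
    · rw [Nat.cast_add_one]
      exact (Nat.lt_floor_add_one _).le

/-- Since `α < 1`, the larger divisor is still contained in the central fibre, so `t` has
coefficients in its ideal. -/
theorem ceil_add_jump_le {α : ℚ} (h0 : 0 ≤ α) (h1 : α < 1) (i : I) :
    ⌈α * S.e i⌉₊ + S.jump α i ≤ S.e i := by
  rw [S.ceil_add_jump h0, Nat.succ_le_iff, Nat.floor_lt (by positivity)]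
  have : (0 : ℚ) < S.e i := by exact_mod_cast S.e_pos i
  nlinarith

variable {S}

namespace Frame
variable (𝔣 : S.Frame x) {y : X} (hy : y ∈ 𝔣.z.source)

theorem nonempty_E (h : S.f x = 0) : 𝔣.E.Nonempty := by
  obtain ⟨i, hi⟩ := (S.fiber x).1 h
  exact ⟨_, Finset.mem_image_of_mem _ ((𝔣.mem_B i).2 hi)⟩

theorem push_add (m k : I → ℕ) : 𝔣.push (m + k) = 𝔣.push m + 𝔣.push k :=
  funext fun _ => Finset.sum_add_distrib

/-- The exponents of the divisor `⌈αY⌉`. -/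
def ge (α : ℚ) : Fin (n + 1) → ℕ := 𝔣.push fun i => ⌈α * S.e i⌉₊

theorem idealGe_eq (α : ℚ) : S.idealGe α y = Ideal.span {(𝔣.log hy).mono (𝔣.ge α)} :=
  𝔣.divIdeal_eq hy _

theorem idealGt_eq {α : ℚ} (h0 : 0 ≤ α) :
    S.idealGt α y = Ideal.span {(𝔣.log hy).mono (𝔣.ge α + 𝔣.push (S.jump α))} := by
  rw [ge, ← push_add, idealGt, 𝔣.divIdeal_eq hy]
  congr 5
  funext i
  exact (S.ceil_add_jump h0 i).symm

theorem ge_add_le {α : ℚ} (h0 : 0 ≤ α) (h1 : α < 1) (l : Fin (n + 1)) :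
    𝔣.ge α l + 𝔣.push (S.jump α) l ≤ (𝔣.log hy).e l := by
  rw [← Pi.add_apply, ge, ← push_add]
  by_cases hl : l ∈ 𝔣.E
  · rw [𝔣.log_e hy hl]
    obtain ⟨i, hi, rfl⟩ := Finset.mem_image.1 hl
    rw [𝔣.push_σ _ hi, 𝔣.push_σ _ hi]
    exact S.ceil_add_jump_le h0 h1 i
  · rw [𝔣.push_of_notMem _ hl]
    exact Nat.zero_le _

/-- The exponents `r` with `r / e_i ≥ α` are those with `r ≥ ⌈α e_i⌉`; for the strict inequality the
bound is `⌊α e_i⌋ + 1`. -/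
theorem Mge_eq (h : S.f x = 0) {α : ℚ} (h0 : 0 ≤ α) (h1 : α < 1) :
    Mge (S.J y) (S.t y) n α = (𝔣.log hy).imageM (S.J y) (S.t y) (𝔣.ge α) := by
  refine (𝔣.adapted hy).genEigen_eq (𝔣.nonempty_E h)
    (fun l => le_trans (Nat.le_add_right _ _) (𝔣.ge_add_le hy h0 h1 l)) ?_ ?_
  all_goals
    intro l hl r hr
    have hl' : l ∈ 𝔣.E := hl
    rw [𝔣.log_e hy hl']
    obtain ⟨i, hi, rfl⟩ := Finset.mem_image.1 hl'
    rw [ge, 𝔣.push_σ _ hi] at hr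
    rw [𝔣.push_σ _ hi, Set.mem_Ici]
    have he : (0 : ℝ) < S.e i := by exact_mod_cast S.e_pos i
  · rw [not_le, div_lt_iff₀ he]
    have := Nat.lt_ceil.1 hr
    exact_mod_cast this
  · intro _
    rw [le_div_iff₀ he]
    have := Nat.ceil_le.1 hr
    exact_mod_cast this

theorem Mgt_eq (h : S.f x = 0) {α : ℚ} (h0 : 0 ≤ α) (h1 : α < 1) :
    Mgt (S.J y) (S.t y) n α =
      (𝔣.log hy).imageM (S.J y) (S.t y) (𝔣.ge α + 𝔣.push (S.jump α)) := by
  refine (𝔣.adapted hy).genEigen_eq (𝔣.nonempty_E h) (𝔣.ge_add_le hy h0 h1) ?_ ?_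
  all_goals
    intro l hl r hr
    have hl' : l ∈ 𝔣.E := hl
    rw [𝔣.log_e hy hl']
    obtain ⟨i, hi, rfl⟩ := Finset.mem_image.1 hl'
    rw [ge, 𝔣.push_σ _ hi, 𝔣.push_σ _ hi, S.ceil_add_jump h0] at hr
    rw [𝔣.push_σ _ hi, Set.mem_Ioi]
    have he : (0 : ℝ) < S.e i := by exact_mod_cast S.e_pos i
    have hnn : 0 ≤ α * S.e i := by positivity
  · rw [not_lt, div_le_iff₀ he]
    have := (Nat.le_floor_iff hnn).1 (Nat.lt_succ_iff.1 hr)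
    exact_mod_cast this
  · intro _
    rw [lt_div_iff₀ he]
    have := (Nat.floor_lt hnn).1 (Nat.succ_le_iff.1 hr)
    exact_mod_cast this

theorem isGood_H0 (𝔣 : S.Frame x) (h : S.f x = 0) {α : ℚ} (h0 : 0 ≤ α) {M' : Type*} [AddCommGroup M']
    [Module (DR (O n x)) M'] (Φ' : Filt (O n x) M') (ψ : S.stalkH0 α x ≃ₗ[DR (O n x)] M')
    (hψ : ∀ l m, m ∈ (S.filtH0 α x).F l ↔ ψ m ∈ Φ'.F l) : Φ'.IsGood ∧
      Φ'.charCycle = ∑ K : Finset I, (S.indices α ∩ K).card • S.conormal K x := by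
  have key : ∀ a b : Ideal (O n x),
      Ideal.span {(𝔣.log 𝔣.hx).mono (𝔣.ge α)} = a →
      Ideal.span {(𝔣.log 𝔣.hx).mono (𝔣.ge α + 𝔣.push (S.jump α))} = b →
      ∀ ψ : (S.rel x).H0 a b n ≃ₗ[DR (O n x)] M',
        (∀ l m, m ∈ ((S.rel x).H0Filt a b n).F l ↔ ψ m ∈ Φ'.F l) → Φ'.IsGood ∧
      Φ'.charCycle = ∑ K ∈ 𝔣.E.powerset, (∑ j ∈ K, 𝔣.push (S.jump α) j) •
        conormalCycle (Ideal.span ((𝔣.log 𝔣.hx).w '' K)) := by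
    rintro _ _ rfl rfl ψ hψ
    exact (𝔣.adapted 𝔣.hx).cycle_H0 𝔣.centered (𝔣.nonempty_E h) _ _ Φ' ψ hψ
  have := key _ _ (𝔣.idealGe_eq 𝔣.hx α).symm (𝔣.idealGt_eq 𝔣.hx h0).symm ψ hψ
  rw [← 𝔣.sum_conormal (S.jump α) fun _ _ => rfl] at this
  simpa only [S.sum_jump] using this

end Frame

/-! ### The stalkwise statements. -/

variable (S)

theorem existsUnique_residue (x : X) : ∃! R, IsResidue (S.J x) (S.t x) n R := by
  by_cases h : S.f x = 0
  · obtain ⟨𝔣⟩ := S.exists_frame h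
    obtain ⟨i, hi⟩ := 𝔣.nonempty_E h
    exact (𝔣.adapted 𝔣.hx).existsUnique_residue (i := i) hi
  · have := S.subsingleton_stalkM h
    exact ⟨0, fun _ _ _ => Subsingleton.elim _ _, fun _ _ =>
      LinearMap.ext fun _ => Subsingleton.elim _ _⟩

theorem isGood_filtM (x : X) : (S.filtM x).IsGood ∧
    (S.filtM x).charCycle = ∑ K : Finset I, (∑ j ∈ K, S.e j) • S.conormal K x := by
  by_cases h : S.f x = 0
  · obtain ⟨𝔣⟩ := S.exists_frame h
    have := (𝔣.adapted 𝔣.hx).cycle_M 𝔣.centered (𝔣.nonempty_E h)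
    rwa [𝔣.sum_conormal S.e fun l hl => 𝔣.log_e 𝔣.hx hl]
  · have := S.subsingleton_stalkM h
    rw [S.sum_conormal_of_ne h _ (by simp)]
    exact Filt.isGood_of_subsingleton _

theorem filteredAcyclic (x : X) {α : ℚ} (h0 : 0 ≤ α) :
    (S.rel x).FilteredAcyclic (S.idealGe α x) (S.idealGt α x) n := by
  by_cases h : S.f x = 0
  · obtain ⟨𝔣⟩ := S.exists_frame h
    rw [𝔣.idealGe_eq 𝔣.hx, 𝔣.idealGt_eq 𝔣.hx h0]
    exact (𝔣.adapted 𝔣.hx).filteredAcyclic 𝔣.centered _ _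
  · rw [idealGe, idealGt, S.divIdeal_of_ne h, S.divIdeal_of_ne h]
    exact LogCoords.filteredAcyclic_self _

theorem isGood_filtH0 (x : X) {α : ℚ} (h0 : 0 ≤ α) : (S.filtH0 α x).IsGood ∧
    (S.filtH0 α x).charCycle = ∑ K : Finset I, (S.indices α ∩ K).card • S.conormal K x := by
  by_cases h : S.f x = 0
  · obtain ⟨𝔣⟩ := S.exists_frame h
    exact 𝔣.isGood_H0 h h0 _ (LinearEquiv.refl _ _) fun _ _ => Iff.rfl
  · have := S.subsingleton_stalkH0 h α
    rw [S.sum_conormal_of_ne h _ (by simp)]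
    exact Filt.isGood_of_subsingleton _

theorem exists_stalk_equiv (x : X) {α : ℚ} (h0 : 0 ≤ α) (h1 : α < 1) :
    ∃ ψ : S.stalkH0 α x ≃ₗ[DR (O n x)] S.stalkEig α x,
      (∀ (φ : (S.rel x).Form n) (h : φ ∈ (S.rel x).K (S.idealGe α x) n),
        ∃ h' : M.mk (S.J x) (S.t x) φ ∈ Mge (S.J x) (S.t x) n α,
          ψ ((S.rel x).cls (S.idealGt α x) φ h) = Submodule.Quotient.mk ⟨_, h'⟩) ∧
      ∀ l m, m ∈ (S.filtH0 α x).F l ↔ ψ m ∈ (S.filtEig α x).F l := by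
  by_cases h : S.f x = 0
  · obtain ⟨𝔣⟩ := S.exists_frame h
    have key : ∀ a b : Ideal (O n x),
        Ideal.span {(𝔣.log 𝔣.hx).mono (𝔣.ge α)} = a →
        Ideal.span {(𝔣.log 𝔣.hx).mono (𝔣.ge α + 𝔣.push (S.jump α))} = b →
        ∃ ψ : (S.rel x).H0 a b n ≃ₗ[DR (O n x)] S.stalkEig α x,
          (∀ (φ : (S.rel x).Form n) (h : φ ∈ (S.rel x).K a n),
            ∃ h' : M.mk (S.J x) (S.t x) φ ∈ Mge (S.J x) (S.t x) n α,
              ψ ((S.rel x).cls b φ h) = Submodule.Quotient.mk ⟨_, h'⟩) ∧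
          ∀ l m, m ∈ ((S.rel x).H0Filt a b n).F l ↔ ψ m ∈ (S.filtEig α x).F l := by
      rintro _ _ rfl rfl
      exact (𝔣.adapted 𝔣.hx).exists_equiv 𝔣.centered (𝔣.nonempty_E h)
        (𝔣.ge_add_le 𝔣.hx h0 h1) (𝔣.Mge_eq 𝔣.hx h h0 h1) (𝔣.Mgt_eq 𝔣.hx h h0 h1)
    exact key _ _ (𝔣.idealGe_eq 𝔣.hx α).symm (𝔣.idealGt_eq 𝔣.hx h0).symm
  · have := S.subsingleton_stalkM h
    have := S.subsingleton_stalkH0 h α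
    have := S.subsingleton_stalkEig h α
    refine ⟨0, fun φ hφ => ⟨?_, Subsingleton.elim _ _⟩, fun l m => ?_⟩
    · rw [Subsingleton.elim (M.mk (S.J x) (S.t x) φ) 0]
      exact zero_mem _
    · rw [Subsingleton.elim m 0, map_zero]
      exact iff_of_true (zero_mem ((S.filtH0 α x).F l)) (zero_mem ((S.filtEig α x).F l))

theorem isGood_filtEig (x : X) {α : ℚ} (h0 : 0 ≤ α) (h1 : α < 1) : (S.filtEig α x).IsGood ∧
    (S.filtEig α x).charCycle = ∑ K : Finset I, (S.indices α ∩ K).card • S.conormal K x := by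
  by_cases h : S.f x = 0
  · obtain ⟨𝔣⟩ := S.exists_frame h
    obtain ⟨ψ, -, hψ⟩ := S.exists_stalk_equiv x h0 h1
    exact 𝔣.isGood_H0 h h0 _ ψ hψ
  · have := S.subsingleton_stalkEig h α
    rw [S.sum_conormal_of_ne h _ (by simp)]
    exact Filt.isGood_of_subsingleton _

end Degeneration

/-! ### Sections of the sheaves of functions, fields and operators. -/

section
variable {n : ℕ} {X : Type*} [TopologicalSpace X] [ChartedSpace (Model n) X] {U V : Set X}

/-- The global function is the value of each germ at its own point, so the local representatives
need not be chosen compatibly. -/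
theorem isSecO_of_local {g : ∀ x : X, O n x}
    (h : ∀ x ∈ U, ∃ h : X → ℂ, ∀ᶠ y in 𝓝 x, (g y).germ = (h : Germ (𝓝 y) ℂ)) : IsSecO n U g := by
  refine ⟨fun y => (g y).germ.value, fun x hx => ?_⟩
  obtain ⟨h, hh⟩ := h x hx
  rw [hh.self_of_nhds]
  refine Germ.coe_eq.2 ?_
  filter_upwards [hh] with y hy
  rw [hy]
  rfl

namespace IsSecO
variable {g g' : ∀ x : X, O n x}

theorem mono (h : IsSecO n U g) (hV : V ⊆ U) : IsSecO n V g :=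
  h.imp fun _ hk x hx => hk x (hV hx)

theorem congr (h : IsSecO n U g) (e : ∀ x ∈ U, g x = g' x) : IsSecO n U g' :=
  h.imp fun _ hk x hx => by rw [← e x hx]; exact hk x hx

theorem add (h : IsSecO n U g) (h' : IsSecO n U g') : IsSecO n U fun x => g x + g' x := by
  obtain ⟨k, hk⟩ := h
  obtain ⟨k', hk'⟩ := h'
  exact ⟨k + k', fun x hx => by rw [map_add, hk x hx, hk' x hx]; rfl⟩

theorem mul (h : IsSecO n U g) (h' : IsSecO n U g') : IsSecO n U fun x => g x * g' x := by
  obtain ⟨k, hk⟩ := h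
  obtain ⟨k', hk'⟩ := h'
  exact ⟨k * k', fun x hx => by rw [map_mul, hk x hx, hk' x hx]; rfl⟩

theorem const (c : ℂ) : IsSecO n U fun x => algebraMap ℂ (O n x) c := ⟨fun _ => c, fun _ _ => rfl⟩

theorem sum {ι : Type*} (s : Finset ι) {g : ι → ∀ x : X, O n x} (h : ∀ i ∈ s, IsSecO n U (g i)) :
    IsSecO n U fun x => ∑ i ∈ s, g i x := by
  classical
  induction s using Finset.induction_on with
  | empty => exact (const 0).congr fun x _ => by rw [map_zero, Finset.sum_empty]
  | insert i s hi ih =>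
    exact ((h i (by simp)).add (ih fun j hj => h j (by simp [hj]))).congr fun x _ => by
      rw [Finset.sum_insert hi]

theorem prod {ι : Type*} (s : Finset ι) {g : ι → ∀ x : X, O n x} (h : ∀ i ∈ s, IsSecO n U (g i)) :
    IsSecO n U fun x => ∏ i ∈ s, g i x := by
  classical
  induction s using Finset.induction_on with
  | empty => exact (const 1).congr fun x _ => by rw [map_one, Finset.prod_empty]
  | insert i s hi ih =>
    exact ((h i (by simp)).mul (ih fun j hj => h j (by simp [hj]))).congr fun x _ => by
      rw [Finset.prod_insert hi]

theorem pow (h : IsSecO n U g) (k : ℕ) : IsSecO n U fun x => g x ^ k :=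
  (prod (Finset.range k) (g := fun _ => g) fun _ _ => h).congr fun x _ => by simp

theorem det {p : ℕ} {c : ∀ x : X, Matrix (Fin p) (Fin p) (O n x)}
    (h : ∀ i j, IsSecO n U fun x => c x i j) : IsSecO n U fun x => (c x).det := by
  refine (sum Finset.univ (g := fun (τ : Equiv.Perm (Fin p)) x =>
    algebraMap ℂ (O n x) (Equiv.Perm.sign τ : ℤ) * ∏ i, c x (τ i) i) fun τ _ =>
      (const _).mul (prod _ fun i _ => h (τ i) i)).congr fun x _ => ?_
  rw [Matrix.det_apply']
  exact Finset.sum_congr rfl fun τ _ => by rw [map_intCast]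

/-- A family of germs whose product with a nonvanishing section is a section is a section. -/
theorem of_mul [IsManifold 𝓘(ℂ, Model n) ω X] (hU : IsOpen U) (h' : IsSecO n U g')
    (h : IsSecO n U fun x => g x * g' x) (hne : ∀ x ∈ U, g' x ≠ 0) : IsSecO n U g := by
  refine isSecO_of_local fun x hx => ?_
  obtain ⟨p, hp⟩ := h
  obtain ⟨v, hv⟩ := h'
  obtain ⟨k, hk, hk'⟩ := (g x).2
  have e : k * v =ᶠ[𝓝 x] p := Germ.coe_eq.1 (by
    rw [← hp x hx, map_mul, hv x hx]
    exact congrArg (· * (v : Germ (𝓝 x) ℂ)) hk.symm)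
  refine ⟨k, ?_⟩
  filter_upwards [eventually_eventually_nhds.2 hk', eventually_eventuallyEq_nhds.2 e,
    hU.mem_nhds hx] with y h1 h2 hy
  -- A representative of the germ at `x` is holomorphic nearby; there its product with `g'` is the
  -- given section, so cancelling `g'` shows that it represents `g` at `y`.
  let κ : O n y := ⟨(k : Germ (𝓝 y) ℂ), k, rfl, h1⟩
  have : g y = κ := by
    refine mul_right_cancel₀ (hne y hy) (O.ext ?_)
    rw [hp y hy, map_mul, hv y hy]
    exact (Germ.coe_eq.2 h2).symm
  rw [this]
  rfl

end IsSecO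

namespace IsSecD
variable {P P' : ∀ x : X, D (O n x)}

theorem mono (h : IsSecD n U P) (hV : V ⊆ U) : IsSecD n V P :=
  fun W hW => h W (hW.trans hV)

theorem congr (h : IsSecD n U P) (e : ∀ x ∈ U, P x = P' x) : IsSecD n U P' :=
  fun W hW hWo g hg => (h W hW hWo g hg).congr fun x hx => by rw [e x (hW hx)]

theorem add (h : IsSecD n U P) (h' : IsSecD n U P') : IsSecD n U fun x => P x + P' x :=
  fun W hW hWo g hg => (h W hW hWo g hg).add (h' W hW hWo g hg)

theorem mul (h : IsSecD n U P) (h' : IsSecD n U P') : IsSecD n U fun x => P x * P' x :=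
  fun W hW hWo g hg => h W hW hWo _ (h' W hW hWo g hg)

theorem smul {g : ∀ x : X, O n x} (hg : IsSecO n U g) (h : IsSecD n U P) :
    IsSecD n U fun x => g x • P x :=
  fun W hW hWo g' hg' => (hg.mono hW).mul (h W hW hWo g' hg')

theorem toD {g : ∀ x : X, O n x} (hg : IsSecO n U g) : IsSecD n U fun x => LogD.toD (g x) :=
  fun _ hW _ _ hg' => (hg.mono hW).mul hg'

theorem derD {θ : ∀ x : X, Derivation ℂ (O n x) (O n x)} (hθ : IsSecT n U θ) :
    IsSecD n U fun x => LogD.derD (θ x) := hθ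

theorem sub (h : IsSecD n U P) (h' : IsSecD n U P') : IsSecD n U fun x => P x - P' x :=
  (h.add ((toD (IsSecO.const (-1))).mul h')).congr fun x _ => by
    rw [map_neg, map_one, map_neg, map_one, neg_one_mul, sub_eq_add_neg]

theorem sum {ι : Type*} (s : Finset ι) {P : ι → ∀ x : X, D (O n x)}
    (h : ∀ i ∈ s, IsSecD n U (P i)) : IsSecD n U fun x => ∑ i ∈ s, P i x := by
  classical
  induction s using Finset.induction_on with
  | empty =>
    exact (toD (IsSecO.const 0)).congr fun x _ => by
      rw [map_zero, map_zero, Finset.sum_empty]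
  | insert i s hi ih =>
    exact ((h i (by simp)).add (ih fun j hj => h j (by simp [hj]))).congr fun x _ => by
      rw [Finset.sum_insert hi]

end IsSecD

theorem IsSecT.mono {θ : ∀ x : X, Derivation ℂ (O n x) (O n x)} (h : IsSecT n U θ) (hV : V ⊆ U) :
    IsSecT n V θ := fun W hW => h W (hW.trans hV)

theorem IsSecT.congr {θ θ' : ∀ x : X, Derivation ℂ (O n x) (O n x)} (h : IsSecT n U θ)
    (e : ∀ x ∈ U, θ x = θ' x) : IsSecT n U θ' :=
  fun W hW hWo g hg => (h W hW hWo g hg).congr fun x hx => by rw [e x (hW hx)]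

/-- The extension by zero of a family. -/
def ext0 {s : Set X} {β : X → Type*} [∀ y, Zero (β y)] (g : ∀ y ∈ s, β y) (y : X) : β y :=
  open Classical in if h : y ∈ s then g y h else 0

theorem ext0_of_mem {s : Set X} {β : X → Type*} [∀ y, Zero (β y)] (g : ∀ y ∈ s, β y) {y : X}
    (h : y ∈ s) : ext0 g y = g y h := dif_pos h

variable [IsManifold 𝓘(ℂ, Model n) ω X]
  {z : OpenPartialHomeomorph X (Model n)} (hz : z ∈ IsManifold.maximalAtlas 𝓘(ℂ, Model n) ω X)

theorem isSecO_coordAt (l : Fin (n + 1)) :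
    IsSecO n z.source (ext0 fun _ hy => coordAt hz hy l) :=
  ⟨fun y => z y l, fun y hy => by rw [ext0_of_mem _ hy]; rfl⟩

theorem isSecT_derAt (j : Fin (n + 1)) :
    IsSecT n z.source (ext0 fun _ hy => derAt hz hy j) := by
  rintro V hV - g ⟨h, hh⟩
  refine ⟨fun x => fderiv ℂ (h ∘ z.symm) (z x) (EuclideanSpace.single j 1), fun y hy => ?_⟩
  obtain ⟨hF, e⟩ := eq_ofHol_of_germ hz (hV hy) (hh y hy)
  beta_reduce
  rw [ext0_of_mem _ (hV hy), e, derAt_ofHol]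
  rfl

theorem exists_section_polynomial {y : X} (hy : y ∈ z.source) {p : O n y}
    (hp : p ∈ Algebra.adjoin ℂ (Set.range (coordsAt hz hy).w)) :
    ∃ g : ∀ x : X, O n x, IsSecO n z.source g ∧ g y = p := by
  induction hp using Algebra.adjoin_induction with
  | mem p hp =>
    obtain ⟨l, rfl⟩ := hp
    refine ⟨fun x => ext0 (fun _ hy => coordAt hz hy l) x + algebraMap ℂ (O n x) (-z y l),
      (isSecO_coordAt hz l).add (IsSecO.const _), ?_⟩
    beta_reduce
    rw [ext0_of_mem _ hy, map_neg, ← sub_eq_add_neg]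
    rfl
  | algebraMap c => exact ⟨_, IsSecO.const c, rfl⟩
  | add p q _ _ hp hq =>
    obtain ⟨g, hg, rfl⟩ := hp
    obtain ⟨g', hg', rfl⟩ := hq
    exact ⟨_, hg.add hg', rfl⟩
  | mul p q _ _ hp hq =>
    obtain ⟨g, hg, rfl⟩ := hp
    obtain ⟨g', hg', rfl⟩ := hq
    exact ⟨_, hg.mul hg', rfl⟩

/-- Sections of the sheaf of differential operators with the same germ agree nearby. -/
theorem IsSecD.exists_eq (hU : IsOpen U) {P P' : ∀ x : X, D (O n x)} (hP : IsSecD n U P)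
    (hP' : IsSecD n U P') {x : X} (hx : x ∈ U) (e : P x = P' x) :
    ∃ W ⊆ U, IsOpen W ∧ x ∈ W ∧ ∀ y ∈ W, P y = P' y := by
  let z := chartAt (Model n) x
  have hz : z ∈ IsManifold.maximalAtlas 𝓘(ℂ, Model n) ω X := IsManifold.chart_mem_maximalAtlas x
  have hxz : x ∈ z.source := mem_chart_source (Model n) x
  have hnhds : ∀ᶠ v in 𝓝 (z x), v ∈ z.target ∧ z.symm v ∈ U := by
    have ht : Tendsto z.symm (𝓝 (z x)) (𝓝 x) := z.tendsto_symm hxz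
    exact (z.open_target.eventually_mem (z.map_source hxz)).and (ht.eventually (hU.eventually_mem hx))
  obtain ⟨r, hr, hball⟩ := Metric.eventually_nhds_iff_ball.1 hnhds
  let W := z.source ∩ z ⁻¹' Metric.ball (z x) r
  have hWo : IsOpen W := z.isOpen_inter_preimage Metric.isOpen_ball
  have hWU : W ⊆ U := fun y hy => by
    have := (hball _ hy.2).2
    rwa [z.left_inv hy.1] at this
  have hxW : x ∈ W := ⟨hxz, Metric.mem_ball_self hr⟩
  -- At a point `y` of `W` the difference is tested on polynomials in the coordinates. These extend
  -- over the chart, and the resulting function vanishes near `x`, hence on the whole ball. So one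
  -- `W` serves for all polynomials and all `y`.
  refine ⟨W, hWU, hWo, hxW, fun y hy => sub_eq_zero.1
    ((coordsAt hz hy.1).eq_zero_of_polynomial fun p hp => ?_)⟩
  obtain ⟨g, hg, rfl⟩ := exists_section_polynomial hz hy.1 hp
  obtain ⟨h, hh⟩ := (hP.sub hP') W hWU hWo g (hg.mono Set.inter_subset_left)
  have hd : ∀ v ∈ Metric.ball (z x) r, DifferentiableAt ℂ (h ∘ z.symm) v := by
    intro v hv
    have hvt := (hball v hv).1
    have hvW : z.symm v ∈ W :=
      ⟨z.map_target hvt, by rw [Set.mem_preimage, z.right_inv hvt]; exact hv⟩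
    obtain ⟨hF, -⟩ := eq_ofHol_of_germ hz hvW.1 (hh _ hvW)
    rw [z.right_inv hvt] at hF
    exact hF.differentiableAt
  have h0 : h ∘ z.symm =ᶠ[𝓝 (z x)] 0 := by
    obtain ⟨hF, e'⟩ := eq_ofHol_of_germ hz hxz (hh x hxW)
    beta_reduce at e'
    rw [e, sub_self, map_zero, LinearMap.zero_apply] at e'
    exact (ofHol_eq_zero_iff hz hxz).1 e'.symm
  have hzero := eqOn_zero_of_eventuallyEq Metric.isOpen_ball (convex_ball _ _) hd
    (Metric.mem_ball_self hr) h0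
  refine O.ext ((hh y hy).trans (Germ.coe_eq.2 ?_))
  filter_upwards [hWo.mem_nhds hy] with y' hy'
  have := hzero _ hy'.2
  rwa [Function.comp, z.left_inv hy'.1] at this

/-- A germ of a differential operator extends to a section nearby. -/
theorem exists_isSecD {x : X} (Q : D (O n x)) :
    ∃ (P : ∀ y : X, D (O n y)) (U : Set X), IsOpen U ∧ x ∈ U ∧ IsSecD n U P ∧ P x = Q := by
  let z := chartAt (Model n) x
  have hz : z ∈ IsManifold.maximalAtlas 𝓘(ℂ, Model n) ω X := IsManifold.chart_mem_maximalAtlas x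
  have hxz : x ∈ z.source := mem_chart_source (Model n) x
  have htoD : ∀ g : O n x, ∃ (P : ∀ y : X, D (O n y)) (U : Set X),
      IsOpen U ∧ x ∈ U ∧ IsSecD n U P ∧ P x = toD g := by
    intro g
    obtain ⟨h, hh, hh'⟩ := g.2
    obtain ⟨U, hU, hUo, hxU⟩ := eventually_nhds_iff.1 (eventually_eventually_nhds.2 hh')
    refine ⟨fun y => toD (ext0 (s := U) (fun y hy => (⟨(h : Germ (𝓝 y) ℂ), h, rfl, hU y hy⟩ :
      O n y)) y), U, hUo, hxU, IsSecD.toD ⟨h, fun y hy => ?_⟩, ?_⟩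
    · rw [ext0_of_mem _ hy]
      rfl
    · beta_reduce
      rw [ext0_of_mem _ hxU]
      exact congrArg toD (O.ext hh.symm)
  -- The germs that extend form a subring; it contains the functions and the coordinate derivations,
  -- which generate.
  let T : Subring (D (O n x)) :=
    { carrier := {Q | ∃ (P : ∀ y : X, D (O n y)) (U : Set X),
        IsOpen U ∧ x ∈ U ∧ IsSecD n U P ∧ P x = Q}
      mul_mem' := by
        rintro _ _ ⟨P, U, hU, hx, hP, rfl⟩ ⟨P', U', hU', hx', hP', rfl⟩
        exact ⟨_, U ∩ U', hU.inter hU', ⟨hx, hx'⟩, (hP.mono Set.inter_subset_left).mul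
          (hP'.mono Set.inter_subset_right), rfl⟩
      add_mem' := by
        rintro _ _ ⟨P, U, hU, hx, hP, rfl⟩ ⟨P', U', hU', hx', hP', rfl⟩
        exact ⟨_, U ∩ U', hU.inter hU', ⟨hx, hx'⟩, (hP.mono Set.inter_subset_left).add
          (hP'.mono Set.inter_subset_right), rfl⟩
      one_mem' := by
        obtain ⟨P, U, hU, hx, hP, e⟩ := htoD 1
        exact ⟨P, U, hU, hx, hP, e.trans (map_one _)⟩
      zero_mem' := by
        obtain ⟨P, U, hU, hx, hP, e⟩ := htoD 0
        exact ⟨P, U, hU, hx, hP, e.trans (map_zero _)⟩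
      neg_mem' := by
        rintro _ ⟨P, U, hU, hx, hP, rfl⟩
        obtain ⟨P', U', hU', hx', hP', e⟩ := htoD 0
        exact ⟨_, U ∩ U', hU.inter hU', ⟨hx, hx'⟩, (hP'.mono Set.inter_subset_right).sub
          (hP.mono Set.inter_subset_left), by rw [e, map_zero, zero_sub]⟩ }
  refine (coordsAt hz hxz).mem_of_generators T htoD (fun j => ?_) Q
  refine ⟨_, z.source, z.open_source, hxz, IsSecD.derD (isSecT_derAt hz j), ?_⟩
  rw [ext0_of_mem _ hxz]
  rfl

end

/-! ### Sections of forms in the basis of a frame. -/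

section
open Fields

/-- Among the basis fields only the one with index `m` moves this coordinate. Evaluation on it
therefore recovers the coefficient, up to a nonvanishing section, and shows that coefficients of
sections are sections. -/
theorem LogCoords.Adapted.apply_u_succAbove {A : Type*} [CommRing A] [Algebra ℂ A] [IsDomain A]
    {n : ℕ} {ℓ : LogCoords A n} {J : Ideal A} {t : A} (H : ℓ.Adapted J t) {i : Fin (n + 1)}
    (hi : i ∈ ℓ.E) (θ : (relFields J t).T) (m : Fin n) :
    (θ : Derivation ℂ A A) (ℓ.u (i.succAbove m)) = (H.basis hi).repr θ m *
      (algebraMap ℂ A (ℓ.wt i (i.succAbove m) (i.succAbove m)) * ℓ.v (i.succAbove m)) := by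
  conv_lhs => rw [← (H.basis hi).sum_repr θ]
  rw [AddSubmonoidClass.coe_finsetSum, derivation_sum_apply, Finset.sum_eq_single m]
  · change _ * ((H.basis hi m : Derivation ℂ A A) _) = _
    rw [H.basis_apply, diag_u]
  · intro m' _ hm
    change _ * ((H.basis hi m' : Derivation ℂ A A) _) = _
    rw [H.basis_apply, diag_u, wt_succAbove, if_neg hm.symm, map_zero, zero_mul, mul_zero]
  · simp

theorem LogCoords.wt_succAbove_ne_zero {A : Type*} [CommRing A] [Algebra ℂ A] [IsDomain A] {n : ℕ}
    (ℓ : LogCoords A n) (i : Fin (n + 1)) (m : Fin n) :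
    ℓ.wt i (i.succAbove m) (i.succAbove m) ≠ 0 := by
  rw [wt_succAbove, if_pos rfl]
  split_ifs
  · exact inv_ne_zero (ℓ.e_ne_zero _)
  · exact one_ne_zero

namespace Degeneration
variable {n : ℕ} {X : Type*} [TopologicalSpace X] [ChartedSpace (Model n) X]
  {I : Type*} [Fintype I] [DecidableEq I] {S : Degeneration n X I}
  [IsManifold 𝓘(ℂ, Model n) ω X] {x : X}

theorem isSecO_t (U : Set X) : IsSecO n U S.t := ⟨S.f, fun _ _ => rfl⟩

namespace Frame
variable (𝔣 : S.Frame x)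

theorem isSecO_u (l : Fin (n + 1)) :
    IsSecO n 𝔣.z.source (ext0 fun _ hy => (𝔣.log hy).u l) := isSecO_coordAt 𝔣.mem l

theorem isSecO_v (l : Fin (n + 1)) :
    IsSecO n 𝔣.z.source (ext0 fun _ hy => (𝔣.log hy).v l) := by
  by_cases h : l ∈ 𝔣.E
  · refine (𝔣.isSecO_u l).congr fun y hy => ?_
    rw [ext0_of_mem _ hy, ext0_of_mem _ hy]
    exact (if_pos h).symm
  · refine (IsSecO.const 1).congr fun y hy => ?_
    rw [ext0_of_mem _ hy, map_one]
    exact (if_neg h).symm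

theorem isSecO_mono (m : Fin (n + 1) → ℕ) :
    IsSecO n 𝔣.z.source (ext0 fun _ hy => (𝔣.log hy).mono m) := by
  refine (IsSecO.prod 𝔣.E fun l _ => (𝔣.isSecO_u l).pow (m l)).congr fun y hy => ?_
  rw [ext0_of_mem _ hy]
  exact Finset.prod_congr rfl fun l _ => by rw [ext0_of_mem _ hy]

theorem isSecT_diag (c : Fin (n + 1) → ℂ) :
    IsSecT n 𝔣.z.source (ext0 fun _ hy => (𝔣.log hy).diag c) := by
  intro V hV hVo g hg
  refine (IsSecO.sum Finset.univ fun l _ => ((IsSecO.const (c l)).mul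
    ((𝔣.isSecO_v l).mono hV)).mul (isSecT_derAt 𝔣.mem l V hV hVo g hg)).congr fun y hy => ?_
  rw [ext0_of_mem _ (hV hy), LogCoords.diag, derivation_sum_apply]
  refine Finset.sum_congr rfl fun l _ => ?_
  rw [ext0_of_mem _ (hV hy), ext0_of_mem _ (hV hy)]
  rfl

/-- The basis of the relative logarithmic fields at a point near the centre. -/
def basis {i : Fin (n + 1)} (hi : i ∈ 𝔣.E) {y : X} (hy : y ∈ 𝔣.z.source) :
    Module.Basis (Fin n) (O n y) (S.rel y).T := (𝔣.adapted hy).basis (i := i) hi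

variable {i : Fin (n + 1)} (hi : i ∈ 𝔣.E) {V : Set X} (hV : V ⊆ 𝔣.z.source)

theorem isSecT_basis (m : Fin n) : IsSecT n 𝔣.z.source fun y =>
    ((ext0 (β := fun y => Fin n → (S.rel y).T) (fun _ hy => 𝔣.basis hi hy) y m : (S.rel y).T) :
      Derivation ℂ (O n y) (O n y)) := by
  refine (𝔣.isSecT_diag ((𝔣.log 𝔣.hx).wt i (i.succAbove m))).congr fun y hy => ?_
  rw [ext0_of_mem _ hy, ext0_of_mem _ hy]
  exact ((𝔣.adapted hy).basis_apply hi m).symm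

theorem isSecO_repr (hVo : IsOpen V) {θ : ∀ y : X, (S.rel y).T}
    (hθ : IsSecT n V fun y => (θ y : Derivation ℂ (O n y) (O n y))) (m : Fin n) :
    IsSecO n V (ext0 fun y hy => (𝔣.basis hi (hV hy)).repr (θ y) m) := by
  have hg := ((IsSecO.const ((𝔣.log 𝔣.hx).wt i (i.succAbove m) (i.succAbove m))).mul
    (𝔣.isSecO_v (i.succAbove m))).mono hV
  refine hg.of_mul hVo ((hθ V subset_rfl hVo _ ((𝔣.isSecO_u (i.succAbove m)).mono hV)).congr
    fun y hy => ?_) fun y hy => ?_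
  · rw [ext0_of_mem _ hy, ext0_of_mem _ (hV hy), ext0_of_mem _ (hV hy)]
    exact (𝔣.adapted (hV hy)).apply_u_succAbove hi (θ y) m
  · rw [ext0_of_mem _ (hV hy)]
    refine mul_ne_zero ?_ ((𝔣.log (hV hy)).v_ne_zero _)
    exact (map_ne_zero_iff _ (algebraMap ℂ (O n y)).injective).2
      ((𝔣.log 𝔣.hx).wt_succAbove_ne_zero i m)

theorem isSecForm_topForm {P : ∀ y : X, D (O n y)} (hP : IsSecD n V P) :
    S.IsSecForm V (ext0 fun y hy => topForm (𝔣.basis hi (hV hy)) (P y)) := by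
  intro W hW hWo θ hθ
  refine (IsSecD.smul (IsSecO.det fun k m =>
    𝔣.isSecO_repr hi (hW.trans hV) hWo (hθ m) k) (hP.mono hW)).congr fun y hy => ?_
  rw [ext0_of_mem _ (hW hy), Fields.form_apply_eq_det (𝔣.basis hi (hV (hW hy))), ← ev_eq,
    ev_topForm, Module.Basis.det_apply]
  congr 2
  ext k m
  rw [ext0_of_mem _ hy]
  rfl

theorem isSecD_ev {φ : ∀ y : X, (S.rel y).Form n} (hVo : IsOpen V) (hφ : S.IsSecForm V φ) :
    IsSecD n V (ext0 fun y hy => ev (𝔣.basis hi (hV hy)) (φ y)) := by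
  refine (hφ V subset_rfl hVo (ext0 fun _ hy => 𝔣.basis hi hy) fun m =>
    (𝔣.isSecT_basis hi m).mono hV).congr fun y hy => ?_
  rw [ext0_of_mem _ hy, ext0_of_mem _ (hV hy), ev_eq]

end Frame
end Degeneration

end

/-! ### Compatibility of the isomorphism with sections. -/

section
open Fields
namespace Degeneration
variable {n : ℕ} {X : Type*} [TopologicalSpace X] [ChartedSpace (Model n) X]
  {I : Type*} [Fintype I] [DecidableEq I] {S : Degeneration n X I}
  [IsManifold 𝓘(ℂ, Model n) ω X] {x : X} {V : Set X}

theorem IsSecForm.mono {p : ℕ} {φ : ∀ y : X, (S.rel y).Form p} {W : Set X}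
    (h : S.IsSecForm V φ) (hW : W ⊆ V) : S.IsSecForm W φ := fun U hU => h U (hU.trans hW)

/-- A section of forms whose class at a point of the central fibre lies in the image of the forms
with zeros along a divisor is, near that point and up to boundaries, a section of such forms. -/
theorem Frame.exists_section (𝔣 : S.Frame x) (h : S.f x = 0) (hV : IsOpen V) (hx : x ∈ V)
    {φ : ∀ y : X, (S.rel y).Form n} (hφ : S.IsSecForm V φ) (m : Fin (n + 1) → ℕ)
    (hm : M.mk (S.J x) (S.t x) (φ x) ∈ (𝔣.log 𝔣.hx).imageM (S.J x) (S.t x) m) :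
    ∃ W ⊆ V, W ⊆ 𝔣.z.source ∧ IsOpen W ∧ x ∈ W ∧ ∃ χ : ∀ y : X, (S.rel y).Form n,
      S.IsSecForm W χ ∧ ∀ (y : X) (_ : y ∈ W) (hy : y ∈ 𝔣.z.source),
        χ y ∈ (S.rel y).K (Ideal.span {(𝔣.log hy).mono m}) n ∧
          M.mk (S.J y) (S.t y) (χ y) = M.mk (S.J y) (S.t y) (φ y) := by
  obtain ⟨i, hi⟩ := 𝔣.nonempty_E h
  obtain ⟨χ₀, hχ₀, e₀⟩ := LogCoords.mem_imageM.1 hm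
  obtain ⟨Q₀, hQ₀⟩ := (mem_K_iff_ev (𝔣.basis hi 𝔣.hx)).1 hχ₀
  obtain ⟨Q₁, η, e₁⟩ := ((𝔣.adapted 𝔣.hx).mk_eq_iff hi _ _).1 e₀.symm
  -- The hypothesis at `x` is an identity of germs of operators: the coefficient of `φ` minus `g Q₀`
  -- equals `t Q₁ + ∑ θ_k η_k`. All operators in it extend to sections, the identity persists near
  -- `x`, and `g P₀` is the coefficient of the form sought.
  obtain ⟨P₀, U₀, hU₀, hxU₀, hP₀, rfl⟩ := exists_isSecD Q₀
  obtain ⟨P₁, U₁, hU₁, hxU₁, hP₁, rfl⟩ := exists_isSecD Q₁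
  choose N U₂ hU₂ hxU₂ hN hNx using fun k => exists_isSecD (η k)
  let U : Set X := V ∩ 𝔣.z.source ∩ (U₀ ∩ U₁ ∩ ⋂ k, U₂ k)
  have hU : IsOpen U := (hV.inter 𝔣.z.open_source).inter
    ((hU₀.inter hU₁).inter (isOpen_iInter_of_finite hU₂))
  have hxU : x ∈ U := ⟨⟨hx, 𝔣.hx⟩, ⟨hxU₀, hxU₁⟩, Set.mem_iInter.2 hxU₂⟩
  have hUs : U ⊆ 𝔣.z.source := fun y hy => hy.1.2
  have h0 : IsSecD n U fun y =>
      (ext0 (fun _ hy => (𝔣.log hy).mono m) y : O n y) • P₀ y :=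
    IsSecD.smul ((𝔣.isSecO_mono m).mono hUs) (hP₀.mono fun y hy => hy.2.1.1)
  have h1 := (𝔣.isSecD_ev hi hUs hU (hφ.mono fun y hy => hy.1.1)).sub h0
  have h2 : IsSecD n U fun y => S.t y • P₁ y + ∑ k, derD ((ext0 (β := fun y => Fin n → (S.rel y).T)
      (fun _ hy => 𝔣.basis hi hy) y k : (S.rel y).T) : Derivation ℂ (O n y) (O n y)) * N k y :=
    (IsSecD.smul (isSecO_t U) (hP₁.mono fun y hy => hy.2.1.2)).add
      (IsSecD.sum Finset.univ fun k _ => (IsSecD.derD ((𝔣.isSecT_basis hi k).mono hUs)).mul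
        ((hN k).mono fun y hy => Set.mem_iInter.1 hy.2.2 k))
  obtain ⟨W, hWU, hW, hxW, e⟩ := h1.exists_eq hU h2 hxU (by
    beta_reduce
    rw [ext0_of_mem _ hxU, ext0_of_mem _ 𝔣.hx, ext0_of_mem _ 𝔣.hx]
    simp only [hNx]
    rw [← hQ₀]
    exact e₁)
  refine ⟨W, fun y hy => (hWU hy).1.1, hWU.trans hUs, hW, hxW, _,
    (𝔣.isSecForm_topForm hi hUs h0).mono hWU, fun y hyW hy => ⟨?_, ?_⟩⟩
  · rw [ext0_of_mem _ (hWU hyW), ext0_of_mem _ hy]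
    exact (mem_K_iff_ev (𝔣.basis hi hy)).2 ⟨_, ev_topForm _ _⟩
  · refine (((𝔣.adapted hy).mk_eq_iff hi _ _).2 ⟨P₁ y, fun k => N k y, ?_⟩).symm
    have := e y hyW
    beta_reduce at this
    rw [ext0_of_mem _ (hWU hyW), ext0_of_mem _ hy, ext0_of_mem _ hy] at this
    refine Eq.trans ?_ this
    rw [ext0_of_mem _ (hWU hyW), ext0_of_mem _ hy]
    exact congrArg (_ - ·) (ev_topForm (𝔣.basis hi hy) _)

variable (S) in
-- Only the converse needs work: a section of `M_α` is locally given by forms without any zeros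
-- along the divisor. Near a point of the central fibre `Frame.exists_section` replaces them by
-- forms with such zeros and the same classes in `M`; off the central fibre the stalks vanish.
theorem isSecH0_iff {α : ℚ} (h0 : 0 ≤ α) (h1 : α < 1)
    {ψ : ∀ x : X, S.stalkH0 α x ≃ₗ[DR (O n x)] S.stalkEig α x}
    (hψ : ∀ (x : X) (φ : (S.rel x).Form n) (h : φ ∈ (S.rel x).K (S.idealGe α x) n),
      ∃ h' : M.mk (S.J x) (S.t x) φ ∈ Mge (S.J x) (S.t x) n α,
        ψ x ((S.rel x).cls (S.idealGt α x) φ h) = Submodule.Quotient.mk ⟨_, h'⟩)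
    (U : Set X) (s : ∀ x : X, S.stalkH0 α x) :
    S.IsSecH0 α U s ↔ S.IsSecEig α U fun x => ψ x (s x) := by
  constructor
  · intro h x hx
    obtain ⟨V, hVU, hV, hxV, φ, hφ, hs⟩ := h x hx
    refine ⟨V, hVU, hV, hxV, φ, hφ, fun y hy => ?_⟩
    obtain ⟨hK, e⟩ := hs y hy
    beta_reduce
    rw [e]
    exact hψ y (φ y) hK
  · intro hs x hx
    obtain ⟨V, hVU, hV, hxV, φ, hφ, hs⟩ := hs x hx
    by_cases h : S.f x = 0
    · obtain ⟨𝔣⟩ := S.exists_frame h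
      obtain ⟨hm, -⟩ := hs x hxV
      rw [𝔣.Mge_eq 𝔣.hx h h0 h1] at hm
      obtain ⟨W, hWV, hWs, hW, hxW, χ, hχ, hW'⟩ := 𝔣.exists_section h hV hxV hφ _ hm
      refine ⟨W, hWV.trans hVU, hW, hxW, χ, hχ, fun y hy => ?_⟩
      obtain ⟨hK, e⟩ := hW' y hy (hWs hy)
      rw [← 𝔣.idealGe_eq] at hK
      obtain ⟨hy', e'⟩ := hs y (hWV hy)
      obtain ⟨hy'', e''⟩ := hψ y (χ y) hK
      refine ⟨hK, (ψ y).injective ?_⟩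
      rw [e'']
      refine Eq.trans e' (congrArg Submodule.Quotient.mk (Subtype.ext e.symm))
    · have ho : IsOpen {y | S.f y ≠ 0} :=
        isOpen_ne_fun S.holomorphic.continuous continuous_const
      refine ⟨V ∩ {y | S.f y ≠ 0}, Set.inter_subset_left.trans hVU, hV.inter ho, ⟨hxV, h⟩, φ,
        hφ.mono Set.inter_subset_left, fun y hy => ?_⟩
      have := S.subsingleton_stalkH0 hy.2 α
      exact ⟨by rw [idealGe, S.divIdeal_of_ne hy.2]; exact Fields.mem_K_top _ _,
        Subsingleton.elim _ _⟩

end Degeneration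

end

end LogD
end

theorem mainTheorem11 (n : ℕ) {X : Type*} [TopologicalSpace X] [T2Space X]
    [ChartedSpace (LogD.Model n) X] [IsManifold 𝓘(ℂ, LogD.Model n) ω X]
    {I : Type*} [Fintype I] [DecidableEq I] (S : LogD.Degeneration n X I) :
    -- the operator `R` on `M` is well defined
    (∀ x : X, ∃! R, LogD.IsResidue (S.J x) (S.t x) n R) ∧
    -- the characteristic cycle of `M`
    (∀ x : X, (S.filtM x).IsGood ∧
      (S.filtM x).charCycle = ∑ K : Finset I, (∑ j ∈ K, S.e j) • S.conormal K x) ∧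
    ∀ α : ℚ, 0 ≤ α → α < 1 →
      -- the complex `C_α ⊗ D` and the characteristic cycle of its cohomology
      (∀ x : X, (S.rel x).FilteredAcyclic (S.idealGe α x) (S.idealGt α x) n) ∧
      (∀ x : X, (S.filtH0 α x).IsGood ∧
        (S.filtH0 α x).charCycle =
          ∑ K : Finset I, (S.indices α ∩ K).card • S.conormal K x) ∧
      -- the filtered isomorphism of sheaves of right `D`-modules, induced by the identity on forms
      (∃ ψ : ∀ x : X, S.stalkH0 α x ≃ₗ[LogD.DR (LogD.O n x)] S.stalkEig α x,
        (∀ (x : X) (φ : (S.rel x).Form n) (h : φ ∈ (S.rel x).K (S.idealGe α x) n),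
          ∃ h' : LogD.M.mk (S.J x) (S.t x) φ ∈ LogD.Mge (S.J x) (S.t x) n α,
            ψ x ((S.rel x).cls (S.idealGt α x) φ h) = Submodule.Quotient.mk ⟨_, h'⟩) ∧
        (∀ (x : X) (l : ℤ) (m : S.stalkH0 α x),
          m ∈ (S.filtH0 α x).F l ↔ ψ x m ∈ (S.filtEig α x).F l) ∧
        ∀ U : Set X, IsOpen U → ∀ s : ∀ x : X, S.stalkH0 α x,
          S.IsSecH0 α U s ↔ S.IsSecEig α U fun x => ψ x (s x)) ∧
      -- the characteristic cycle of `M_α`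
      ∀ x : X, (S.filtEig α x).IsGood ∧
        (S.filtEig α x).charCycle =
          ∑ K : Finset I, (S.indices α ∩ K).card • S.conormal K x := by
  refine ⟨S.existsUnique_residue, S.isGood_filtM, fun α h0 h1 => ?_⟩
  -- The stalkwise isomorphisms can be chosen point by point: their values on classes of forms are
  -- prescribed, so they fit together on sections.
  choose ψ hψ hF using fun x => S.exists_stalk_equiv x h0 h1
  exact ⟨fun x => S.filteredAcyclic x h0, fun x => S.isGood_filtH0 x h0,
    ⟨ψ, hψ, hF, fun U _ s => S.isSecH0_iff h0 h1 hψ U s⟩, fun x => S.isGood_filtEig x h0 h1⟩
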